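/- **Conventions.** For a finite nonempty $S\subseteq\mathbb F_2^n$ let $d$ be the Hamming distance, let $A_i$ be the number of ordered pairs $(\mathbf x,\mathbf y)\in S^2$ with $d(\mathbf x,\mathbf y)=i$, let $A(S,x)=\sum_{i=0}^n A_i x^i$ be its distance distribution function, and let $$P_S(p)=\frac1{|S|}\sum_{\mathbf x,\mathbf y\in S}p^{d(\mathbf x,\mathbf y)}(1-p)^{n-d(\mathbf x,\mathbf y)} .$$ The set $S$ is *optimal for $p$* if $P_T(p)\le P_S(p)$ for every $T\subseteq\mathbb F_2^n$ with $|T|=|S|$. Two subsets of $\mathbb F_2^n$ are *isomorphic* if one is obtained from the other by a series of complementations of a coordinate and switches of two coordinates. Let $\rho_i(\mathbf x)$ be $\mathbf x$ with $x_i$ replaced by $0$, and let $\sigma_{ij}(\mathbf x)$ be $\mathbf x$ if $x_{\min(i,j)}=0$, and $\mathbf x$ with coordinates $i,j$ switched otherwise. A set is a *down-set* if it is closed under all $\rho_i$, and *right-shifted* if it is closed under all $\sigma_{ij}$. Identify the integer $m=\sum_{i<n}2^i x_{n-i}$ with $(x_1,\dots,x_n)\in\mathbb F_2^n$; for integers $m_1,m_2,\dots<2^n$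 let $\langle m_1,m_2,\dots\rangle\subseteq\mathbb F_2^n$ be the set of all vectors obtained from some $m_k$ by a series of operations $\rho_i$, $\sigma_{ij}$ (the right-shifted down-set generated by the $m_k$). If $m_1,m_2,\dots<2^{n'}$ and $n'\le n$, the notation is used in $\mathbb F_2^n$ as well. **Theorem.** Consider the following table, whose rows $e$ have entries $t_e$, $n_e$, a decimal number $g_e$, a polynomial, and one or two sets $\langle\dots\rangle$ (in $\mathbb F_2^{n_e}$). 1. Every set listed in a row $e$ is a right-shifted down-set of size $2^{t_e}$ in $\mathbb F_2^{n_e}$; its distance distribution function is the listed polynomial; no listed generator can be omitted; and when two sets are listed in a row, they are not isomorphic. 2. For each row $e$ let $\gamma_e$ be the infimum of all $p\in(0,\tfrac12)$ for which, in $\mathbb F_2^{n_e}$, the sets of row $e$ have strictly greater $P(p)$ than the sets of all preceding rows with the same $t$. Then $\gamma_e$ exists and equals $g_e$ rounded to the decimals shown, that is, $|\gamma_e-g_e|\le\frac12 10^{-k}$, where $k$ is the number of decimals of $g_e$ (and $\gamma_e=0$ for the first row of each $t$). 3. Let $t\in\{1,\dots,6\}$, $n<2^t$ and $p\in(0,\tfrac12)$.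 A set $S\subseteq\mathbb F_2^n$ of size $2^t$ is optimal for $p$ if and only if $S$ is isomorphic to one of the sets (taken in $\mathbb F_2^n$) of a row $e$ with $t_e=t$, $n_e\le n$, $\gamma_e\le p$, and $p\le\gamma_{e'}$ for all later rows $e'$ with $t_{e'}=t$ and $n_{e'}\le n$. (So for $p$ not equal to a crossover value the optimal sets are those of the last row with $t_e=t$, $n_e\le n$ and $\gamma_e<p$.) $$\begin{array}{|c|c|c|l|l|}\hline t&n&g&\text{distance distribution function}&\text{sets}\\\hline 1 & 1 & 0 & 2+2x & \langle 1\rangle\\ 2 & 2 & 0 & 4+8x+4x^2 & \langle 2^{2}-1\rangle\\ 3 & 3 & 0 & 8+24x+24x^2+8x^3 & \langle 2^{3}-1\rangle\\ 4 & 4 & 0 & 16+64x+96x^2+64x^3+16x^4 & \langle 2^{4}-1\rangle\\ 4 & 12 & 0.4560 & 16+36x+144x^2+60x^3 & \langle 2^{11}, 2^{3}+1\rangle,\ \langle 2^{11}, 3\cdot 2\rangle\\ 4 & 13 & 0.3929 & 16+34x+162x^2+44x^3 & \langle 2^{12}, 2^{2}+1\rangle\\ 4 & 14 & 0.3333 &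 16+32x+184x^2+24x^3 & \langle 2^{13}, 2+1\rangle\\ 4 & 15 & 0.2826 & 16+30x+210x^2 & \langle 2^{14}\rangle\\ 5 & 5 & 0 & 32+160x+320x^2+320x^3+160x^4+32x^5 & \langle 2^{5}-1\rangle\\ 5 & 12 & 0.4882 & 32+100x+368x^2+380x^3+144x^4 & \langle 2^{11}+1, 2^{9}+2\rangle,\ \langle 2^{11}, 2^{10}+2\rangle\\ 5 & 13 & 0.4492 & 32+98x+378x^2+396x^3+120x^4 & \langle 2^{12}+1, 2^{7}+2\rangle\\ 5 & 14 & 0.3929 & 32+100x+392x^2+412x^3+88x^4 & \langle 2^{13}+1, 2^{3}+3\rangle\\ 5 & 15 & 0.3333 & 32+96x+432x^2+416x^3+48x^4 & \langle 2^{14}+1, 7\rangle\\ 5 & 16 & 0.2826 & 32+92x+480x^2+420x^3 & \langle 2^{15}+1\rangle\\ 5 & 19 & 0.3333 & 32+86x+498x^2+408x^3 & \langle 2^{18}, 2^{12}+1\rangle\\ 5 & 20 & 0.2799 & 32+84x+512x^2+396x^3 & \langle 2^{19}, 2^{11}+1\rangle\\ 5 & 21 & 0.2724 & 32+82x+530x^2+380x^3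 & \langle 2^{20}, 2^{10}+1\rangle\\ 5 & 22 & 0.2627 & 32+80x+552x^2+360x^3 & \langle 2^{21}, 2^{9}+1\rangle\\ 5 & 23 & 0.2515 & 32+78x+578x^2+336x^3 & \langle 2^{22}, 2^{8}+1\rangle\\ 5 & 24 & 0.2390 & 32+76x+608x^2+308x^3 & \langle 2^{23}, 2^{7}+1\rangle\\ 5 & 25 & 0.2259 & 32+74x+642x^2+276x^3 & \langle 2^{24}, 2^{6}+1\rangle\\ 5 & 26 & 0.2125 & 32+72x+680x^2+240x^3 & \langle 2^{25}, 2^{5}+1\rangle\\ 5 & 27 & 0.1992 & 32+70x+722x^2+200x^3 & \langle 2^{26}, 2^{4}+1\rangle\\ 5 & 28 & 0.1864 & 32+68x+768x^2+156x^3 & \langle 2^{27}, 2^{3}+1\rangle,\ \langle 2^{27}, 3\cdot 2\rangle\\ 5 & 29 & 0.1741 & 32+66x+818x^2+108x^3 & \langle 2^{28}, 2^{2}+1\rangle\\ 5 & 30 & 0.1626 & 32+64x+872x^2+56x^3 & \langle 2^{29}, 2+1\rangle\\ 5 & 31 & 0.1518 & 32+62x+930x^2 & \langle 2^{30}\rangle\\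 6 & 6 & 0 & 64+384x+960x^2+1280x^3+960x^4+384x^5+64x^6 & \langle 2^{6}-1\rangle\\ 6 & 12 & 0.487 & 64+228x+1092x^2+1020x^3+1692x^4 & \langle 2^{11}, 2^{10}+2^{5}, 3\cdot 2^{8}\rangle\\ 6 & 13 & 0.470 & 64+226x+1086x^2+1100x^3+1620x^4 & \langle 2^{12}, 2^{10}+2^{4}, 3\cdot 2^{8}\rangle\\ 6 & 14 & 0.439 & 64+250x+1002x^2+1508x^3+1032x^4+240x^5 & \langle 2^{13}+2^{2}, 2^{13}+3, 2^{3}+5\rangle\\ 6 & 15 & 0.391 & 64+248x+1024x^2+1592x^3+992x^4+176x^5 & \langle 2^{14}+3, 2^{10}+2^{2}\rangle\\ 6 & 16 & 0.333 & 64+256x+1056x^2+1696x^3+928x^4+96x^5 & \langle 2^{15}+3, 2^{4}-1\rangle\\ 6 & 17 & 0.283 & 64+248x+1144x^2+1800x^3+840x^4 & \langle 2^{16}+3\rangle\\ 6 & 19 & 0.36 & 64+232x+1184x^2+1784x^3+832x^4 & \langle 2^{18}+2, 2^{10}+3\rangle\\ 6 & 20 & 0.277 & 64+224x+1240x^2+1752x^3+816x^4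 & \langle 2^{19}+2, 2^{7}+3\rangle\\ 6 & 21 & 0.263 & 64+216x+1320x^2+1704x^3+792x^4 & \langle 2^{20}+2, 2^{4}+3\rangle\\ 6 & 22 & 0.244 & 64+208x+1424x^2+1640x^3+760x^4 & \langle 2^{21}+2\rangle\\ 6 & 23 & 0.242 & 64+206x+1426x^2+1680x^3+720x^4 & \langle 2^{22}+1, 2^{19}+2\rangle\\ 6 & 24 & 0.238 & 64+204x+1440x^2+1716x^3+672x^4 & \langle 2^{23}+1, 2^{17}+2\rangle\\ 6 & 25 & 0.231 & 64+202x+1466x^2+1748x^3+616x^4 & \langle 2^{24}+1, 2^{15}+2\rangle\\ 6 & 26 & 0.222 & 64+200x+1504x^2+1776x^3+552x^4 & \langle 2^{25}+1, 2^{13}+2\rangle\\ 6 & 27 & 0.212 & 64+198x+1554x^2+1800x^3+480x^4 & \langle 2^{26}+1, 2^{11}+2\rangle\\ 6 & 28 & 0.199 & 64+204x+1584x^2+1844x^3+400x^4 & \langle 2^{27}+1, 2^{5}+3\rangle\\ 6 & 28 & 0.25 & 64+196x+1616x^2+1820x^3+400x^4 & \langle 2^{27}+1, 2^{9}+2\rangle\\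 6 & 29 & 0.186 & 64+200x+1672x^2+1848x^3+312x^4 & \langle 2^{28}+1, 2^{4}+3\rangle,\ \langle 2^{28}+1, 3\cdot 2^{2}+1\rangle\\ 6 & 29 & 0.333 & 64+194x+1690x^2+1836x^3+312x^4 & \langle 2^{28}+1, 2^{7}+2\rangle\\ 6 & 30 & 0.174 & 64+196x+1768x^2+1852x^3+216x^4 & \langle 2^{29}+1, 2^{3}+3\rangle\\ 6 & 31 & 0.163 & 64+192x+1872x^2+1856x^3+112x^4 & \langle 2^{30}+1, 7\rangle\\ 6 & 32 & 0.152 & 64+188x+1984x^2+1860x^3 & \langle 2^{31}+1\rangle\\ 6 & 35 & 0.3333 & 64+182x+2002x^2+1848x^3 & \langle 2^{34}, 2^{28}+1\rangle\\ 6 & 36 & 0.2500 & 64+180x+2016x^2+1836x^3 & \langle 2^{35}, 2^{27}+1\rangle\\ 6 & 37 & 0.200 & 64+178x+2034x^2+1820x^3 & \langle 2^{36}, 2^{26}+1\rangle\\ 6 & 38 & 0.167 & 64+176x+2056x^2+1800x^3 & \langle 2^{37}, 2^{25}+1\rangle\\ 6 & 39 & 0.151 & 64+174x+2082x^2+1776x^3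 & \langle 2^{38}, 2^{24}+1\rangle\\ 6 & 40 & 0.150 & 64+172x+2112x^2+1748x^3 & \langle 2^{39}, 2^{23}+1\rangle\\ 6 & 41 & 0.148 & 64+170x+2146x^2+1716x^3 & \langle 2^{40}, 2^{22}+1\rangle\\ 6 & 42 & 0.146 & 64+168x+2184x^2+1680x^3 & \langle 2^{41}, 2^{21}+1\rangle\\ 6 & 43 & 0.144 & 64+166x+2226x^2+1640x^3 & \langle 2^{42}, 2^{20}+1\rangle\\ 6 & 44 & 0.141 & 64+164x+2272x^2+1596x^3 & \langle 2^{43}, 2^{19}+1\rangle\\ 6 & 45 & 0.139 & 64+162x+2322x^2+1548x^3 & \langle 2^{44}, 2^{18}+1\rangle\\ 6 & 46 & 0.136 & 64+160x+2376x^2+1496x^3 & \langle 2^{45}, 2^{17}+1\rangle\\ 6 & 47 & 0.133 & 64+158x+2434x^2+1440x^3 & \langle 2^{46}, 2^{16}+1\rangle\\ 6 & 48 & 0.130 & 64+156x+2496x^2+1380x^3 & \langle 2^{47}, 2^{15}+1\rangle\\ 6 & 49 & 0.127 & 64+154x+2562x^2+1316x^3 & \langle 2^{48}, 2^{14}+1\rangle\\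 6 & 50 & 0.123 & 64+152x+2632x^2+1248x^3 & \langle 2^{49}, 2^{13}+1\rangle\\ 6 & 51 & 0.120 & 64+150x+2706x^2+1176x^3 & \langle 2^{50}, 2^{12}+1\rangle\\ 6 & 52 & 0.117 & 64+148x+2784x^2+1100x^3 & \langle 2^{51}, 2^{11}+1\rangle\\ 6 & 53 & 0.114 & 64+146x+2866x^2+1020x^3 & \langle 2^{52}, 2^{10}+1\rangle\\ 6 & 54 & 0.110 & 64+144x+2952x^2+936x^3 & \langle 2^{53}, 2^{9}+1\rangle\\ 6 & 55 & 0.107 & 64+142x+3042x^2+848x^3 & \langle 2^{54}, 2^{8}+1\rangle\\ 6 & 56 & 0.104 & 64+140x+3136x^2+756x^3 & \langle 2^{55}, 2^{7}+1\rangle\\ 6 & 57 & 0.101 & 64+138x+3234x^2+660x^3 & \langle 2^{56}, 2^{6}+1\rangle\\ 6 & 58 & 0.0978 & 64+138x+3330x^2+452x^3+112x^4 & \langle 2^{57}, 2^{3}+1, 7\rangle\\ 6 & 58 & 0.1047 & 64+136x+3336x^2+560x^3 & \langle 2^{57}, 2^{5}+1\rangle\\ 6 & 59 & 0.0946 & 64+136x+3440x^2+344x^3+112x^4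 & \langle 2^{58}, 7\rangle\\ 6 & 59 & 0.1179 & 64+134x+3442x^2+456x^3 & \langle 2^{58}, 2^{4}+1\rangle\\ 6 & 60 & 0.0920 & 64+132x+3552x^2+348x^3 & \langle 2^{59}, 2^{3}+1\rangle,\ \langle 2^{59}, 3\cdot 2\rangle\\ 6 & 61 & 0.0892 & 64+130x+3666x^2+236x^3 & \langle 2^{60}, 2^{2}+1\rangle\\ 6 & 62 & 0.0864 & 64+128x+3784x^2+120x^3 & \langle 2^{61}, 2+1\rangle\\ 6 & 63 & 0.0838 & 64+126x+3906x^2 & \langle 2^{62}\rangle\\ \hline\end{array}$$ -/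

import Mathlib

/-- The `n`-cube `𝔽₂ⁿ`; the coordinate `xₖ` (`1 ≤ k ≤ n`) is the value at `k - 1 : Fin n`. -/
abbrev BitCube (n : ℕ) : Type := Fin n → ZMod 2

/-- The number `A_i` of ordered pairs of points of `S` at Hamming distance `i`. -/
def pairCount {n : ℕ} (S : Finset (BitCube n)) (i : ℕ) : ℕ :=
  ((S ×ˢ S).filter (fun z => hammingDist z.1 z.2 = i)).card

/-- The distance distribution function `A(S, ζ) = ∑ i, A_i ζ ^ i`, as a polynomial in `ζ`. -/
noncomputable def distDistribution {n : ℕ} (S : Finset (BitCube n)) : Polynomial ℕ :=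
  ∑ i ∈ Finset.range (n + 1), Polynomial.monomial i (pairCount S i)

/-- `P_S(p)`: the probability that `x + e ∈ S`, where `x` is uniform on `S` and the bits of the
error vector `e` are independently nonzero with probability `p`. -/
noncomputable def collisionProb {n : ℕ} (S : Finset (BitCube n)) (p : ℝ) : ℝ :=
  (1 / (S.card : ℝ)) *
    ∑ x ∈ S, ∑ y ∈ S, p ^ hammingDist x y * (1 - p) ^ (n - hammingDist x y)

/-- `S` is optimal for `p`: no set of the same size in the same cube has greater probability. -/
def IsOptimalFor {n : ℕ} (S : Finset (BitCube n)) (p : ℝ) : Prop :=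
  ∀ T : Finset (BitCube n), T.card = S.card → collisionProb T p ≤ collisionProb S p

/-- `r_i`: complement the `i`-th coordinate. -/
def flipCoord {n : ℕ} (i : Fin n) (x : BitCube n) : BitCube n :=
  Function.update x i (x i + 1)

/-- `s_ij`: switch the `i`-th and the `j`-th coordinate. -/
def swapCoord {n : ℕ} (i j : Fin n) (x : BitCube n) : BitCube n :=
  x ∘ Equiv.swap i j

/-- `Isomorphic S T`: `T` can be gotten from `S` by a series of `r_i` and `s_ij`. -/
inductive Isomorphic {n : ℕ} (S : Finset (BitCube n)) : Finset (BitCube n) → Prop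
  | refl : Isomorphic S S
  | flip (T : Finset (BitCube n)) (i : Fin n) :
      Isomorphic S T → Isomorphic S (T.image (flipCoord i))
  | swap (T : Finset (BitCube n)) (i j : Fin n) :
      Isomorphic S T → Isomorphic S (T.image (swapCoord i j))

/-- `ρ_i`: set the `i`-th coordinate to `0`. -/
def clearCoord {n : ℕ} (i : Fin n) (x : BitCube n) : BitCube n :=
  Function.update x i 0

/-- `σ_ij`: switch the coordinates `i` and `j` unless the coordinate `min i j` is `0`. -/
def shiftCoord {n : ℕ} (i j : Fin n) (x : BitCube n) : BitCube n :=
  if x (min i j) = 0 then x else swapCoord i j x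

def IsDownSet {n : ℕ} (S : Finset (BitCube n)) : Prop :=
  ∀ i : Fin n, ∀ x ∈ S, clearCoord i x ∈ S

def IsRightShifted {n : ℕ} (S : Finset (BitCube n)) : Prop :=
  ∀ i j : Fin n, ∀ x ∈ S, shiftCoord i j x ∈ S

/-- `Below x y` is the partial order `x ⪯ y`: `x` is obtained from `y` by a series of operations
`ρ_i` and `σ_ij`. -/
inductive Below {n : ℕ} (y : BitCube n) : BitCube n → Prop
  | refl : Below y y
  | clear (x : BitCube n) (i : Fin n) : Below y x → Below y (clearCoord i x)
  | shift (x : BitCube n) (i j : Fin n) : Below y x → Below y (shiftCoord i j x)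

/-- The vector `(x₁, …, xₙ)` with `m = ∑ i < n, 2 ^ i * x_{n - i}` (for `m < 2 ^ n`). -/
def bitVector (n m : ℕ) : BitCube n :=
  fun k => if m.testBit (n - 1 - k) then 1 else 0

open Classical in
/-- `⟨G⟩` in `𝔽₂ⁿ`: the ideal for `⪯` generated by the vectors with binary expansion in `G`, that
is, the smallest right-shifted down-set containing them. -/
noncomputable def generated (n : ℕ) (G : List ℕ) : Finset (BitCube n) :=
  Finset.univ.filter (fun x => ∃ m ∈ G, Below (bitVector n m) x)

/-- The polynomial with the given list of coefficients, the constant one first. -/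
noncomputable def coeffPolynomial (l : List ℕ) : Polynomial ℕ :=
  ∑ i ∈ Finset.range l.length, Polynomial.monomial i (l.getD i 0)

/-- A row of the table of optimal sets of size `2 ^ t`. -/
structure OptRow where
  t : ℕ
  /-- The dimension from which on the sets of this row are available. -/
  n : ℕ
  /-- The crossover probability, rounded to `digits` decimals. -/
  cross : ℚ
  digits : ℕ
  /-- The coefficients of the distance distribution function. -/
  dist : List ℕ
  /-- Generators of the sets of this row (there are two sets in some rows). -/
  sets : List (List ℕ)

/-- The rows with `t ≤ 4`. -/
def optTableA : List OptRow := [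
  ⟨1, 1, 0, 4, [2, 2], [[1]]⟩,
  ⟨2, 2, 0, 4, [4, 8, 4], [[2 ^ 2 - 1]]⟩,
  ⟨3, 3, 0, 4, [8, 24, 24, 8], [[2 ^ 3 - 1]]⟩,
  ⟨4, 4, 0, 4, [16, 64, 96, 64, 16], [[2 ^ 4 - 1]]⟩,
  ⟨4, 12, 0.4560, 4, [16, 36, 144, 60], [[2 ^ 11, 2 ^ 3 + 1], [2 ^ 11, 3 * 2]]⟩,
  ⟨4, 13, 0.3929, 4, [16, 34, 162, 44], [[2 ^ 12, 2 ^ 2 + 1]]⟩,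
  ⟨4, 14, 0.3333, 4, [16, 32, 184, 24], [[2 ^ 13, 2 + 1]]⟩,
  ⟨4, 15, 0.2826, 4, [16, 30, 210], [[2 ^ 14]]⟩]

/-- The rows with `t = 5`. -/
def optTableB : List OptRow := [
  ⟨5, 5, 0, 4, [32, 160, 320, 320, 160, 32], [[2 ^ 5 - 1]]⟩,
  ⟨5, 12, 0.4882, 4, [32, 100, 368, 380, 144], [[2 ^ 11 + 1, 2 ^ 9 + 2], [2 ^ 11, 2 ^ 10 + 2]]⟩,
  ⟨5, 13, 0.4492, 4, [32, 98, 378, 396, 120], [[2 ^ 12 + 1, 2 ^ 7 + 2]]⟩,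
  ⟨5, 14, 0.3929, 4, [32, 100, 392, 412, 88], [[2 ^ 13 + 1, 2 ^ 3 + 3]]⟩,
  ⟨5, 15, 0.3333, 4, [32, 96, 432, 416, 48], [[2 ^ 14 + 1, 7]]⟩,
  ⟨5, 16, 0.2826, 4, [32, 92, 480, 420], [[2 ^ 15 + 1]]⟩,
  ⟨5, 19, 0.3333, 4, [32, 86, 498, 408], [[2 ^ 18, 2 ^ 12 + 1]]⟩,
  ⟨5, 20, 0.2799, 4, [32, 84, 512, 396], [[2 ^ 19, 2 ^ 11 + 1]]⟩,
  ⟨5, 21, 0.2724, 4, [32, 82, 530, 380], [[2 ^ 20, 2 ^ 10 + 1]]⟩,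
  ⟨5, 22, 0.2627, 4, [32, 80, 552, 360], [[2 ^ 21, 2 ^ 9 + 1]]⟩,
  ⟨5, 23, 0.2515, 4, [32, 78, 578, 336], [[2 ^ 22, 2 ^ 8 + 1]]⟩,
  ⟨5, 24, 0.2390, 4, [32, 76, 608, 308], [[2 ^ 23, 2 ^ 7 + 1]]⟩,
  ⟨5, 25, 0.2259, 4, [32, 74, 642, 276], [[2 ^ 24, 2 ^ 6 + 1]]⟩,
  ⟨5, 26, 0.2125, 4, [32, 72, 680, 240], [[2 ^ 25, 2 ^ 5 + 1]]⟩,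
  ⟨5, 27, 0.1992, 4, [32, 70, 722, 200], [[2 ^ 26, 2 ^ 4 + 1]]⟩,
  ⟨5, 28, 0.1864, 4, [32, 68, 768, 156], [[2 ^ 27, 2 ^ 3 + 1], [2 ^ 27, 3 * 2]]⟩,
  ⟨5, 29, 0.1741, 4, [32, 66, 818, 108], [[2 ^ 28, 2 ^ 2 + 1]]⟩,
  ⟨5, 30, 0.1626, 4, [32, 64, 872, 56], [[2 ^ 29, 2 + 1]]⟩,
  ⟨5, 31, 0.1518, 4, [32, 62, 930], [[2 ^ 30]]⟩]

/-- The rows with `t = 6` and `n ≤ 34`. -/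
def optTableC : List OptRow := [
  ⟨6, 6, 0, 4, [64, 384, 960, 1280, 960, 384, 64], [[2 ^ 6 - 1]]⟩,
  ⟨6, 12, 0.487, 3, [64, 228, 1092, 1020, 1692], [[2 ^ 11, 2 ^ 10 + 2 ^ 5, 3 * 2 ^ 8]]⟩,
  ⟨6, 13, 0.470, 3, [64, 226, 1086, 1100, 1620], [[2 ^ 12, 2 ^ 10 + 2 ^ 4, 3 * 2 ^ 8]]⟩,
  ⟨6, 14, 0.439, 3, [64, 250, 1002, 1508, 1032, 240], [[2 ^ 13 + 2 ^ 2, 2 ^ 13 + 3, 2 ^ 3 + 5]]⟩,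
  ⟨6, 15, 0.391, 3, [64, 248, 1024, 1592, 992, 176], [[2 ^ 14 + 3, 2 ^ 10 + 2 ^ 2]]⟩,
  ⟨6, 16, 0.333, 3, [64, 256, 1056, 1696, 928, 96], [[2 ^ 15 + 3, 2 ^ 4 - 1]]⟩,
  ⟨6, 17, 0.283, 3, [64, 248, 1144, 1800, 840], [[2 ^ 16 + 3]]⟩,
  ⟨6, 19, 0.36, 2, [64, 232, 1184, 1784, 832], [[2 ^ 18 + 2, 2 ^ 10 + 3]]⟩,
  ⟨6, 20, 0.277, 3, [64, 224, 1240, 1752, 816], [[2 ^ 19 + 2, 2 ^ 7 + 3]]⟩,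
  ⟨6, 21, 0.263, 3, [64, 216, 1320, 1704, 792], [[2 ^ 20 + 2, 2 ^ 4 + 3]]⟩,
  ⟨6, 22, 0.244, 3, [64, 208, 1424, 1640, 760], [[2 ^ 21 + 2]]⟩,
  ⟨6, 23, 0.242, 3, [64, 206, 1426, 1680, 720], [[2 ^ 22 + 1, 2 ^ 19 + 2]]⟩,
  ⟨6, 24, 0.238, 3, [64, 204, 1440, 1716, 672], [[2 ^ 23 + 1, 2 ^ 17 + 2]]⟩,
  ⟨6, 25, 0.231, 3, [64, 202, 1466, 1748, 616], [[2 ^ 24 + 1, 2 ^ 15 + 2]]⟩,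
  ⟨6, 26, 0.222, 3, [64, 200, 1504, 1776, 552], [[2 ^ 25 + 1, 2 ^ 13 + 2]]⟩,
  ⟨6, 27, 0.212, 3, [64, 198, 1554, 1800, 480], [[2 ^ 26 + 1, 2 ^ 11 + 2]]⟩,
  ⟨6, 28, 0.199, 3, [64, 204, 1584, 1844, 400], [[2 ^ 27 + 1, 2 ^ 5 + 3]]⟩,
  ⟨6, 28, 0.25, 2, [64, 196, 1616, 1820, 400], [[2 ^ 27 + 1, 2 ^ 9 + 2]]⟩,
  ⟨6, 29, 0.186, 3, [64, 200, 1672, 1848, 312], [[2 ^ 28 + 1, 2 ^ 4 + 3], [2 ^ 28 + 1, 3 * 2 ^ 2 + 1]]⟩,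
  ⟨6, 29, 0.333, 3, [64, 194, 1690, 1836, 312], [[2 ^ 28 + 1, 2 ^ 7 + 2]]⟩,
  ⟨6, 30, 0.174, 3, [64, 196, 1768, 1852, 216], [[2 ^ 29 + 1, 2 ^ 3 + 3]]⟩,
  ⟨6, 31, 0.163, 3, [64, 192, 1872, 1856, 112], [[2 ^ 30 + 1, 7]]⟩,
  ⟨6, 32, 0.152, 3, [64, 188, 1984, 1860], [[2 ^ 31 + 1]]⟩]

/-- The rows with `t = 6` and `35 ≤ n`. -/
def optTableD : List OptRow := [
  ⟨6, 35, 0.3333, 4, [64, 182, 2002, 1848], [[2 ^ 34, 2 ^ 28 + 1]]⟩,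
  ⟨6, 36, 0.2500, 4, [64, 180, 2016, 1836], [[2 ^ 35, 2 ^ 27 + 1]]⟩,
  ⟨6, 37, 0.200, 3, [64, 178, 2034, 1820], [[2 ^ 36, 2 ^ 26 + 1]]⟩,
  ⟨6, 38, 0.167, 3, [64, 176, 2056, 1800], [[2 ^ 37, 2 ^ 25 + 1]]⟩,
  ⟨6, 39, 0.151, 3, [64, 174, 2082, 1776], [[2 ^ 38, 2 ^ 24 + 1]]⟩,
  ⟨6, 40, 0.150, 3, [64, 172, 2112, 1748], [[2 ^ 39, 2 ^ 23 + 1]]⟩,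
  ⟨6, 41, 0.148, 3, [64, 170, 2146, 1716], [[2 ^ 40, 2 ^ 22 + 1]]⟩,
  ⟨6, 42, 0.146, 3, [64, 168, 2184, 1680], [[2 ^ 41, 2 ^ 21 + 1]]⟩,
  ⟨6, 43, 0.144, 3, [64, 166, 2226, 1640], [[2 ^ 42, 2 ^ 20 + 1]]⟩,
  ⟨6, 44, 0.141, 3, [64, 164, 2272, 1596], [[2 ^ 43, 2 ^ 19 + 1]]⟩,
  ⟨6, 45, 0.139, 3, [64, 162, 2322, 1548], [[2 ^ 44, 2 ^ 18 + 1]]⟩,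
  ⟨6, 46, 0.136, 3, [64, 160, 2376, 1496], [[2 ^ 45, 2 ^ 17 + 1]]⟩,
  ⟨6, 47, 0.133, 3, [64, 158, 2434, 1440], [[2 ^ 46, 2 ^ 16 + 1]]⟩,
  ⟨6, 48, 0.130, 3, [64, 156, 2496, 1380], [[2 ^ 47, 2 ^ 15 + 1]]⟩,
  ⟨6, 49, 0.127, 3, [64, 154, 2562, 1316], [[2 ^ 48, 2 ^ 14 + 1]]⟩,
  ⟨6, 50, 0.123, 3, [64, 152, 2632, 1248], [[2 ^ 49, 2 ^ 13 + 1]]⟩,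
  ⟨6, 51, 0.120, 3, [64, 150, 2706, 1176], [[2 ^ 50, 2 ^ 12 + 1]]⟩,
  ⟨6, 52, 0.117, 3, [64, 148, 2784, 1100], [[2 ^ 51, 2 ^ 11 + 1]]⟩,
  ⟨6, 53, 0.114, 3, [64, 146, 2866, 1020], [[2 ^ 52, 2 ^ 10 + 1]]⟩,
  ⟨6, 54, 0.110, 3, [64, 144, 2952, 936], [[2 ^ 53, 2 ^ 9 + 1]]⟩,
  ⟨6, 55, 0.107, 3, [64, 142, 3042, 848], [[2 ^ 54, 2 ^ 8 + 1]]⟩,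
  ⟨6, 56, 0.104, 3, [64, 140, 3136, 756], [[2 ^ 55, 2 ^ 7 + 1]]⟩,
  ⟨6, 57, 0.101, 3, [64, 138, 3234, 660], [[2 ^ 56, 2 ^ 6 + 1]]⟩,
  ⟨6, 58, 0.0978, 4, [64, 138, 3330, 452, 112], [[2 ^ 57, 2 ^ 3 + 1, 7]]⟩,
  ⟨6, 58, 0.1047, 4, [64, 136, 3336, 560], [[2 ^ 57, 2 ^ 5 + 1]]⟩,
  ⟨6, 59, 0.0946, 4, [64, 136, 3440, 344, 112], [[2 ^ 58, 7]]⟩,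
  ⟨6, 59, 0.1179, 4, [64, 134, 3442, 456], [[2 ^ 58, 2 ^ 4 + 1]]⟩,
  ⟨6, 60, 0.0920, 4, [64, 132, 3552, 348], [[2 ^ 59, 2 ^ 3 + 1], [2 ^ 59, 3 * 2]]⟩,
  ⟨6, 61, 0.0892, 4, [64, 130, 3666, 236], [[2 ^ 60, 2 ^ 2 + 1]]⟩,
  ⟨6, 62, 0.0864, 4, [64, 128, 3784, 120], [[2 ^ 61, 2 + 1]]⟩,
  ⟨6, 63, 0.0838, 4, [64, 126, 3906], [[2 ^ 62]]⟩]

def optTable : List OptRow := optTableA ++ optTableB ++ optTableC ++ optTableD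

/-- The `i`-th row of the table. -/
def optRow (i : Fin optTable.length) : OptRow := optTable.get i

/-- The values of `p` at which the sets of row `i` perform better than the sets of all preceding
rows with the same `t`. -/
def beatsPreceding (i : Fin optTable.length) : Set ℝ :=
  {p : ℝ | p ∈ Set.Ioo (0 : ℝ) (1 / 2) ∧
    ∀ j < i, (optRow j).t = (optRow i).t → ∀ G ∈ (optRow i).sets, ∀ H ∈ (optRow j).sets,
      collisionProb (generated (optRow i).n H) p < collisionProb (generated (optRow i).n G) p}

/-!
Up to a positive factor, `P_S(p)` is `∑ θ ^ d(x, y)` over the pairs of points of `S`, where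
`θ = p / (1 - p)` lies between `0` and `1` (`collisionProb_eq`). The theorem asks which sets of `2 ^ t`
points maximize this sum.

*Reduction.* Replacing the points of `S` outside a half-space by their mirror images, where these are
not yet in `S`, does not decrease the sum, and strictly increases it unless this amounts to a symmetry
(`cubeSum_compress`). Applied to complementations and to switches of two coordinates, this shows that
every optimal set is isomorphic to a right-shifted down-set (`exists_isomorphic_ideal`). Represent the
points by their sets of binary exponents. A right-shifted down-set becomes a family closed under passing
to smaller sets in the partial order `Dom`, which compares the numbers of elements in final segments
(`below_iff`). If the one-element sets in it are `{0}, …, {m - 1}`, the family is determined by its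
members with at least two elements, and each of these has at most `2 ^ t ≤ 64` sets below it. There are
few such sets (`mem_universeData`).

*Search.* Fix `t` and `m`, and divide `[0, 1)` into a few intervals `[a / q, b / q)`. With
`θ = (a + b y) / (q + q y)` and `y ≥ 0`, the sum for a family, multiplied by `(q + q y) ^ N`, becomes a
polynomial in `y` whose coefficients are linear functionals of the distance distribution with
nonnegative weights. On each interval a row of the table is chosen for comparison, and it suffices that
no functional exceeds its value for this row (`distSum_lt_of_weightSum`). The functional is a sum of
scores of the members and of interactions of pairs, so a branch-and-bound search over the families
proves the inequality (`search_sound`, `checkInterval_sound`). Only the families of the sets listed for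
`t` and `m` are excepted. The search works on vectors packed into natural numbers, whose arithmetic the
kernel performs natively. The result is `family_beaten`: a family is listed in the table, or for every
`θ` it is beaten by some row.

*The table.* The sizes and distance distributions of the listed sets are evaluated
(`distSum_generatedFamily`). Sets in the same row are told apart by the sum of the cubes of the numbers
of neighbours of their points, an invariant under isomorphism (`neighbourCubes_eq_of_isomorphic`).

*Crossover values.* If the partial sums of the coefficients of two distance distribution functions
change their order only once, the functions cross exactly once in `(0, 1)` (`exists_unique_crossing`).
Each row other than the first one of its size has a preceding row with this property whose crossing
point lies within narrow bounds; beyond it the row is better than all preceding ones, at least up to a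
point where the next row has taken over (`Thresholds`). Hence the crossing points are the required
infima (`isGLB_beatsPreceding`), and they determine the rows with maximal value for each `θ`
(`Thresholds.maximal_iff`). Some optimal set exists and is isomorphic to a listed one, so exactly the
sets isomorphic to those of the maximal rows are optimal (`isOptimalFor_iff`).
-/

noncomputable section

/-! ### Symmetries of the cube and compression -/

section

variable {n : ℕ}

theorem flipCoord_flipCoord (i : Fin n) (x : BitCube n) : flipCoord i (flipCoord i x) = x := by
  funext k
  by_cases h : k = i
  · subst h
    simp only [flipCoord, Function.update_self]
    have : ∀ a : ZMod 2, a + 1 + 1 = a := by decide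
    exact this _
  · simp [flipCoord, h]

theorem swapCoord_swapCoord (i j : Fin n) (x : BitCube n) : swapCoord i j (swapCoord i j x) = x := by
  funext k
  simp [swapCoord]

theorem hammingDist_flipCoord (i : Fin n) (x y : BitCube n) :
    hammingDist (flipCoord i x) (flipCoord i y) = hammingDist x y := by
  unfold hammingDist
  congr 1
  ext k
  refine Finset.mem_filter.trans (Iff.trans ?_ Finset.mem_filter.symm)
  by_cases h : k = i
  · subst h; simp [flipCoord]
  · simp [flipCoord, h]

theorem hammingDist_swapCoord (i j : Fin n) (x y : BitCube n) :
    hammingDist (swapCoord i j x) (swapCoord i j y) = hammingDist x y := by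
  unfold hammingDist
  refine Finset.card_bij (fun k _ => Equiv.swap i j k) (fun k hk => ?_)
    (fun _ _ _ _ h => (Equiv.swap i j).injective h) fun k hk => ⟨Equiv.swap i j k, ?_, by simp⟩
  · exact Finset.mem_filter.2 ⟨Finset.mem_univ _, (Finset.mem_filter.1 hk).2⟩
  · refine Finset.mem_filter.2 ⟨Finset.mem_univ _, ?_⟩
    have := (Finset.mem_filter.1 hk).2
    simpa [swapCoord] using this

/-- Symmetries preserve size and collision probability. -/
theorem isometry_invariant {τ : BitCube n → BitCube n} (h1 : ∀ x, τ (τ x) = x)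
    (h2 : ∀ x y, hammingDist (τ x) (τ y) = hammingDist x y) (S : Finset (BitCube n)) :
    (S.image τ).card = S.card ∧ ∀ p, collisionProb (S.image τ) p = collisionProb S p := by
  have hinj : Function.Injective τ := fun x y h => by rw [← h1 x, h, h1]
  have hc := Finset.card_image_of_injective S hinj
  refine ⟨hc, fun p => ?_⟩
  unfold collisionProb
  rw [hc, Finset.sum_image fun _ _ _ _ h => hinj h]
  simp only [Finset.sum_image fun _ _ _ _ h => hinj h, h2]

/-- Isomorphic sets have the same size and the same collision probabilities. -/
theorem Isomorphic.invariant {S T : Finset (BitCube n)} (h : Isomorphic S T) :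
    T.card = S.card ∧ ∀ p, collisionProb T p = collisionProb S p := by
  induction h with
  | refl => exact ⟨rfl, fun _ => rfl⟩
  | flip V i _ ih =>
    obtain ⟨h1, h2⟩ := isometry_invariant (flipCoord_flipCoord i) (hammingDist_flipCoord i) V
    exact ⟨h1.trans ih.1, fun p => (h2 p).trans (ih.2 p)⟩
  | swap V i j _ ih =>
    obtain ⟨h1, h2⟩ := isometry_invariant (swapCoord_swapCoord i j) (hammingDist_swapCoord i j) V
    exact ⟨h1.trans ih.1, fun p => (h2 p).trans (ih.2 p)⟩

/-- `∑ θ ^ d(x, y)` over the pairs of points of a set. -/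
def cubeSum (S : Finset (BitCube n)) (θ : ℝ) : ℝ := ∑ x ∈ S, ∑ y ∈ S, θ ^ hammingDist x y

/-- Up to a factor that depends only on `p`, `n` and the size of the set, the collision probability
is the sum of `θ ^ d(x, y)` for the odds `θ = p / (1 - p)`. -/
theorem collisionProb_eq (S : Finset (BitCube n)) {p : ℝ} (hp : p < 1) :
    collisionProb S p = (1 - p) ^ n / S.card * cubeSum S (p / (1 - p)) := by
  have h1 : (1 - p) ≠ 0 := by linarith
  have h2 : ∀ x y : BitCube n, p ^ hammingDist x y * (1 - p) ^ (n - hammingDist x y) =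
      (1 - p) ^ n * (p / (1 - p)) ^ hammingDist x y := fun x y => by
    have hle : hammingDist x y ≤ n := by
      simpa using hammingDist_le_card_fintype (x := x) (y := y)
    obtain ⟨k, hk⟩ := Nat.exists_eq_add_of_le hle
    have h3 : n - hammingDist x y = k := by omega
    have h4 : (1 - p) ^ n = (1 - p) ^ hammingDist x y * (1 - p) ^ k := by rw [← pow_add, ← hk]
    rw [h3, h4, div_pow]
    field_simp
  unfold collisionProb cubeSum
  simp only [h2, ← Finset.mul_sum]
  ring

theorem collisionProb_le_iff {S T : Finset (BitCube n)} (h : T.card = S.card) (hS : 0 < S.card) {p : ℝ}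
    (hp : p < 1) : collisionProb T p ≤ collisionProb S p ↔
      cubeSum T (p / (1 - p)) ≤ cubeSum S (p / (1 - p)) := by
  rw [collisionProb_eq S hp, collisionProb_eq T hp, h]
  have h1 : 0 < 1 - p := by linarith
  exact mul_le_mul_iff_right₀ (by positivity)

/-- Moving the points of `B` by `τ` brings them closer to the points of `C` and changes nothing in the
multiset of their distances to the other points. -/
theorem cubeSum_compress {τ : BitCube n → BitCube n} (h1 : ∀ x, τ (τ x) = x)
    (h2 : ∀ x y, hammingDist (τ x) (τ y) = hammingDist x y) {B C Q : Finset (BitCube n)}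
    (hBC : Disjoint B C) (hBQ : Disjoint B Q) (hCQ : Disjoint C Q) (hQ : ∀ x ∈ Q, τ x ∈ Q)
    (hB : Disjoint (B.image τ) (C ∪ Q)) (hB0 : B.Nonempty) (hC0 : C.Nonempty)
    (hlt : ∀ x ∈ B, ∀ y ∈ C, hammingDist (τ x) y < hammingDist x y) {θ : ℝ} (hθ : 0 < θ)
    (hθ1 : θ < 1) : cubeSum (B ∪ (C ∪ Q)) θ < cubeSum (B.image τ ∪ (C ∪ Q)) θ := by
  have hinj : Function.Injective τ := fun x y h => by rw [← h1 x, h, h1]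
  have hsplit : ∀ X : Finset (BitCube n), Disjoint X (C ∪ Q) → cubeSum (X ∪ (C ∪ Q)) θ =
      cubeSum X θ + 2 * (∑ x ∈ X, ∑ y ∈ C, θ ^ hammingDist x y +
        ∑ x ∈ X, ∑ y ∈ Q, θ ^ hammingDist x y) + cubeSum (C ∪ Q) θ := fun X hX => by
    have e1 : ∑ x ∈ C ∪ Q, ∑ y ∈ X, θ ^ hammingDist x y =
        ∑ x ∈ X, ∑ y ∈ C ∪ Q, θ ^ hammingDist x y := by
      rw [Finset.sum_comm]
      simp only [hammingDist_comm]
    have e2 : ∑ x ∈ X, ∑ y ∈ C ∪ Q, θ ^ hammingDist x y = ∑ x ∈ X, ∑ y ∈ C, θ ^ hammingDist x y +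
        ∑ x ∈ X, ∑ y ∈ Q, θ ^ hammingDist x y := by
      rw [← Finset.sum_add_distrib]
      exact Finset.sum_congr rfl fun x _ => Finset.sum_union hCQ
    unfold cubeSum
    rw [Finset.sum_union hX, Finset.sum_congr rfl fun x _ => Finset.sum_union hX,
      Finset.sum_congr rfl (s₁ := C ∪ Q) fun x _ => Finset.sum_union hX, Finset.sum_add_distrib,
      Finset.sum_add_distrib, e1, e2]
    ring
  rw [hsplit _ (Finset.disjoint_union_right.2 ⟨hBC, hBQ⟩), hsplit _ hB]
  have e3 : cubeSum (B.image τ) θ = cubeSum B θ := by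
    unfold cubeSum
    rw [Finset.sum_image fun _ _ _ _ h => hinj h]
    simp only [Finset.sum_image fun _ _ _ _ h => hinj h, h2]
  have e4 : ∑ x ∈ B.image τ, ∑ y ∈ Q, θ ^ hammingDist x y =
      ∑ x ∈ B, ∑ y ∈ Q, θ ^ hammingDist x y := by
    rw [Finset.sum_image fun _ _ _ _ h => hinj h]
    refine Finset.sum_congr rfl fun x _ => ?_
    refine Finset.sum_nbij' τ τ hQ hQ (fun y _ => h1 y) (fun y _ => h1 y) fun y _ => ?_
    rw [← h2, h1]
  have e5 : ∑ x ∈ B, ∑ y ∈ C, θ ^ hammingDist x y <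
      ∑ x ∈ B.image τ, ∑ y ∈ C, θ ^ hammingDist x y := by
    rw [Finset.sum_image fun _ _ _ _ h => hinj h]
    exact Finset.sum_lt_sum_of_nonempty hB0 fun x hx => Finset.sum_lt_sum_of_nonempty hC0 fun y hy =>
      pow_lt_pow_right_of_lt_one₀ hθ hθ1 (hlt x hx y hy)
  rw [e3, e4]
  linarith

/-- The sum of the positions, counted from the right, of the nonzero coordinates. -/
def positionSum (x : BitCube n) : ℕ := ∑ k : Fin n, if x k = 0 then 0 else n - k

/-- An optimal set with the least sum of `positionSum` among its isomorphic copies is closed under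
every symmetry that lowers `positionSum`. -/
theorem compress_mem {τ : BitCube n → BitCube n} (h1 : ∀ x, τ (τ x) = x)
    (h2 : ∀ x y, hammingDist (τ x) (τ y) = hammingDist x y) {up : BitCube n → Prop}
    (hup : ∀ x, τ x ≠ x → up x ∨ up (τ x)) (hup' : ∀ x, up x → ¬ up (τ x))
    (hpos : ∀ x, up x → positionSum (τ x) < positionSum x)
    (hlt : ∀ x y, up x → up (τ y) → hammingDist (τ x) y < hammingDist x y)
    {S : Finset (BitCube n)} {p : ℝ} (hp : 0 < p) (hp2 : p < 1 / 2) (hS : IsOptimalFor S p)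
    (hmin : ∑ x ∈ S, positionSum x ≤ ∑ x ∈ S.image τ, positionSum x) :
    ∀ x ∈ S, up x → τ x ∈ S := by
  classical
  intro x0 hx0 hux0
  by_contra hτx0
  have hinj : Function.Injective τ := fun x y h => by rw [← h1 x, h, h1]
  -- `B` and `C` hold the points that are moved out of `S`, upper and lower ones; `τ` permutes `Q`
  set B := S.filter fun x => up x ∧ τ x ∉ S with hB
  set C := S.filter fun x => up (τ x) ∧ τ x ∉ S with hC
  set Q := S.filter fun x => τ x ∈ S with hQ
  have hBC : Disjoint B C := Finset.disjoint_filter.2 fun x _ h h' => hup' x h.1 h'.1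
  have hBQ : Disjoint B Q := Finset.disjoint_filter.2 fun x _ h h' => h.2 h'
  have hCQ : Disjoint C Q := Finset.disjoint_filter.2 fun x _ h h' => h.2 h'
  have hSe : S = B ∪ (C ∪ Q) := by
    ext x
    simp only [hB, hC, hQ, Finset.mem_union, Finset.mem_filter]
    constructor
    · intro hx
      by_cases h : τ x ∈ S
      · exact Or.inr (Or.inr ⟨hx, h⟩)
      · rcases hup x fun h' => h (h'.symm ▸ hx) with h' | h'
        · exact Or.inl ⟨hx, h', h⟩
        · exact Or.inr (Or.inl ⟨hx, h', h⟩)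
    · rintro (h | h | h) <;> exact h.1
  have hQτ : ∀ x ∈ Q, τ x ∈ Q := fun x hx => by
    have := Finset.mem_filter.1 hx
    exact Finset.mem_filter.2 ⟨this.2, (h1 x).symm ▸ this.1⟩
  have hBτ : Disjoint (B.image τ) (C ∪ Q) := by
    rw [Finset.disjoint_left]
    intro y hy hy'
    obtain ⟨x, hx, rfl⟩ := Finset.mem_image.1 hy
    refine (Finset.mem_filter.1 hx).2.2 ?_
    rw [hSe]; exact Finset.mem_union_right _ hy'
  have hB0 : B.Nonempty := ⟨x0, Finset.mem_filter.2 ⟨hx0, hux0, hτx0⟩⟩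
  rcases C.eq_empty_or_nonempty with hC0 | hC0
  · -- all points that are moved are moved down
    have h3 : ∑ x ∈ Q, positionSum (τ x) = ∑ x ∈ Q, positionSum x :=
      Finset.sum_nbij' τ τ hQτ hQτ (fun y _ => h1 y) (fun y _ => h1 y) fun y _ => rfl
    have h4 : ∑ x ∈ B, positionSum (τ x) < ∑ x ∈ B, positionSum x :=
      Finset.sum_lt_sum_of_nonempty hB0 fun x hx => hpos x (Finset.mem_filter.1 hx).2.1
    rw [Finset.sum_image fun _ _ _ _ h => hinj h, hSe, hC0, Finset.empty_union,
      Finset.sum_union hBQ, Finset.sum_union hBQ, h3] at hmin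
    omega
  · -- if there are lower points as well, moving the upper ones increases the collision probability
    have hp1 : 0 < 1 - p := by linarith
    have hc : (B.image τ ∪ (C ∪ Q)).card = S.card := by
      rw [hSe, Finset.card_union_of_disjoint hBτ, Finset.card_image_of_injective _ hinj,
        Finset.card_union_of_disjoint (Finset.disjoint_union_right.2 ⟨hBC, hBQ⟩)]
    have h3 := (collisionProb_le_iff hc (Finset.card_pos.2 ⟨x0, hx0⟩) (by linarith)).1 (hS _ hc)
    have h4 := cubeSum_compress h1 h2 hBC hBQ hCQ hQτ hBτ hB0 hC0
      (fun x hx y hy => hlt x y (Finset.mem_filter.1 hx).2.1 (Finset.mem_filter.1 hy).2.1)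
      (div_pos hp hp1) (by rw [div_lt_one hp1]; linarith)
    rw [← hSe] at h4
    exact absurd h3 (not_le.2 h4)

end

/-! ### Reduction to right-shifted down-sets -/

section

variable {n : ℕ}

theorem bit_cases (a : ZMod 2) : a = 0 ∨ a = 1 := by revert a; decide

theorem shiftCoord_comm (i j : Fin n) (x : BitCube n) : shiftCoord i j x = shiftCoord j i x := by
  unfold shiftCoord swapCoord
  rw [min_comm, Equiv.swap_comm]

theorem positionSum_flipCoord {i : Fin n} {x : BitCube n} (h : x i = 1) :
    positionSum (flipCoord i x) < positionSum x := by
  refine Finset.sum_lt_sum (fun k _ => ?_) ⟨i, Finset.mem_univ _, ?_⟩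
  · by_cases hk : k = i
    · subst hk; simp [flipCoord, h, show (1 : ZMod 2) + 1 = 0 by decide]
    · simp [flipCoord, hk]
  · simp [flipCoord, h, show (1 : ZMod 2) + 1 = 0 by decide]

theorem hammingDist_lt {x y z : BitCube n} (h : ∀ k, x k ≠ y k → z k ≠ y k) {a : Fin n}
    (h1 : x a = y a) (h2 : z a ≠ y a) : hammingDist x y < hammingDist z y := by
  refine Finset.card_lt_card ((Finset.ssubset_iff_of_subset fun k hk => ?_).2 ⟨a, ?_, fun ha => ?_⟩)
  · exact Finset.mem_filter.2 ⟨Finset.mem_univ _, h k (Finset.mem_filter.1 hk).2⟩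
  · exact Finset.mem_filter.2 ⟨Finset.mem_univ _, h2⟩
  · exact (Finset.mem_filter.1 ha).2 h1

theorem positionSum_swapCoord {i j : Fin n} (hij : i < j) {x : BitCube n} (hi : x i = 1)
    (hj : x j = 0) : positionSum (swapCoord i j x) < positionSum x := by
  have h1 : positionSum (swapCoord i j x) =
      ∑ k : Fin n, if x k = 0 then 0 else n - (Equiv.swap i j k : ℕ) := by
    refine Finset.sum_nbij' (Equiv.swap i j) (Equiv.swap i j) (fun _ _ => Finset.mem_univ _)
      (fun _ _ => Finset.mem_univ _) (fun _ _ => by simp) (fun _ _ => by simp) fun k _ => ?_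
    simp [swapCoord]
    rfl
  rw [h1]
  have hlt : (i : ℕ) < j := hij
  refine Finset.sum_lt_sum (fun k _ => ?_) ⟨i, Finset.mem_univ _, ?_⟩
  · by_cases hki : k = i
    · subst hki; simp only [hi, one_ne_zero, if_false, Equiv.swap_apply_left]; omega
    · by_cases hkj : k = j
      · subst hkj; simp [hj]
      · rw [Equiv.swap_apply_of_ne_of_ne hki hkj]
  · simp only [hi, one_ne_zero, if_false, Equiv.swap_apply_left]
    have := j.isLt
    omega

/-- Every optimal set has an isomorphic copy that is a right-shifted down-set. -/
theorem exists_isomorphic_ideal {S : Finset (BitCube n)} {p : ℝ} (hp : 0 < p) (hp2 : p < 1 / 2)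
    (hS : IsOptimalFor S p) :
    ∃ T, Isomorphic S T ∧ IsOptimalFor T p ∧ IsDownSet T ∧ IsRightShifted T := by
  classical
  obtain ⟨T, hT, hmin⟩ := (measure fun T : Finset (BitCube n) => ∑ x ∈ T, positionSum x).wf.has_min
    {T | Isomorphic S T} ⟨S, .refl⟩
  have hmin : ∀ U, Isomorphic S U → ∑ x ∈ T, positionSum x ≤ ∑ x ∈ U, positionSum x := fun U hU =>
    not_lt.1 (hmin U hU)
  obtain ⟨hc, hP⟩ := hT.invariant
  have hTopt : IsOptimalFor T p := fun U hU => by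
    rw [hP p]; exact hS U (hU.trans hc)
  refine ⟨T, hT, hTopt, fun i x hx => ?_, fun i j => ?_⟩
  · rcases bit_cases (x i) with h | h
    · have : clearCoord i x = x := by
        funext k; by_cases hk : k = i
        · subst hk; simp [clearCoord, h]
        · simp [clearCoord, hk]
      rwa [this]
    · have : clearCoord i x = flipCoord i x := by
        unfold clearCoord flipCoord
        rw [h, show (1 : ZMod 2) + 1 = 0 by decide]
      rw [this]
      refine compress_mem (flipCoord_flipCoord i) (hammingDist_flipCoord i) (up := fun x => x i = 1)
        (fun x _ => ?_) (fun x hx => ?_) (fun x hx => positionSum_flipCoord hx) (fun x y hx hy => ?_)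
        hp hp2 hTopt (hmin _ (hT.flip T i)) x hx h
      · rcases bit_cases (x i) with h | h <;> simp [flipCoord, h]
      · simp [flipCoord, hx, show (1 : ZMod 2) + 1 = 0 by decide]
      · have hy : y i = 0 := by
          rcases bit_cases (y i) with h | h
          · exact h
          · simp [flipCoord, h, show (1 : ZMod 2) + 1 = 0 by decide] at hy
        refine hammingDist_lt (fun k hk => ?_) (a := i) ?_ ?_
        · by_cases hki : k = i
          · subst hki; simp [hx, hy]
          · simpa [flipCoord, hki] using hk
        · simp [flipCoord, hx, hy, show (1 : ZMod 2) + 1 = 0 by decide]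
        · simp [hx, hy]
  · have key : ∀ i j : Fin n, i < j → ∀ x ∈ T, shiftCoord i j x ∈ T := by
      intro i j hij x hx
      have hsw : ∀ z : BitCube n, swapCoord i j z i = z j ∧ swapCoord i j z j = z i := fun z => by
        simp [swapCoord]
      have hsw' : ∀ (z : BitCube n) (k : Fin n), k ≠ i → k ≠ j → swapCoord i j z k = z k :=
        fun z k h1 h2 => by simp [swapCoord, Equiv.swap_apply_of_ne_of_ne h1 h2]
      have hfix : ∀ z : BitCube n, z i = z j → swapCoord i j z = z := fun z h => by
        funext k
        by_cases h1 : k = i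
        · subst h1; rw [(hsw z).1, h]
        · by_cases h2 : k = j
          · subst h2; rw [(hsw z).2, h]
          · exact hsw' z k h1 h2
      unfold shiftCoord
      rw [min_eq_left hij.le]
      split_ifs with h
      · exact hx
      have hi := (bit_cases (x i)).resolve_left h
      rcases bit_cases (x j) with hj | hj
      · refine compress_mem (swapCoord_swapCoord i j) (hammingDist_swapCoord i j)
          (up := fun x => x i = 1 ∧ x j = 0) (fun x hx => ?_) (fun x hx => ?_)
          (fun x hx => positionSum_swapCoord hij hx.1 hx.2) (fun x y hx hy => ?_)
          hp hp2 hTopt (hmin _ (hT.swap T i j)) x hx ⟨hi, hj⟩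
        · rw [(hsw x).1, (hsw x).2]
          have : x i ≠ x j := fun h => hx (hfix x h)
          rcases bit_cases (x i) with h1 | h1 <;> rcases bit_cases (x j) with h2 | h2 <;> simp_all
        · rw [(hsw x).1, (hsw x).2, hx.1, hx.2]; decide
        · rw [(hsw y).1, (hsw y).2] at hy
          refine hammingDist_lt (fun k hk => ?_) (a := i) ?_ ?_
          · by_cases h1 : k = i
            · subst h1; rw [hx.1, hy.2]; decide
            · by_cases h2 : k = j
              · subst h2; rw [hx.2, hy.1]; decide
              · rwa [hsw' x k h1 h2] at hk
          · rw [(hsw x).1, hx.2, hy.2]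
          · rw [hx.1, hy.2]; decide
      · rw [hfix x (hi.trans hj.symm)]; exact hx
    intro x hx
    rcases lt_trichotomy i j with h | h | h
    · exact key i j h x hx
    · subst h
      unfold shiftCoord
      have : swapCoord i i x = x := by funext k; simp [swapCoord]
      rw [this]; split_ifs <;> exact hx
    · rw [shiftCoord_comm]; exact key j i h x hx

end

namespace OptimalSets

/-! ### Vectors packed into natural numbers -/

theorem shr_eq (a b : ℕ) : Nat.shiftRight a b = a / 2 ^ b := Nat.shiftRight_eq_div_pow a b

theorem shl_eq (a b : ℕ) : Nat.shiftLeft a b = a * 2 ^ b := Nat.shiftLeft_eq a b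

/-- The number whose `n` lowest lanes of `W` bits are the values of `f`. -/
def pk (W n : ℕ) (f : ℕ → ℕ) : ℕ := ∑ i ∈ Finset.range n, f i * 2 ^ (W * i)

theorem pk_zero (W : ℕ) (f : ℕ → ℕ) : pk W 0 f = 0 := rfl

theorem pk_succ (W n : ℕ) (f : ℕ → ℕ) : pk W (n + 1) f = pk W n f + 2 ^ (W * n) * f n := by
  rw [pk, Finset.sum_range_succ, mul_comm (f n)]; rfl

theorem pk_succ' (W n : ℕ) (f : ℕ → ℕ) :
    pk W (n + 1) f = f 0 + 2 ^ W * pk W n (fun i => f (i + 1)) := by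
  rw [pk, Finset.sum_range_succ', pk, Finset.mul_sum, add_comm]
  simp only [mul_zero, pow_zero, mul_one, Nat.mul_add, pow_add]
  congr 1
  exact Finset.sum_congr rfl fun i _ => by ring

theorem pk_congr {W n : ℕ} {f g : ℕ → ℕ} (h : ∀ i < n, f i = g i) : pk W n f = pk W n g :=
  Finset.sum_congr rfl fun i hi => by rw [h i (Finset.mem_range.1 hi)]

theorem pk_add (W n : ℕ) (f g : ℕ → ℕ) : pk W n f + pk W n g = pk W n (fun i => f i + g i) := by
  simp only [pk, ← Finset.sum_add_distrib, add_mul]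

theorem mul_pk (W n c : ℕ) (f : ℕ → ℕ) : c * pk W n f = pk W n (fun i => c * f i) := by
  simp only [pk, Finset.mul_sum, mul_assoc]

theorem pk_sub {W n : ℕ} {f g : ℕ → ℕ} (h : ∀ i < n, g i ≤ f i) :
    pk W n f - pk W n g = pk W n (fun i => f i - g i) := by
  refine (Nat.sub_eq_iff_eq_add (Finset.sum_le_sum fun i hi =>
    Nat.mul_le_mul_right _ (h i (Finset.mem_range.1 hi)))).2 ?_
  refine .trans ?_ (pk_add W n _ _).symm
  exact pk_congr fun i hi => (Nat.sub_add_cancel (h i hi)).symm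

theorem pk_lt {W n : ℕ} {f : ℕ → ℕ} (h : ∀ i < n, f i < 2 ^ W) : pk W n f < 2 ^ (W * n) := by
  induction n with
  | zero => simp [pk_zero]
  | succ n ih =>
    have h1 := ih fun i hi => h i (hi.trans (Nat.lt_succ_self n))
    have h2 : f n + 1 ≤ 2 ^ W := h n (Nat.lt_succ_self n)
    rw [pk_succ, Nat.mul_succ, pow_add]
    nlinarith [Nat.mul_le_mul_left (2 ^ (W * n)) h2]

theorem lane_pk {W n : ℕ} {f : ℕ → ℕ} (h : ∀ i < n, f i < 2 ^ W) {i : ℕ} (hi : i < n) :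
    pk W n f / 2 ^ (W * i) % 2 ^ W = f i := by
  induction n generalizing f i with
  | zero => omega
  | succ n ih =>
    rw [pk_succ']
    have h0 : f 0 < 2 ^ W := h 0 (Nat.succ_pos n)
    cases i with
    | zero => simp [Nat.mod_eq_of_lt h0]
    | succ i =>
      rw [Nat.mul_succ, add_comm (W * i), pow_add, ← Nat.div_div_eq_div_mul,
        Nat.add_mul_div_left _ _ (by positivity), Nat.div_eq_of_lt h0, zero_add]
      exact ih (f := fun i => f (i + 1)) (fun j hj => h (j + 1) (by omega)) (by omega)

/-- Bitwise conjunction acts separately on the lowest `k` bits and on the others. -/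
theorem land_split {k a b c d : ℕ} (ha : a < 2 ^ k) (hc : c < 2 ^ k) :
    (a + 2 ^ k * b) &&& (c + 2 ^ k * d) = (a &&& c) + 2 ^ k * (b &&& d) := by
  have hac : a &&& c < 2 ^ k := lt_of_le_of_lt Nat.and_le_left ha
  apply Nat.eq_of_testBit_eq
  intro j
  rw [Nat.testBit_and, add_comm a, add_comm c, add_comm (a &&& c),
    Nat.testBit_two_pow_mul_add _ ha, Nat.testBit_two_pow_mul_add _ hc,
    Nat.testBit_two_pow_mul_add _ hac]
  split <;> simp [Nat.testBit_and]

theorem lor_split {k a b c d : ℕ} (ha : a < 2 ^ k) (hc : c < 2 ^ k) :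
    (a + 2 ^ k * b) ||| (c + 2 ^ k * d) = (a ||| c) + 2 ^ k * (b ||| d) := by
  have hac : a ||| c < 2 ^ k := Nat.or_lt_two_pow ha hc
  apply Nat.eq_of_testBit_eq
  intro j
  rw [Nat.testBit_or, add_comm a, add_comm c, add_comm (a ||| c),
    Nat.testBit_two_pow_mul_add _ ha, Nat.testBit_two_pow_mul_add _ hc,
    Nat.testBit_two_pow_mul_add _ hac]
  split <;> simp [Nat.testBit_or]

theorem pk_land {W n : ℕ} {f g : ℕ → ℕ} (hf : ∀ i < n, f i < 2 ^ W) (hg : ∀ i < n, g i < 2 ^ W) :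
    pk W n f &&& pk W n g = pk W n (fun i => f i &&& g i) := by
  induction n with
  | zero => simp [pk_zero]
  | succ n ih =>
    rw [pk_succ, pk_succ, pk_succ, land_split (pk_lt fun i hi => hf i (by omega))
      (pk_lt fun i hi => hg i (by omega)), ih (fun i hi => hf i (by omega))
      (fun i hi => hg i (by omega))]

theorem pk_lor {W n : ℕ} {f g : ℕ → ℕ} (hf : ∀ i < n, f i < 2 ^ W) (hg : ∀ i < n, g i < 2 ^ W) :
    pk W n f ||| pk W n g = pk W n (fun i => f i ||| g i) := by
  induction n with
  | zero => simp [pk_zero]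
  | succ n ih =>
    rw [pk_succ, pk_succ, pk_succ, lor_split (pk_lt fun i hi => hf i (by omega))
      (pk_lt fun i hi => hg i (by omega)), ih (fun i hi => hf i (by omega))
      (fun i hi => hg i (by omega))]

/-- Modulo `2 ^ W - 1` the weight of every lane is `1`: casting out `2 ^ W - 1` adds up the lanes.
-/
theorem pk_mod {W n : ℕ} {f : ℕ → ℕ} (h : ∑ i ∈ Finset.range n, f i < 2 ^ W - 1) :
    pk W n f % (2 ^ W - 1) = ∑ i ∈ Finset.range n, f i := by
  have h1 : 2 ^ W ≡ 1 [MOD 2 ^ W - 1] := by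
    have : 1 ≤ 2 ^ W := Nat.one_le_two_pow
    exact (Nat.modEq_iff_dvd' this).2 dvd_rfl |>.symm
  have h2 : pk W n f ≡ ∑ i ∈ Finset.range n, f i [MOD 2 ^ W - 1] := by
    unfold pk
    clear h
    induction n with
    | zero => rfl
    | succ n ih =>
      rw [Finset.sum_range_succ, Finset.sum_range_succ]
      refine ih.add ?_
      have := (h1.pow n).mul_left (f n)
      rwa [one_pow, mul_one, ← pow_mul] at this
  rw [h2, Nat.mod_eq_of_lt h]

theorem pk_shr {V W n : ℕ} {f : ℕ → ℕ} : pk W n (fun i => 2 ^ V * f i) / 2 ^ V = pk W n f := by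
  rw [← mul_pk, Nat.mul_div_cancel_left _ (by positivity)]

/-- `L = a - (a &&& (a - 1))` is the lowest bit of `a`. -/
theorem lowest_bit {a : ℕ} (ha : a ≠ 0) : ∃ p, a.testBit p = true ∧ a - (a &&& (a - 1)) = 2 ^ p := by
  obtain ⟨p, m, ⟨b, rfl⟩, rfl⟩ := Nat.exists_eq_two_pow_mul_odd ha
  refine ⟨p, by simp [Nat.testBit_two_pow_mul], ?_⟩
  have h1 : 2 ^ p * (2 * b + 1) - 1 = (2 ^ p - 1) + 2 ^ p * (2 * b) := by
    have : 1 ≤ 2 ^ p := Nat.one_le_two_pow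
    rw [mul_add]; omega
  have h2 : (2 * b + 1) &&& (2 * b) = 2 * b := by
    have := land_split (k := 1) (a := 1) (b := b) (c := 0) (d := b) (by norm_num) (by norm_num)
    simp only [pow_one, Nat.and_zero, zero_add, Nat.and_self] at this
    rwa [add_comm] at this
  have h3 := land_split (k := p) (a := 0) (b := 2 * b + 1) (c := 2 ^ p - 1) (d := 2 * b)
    (by positivity) (by have : 1 ≤ 2 ^ p := Nat.one_le_two_pow
                        omega)
  rw [zero_add, Nat.zero_and, zero_add, h2] at h3
  rw [h1, h3, mul_add]; omega

/-- In a packed mask with one guard bit in each lane, a set bit determines its lane. -/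
theorem testBit_pk {W n V : ℕ} (hV : V < W) {al : ℕ → ℕ} (hal : ∀ i < n, al i ≤ 1) {p : ℕ}
    (h : (pk W n fun i => 2 ^ V * al i).testBit p = true) :
    ∃ i < n, al i = 1 ∧ p = W * i + V := by
  induction n generalizing p al with
  | zero => simp [pk_zero] at h
  | succ n ih =>
    have h0 : 2 ^ V * al 0 < 2 ^ W := by
      have := hal 0 (Nat.succ_pos n)
      calc 2 ^ V * al 0 ≤ 2 ^ V * 1 := Nat.mul_le_mul_left _ this
        _ < 2 ^ W := by rw [mul_one]; exact Nat.pow_lt_pow_right (by norm_num) hV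
    rw [pk_succ', add_comm, Nat.testBit_two_pow_mul_add _ h0] at h
    split at h
    · refine ⟨0, Nat.succ_pos n, ?_⟩
      rcases Nat.le_one_iff_eq_zero_or_eq_one.1 (hal 0 (Nat.succ_pos n)) with h1 | h1
      · simp [h1] at h
      · rw [h1, mul_one, Nat.testBit_two_pow] at h
        exact ⟨h1, by simpa using (of_decide_eq_true h).symm⟩
    · obtain ⟨i, hi, h1, h2⟩ := ih (al := fun i => al (i + 1)) (fun i hi => hal _ (by omega)) h
      exact ⟨i + 1, by omega, h1, by rw [Nat.mul_succ]; omega⟩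

/-! ### Branch and bound in packed arithmetic -/

/-- `k n`, arranged so that the kernel evaluates `n` to a literal before it passes it on. -/
def force {α : Type} (n : ℕ) (k : ℕ → α) : α :=
  Nat.rec (k 0) (fun p _ => k (Nat.succ p)) n

/-- `k (l.map f)`, with every entry evaluated before it is passed on. -/
def mapForce {α β : Type} (f : α → ℕ) (l : List α) : (List ℕ → β) → β :=
  List.rec (fun k => k []) (fun x _ ih k => force (f x) fun y => ih fun ys => k (y :: ys)) l

/-- The entry with the given index, or `0`. -/
def nth (l : List ℕ) : ℕ → ℕ :=
  List.rec (fun _ => 0) (fun x _ ih i => Nat.rec x (fun j _ => ih j) i) l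

/-- The vector `l` with lanes of `W` bits. -/
def pack (W : ℕ) (l : List ℕ) : ℕ :=
  List.rec 0 (fun x _ ih => Nat.add x (Nat.shiftLeft ih W)) l

/-- The length of a list, in a form that the kernel evaluates directly. -/
def len {α : Type} (l : List α) : ℕ := List.rec 0 (fun _ _ ih => Nat.succ ih) l

/-- Disjunction; the second argument is looked at only if the first one is `false`. -/
def orB (b c : Bool) : Bool := Bool.rec c true b

/-- Conjunction; the second argument is looked at only if the first one is `true`. -/
def andB (b c : Bool) : Bool := Bool.rec false c b

/-- What the search needs to know at each depth. An entry with `r` elements still to be chosen holds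
the packed guard constant `K`, with `2 ^ V - λ` in every lane, and the bound `c` for the
contribution of `r` elements with scores at most `λ`. -/
inductive Sched where
  | nil : Sched
  | cons (K c r : ℕ) (tl : Sched) : Sched

/-- Whether `J` is an entry of `l`. -/
def memB (J : ℕ) (l : List ℕ) : Bool :=
  List.rec false (fun x _ ih => orB (Nat.beq x J) ih) l

/-- A packed state, the mask of the chosen elements, and the remaining schedule. -/
abbrev Search := ℕ → ℕ → Sched → Bool

/-- The test of a complete choice: its value `A` is at most `T`, or the mask `J` of the chosen
elements is one of the exceptional ones. -/
def leaf (T A J : ℕ) (exc : List ℕ) : Bool := orB (Nat.ble A T) (memB J exc)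

/-- Whether fewer than `r` elements are available. In `a` the guard bit of every available lane is
set; casting out `B1 = 2 ^ W - 1` counts them. -/
def tooFew (V B1 a r : ℕ) : Bool := Nat.ble (Nat.succ (Nat.mod (Nat.shiftRight a V) B1)) r

/-- The sum of `v - λ` over the available lanes with `v ≥ λ`, where `Z` has the lanes `v + 2 ^ V -
λ` and `G` consists of the guard bits of the lanes that count. Each guard bit is turned into a mask
of the `V` bits below it, and the remaining lanes are added up by casting out `2 ^ W - 1`. -/
def excess (V B1 Z G : ℕ) : ℕ :=
  Nat.mod (Nat.land Z (Nat.sub G (Nat.shiftRight G V))) B1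

/-- The bound: even if all remaining elements have maximal interactions and the best available
scores, the value does not exceed `T`. The best scores are estimated by `λ` for each element and all
excesses over `λ`. -/
def boundOk (V B1 T A a c Z : ℕ) : Bool :=
  Nat.ble (Nat.add (Nat.add A c) (Nat.mul 2 (excess V B1 Z (Nat.land Z a)))) T

/-- The branch that includes element `i`: its row of interactions is added to the scores, the value
increases by `w0` plus twice its score, the element becomes unavailable, and its bit is set in `J`.
The state `s` consists of the following parts. Bits `0` to `79` are arbitrary; at `80` there are the
packed scores, of `RW = W n` bits; at `OU = 80 + RW` there is the mask of unavailable elements, also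
of `RW` bits, with the guard bit `V = W - 1` of every lane in use, so that the one of lane `0` is at
`ON = OU + V`; at `OA = OU + RW` there is the value. Further constants are the masks `Wm = 2 ^ V -
1`, `M = 2 ^ RW - 1` and `RM = 2 ^ (RW + 80) - 1`, the mask `H` of all guard bits, the table `RT` of
the rows of interactions (each preceded by `80` arbitrary bits) and the table `UT` of the elements
above each element. -/
def incl (W Wm w0 OA ON RW RM RT : ℕ) (ih : Search) (s J : ℕ) (rs : Sched) (i : ℕ) : Bool :=
  force (Nat.add
      (Nat.add s (Nat.land (Nat.shiftRight RT (Nat.mul (Nat.add RW 80) i)) RM))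
      (Nat.add
        (Nat.shiftLeft (Nat.add w0 (Nat.mul 2
          (Nat.land (Nat.shiftRight s (Nat.add 80 (Nat.mul W i))) Wm))) OA)
        (Nat.shiftLeft 1 (Nat.add ON (Nat.mul W i))))) fun s' =>
  ih s' (Nat.add J (Nat.shiftLeft 1 i)) rs

/-- An odd number of 64 bits. It is added to the arbitrary part of the state in order to vary the lowest
64 bits, by which literals are hashed. -/
def scramble : ℕ := 9241434498121223497

/-- The branch that leaves out element `i`: all elements above it, including itself, become
unavailable. -/
def excl (OU RW M UT : ℕ) (ih : Search) (s J : ℕ) (rs : Sched) (i : ℕ) : Bool :=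
  force (Nat.add
    (Nat.lor s (Nat.shiftLeft (Nat.land (Nat.shiftRight UT (Nat.mul RW i)) M) OU))
    scramble) fun s' => ih s' J rs

/-- Both branches for element `i`. Leaving it out does not change the number of elements still to be
chosen, so that the schedule remains `rs`; including it leads to the rest `tl` of the schedule. -/
def branch (W Wm w0 OA ON OU RW RM M RT UT : ℕ) (ih : Search) (s J : ℕ) (rs tl : Sched) (i : ℕ) :
    Bool :=
  andB (excl OU RW M UT ih s J rs i) (incl W Wm w0 OA ON RW RM RT ih s J tl i)

/-- The index of the lowest bit of `a` is passed on to `k`. It is looked up in the table `IT` of 149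
bytes, for the positions of the guard bits are determined by their powers of two modulo the prime
`149`. -/
def locate (IT a : ℕ) (k : ℕ → Bool) : Bool :=
  force (Nat.land (Nat.shiftRight IT (Nat.mul 8 (Nat.mod (Nat.sub a (Nat.land a (Nat.pred a))) 149))) 255) k

/-- One node of the search tree: with a complete choice the test `leaf`; otherwise the node is
closed if too few elements are available or if the bound holds, and else the search branches on the
first available element. -/
def node (W V B1 Wm T w0 OA ON OU RW RM M H RT UT IT : ℕ) (exc : List ℕ) (ih : Search) : Search :=
  fun s J rs =>
  Sched.rec (motive := fun _ => Bool) (leaf T (Nat.shiftRight s OA) J exc)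
    (fun K c r tl _ =>
      (fun a => orB (tooFew V B1 a r)
        (orB (boundOk V B1 T (Nat.shiftRight s OA) a c (Nat.add (Nat.shiftRight s 80) K))
          (locate IT a (branch W Wm w0 OA ON OU RW RM M RT UT ih s J rs tl))))
        (Nat.sub H (Nat.land (Nat.shiftRight s OU) M))) rs

/-- Branch and bound. The elements `0, …, n - 1` have scores, pairs of elements have interactions,
and each element has a set of elements above it. The search returns `true` only if every choice of
the scheduled number of elements that is closed downwards has a value of at most `T` or is
exceptional. It runs on natural numbers with bitwise operations, which the kernel evaluates
natively; `fuel` limits the depth. -/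
def search (W V B1 Wm T w0 OA ON OU RW RM M H RT UT IT : ℕ) (exc : List ℕ) (fuel : ℕ) : Search :=
  Nat.rec (fun _ _ _ => false) (fun _ ih => node W V B1 Wm T w0 OA ON OU RW RM M H RT UT IT exc ih) fuel

/-! ### Packed vectors of incidences and distances -/

/-- `1` if `e` is an entry of `y`, and `0` otherwise. -/
def memList (e : ℕ) (y : List ℕ) : ℕ := List.rec 0 (fun x _ ih => Bool.rec ih 1 (Nat.beq x e)) y

/-- The list `0, …, m - 1`. -/
def upto (m : ℕ) : List ℕ := Nat.rec (fun acc => acc) (fun k ih acc => ih (k :: acc)) m []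

/-- The sum of the entries of `Cs` at the positions in `y`. -/
def sumAt (Cs : List ℕ) (y : List ℕ) : ℕ := List.rec 0 (fun e _ ih => Nat.add (nth Cs e) ih) y

/-- The packed vector of the truth values of `D ≥ d`, read off from the guard bits of `D + 2 ^ V -
d`. -/
def geLane (W H ones D d : ℕ) : ℕ :=
  Nat.shiftRight (Nat.land (Nat.sub (Nat.add D H) (Nat.mul d ones)) H) (Nat.sub W 1)

/-- For every `y` in `U`, the packed vectors of the truth values of `d(x, y) ≥ d`, for `d` in `ds`, where
`x` ranges over `U`. The distances are `|x| + |y| - 2 |x ∩ y|`; `Wt` holds the sizes `|x|`, and `Cs` the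
incidences `e ∈ x`. -/
def geRows {β : Type} (W H ones Wt : ℕ) (Cs ds : List ℕ) (U : List (List ℕ)) :
    (List (List ℕ) → β) → β :=
  List.rec (fun k => k [])
    (fun y _ ih k =>
      force (Nat.sub (Nat.add Wt (Nat.mul (len y) ones)) (Nat.mul 2 (sumAt Cs y))) fun D =>
      mapForce (geLane W H ones D) ds fun ge => ih fun l => k (ge :: l)) U

/-- The sums of the final segments of `Cs` are passed on. -/
def tails {β : Type} (Cs : List ℕ) : (List ℕ → β) → β :=
  List.rec (fun k => k [0])
    (fun C _ ih k => ih fun ts => force (Nat.add C (nth ts 0)) fun s => k (s :: ts)) Cs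

/-- The guard bits of the elements above `y`: for each `i`, the number of entries that are at least
the `i`-th entry of `y`, read from the packed vector `ts`, has to be at least `i`. -/
def upMask (H ones : ℕ) (ts : List ℕ) (y : List ℕ) : ℕ → ℕ :=
  List.rec (fun _ => H)
    (fun p _ ih j => Nat.land (Nat.land (Nat.sub (Nat.add (nth ts p) H) (Nat.mul j ones)) H)
      (ih (Nat.succ j))) y

/-- The scalar product of two lists; missing entries count as `0`. -/
def dot (a b : List ℕ) : ℕ :=
  List.rec (fun _ => 0) (fun x _ ih b => Nat.add (Nat.mul x (nth b 0)) (ih b.tail)) a b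

/-- The decreases from each entry to the next, starting from `p`. -/
def diffs (l : List ℕ) : ℕ → List ℕ :=
  List.rec (fun _ => []) (fun x _ ih p => Nat.sub p x :: ih x) l

/-- The weight of a pair at distance `d`, with the distance clamped to lie between `2` and `N`. -/
def far (w : List ℕ) (N d : ℕ) : ℕ := nth w (Bool.rec (Bool.rec 2 d (Nat.ble 2 d)) N (Nat.ble N d))

/-- The contribution of a set of `l ≥ 2` exponents together with the empty set and the one-element
sets, in one of the two orders of each pair. The weight at distance one is the one at distance two,
except that each such pair is charged to the larger of the two sets, which has `l` pairs of this
kind; this explains the first summand. -/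
def score0 (m N : ℕ) (w : List ℕ) (l : ℕ) : ℕ :=
  Nat.add (Nat.add (Nat.mul l (Nat.sub (nth w 1) (nth w 2))) (far w N l))
    (Nat.add (Nat.mul l (far w N (Nat.pred l))) (Nat.mul (Nat.sub m l) (far w N (Nat.succ l))))

/-- The schedule for `r` elements. With `s` elements to be chosen, the level is `λ = ⌊(a - b s) w0 /
256⌋`. The parameters `a` and `b` only influence how many nodes the bound closes. -/
def sched {β : Type} (H ones w0 w2 a b : ℕ) (r : ℕ) : (Sched → β) → β :=
  Nat.rec (fun k => k Sched.nil)
    (fun r ih k => ih fun tl =>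
      force (Nat.succ r) fun s =>
      force (Nat.div (Nat.mul (Nat.sub a (Nat.mul b s)) w0) 256) fun lam =>
      force (Nat.sub H (Nat.mul lam ones)) fun K =>
      force (Nat.add (Nat.mul s (Nat.add w0 (Nat.mul 2 lam))) (Nat.mul (Nat.mul s r) w2)) fun c =>
      k (Sched.cons K c s tl)) r

/-! ### Functionals of the distance distribution and their checks -/

/-- The coefficients of the product of a polynomial with `a + b y`. -/
def mulLin (a b : ℕ) (l : List ℕ) : List ℕ :=
  List.rec (fun c => [Nat.mul b c]) (fun x _ ih c => Nat.add (Nat.mul a x) (Nat.mul b c) :: ih x) l 0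

/-- The coefficients of the product of a polynomial with `(a + b y) ^ k`. -/
def powLin (a b : ℕ) (l : List ℕ) (k : ℕ) : List ℕ := Nat.rec l (fun _ ih => mulLin a b ih) k

/-- The coefficient of `y ^ k` in `(a + b y) ^ d * (q + q y) ^ (N - d)`. -/
def omega (a b q N k d : ℕ) : ℕ := nth (powLin a b (powLin q q [1] (Nat.sub N d)) d) k

/-- The number of entries of `y` that are at least `p`. -/
def countGe (p : ℕ) (y : List ℕ) : ℕ :=
  List.rec 0 (fun x _ ih => Bool.rec ih (Nat.succ ih) (Nat.ble p x)) y

/-- Whether the `i`-th element of `x` is at most the `(i + j)`-th largest element of `y`. -/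
def domB (y x : List ℕ) : ℕ → Bool :=
  List.rec (fun _ => true) (fun p _ ih j => andB (Nat.ble j (countGe p y)) (ih (Nat.succ j))) x

/-- Whether `x` is below one of the entries of `G`. -/
def anyDom (G : List (List ℕ)) (x : List ℕ) : Bool :=
  List.rec false (fun y _ ih => orB (domB y x 1) ih) G

/-- The mask of the elements of `U` below one of the generators `G`. -/
def maskOf (G U : List (List ℕ)) : ℕ :=
  pack 1 (U.map fun x => Bool.rec 0 1 (anyDom G x))

/-- Whether `w` is weakly decreasing with entries at most `p`. -/
def antitoneB (w : List ℕ) : ℕ → Bool :=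
  List.rec (fun _ => true) (fun x _ ih p => andB (Nat.ble x p) (ih x)) w

/-- Some bits that depend on the row, for the arbitrary part of the state of the search. The modulus
is a prime below `2 ^ 64`. -/
def saltOf (ge : List ℕ) : ℕ := Nat.mod (nth ge 0) 18446744073709551557

/-- The rows of interactions. The weight of a pair is `w2` less the decreases at all `d` up to its
distance. -/
def rowsOf {β : Type} (ones w2 : ℕ) (ds : List ℕ) (ges : List (List ℕ)) : (List ℕ → β) → β :=
  mapForce (fun ge => Nat.add (Nat.shiftLeft (Nat.sub (Nat.mul w2 ones) (dot ds ge)) 80) (saltOf ge)) ges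

/-- The table for `locate`: the byte at `2 ^ (W i + W - 1) mod 149` is `i`. -/
def indexTable (W n : ℕ) : ℕ :=
  List.rec 0 (fun i _ ih => Nat.add ih (Nat.shiftLeft i (Nat.mul 8
    (Nat.mod (Nat.shiftLeft 1 (Nat.add (Nat.mul W i) (Nat.sub W 1))) 149)))) (upto n)

/-- Whether the residues modulo `149` are distinct, so that the table returns all indices correctly.
-/
def indexOk (W n IT : ℕ) : Bool :=
  List.rec true (fun i _ ih => andB (Nat.beq i (Nat.land (Nat.shiftRight IT (Nat.mul 8
    (Nat.mod (Nat.shiftLeft 1 (Nat.add (Nat.mul W i) (Nat.sub W 1))) 149))) 255)) ih) (upto n)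

/-- The value of the empty set and the `m` one-element sets: `m + 1` pairs at distance zero, and,
with `m (m - 1)` at distance two, `2 m` at distance one. -/
def initialValue (m : ℕ) (w : List ℕ) : ℕ :=
  Nat.add (Nat.add (Nat.mul (Nat.succ m) (nth w 0)) (Nat.mul (Nat.mul 2 m) (nth w 1)))
    (Nat.mul (Nat.mul m (Nat.pred m)) (nth w 2))

/-- Lanes of `W` bits are wide enough: neither a score nor a sum of all scores overflows. -/
def lanesOk (t m W n w0 a : ℕ) : Bool :=
  Nat.ble (Nat.add (Nat.add (Nat.mul (Nat.succ n) (Nat.succ (Nat.mul w0 (Nat.add m (Nat.pow 2 t)))))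
    (Nat.mul a w0)) 300) (Nat.shiftLeft 1 (Nat.sub W 2))

/-- The preparation and the start of the search for one functional with weights `w`. -/
def runSearch (m N W n ones H UT r0 IT T a b w0 w2 : ℕ) (U ges : List (List ℕ)) (exc w : List ℕ) :
    Bool :=
  mapForce (fun x => x) (diffs (w.drop 3) w2) fun ds =>
  rowsOf ones w2 ds ges fun rows =>
  force (Nat.mul W n) fun RW =>
  force (pack (Nat.add RW 80) rows) fun RT =>
  sched H ones w0 w2 a b r0 fun rs =>
  force (pack W (U.map fun y => score0 m N w (len y))) fun v =>
  force (initialValue m w) fun A =>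
  force (Nat.sub (Nat.shiftLeft 1 W) 1) fun B1 =>
  force (Nat.sub (Nat.shiftLeft 1 (Nat.sub W 1)) 1) fun Wm =>
  force (Nat.sub (Nat.shiftLeft 1 (Nat.add RW 80)) 1) fun RM =>
  force (Nat.sub (Nat.shiftLeft 1 RW) 1) fun M =>
  force (Nat.sub W 1) fun V =>
  force (Nat.add 80 RW) fun OU =>
  force (Nat.add OU RW) fun OA =>
  force (Nat.add OU V) fun ON =>
  search W V B1 Wm T w0 OA ON OU RW RM M H RT UT IT exc (Nat.succ n)
    (Nat.add (Nat.shiftLeft A OA) (Nat.shiftLeft v 80)) 0 rs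

/-- The last two parameters determine the levels `λ`. -/
def checkWeights (t m N W n ones H UT : ℕ) (U ges : List (List ℕ)) (exc : List ℕ) (T : ℕ)
    (w : List ℕ) (a b : ℕ) : Bool :=
  force (nth w 0) fun w0 =>
  force (nth w 2) fun w2 =>
  force (Nat.sub (Nat.pow 2 t) (Nat.succ m)) fun r0 =>
  force (indexTable W n) fun IT =>
  andB (lanesOk t m W n w0 a) (andB (Nat.ble n 255) (andB (antitoneB w w0) (andB (indexOk W n IT)
    (runSearch m N W n ones H UT r0 IT T a b w0 w2 U ges exc w))))

/-- `1` for the functionals for which a strict inequality is needed. -/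
def strictness (pa k : ℕ) : ℕ :=
  Bool.rec (Bool.rec 0 1 (Nat.beq k 0)) (Bool.rec 0 1 (Nat.beq k 1)) (Nat.beq pa 0)

/-- The check of the functional with index `k` for one interval: its value for a family of `2 ^ t`
sets is at most its value `d` for the distance distribution `g`, and less if a strict inequality is
needed. -/
def checkFun (t m N W n ones H UT : ℕ) (U ges : List (List ℕ)) (exc : List ℕ) (pa pb q : ℕ)
    (g : List ℕ) (k a b : ℕ) : Bool :=
  mapForce (omega pa pb q N k) (upto (Nat.succ N)) fun w =>
  force (dot g w) fun d =>
  andB (Nat.ble 1 d)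
    (checkWeights t m N W n ones H UT U ges exc (Nat.sub d (strictness pa k)) w a b)

/-- The checks of all functionals `fs` for the interval `[pa / q, pb / q)`. The distances between
the elements of `U`, the partial order and the exceptional sets do not depend on the functional and
are prepared once. -/
def checkInterval (t m W N pa pb q : ℕ) (U : List (List ℕ)) (Gs : List (List (List ℕ)))
    (g : List ℕ) (fs : List (ℕ × ℕ × ℕ)) : Bool :=
  force (len U) fun n =>
  force (pack W (U.map fun _ => 1)) fun ones =>
  force (Nat.shiftLeft ones (Nat.sub W 1)) fun H =>
  mapForce (fun e => pack W (U.map (memList e))) (upto m) fun Cs =>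
  tails Cs fun ts =>
  geRows W H ones (nth ts 0) Cs ((upto (Nat.succ N)).drop 3) U fun ges =>
  mapForce (fun y => upMask H ones ts y 1) U fun ups =>
  force (pack (Nat.mul W n) ups) fun UT =>
  mapForce (fun G => maskOf G U) Gs fun exc =>
  List.rec true
    (fun f _ ih => andB (checkFun t m N W n ones H UT U ges exc pa pb q g f.1 f.2.1 f.2.2) ih) fs

/-- All decreasing lists of at least two exponents with at most `64` sets below them, with the
number of these. -/
def universeData : List (ℕ × List ℕ) := [
(4, [1, 0]),
(6, [2, 0]),
(7, [2, 1]),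
(8, [3, 0]),
(10, [3, 1]),
(10, [4, 0]),
(11, [3, 2]),
(12, [5, 0]),
(13, [4, 1]),
(14, [6, 0]),
(15, [4, 2]),
(16, [4, 3]),
(16, [5, 1]),
(16, [7, 0]),
(8, [2, 1, 0]),
(18, [8, 0]),
(19, [5, 2]),
(19, [6, 1]),
(20, [9, 0]),
(12, [3, 1, 0]),
(21, [5, 3]),
(22, [5, 4]),
(22, [7, 1]),
(22, [10, 0]),
(14, [3, 2, 0]),
(23, [6, 2]),
(15, [3, 2, 1]),
(24, [11, 0]),
(16, [4, 1, 0]),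
(25, [8, 1]),
(26, [6, 3]),
(26, [12, 0]),
(27, [7, 2]),
(28, [6, 4]),
(28, [9, 1]),
(28, [13, 0]),
(20, [4, 2, 0]),
(20, [5, 1, 0]),
(29, [6, 5]),
(30, [14, 0]),
(22, [4, 2, 1]),
(22, [4, 3, 0]),
(31, [7, 3]),
(31, [8, 2]),
(31, [10, 1]),
(32, [15, 0]),
(24, [6, 1, 0]),
(25, [4, 3, 1]),
(34, [7, 4]),
(34, [11, 1]),
(34, [16, 0]),
(26, [4, 3, 2]),
(26, [5, 2, 0]),
(35, [9, 2]),
(16, [3, 2, 1, 0]),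
(36, [7, 5]),
(36, [8, 3]),
(36, [17, 0]),
(28, [7, 1, 0]),
(37, [7, 6]),
(37, [12, 1]),
(29, [5, 2, 1]),
(38, [18, 0]),
(30, [5, 3, 0]),
(39, [10, 2]),
(40, [8, 4]),
(40, [13, 1]),
(40, [19, 0]),
(32, [5, 4, 0]),
(32, [6, 2, 0]),
(32, [8, 1, 0]),
(41, [9, 3]),
(42, [20, 0]),
(43, [8, 5]),
(43, [11, 2]),
(43, [14, 1]),
(24, [4, 2, 1, 0]),
(35, [5, 3, 1]),
(44, [21, 0]),
(36, [6, 2, 1]),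
(45, [8, 6]),
(36, [9, 1, 0]),
(37, [5, 3, 2]),
(46, [8, 7]),
(46, [9, 4]),
(46, [10, 3]),
(46, [15, 1]),
(46, [22, 0]),
(38, [5, 4, 1]),
(38, [6, 3, 0]),
(38, [7, 2, 0]),
(47, [12, 2]),
(28, [4, 3, 1, 0]),
(48, [23, 0]),
(40, [10, 1, 0]),
(49, [16, 1]),
(30, [4, 3, 2, 0]),
(41, [5, 4, 2]),
(50, [9, 5]),
(50, [24, 0]),
(31, [4, 3, 2, 1]),
(42, [5, 4, 3]),
(42, [6, 4, 0]),
(51, [11, 3]),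
(51, [13, 2]),
(32, [5, 2, 1, 0]),
(43, [7, 2, 1]),
(52, [10, 4]),
(52, [17, 1]),
(52, [25, 0]),
(44, [6, 5, 0]),
(44, [8, 2, 0]),
(53, [9, 6]),
(44, [11, 1, 0]),
(45, [6, 3, 1]),
(54, [26, 0]),
(46, [7, 3, 0]),
(55, [9, 7]),
(55, [14, 2]),
(55, [18, 1]),
(56, [9, 8]),
(56, [12, 3]),
(56, [27, 0]),
(48, [6, 3, 2]),
(57, [10, 5]),
(48, [12, 1, 0]),
(58, [11, 4]),
(58, [19, 1]),
(58, [28, 0]),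
(50, [8, 2, 1]),
(50, [9, 2, 0]),
(59, [15, 2]),
(40, [5, 3, 1, 0]),
(40, [6, 2, 1, 0]),
(51, [6, 4, 1]),
(60, [29, 0]),
(52, [7, 4, 0]),
(61, [10, 6]),
(52, [13, 1, 0]),
(61, [13, 3]),
(61, [20, 1]),
(62, [30, 0]),
(54, [6, 5, 1]),
(54, [8, 3, 0]),
(63, [16, 2]),
(44, [5, 3, 2, 0]),
(44, [5, 4, 1, 0]),
(55, [7, 3, 1]),
(64, [10, 7]),
(64, [11, 5]),
(64, [12, 4]),
(64, [21, 1]),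
(64, [31, 0]),
(56, [6, 4, 2]),
(56, [7, 5, 0]),
(56, [10, 2, 0]),
(56, [14, 1, 0]),
(46, [5, 3, 2, 1]),
(57, [9, 2, 1]),
(32, [4, 3, 2, 1, 0]),
(58, [6, 4, 3]),
(58, [7, 6, 0]),
(48, [7, 2, 1, 0]),
(59, [7, 3, 2]),
(60, [6, 5, 2]),
(60, [15, 1, 0]),
(50, [5, 4, 2, 0]),
(62, [8, 4, 0]),
(62, [9, 3, 0]),
(62, [11, 2, 0]),
(52, [5, 4, 3, 0]),
(52, [6, 3, 1, 0]),
(63, [6, 5, 3]),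
(53, [5, 4, 2, 1]),
(64, [6, 5, 4]),
(64, [7, 4, 1]),
(64, [10, 2, 1]),
(64, [16, 1, 0]),
(56, [5, 4, 3, 1]),
(56, [8, 2, 1, 0]),
(57, [5, 4, 3, 2]),
(58, [6, 3, 2, 0]),
(60, [6, 4, 1, 0]),
(61, [6, 3, 2, 1]),
(48, [5, 3, 2, 1, 0]),
(64, [6, 5, 1, 0]),
(64, [7, 3, 1, 0]),
(64, [9, 2, 1, 0]),
(56, [5, 4, 2, 1, 0]),
(60, [5, 4, 3, 1, 0]),
(62, [5, 4, 3, 2, 0]),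
(63, [5, 4, 3, 2, 1]),
(64, [5, 4, 3, 2, 1, 0]),
(64, [6, 3, 2, 1, 0])
]

/-- Whether a family of `2 ^ t` sets of exponents below `m` has room for the given set: the sets
below it and the one-element sets of larger exponents are at most `2 ^ t` in number. -/
def keep (t m : ℕ) (p : ℕ × List ℕ) : Bool :=
  Bool.rec false
    (Nat.ble (Nat.add p.1 (Nat.sub m (Nat.succ (nth p.2 0)))) (Nat.pow 2 t))
    (Nat.ble (Nat.succ (nth p.2 0)) m)

/-- The sets with at least two elements that a family of `2 ^ t` sets of exponents below `m` can
contain. -/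
def universeOf (t m : ℕ) : List (List ℕ) :=
  List.rec [] (fun p _ ih => Bool.rec ih (p.2 :: ih) (keep t m p)) universeData

/-! ### Correctness of the search -/

theorem force_eq {α : Type} (n : ℕ) (k : ℕ → α) : force n k = k n := by cases n <;> rfl

theorem andB_eq {b c : Bool} : andB b c = (b && c) := by cases b <;> rfl

theorem orB_eq {b c : Bool} : orB b c = (b || c) := by cases b <;> rfl

theorem land_eq (a b : ℕ) : Nat.land a b = a &&& b := rfl

theorem lor_eq (a b : ℕ) : Nat.lor a b = a ||| b := rfl

/-- The value of the set `K` on top of the value `A`, for scores `v` and interactions `R`. -/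
def total (w0 : ℕ) (R : ℕ → ℕ → ℕ) (A : ℕ) (v : ℕ → ℕ) (K : Finset ℕ) : ℕ :=
  A + ∑ k ∈ K, (w0 + 2 * v k) + ∑ k ∈ K, ∑ l ∈ K.erase k, R k l

/-- Taking one element of `K` out and accounting for it in the value and in the scores of the
others. -/
theorem total_insert {w0 A : ℕ} {R : ℕ → ℕ → ℕ} {v : ℕ → ℕ} {K : Finset ℕ} {i : ℕ} (hi : i ∈ K)
    (hR : ∀ j ∈ K, R i j = R j i) :
    total w0 R A v K = total w0 R (A + w0 + 2 * v i) (fun j => v j + R i j) (K.erase i) := by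
  have h1 : ∑ k ∈ K, ∑ l ∈ K.erase k, R k l = ∑ l ∈ K.erase i, R i l +
      ∑ k ∈ K.erase i, (R i k + ∑ l ∈ (K.erase i).erase k, R k l) := by
    rw [← Finset.add_sum_erase K _ hi]
    congr 1
    refine Finset.sum_congr rfl fun k hk => ?_
    have hk' := Finset.mem_erase.1 hk
    rw [← Finset.add_sum_erase (K.erase k) _ (Finset.mem_erase.2 ⟨hk'.1.symm, hi⟩),
      hR k hk'.2, Finset.erase_right_comm]
  unfold total
  rw [← Finset.add_sum_erase K _ hi, h1]
  simp only [Finset.sum_add_distrib, ← Finset.mul_sum, mul_add]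
  ring

/-- The schedule for adding `r` more elements: guard constants and bounds for every stage. -/
def Sched.Ok (W V n w0 w2 : ℕ) : Sched → ℕ → Prop
  | .nil, r => r = 0
  | .cons K c r' tl, r => r' = r ∧ ∃ q lam, r = q + 1 ∧ lam ≤ 2 ^ V ∧
      K = pk W n (fun _ => 2 ^ V - lam) ∧ c = r * (w0 + 2 * lam) + r * q * w2 ∧
      Sched.Ok W V n w0 w2 tl q

/-- At most `r` elements of `al` bring in at most `r λ` and the excesses over `λ`. -/
theorem total_le {n w0 w2 A lam : ℕ} {R : ℕ → ℕ → ℕ} {v : ℕ → ℕ} {K : Finset ℕ} {al : ℕ → ℕ} {q : ℕ}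
    (hK : ∀ k ∈ K, k < n ∧ al k = 1) (hr : K.card = q + 1)
    (hR : ∀ i < n, ∀ j < n, R i j ≤ w2) :
    total w0 R A v K ≤ A + ((q + 1) * (w0 + 2 * lam) + (q + 1) * q * w2) +
      2 * ∑ i ∈ Finset.range n, (if al i = 1 ∧ lam ≤ v i then v i - lam else 0) := by
  have h1 : ∑ k ∈ K, ∑ l ∈ K.erase k, R k l ≤ (q + 1) * q * w2 := by
    have : ∀ k ∈ K, ∑ l ∈ K.erase k, R k l ≤ q * w2 := fun k hk => by
      have := Finset.sum_le_card_nsmul (K.erase k) (R k) w2 fun l hl =>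
        hR k (hK k hk).1 l (hK l (Finset.mem_of_mem_erase hl)).1
      rwa [Finset.card_erase_of_mem hk, hr, smul_eq_mul, Nat.add_sub_cancel] at this
    have := Finset.sum_le_card_nsmul K _ _ this
    rwa [hr, smul_eq_mul, ← mul_assoc] at this
  have h2 : ∑ k ∈ K, (if al k = 1 ∧ lam ≤ v k then v k - lam else 0) ≤
      ∑ i ∈ Finset.range n, (if al i = 1 ∧ lam ≤ v i then v i - lam else 0) :=
    Finset.sum_le_sum_of_subset fun k hk => Finset.mem_range.2 (hK k hk).1
  have h3 : ∑ k ∈ K, (w0 + 2 * v k) ≤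
      ∑ k ∈ K, ((w0 + 2 * lam) + 2 * (if al k = 1 ∧ lam ≤ v k then v k - lam else 0)) := by
    refine Finset.sum_le_sum fun k hk => ?_
    have := (hK k hk).2
    split
    · omega
    · omega
  have h4 : ∑ k ∈ K, ((w0 + 2 * lam) + 2 * (if al k = 1 ∧ lam ≤ v k then v k - lam else 0)) =
      (q + 1) * (w0 + 2 * lam) + 2 * ∑ k ∈ K, (if al k = 1 ∧ lam ≤ v k then v k - lam else 0) := by
    rw [Finset.sum_add_distrib, ← Finset.mul_sum, Finset.sum_const, hr, smul_eq_mul]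
  unfold total
  omega

/-- Masking by a guard bit tests whether the lane has reached `2 ^ V`. -/
theorem and_guard {V Z x : ℕ} (hZ : Z < 2 ^ (V + 1)) (hx : x ≤ 1) :
    Z &&& 2 ^ V * x = 2 ^ V * (if x = 1 ∧ 2 ^ V ≤ Z then 1 else 0) := by
  rcases Nat.le_one_iff_eq_zero_or_eq_one.1 hx with rfl | rfl
  · simp
  have hp : 0 < 2 ^ V := by positivity
  have hZ' : Z / 2 ^ V < 2 := by
    rw [Nat.div_lt_iff_lt_mul hp, mul_comm, ← pow_succ]; exact hZ
  have h := land_split (k := V) (a := Z % 2 ^ V) (b := Z / 2 ^ V) (c := 0) (d := 1)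
    (Nat.mod_lt _ hp) hp
  rw [Nat.mod_add_div, zero_add, Nat.and_zero, zero_add] at h
  rw [h]
  congr 1
  by_cases hc : 2 ^ V ≤ Z
  · have : Z / 2 ^ V = 1 := by
      have := (Nat.one_le_div_iff hp).2 hc; omega
    simp [this, hc]
  · have : Z / 2 ^ V = 0 := Nat.div_eq_of_lt (by omega)
    simp [this, hc]

/-- The packed evaluation of the excesses over `λ`. -/
theorem excess_eq {W V n B vmax lam X Y : ℕ} {v al : ℕ → ℕ} (hW : W = V + 1) (hlam : lam ≤ 2 ^ V)
    (hv : ∀ i < n, v i ≤ vmax) (hvm : vmax < 2 ^ V) (hn : n * vmax < 2 ^ W - 1)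
    (hal : ∀ i < n, al i ≤ 1)
    (hX : X = pk W n v + 2 ^ (W * n) * Y) (hB : B = 2 ^ W - 1) :
    excess V B (X + pk W n fun _ => 2 ^ V - lam)
      ((X + pk W n fun _ => 2 ^ V - lam) &&& pk W n fun i => 2 ^ V * al i) =
    ∑ i ∈ Finset.range n, (if al i = 1 ∧ lam ≤ v i then v i - lam else 0) := by
  have hp : 0 < 2 ^ V := by positivity
  have h2 : 2 ^ W = 2 * 2 ^ V := by rw [hW, pow_succ, mul_comm]
  have hz : ∀ i < n, v i + (2 ^ V - lam) < 2 ^ W := fun i hi => by have := hv i hi; omega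
  have ha : ∀ i < n, 2 ^ V * al i < 2 ^ W := fun i hi => by
    have := Nat.mul_le_mul_left (2 ^ V) (hal i hi); omega
  have hZ : X + pk W n (fun _ => 2 ^ V - lam) =
      pk W n (fun i => v i + (2 ^ V - lam)) + 2 ^ (W * n) * Y := by
    rw [hX, ← pk_add]; ring
  set g : ℕ → ℕ := fun i => if al i = 1 ∧ lam ≤ v i then 1 else 0 with hg
  have hg1 : ∀ i, g i ≤ 1 := fun i => by simp only [hg]; split <;> omega
  have hG : (pk W n (fun i => v i + (2 ^ V - lam)) + 2 ^ (W * n) * Y) &&&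
      pk W n (fun i => 2 ^ V * al i) = pk W n fun i => 2 ^ V * g i := by
    have := land_split (b := Y) (d := 0) (pk_lt hz) (pk_lt ha)
    rw [mul_zero, add_zero, Nat.and_zero, mul_zero, add_zero, pk_land hz ha] at this
    rw [this]
    refine pk_congr fun i hi => ?_
    rw [and_guard (by rw [← hW]; exact hz i hi) (hal i hi)]
    simp only [hg]
    congr 1
    refine if_congr (and_congr_right fun _ => ?_) rfl rfl
    omega
  have hM : ∀ i < n, (2 ^ V - 1) * g i < 2 ^ W := fun i _ => by
    have := Nat.mul_le_mul_left (2 ^ V - 1) (hg1 i); omega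
  unfold excess
  rw [hZ, hG]
  rw [shr_eq, pk_shr]
  change ((pk W n (fun i => v i + (2 ^ V - lam)) + 2 ^ (W * n) * Y) &&&
    (pk W n (fun i => 2 ^ V * g i) - pk W n g)) % B = _
  rw [pk_sub (fun i _ => Nat.le_mul_of_pos_left _ hp)]
  have h3 : pk W n (fun i => 2 ^ V * g i - g i) = pk W n fun i => (2 ^ V - 1) * g i :=
    pk_congr fun i _ => by rw [Nat.sub_mul, one_mul]
  have h4 := land_split (b := Y) (d := 0) (pk_lt hz) (pk_lt hM)
  rw [mul_zero, add_zero, Nat.and_zero, mul_zero, add_zero, pk_land hz hM] at h4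
  rw [h3, h4]
  have h5 : pk W n (fun i => (v i + (2 ^ V - lam)) &&& (2 ^ V - 1) * g i) =
      pk W n fun i => if al i = 1 ∧ lam ≤ v i then v i - lam else 0 := by
    refine pk_congr fun i hi => ?_
    simp only [hg]
    split
    · next h =>
      rw [mul_one, Nat.and_two_pow_sub_one_eq_mod]
      have := hv i hi
      have h6 : v i + (2 ^ V - lam) = (v i - lam) + 2 ^ V := by omega
      rw [h6, Nat.add_mod_right, Nat.mod_eq_of_lt (by omega)]
    · simp
  rw [h5, hB, pk_mod]
  refine lt_of_le_of_lt ?_ hn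
  calc _ ≤ ∑ i ∈ Finset.range n, vmax := Finset.sum_le_sum fun i hi => by
        have := hv i (Finset.mem_range.1 hi); split <;> omega
    _ = n * vmax := by simp

theorem memB_iff {J : ℕ} {l : List ℕ} : memB J l = true ↔ J ∈ l := by
  induction l with
  | nil => simp [memB]
  | cons x l ih =>
    have : memB J (x :: l) = (Nat.beq x J || memB J l) := orB_eq
    rw [this, Bool.or_eq_true, ih, Nat.beq_eq, List.mem_cons, eq_comm]

/-- If some element is available, `locate` passes on the index of one. -/
theorem locate_sound {W V n IT : ℕ} {al : ℕ → ℕ} (hW : W = V + 1)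
    (hIT : ∀ i < n, IT / 2 ^ (8 * (2 ^ (W * i + V) % 149)) % 2 ^ 8 = i)
    (hal : ∀ i < n, al i ≤ 1) (hne : ∃ i < n, al i = 1) {k : ℕ → Bool}
    (h : locate IT (pk W n fun i => 2 ^ V * al i) k = true) : ∃ i < n, al i = 1 ∧ k i = true := by
  have ha : (pk W n fun i => 2 ^ V * al i) ≠ 0 := by
    obtain ⟨i, hi, h1⟩ := hne
    have : 2 ^ V * al i * 2 ^ (W * i) ≤ pk W n fun i => 2 ^ V * al i :=
      Finset.single_le_sum (f := fun i => 2 ^ V * al i * 2 ^ (W * i)) (fun _ _ => Nat.zero_le _)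
        (Finset.mem_range.2 hi)
    have h2 : 0 < 2 ^ V * al i * 2 ^ (W * i) := by rw [h1]; positivity
    omega
  obtain ⟨p, hp, hL⟩ := lowest_bit ha
  obtain ⟨i, hi, h1, rfl⟩ := testBit_pk (by omega) hal hp
  refine ⟨i, hi, h1, ?_⟩
  unfold locate at h
  rw [force_eq, shr_eq] at h
  have hmod (a b : ℕ) : Nat.mod a b = a % b := rfl
  rw [land_eq, land_eq, Nat.mul_eq, Nat.sub_eq, Nat.pred_eq_sub_one, hmod, hL,
    show 255 = 2 ^ 8 - 1 from rfl, Nat.and_two_pow_sub_one_eq_mod, hIT i hi] at h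
  exact h

/-- Reading a single lane of a vector with further bits above it. -/
theorem lane_of {W V n i Y : ℕ} {v : ℕ → ℕ} (hVW : V ≤ W) (hv : ∀ i < n, v i < 2 ^ W) (hi : i < n)
    (hvi : v i < 2 ^ V) : (pk W n v + 2 ^ (W * n) * Y) / 2 ^ (W * i) % 2 ^ V = v i := by
  obtain ⟨k, rfl⟩ : ∃ k, n = i + (k + 1) := ⟨n - i - 1, by omega⟩
  have h1 : 2 ^ (W * (i + (k + 1))) * Y = 2 ^ (W * i) * (2 ^ W * (2 ^ (W * k) * Y)) := by
    rw [mul_add, mul_add, pow_add, pow_add]; ring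
  have h2 := lane_pk hv hi
  rw [h1, Nat.add_mul_div_left _ _ (by positivity),
    ← Nat.mod_mod_of_dvd _ (pow_dvd_pow 2 hVW), Nat.add_mul_mod_self_left, h2,
    Nat.mod_eq_of_lt hvi]

theorem pk_single {W n i c : ℕ} (hi : i < n) :
    (pk W n fun j => if j = i then c else 0) = c * 2 ^ (W * i) := by
  unfold pk
  rw [Finset.sum_eq_single i (fun j _ hj => by simp [hj])
    (fun h => absurd (Finset.mem_range.2 hi) h)]
  simp

theorem scramble_lt : scramble < 2 ^ 64 := by norm_num [scramble]

section

variable {W V B1 Wm T w0 OA ON OU RW RM M H RT UT IT : ℕ} {exc : List ℕ} {ih : Search}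
  {s J i : ℕ} {rs : Sched}

theorem incl_eq : incl W Wm w0 OA ON RW RM RT ih s J rs i =
    ih (s + (RT / 2 ^ ((RW + 80) * i) &&& RM) +
      ((w0 + 2 * (s / 2 ^ (80 + W * i) &&& Wm)) * 2 ^ OA + 2 ^ (ON + W * i))) (J + 2 ^ i) rs := by
  unfold incl
  rw [force_eq]
  simp only [shr_eq, shl_eq, land_eq, Nat.add_eq, Nat.mul_eq, one_mul]

theorem excl_eq : excl OU RW M UT ih s J rs i =
    ih ((s ||| (UT / 2 ^ (RW * i) &&& M) * 2 ^ OU) + scramble) J rs := by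
  unfold excl
  rw [force_eq]
  simp only [shr_eq, shl_eq, land_eq, lor_eq, Nat.add_eq, Nat.mul_eq]

theorem search_zero : search W V B1 Wm T w0 OA ON OU RW RM M H RT UT IT exc 0 s J rs = false := rfl

theorem search_nil (fuel : ℕ) :
    search W V B1 Wm T w0 OA ON OU RW RM M H RT UT IT exc (fuel + 1) s J .nil =
      (decide (s / 2 ^ OA ≤ T) || memB J exc) := by
  have : search W V B1 Wm T w0 OA ON OU RW RM M H RT UT IT exc (fuel + 1) s J .nil =
    leaf T (Nat.shiftRight s OA) J exc := rfl
  rw [this, leaf, orB_eq, shr_eq]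
  congr 1
  rw [Bool.eq_iff_iff, Nat.ble_eq, decide_eq_true_iff]

theorem search_cons (fuel : ℕ) {K c r : ℕ} {tl : Sched} :
    search W V B1 Wm T w0 OA ON OU RW RM M H RT UT IT exc (fuel + 1) s J (.cons K c r tl) =
      (tooFew V B1 (H - (s / 2 ^ OU &&& M)) r ||
      (boundOk V B1 T (s / 2 ^ OA) (H - (s / 2 ^ OU &&& M)) c (s / 2 ^ 80 + K) ||
      locate IT (H - (s / 2 ^ OU &&& M)) fun i =>
        excl OU RW M UT (search W V B1 Wm T w0 OA ON OU RW RM M H RT UT IT exc fuel) s J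
          (.cons K c r tl) i &&
        incl W Wm w0 OA ON RW RM RT (search W V B1 Wm T w0 OA ON OU RW RM M H RT UT IT exc fuel) s J
          tl i)) := by
  have : search W V B1 Wm T w0 OA ON OU RW RM M H RT UT IT exc (fuel + 1) s J (.cons K c r tl) =
    orB (tooFew V B1 (Nat.sub H (Nat.land (Nat.shiftRight s OU) M)) r)
      (orB (boundOk V B1 T (Nat.shiftRight s OA) (Nat.sub H (Nat.land (Nat.shiftRight s OU) M)) c
        (Nat.add (Nat.shiftRight s 80) K)) (locate IT (Nat.sub H (Nat.land (Nat.shiftRight s OU) M))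
      (branch W Wm w0 OA ON OU RW RM M RT UT
        (search W V B1 Wm T w0 OA ON OU RW RM M H RT UT IT exc fuel) s J (.cons K c r tl) tl))) := rfl
  rw [this, orB_eq, orB_eq]
  have h : branch W Wm w0 OA ON OU RW RM M RT UT
      (search W V B1 Wm T w0 OA ON OU RW RM M H RT UT IT exc fuel) s J (.cons K c r tl) tl = fun i =>
      excl OU RW M UT (search W V B1 Wm T w0 OA ON OU RW RM M H RT UT IT exc fuel) s J
        (.cons K c r tl) i &&
      incl W Wm w0 OA ON RW RM RT (search W V B1 Wm T w0 OA ON OU RW RM M H RT UT IT exc fuel) s J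
        tl i := by
    funext i
    exact andB_eq
  rw [h]
  simp only [shr_eq, land_eq, Nat.add_eq, Nat.sub_eq]

end

section

variable {W V n w0 w2 T IT vmax : ℕ} {R up : ℕ → ℕ → ℕ} {salt : ℕ → ℕ} {exc : List ℕ}

/-- Correctness of the search. `S` is a choice closed under passing to smaller elements, and `K` is
the part of it that has not been chosen yet; all other elements of `S` have been chosen and are
unavailable, and no element of `K` is. If the search succeeds, the value of completing the choice by
`K` is at most `T`, or the completed choice is exceptional. The invariants say that the state
encodes `v`, `na` and `A`, that no lane overflows, and that the arbitrary low bits do not overflow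
within the remaining fuel. -/
theorem search_sound (hW : W = V + 1)
    (hRw : ∀ i < n, ∀ j < n, R i j ≤ w2) (hRs : ∀ i < n, ∀ j < n, R i j = R j i)
    (hsalt : ∀ i < n, salt i < 2 ^ 64) (hup : ∀ i < n, ∀ j < n, up i j ≤ 1)
    (hIT : ∀ i < n, IT / 2 ^ (8 * (2 ^ (W * i + V) % 149)) % 2 ^ 8 = i)
    (hvm : vmax < 2 ^ V) (hvn : n * vmax < 2 ^ W - 1) (hnB : n < 2 ^ W - 1) (hwv : w2 ≤ vmax)
    {S : Finset ℕ} (hSn : ∀ i ∈ S, i < n) (hS : ∀ i < n, i ∉ S → ∀ j ∈ S, up i j = 0)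
    (fuel : ℕ) {K : Finset ℕ} {v na : ℕ → ℕ} {s A J : ℕ} {rs : Sched} (hKS : K ⊆ S)
    (hK : ∀ j ∈ K, na j = 0) (hSK : ∀ j ∈ S, j ∉ K → na j = 1) (hna : ∀ j < n, na j ≤ 1)
    (hrs : rs.Ok W V n w0 w2 K.card) (hv : ∀ i < n, v i + K.card * w2 ≤ vmax)
    (hlow : s % 2 ^ 80 + fuel * 2 ^ 64 ≤ 2 ^ 80)
    (hs : s / 2 ^ 80 = pk W n v + 2 ^ (W * n) *
      ((pk W n fun i => 2 ^ V * na i) + 2 ^ (W * n) * A))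
    (h : search W V (2 ^ W - 1) (2 ^ V - 1) T w0 (80 + W * n + W * n) (80 + W * n + V)
      (80 + W * n) (W * n) (2 ^ (W * n + 80) - 1) (2 ^ (W * n) - 1) (pk W n fun _ => 2 ^ V)
      (pk (W * n + 80) n fun i => pk W n (R i) * 2 ^ 80 + salt i)
      (pk (W * n) n fun i => pk W n fun j => 2 ^ V * up i j) IT exc fuel s J rs = true) :
    total w0 R A v K ≤ T ∨ J + ∑ k ∈ K, 2 ^ k ∈ exc := by
  induction fuel generalizing K v na s A J rs with
  | zero => exact absurd (search_zero.symm.trans h) Bool.false_ne_true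
  | succ fuel ih =>
    have hp : 0 < 2 ^ V := by positivity
    have h2 : 2 ^ W = 2 * 2 ^ V := by rw [hW, pow_succ, mul_comm]
    have hvl : ∀ i < n, v i < 2 ^ W := fun i hi => by have := hv i hi; omega
    have hnl : ∀ i < n, 2 ^ V * na i < 2 ^ W := fun i hi => by
      have := Nat.mul_le_mul_left (2 ^ V) (hna i hi); omega
    have hX : s / 2 ^ (80 + W * n) = (pk W n fun i => 2 ^ V * na i) + 2 ^ (W * n) * A := by
      rw [pow_add, ← Nat.div_div_eq_div_mul, hs, Nat.add_mul_div_left _ _ (by positivity),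
        Nat.div_eq_of_lt (pk_lt hvl), zero_add]
    have hA : s / 2 ^ (80 + W * n + W * n) = A := by
      rw [pow_add, ← Nat.div_div_eq_div_mul, hX, Nat.add_mul_div_left _ _ (by positivity),
        Nat.div_eq_of_lt (pk_lt hnl), zero_add]
    have ha : (pk W n fun _ => 2 ^ V) - (s / 2 ^ (80 + W * n) &&& (2 ^ (W * n) - 1)) =
        pk W n fun i => 2 ^ V * (1 - na i) := by
      rw [hX, Nat.and_two_pow_sub_one_eq_mod, Nat.add_mul_mod_self_left, Nat.mod_eq_of_lt (pk_lt hnl),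
        pk_sub fun i hi => by simpa using Nat.mul_le_mul_left (2 ^ V) (hna i hi)]
      exact pk_congr fun i _ => by rw [Nat.mul_sub, mul_one]
    have hal : ∀ i < n, 1 - na i ≤ 1 := fun i _ => by omega
    cases rs with
    | nil =>
      have hK0 : K = ∅ := Finset.card_eq_zero.1 hrs
      subst hK0
      rw [search_nil, Bool.or_eq_true, memB_iff, decide_eq_true_iff, hA] at h
      simpa [total] using h
    | cons Kc c r tl =>
      obtain ⟨rfl, q, lam, hq, hlam, rfl, rfl, htl⟩ := hrs
      have hKal : ∀ k ∈ K, k < n ∧ 1 - na k = 1 := fun k hk => ⟨hSn k (hKS hk), by rw [hK k hk]⟩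
      rw [search_cons, ha, hA, Bool.or_eq_true, Bool.or_eq_true] at h
      rcases h with h | h | h
      · -- the allowed elements do not suffice
        exfalso
        unfold tooFew at h
        rw [Nat.ble_eq, shr_eq, pk_shr] at h
        change (pk W n fun i => 1 - na i) % (2 ^ W - 1) + 1 ≤ K.card at h
        have h3 : ∑ i ∈ Finset.range n, (1 - na i) ≤ n := by
          simpa using Finset.sum_le_card_nsmul (Finset.range n) (fun i => 1 - na i) 1
            fun i hi => hal i (Finset.mem_range.1 hi)
        rw [pk_mod (lt_of_le_of_lt h3 hnB)] at h
        have h4 : ∑ k ∈ K, (1 - na k) ≤ ∑ i ∈ Finset.range n, (1 - na i) :=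
          Finset.sum_le_sum_of_subset fun k hk => Finset.mem_range.2 (hKal k hk).1
        rw [Finset.sum_congr rfl fun k hk => (hKal k hk).2] at h4
        simp only [Finset.sum_const, smul_eq_mul, mul_one] at h4
        omega
      · -- the bound applies
        left
        unfold boundOk at h
        rw [Nat.ble_eq] at h
        have h3 := excess_eq (lam := lam) hW hlam (fun i hi => by have := hv i hi; omega) hvm hvn hal
          hs rfl
        rw [land_eq, h3, Nat.add_eq, Nat.add_eq, Nat.mul_eq, hq] at h
        exact (total_le (lam := lam) hKal hq hRw).trans h
      · -- branching on an available element `i`: the branch that agrees with `K` is followed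
        have hKne : K.Nonempty := by
          rw [← Finset.card_pos]; omega
        obtain ⟨k0, hk0⟩ := hKne
        obtain ⟨i, hi, hali, hbr⟩ := locate_sound hW hIT hal ⟨k0, hKal k0 hk0⟩ h
        have hnai : na i = 0 := by omega
        rw [Bool.and_eq_true, incl_eq, excl_eq] at hbr
        have hrow : (pk (W * n + 80) n fun i => pk W n (R i) * 2 ^ 80 + salt i) /
            2 ^ ((W * n + 80) * i) &&& (2 ^ (W * n + 80) - 1) = pk W n (R i) * 2 ^ 80 + salt i := by
          rw [Nat.and_two_pow_sub_one_eq_mod]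
          refine lane_pk (f := fun i => pk W n (R i) * 2 ^ 80 + salt i) (fun j hj => ?_) hi
          have h3 : pk W n (R j) < 2 ^ (W * n) :=
            pk_lt fun l hl => by have := hRw j hj l hl; omega
          have h4 := hsalt j hj
          rw [pow_add]
          have := Nat.mul_le_mul_right (2 ^ 80) (Nat.succ_le_of_lt h3)
          rw [Nat.succ_mul] at this
          omega
        have hlane : s / 2 ^ (80 + W * i) &&& (2 ^ V - 1) = v i := by
          rw [Nat.and_two_pow_sub_one_eq_mod, pow_add, ← Nat.div_div_eq_div_mul, hs]
          refine lane_of (by omega) hvl hi ?_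
          have := hv i hi; omega
        have hupr : (pk (W * n) n fun i => pk W n fun j => 2 ^ V * up i j) / 2 ^ (W * n * i) &&&
            (2 ^ (W * n) - 1) = pk W n fun j => 2 ^ V * up i j := by
          rw [Nat.and_two_pow_sub_one_eq_mod]
          refine lane_pk (f := fun i => pk W n fun j => 2 ^ V * up i j) (fun j hj => ?_) hi
          refine pk_lt fun l hl => ?_
          have := Nat.mul_le_mul_left (2 ^ V) (hup j hj l hl)
          omega
        have hsd := Nat.mod_add_div s (2 ^ 80)
        have hscr := scramble_lt
        by_cases hiK : i ∈ K
        · have h3 := hbr.2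
          rw [hrow, hlane] at h3
          have hKc : (K.erase i).card + 1 = K.card := Finset.card_erase_add_one hiK
          have hs' : s + (pk W n (R i) * 2 ^ 80 + salt i) + ((w0 + 2 * v i) *
              2 ^ (80 + W * n + W * n) + 2 ^ (80 + W * n + V + W * i)) = (s % 2 ^ 80 + salt i) + 2 ^ 80 *
              (pk W n (fun j => v j + R i j) + 2 ^ (W * n) *
                ((pk W n fun j => 2 ^ V * (if j = i then 1 else na j)) +
                2 ^ (W * n) * (A + w0 + 2 * v i))) := by
            have h5 : (pk W n fun j => 2 ^ V * (if j = i then 1 else na j)) =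
                (pk W n fun j => 2 ^ V * na j) + 2 ^ V * 2 ^ (W * i) := by
              rw [← pk_single hi, pk_add]
              refine pk_congr fun j _ => ?_
              by_cases hj : j = i
              · subst hj; simp [hnai]
              · simp [hj]
            rw [h5, ← pk_add]
            conv_lhs => rw [← hsd, hs]
            simp only [pow_add]
            ring
          have hlo : s % 2 ^ 80 + salt i + fuel * 2 ^ 64 ≤ 2 ^ 80 := by
            have := hsalt i hi
            rw [Nat.succ_mul] at hlow
            omega
          have hsl := hsalt i hi
          rcases Nat.eq_zero_or_pos fuel with rfl | hf
          · exact absurd (search_zero.symm.trans h3) Bool.false_ne_true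
          have hlt : s % 2 ^ 80 + salt i < 2 ^ 80 := by omega
          have h6 := ih (K := K.erase i) (v := fun j => v j + R i j)
            (na := fun j => if j = i then 1 else na j) (A := A + w0 + 2 * v i) (rs := tl)
            ((Finset.erase_subset _ _).trans hKS)
            (fun j hj => by
              rw [if_neg (Finset.ne_of_mem_erase hj)]; exact hK j (Finset.mem_of_mem_erase hj))
            (fun j hj hjK => by
              by_cases hji : j = i
              · rw [if_pos hji]
              · rw [if_neg hji]
                exact hSK j hj fun h => hjK (Finset.mem_erase.2 ⟨hji, h⟩))
            (fun j hj => by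
              split
              · exact le_rfl
              · exact hna j hj)
            (by rw [show (K.erase i).card = q by omega]; exact htl)
            (fun j hj => by
              have h7 := hv j hj
              have h8 := hRw i hi j hj
              rw [← hKc, Nat.succ_mul] at h7
              omega)
            (s := _) (J := _) (by rw [hs', Nat.add_mul_mod_self_left, Nat.mod_eq_of_lt hlt]; exact hlo)
            (by rw [hs', Nat.add_mul_div_left _ _ (by positivity), Nat.div_eq_of_lt hlt, zero_add])
            h3
          rw [total_insert hiK fun j hj => hRs i hi j (hSn j (hKS hj))]
          rwa [← Finset.add_sum_erase K _ hiK, ← add_assoc]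
        · have hiS : i ∉ S := fun h => by have := hSK i h hiK; omega
          have h3 := hbr.1
          rw [hupr] at h3
          have hlt2 : s % 2 ^ (80 + W * n) < 2 ^ (80 + W * n) := Nat.mod_lt _ (by positivity)
          have hul : ∀ j < n, 2 ^ V * up i j < 2 ^ W := fun j hj => by
            have := Nat.mul_le_mul_left (2 ^ V) (hup i hi j hj); omega
          have hlor : s ||| (pk W n fun j => 2 ^ V * up i j) * 2 ^ (80 + W * n) =
              s % 2 ^ (80 + W * n) + 2 ^ (80 + W * n) *
                ((pk W n fun j => 2 ^ V * max (na j) (up i j)) + 2 ^ (W * n) * A) := by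
            have h4 := lor_split (b := s / 2 ^ (80 + W * n)) (c := 0)
              (d := pk W n fun j => 2 ^ V * up i j) hlt2 (by positivity)
            rw [Nat.mod_add_div, zero_add, Nat.or_zero, hX] at h4
            have h5 := lor_split (b := A) (d := 0) (pk_lt hnl) (pk_lt hul)
            rw [mul_zero, add_zero, Nat.or_zero, pk_lor hnl hul] at h5
            rw [mul_comm _ (2 ^ (80 + W * n)), h4, h5]
            congr 3
            refine pk_congr fun j hj => ?_
            rcases Nat.le_one_iff_eq_zero_or_eq_one.1 (hna j hj) with h | h <;>
              rcases Nat.le_one_iff_eq_zero_or_eq_one.1 (hup i hi j hj) with h' | h' <;>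
              simp [h, h']
          have hlow2 : s % 2 ^ (80 + W * n) = s % 2 ^ 80 + 2 ^ 80 * pk W n v := by
            conv_lhs => rw [← hsd, hs, pow_add]
            have h4 : s % 2 ^ 80 < 2 ^ 80 := Nat.mod_lt _ (by positivity)
            have h5 := pk_lt hvl
            rw [Nat.mod_mul, Nat.add_mul_mod_self_left, Nat.mod_mod,
              Nat.add_mul_div_left _ _ (by positivity), Nat.div_eq_of_lt h4, zero_add,
              Nat.add_mul_mod_self_left, Nat.mod_eq_of_lt h5]
          have hs' : (s ||| (pk W n fun j => 2 ^ V * up i j) * 2 ^ (80 + W * n)) + scramble = (s % 2 ^ 80 + scramble) + 2 ^ 80 *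
              (pk W n v + 2 ^ (W * n) *
                ((pk W n fun j => 2 ^ V * max (na j) (up i j)) + 2 ^ (W * n) * A)) := by
            rw [hlor, hlow2, pow_add]
            ring
          rcases Nat.eq_zero_or_pos fuel with rfl | hf
          · exact absurd (search_zero.symm.trans h3) Bool.false_ne_true
          have hlo : s % 2 ^ 80 + scramble + fuel * 2 ^ 64 ≤ 2 ^ 80 := by
            rw [Nat.succ_mul] at hlow
            omega
          have hlt : s % 2 ^ 80 + scramble < 2 ^ 80 := by omega
          exact ih (K := K) (v := v) (na := fun j => max (na j) (up i j)) (A := A)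
            (rs := Sched.cons _ _ _ tl) hKS
            (fun j hj => by
              rw [hK j hj, hS i hi hiS j (hKS hj)]; rfl)
            (fun j hj hjK => by
              have h5 := hup i hi j (hSn j hj)
              change max (na j) (up i j) = 1
              rw [hSK j hj hjK]; exact max_eq_left h5)
            (fun j hj => max_le (hna j hj) (hup i hi j hj))
            ⟨rfl, q, lam, hq, hlam, rfl, rfl, htl⟩ hv (s := _)
            (by rw [hs', Nat.add_mul_mod_self_left, Nat.mod_eq_of_lt hlt]; exact hlo)
            (by rw [hs', Nat.add_mul_div_left _ _ (by positivity), Nat.div_eq_of_lt hlt, zero_add])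
            h3

end

/-! ### The partial order and the distances in packed form -/

theorem nth_eq (l : List ℕ) (i : ℕ) : nth l i = l.getD i 0 := by
  induction l generalizing i with
  | nil => rfl
  | cons x l ih =>
    cases i with
    | zero => rfl
    | succ i => exact (ih i).trans (by simp)

theorem mapForce_eq {α β : Type} (f : α → ℕ) (l : List α) (k : List ℕ → β) :
    mapForce f l k = k (l.map f) := by
  induction l generalizing k with
  | nil => rfl
  | cons x l ih =>
    have : mapForce f (x :: l) k = force (f x) fun y => mapForce f l fun ys => k (y :: ys) := rfl
    rw [this, force_eq, ih]; rfl

theorem len_eq {α : Type} (l : List α) : len l = l.length := by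
  induction l with
  | nil => rfl
  | cons x l ih => exact congrArg Nat.succ ih

theorem upto_eq (m : ℕ) : upto m = List.range m := by
  have h : ∀ acc, (Nat.rec (fun acc => acc) (fun k ih acc => ih (k :: acc)) m : List ℕ → List ℕ) acc =
      List.range m ++ acc := by
    induction m with
    | zero => intro acc; rfl
    | succ m ih =>
      intro acc
      rw [List.range_succ, List.append_assoc]
      exact ih (m :: acc)
  exact (h []).trans (List.append_nil _)

theorem pack_eq {W : ℕ} (l : List ℕ) : pack W l = pk W l.length fun i => l.getD i 0 := by
  induction l with
  | nil => rfl
  | cons x l ih =>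
    have : pack W (x :: l) = x + pack W l * 2 ^ W := by
      rw [← shl_eq]; rfl
    rw [this, ih, List.length_cons, pk_succ', mul_comm]
    rfl

theorem pack_map {α : Type} {W : ℕ} (l : List α) (f : α → ℕ) (d : α) :
    pack W (l.map f) = pk W l.length fun i => f (l.getD i d) := by
  rw [pack_eq, List.length_map]
  refine pk_congr fun i hi => ?_
  simp [List.getD_eq_getElem?_getD, hi]

theorem memList_eq (e : ℕ) (y : List ℕ) : memList e y = if e ∈ y then 1 else 0 := by
  induction y with
  | nil => rfl
  | cons x y ih =>
    have : memList e (x :: y) = Bool.rec (memList e y) 1 (Nat.beq x e) := rfl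
    rw [this, ih]
    cases h : Nat.beq x e with
    | true => rw [if_pos (List.mem_cons.2 (Or.inl (Nat.eq_of_beq_eq_true h).symm))]
    | false =>
      refine if_congr ?_ rfl rfl
      rw [List.mem_cons, or_iff_right fun h' => Nat.ne_of_beq_eq_false h h'.symm]

theorem countGe_eq (p : ℕ) (y : List ℕ) : countGe p y = (y.filter (p ≤ ·)).length := by
  induction y with
  | nil => rfl
  | cons x y ih =>
    have : countGe p (x :: y) = Bool.rec (countGe p y) (Nat.succ (countGe p y)) (Nat.ble p x) := rfl
    rw [this, ih]
    cases h : Nat.ble p x with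
    | true => rw [List.filter_cons_of_pos (by simpa using Nat.le_of_ble_eq_true h)]; rfl
    | false =>
      rw [List.filter_cons_of_neg]
      rw [decide_eq_true_iff]
      exact fun h' => by rw [Nat.ble_eq_true_of_le h'] at h; exact Bool.noConfusion h

/-- The number of elements of `S` that are at least `e`. -/
def tailCard (S : Finset ℕ) (e : ℕ) : ℕ := (S.filter (e ≤ ·)).card

/-- `x ⪯ y`: from every `e` on, `x` has at most as many elements as `y`. -/
def Dom (x y : Finset ℕ) : Prop := ∀ e ∈ x, tailCard x e ≤ tailCard y e

/-- Strictly decreasing lists represent finite sets of exponents. -/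
abbrev Decr (x : List ℕ) : Prop := x.Pairwise (· > ·)

theorem Decr.nodup {x : List ℕ} (h : Decr x) : x.Nodup := h.imp fun h => h.ne'

theorem tailCard_toFinset {y : List ℕ} (hy : Decr y) (e : ℕ) :
    tailCard y.toFinset e = (y.filter (e ≤ ·)).length := by
  have h : (y.toFinset).filter (e ≤ ·) = (y.filter (e ≤ ·)).toFinset := by
    ext a; simp
  rw [tailCard, h, List.toFinset_card_of_nodup (hy.nodup.filter _)]

/-- In terms of decreasing lists: the `i`-th largest element of `x` is at most the `i`-th largest of
`y`. -/
theorem dom_toFinset {x : List ℕ} (hx : Decr x) (y : Finset ℕ) :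
    Dom x.toFinset y ↔ ∀ i, (h : i < x.length) → i + 1 ≤ tailCard y x[i] := by
  have key : ∀ i, (h : i < x.length) → tailCard x.toFinset x[i] = i + 1 := by
    intro i h
    rw [tailCard_toFinset hx]
    have h0 : ∀ p, x.filter (p ≤ ·) =
        (x.take (i + 1)).filter (p ≤ ·) ++ (x.drop (i + 1)).filter (p ≤ ·) := fun p => by
      rw [← List.filter_append, List.take_append_drop]
    have h1 : x.filter (x[i] ≤ ·) = x.take (i + 1) := by
      rw [h0]
      have h2 : (x.take (i + 1)).filter (x[i] ≤ ·) = x.take (i + 1) := by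
        rw [List.filter_eq_self]
        intro a ha
        obtain ⟨j, hj, rfl⟩ := List.mem_take_iff_getElem.1 ha
        rw [decide_eq_true_iff]
        rcases Nat.lt_or_ge j i with h3 | h3
        · exact (List.pairwise_iff_getElem.1 hx j i _ _ h3).le
        · have : j = i := by omega
          subst this; exact le_rfl
      have h3 : (x.drop (i + 1)).filter (x[i] ≤ ·) = [] := by
        rw [List.filter_eq_nil_iff]
        intro a ha
        obtain ⟨j, hj, rfl⟩ := List.mem_drop_iff_getElem.1 ha
        rw [decide_eq_true_iff, not_le]
        exact List.pairwise_iff_getElem.1 hx i _ _ _ (by omega)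
      rw [h2, h3, List.append_nil]
    rw [h1, List.length_take]; omega
  constructor
  · intro h i hi
    rw [← key i hi]
    exact h _ (List.mem_toFinset.2 (List.getElem_mem hi))
  · intro h e he
    obtain ⟨i, hi, rfl⟩ := List.getElem_of_mem (List.mem_toFinset.1 he)
    rw [key i hi]
    exact h i hi

theorem domB_iff {y x : List ℕ} (hy : Decr y) (hx : Decr x) :
    domB y x 1 = true ↔ Dom x.toFinset y.toFinset := by
  rw [dom_toFinset hx]
  have h : ∀ (x : List ℕ) (j : ℕ), domB y x j = true ↔
      ∀ i, (h : i < x.length) → i + j ≤ tailCard y.toFinset x[i] := by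
    intro x
    induction x with
    | nil => intro j; simp [domB]
    | cons p x ih =>
      intro j
      have : domB y (p :: x) j = andB (Nat.ble j (countGe p y)) (domB y x (j + 1)) := rfl
      rw [this, andB_eq, Bool.and_eq_true, ih, Nat.ble_eq, countGe_eq, ← tailCard_toFinset hy]
      constructor
      · rintro ⟨h1, h2⟩ i hi
        cases i with
        | zero => simpa using h1
        | succ i =>
          have := h2 i (by simpa using hi)
          simp only [List.getElem_cons_succ]; omega
      · intro h
        refine ⟨by have h0 := h 0 (by simp); rw [List.getElem_cons_zero] at h0; omega, fun i hi => ?_⟩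
        have := h (i + 1) (by simpa using hi)
        simp only [List.getElem_cons_succ] at this; omega
  exact h x 1

theorem anyDom_iff {G : List (List ℕ)} {x : List ℕ} (hG : ∀ g ∈ G, Decr g) (hx : Decr x) :
    anyDom G x = true ↔ ∃ g ∈ G, Dom x.toFinset g.toFinset := by
  induction G with
  | nil => simp [anyDom]
  | cons g G ih =>
    have : anyDom (g :: G) x = orB (domB g x 1) (anyDom G x) := rfl
    rw [this, orB_eq, Bool.or_eq_true, domB_iff (hG g (by simp)) hx,
      ih fun g' h => hG g' (by simp [h])]
    simp

section

variable {W V n m : ℕ} {U : List (List ℕ)}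

theorem sumAt_eq {y : List ℕ} (hy : ∀ e ∈ y, e < m) :
    sumAt ((List.range m).map fun e => pk W n fun j => memList e (U.getD j [])) y =
      pk W n fun j => (y.map fun e => memList e (U.getD j [])).sum := by
  induction y with
  | nil => simp [sumAt, pk]
  | cons e y ih =>
    have h1 : sumAt ((List.range m).map fun e => pk W n fun j => memList e (U.getD j [])) (e :: y) =
      nth ((List.range m).map fun e => pk W n fun j => memList e (U.getD j [])) e +
      sumAt ((List.range m).map fun e => pk W n fun j => memList e (U.getD j [])) y := rfl
    rw [h1, ih fun e h => hy e (by simp [h]), nth_eq]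
    have h2 : ((List.range m).map fun e => pk W n fun j => memList e (U.getD j [])).getD e 0 =
        pk W n fun j => memList e (U.getD j []) := by
      simp [List.getD_eq_getElem?_getD, hy e (by simp)]
    rw [h2, pk_add]
    simp

/-- The incidence vectors of `x` and `y` have the scalar product `|x ∩ y|`. -/
theorem sum_memList {x y : List ℕ} (hx : Decr x) :
    (x.map fun e => memList e y).sum = (x.toFinset ∩ y.toFinset).card := by
  simp only [memList_eq]
  rw [Finset.inter_comm, ← Finset.filter_mem_eq_inter, Finset.card_filter]
  have h : (y.toFinset).sum (fun i => if i ∈ x.toFinset then 1 else 0) =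
      (x.toFinset).sum fun i => if i ∈ y.toFinset then 1 else 0 := by
    rw [← Finset.card_filter, ← Finset.card_filter, Finset.filter_mem_eq_inter,
      Finset.filter_mem_eq_inter, Finset.inter_comm]
  rw [h, List.sum_toFinset _ hx.nodup]
  simp

/-- The Hamming distance of two sets of exponents. -/
def hd (x y : Finset ℕ) : ℕ := (symmDiff x y).card

theorem hd_add (x y : Finset ℕ) : hd x y + 2 * (x ∩ y).card = x.card + y.card := by
  have h1 : hd x y = (x \ y).card + (y \ x).card := by
    rw [hd, symmDiff_def, Finset.sup_eq_union, Finset.card_union_of_disjoint disjoint_sdiff_sdiff]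
  have h2 := Finset.card_sdiff_add_card_inter x y
  have h3 := Finset.card_sdiff_add_card_inter y x
  rw [Finset.inter_comm] at h3
  omega

/-- The weight `w` at distance `d`, with `d` clamped to lie between `2` and `N`. -/
def farWeight (w : List ℕ) (N d : ℕ) : ℕ := w.getD (min (max d 2) N) 0

theorem far_eq {w : List ℕ} {N : ℕ} (hN : 2 ≤ N) (d : ℕ) : far w N d = farWeight w N d := by
  unfold far farWeight
  rw [nth_eq]
  congr 1
  cases h : Nat.ble N d with
  | true =>
    have := Nat.le_of_ble_eq_true h
    rw [max_eq_left (hN.trans this), min_eq_right this]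
  | false =>
    have h1 : ¬ N ≤ d := fun h' => by rw [Nat.ble_eq_true_of_le h'] at h; exact Bool.noConfusion h
    cases h' : Nat.ble 2 d with
    | true =>
      have := Nat.le_of_ble_eq_true h'
      rw [max_eq_left this, min_eq_left (by omega)]
    | false =>
      have h2 : ¬ 2 ≤ d := fun h3 => by rw [Nat.ble_eq_true_of_le h3] at h'; exact Bool.noConfusion h'
      rw [max_eq_right (by omega), min_eq_left hN]

theorem antitoneB_sound {w : List ℕ} (h : antitoneB w (nth w 0) = true) {i j : ℕ} (hij : i ≤ j) :
    w.getD j 0 ≤ w.getD i 0 := by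
  have h1 : ∀ (w : List ℕ) (p : ℕ), antitoneB w p = true → ∀ i, w.getD i 0 ≤ p ∧
      ∀ j, i ≤ j → w.getD j 0 ≤ w.getD i 0 := by
    intro w
    induction w with
    | nil => intro p _ i; simp
    | cons x w ih =>
      intro p hp i
      have h2 : antitoneB (x :: w) p = andB (Nat.ble x p) (antitoneB w x) := rfl
      rw [h2, andB_eq, Bool.and_eq_true, Nat.ble_eq] at hp
      have h3 := ih x hp.2
      cases i with
      | zero =>
        refine ⟨by simpa using hp.1, fun j _ => ?_⟩
        cases j with
        | zero => simp
        | succ j => simpa using (h3 j).1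
      | succ i =>
        refine ⟨by simpa using (h3 i).1.trans hp.1, fun j hj => ?_⟩
        obtain ⟨j, rfl⟩ : ∃ k, j = k + 1 := ⟨j - 1, by omega⟩
        simpa using (h3 i).2 j (by omega)
  exact (h1 w _ h i).2 j hij

theorem and_guard_one {Z : ℕ} (hZ : Z < 2 ^ (V + 1)) :
    Z &&& 2 ^ V = 2 ^ V * if 2 ^ V ≤ Z then 1 else 0 := by
  simpa using and_guard hZ (le_refl 1)

theorem geLane_eq {d : ℕ} {f : ℕ → ℕ} (hW : W = V + 1) (hf : ∀ j < n, f j < 2 ^ V) (hd : d ≤ 2 ^ V)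
    (hd0 : 0 < d) :
    geLane W (pk W n fun _ => 2 ^ V) (pk W n fun _ => 1) (pk W n f) d =
      pk W n fun j => if d ≤ f j then 1 else 0 := by
  have h2 : 2 ^ W = 2 * 2 ^ V := by rw [hW, pow_succ, mul_comm]
  have hV : Nat.sub W 1 = V := by rw [hW]; rfl
  unfold geLane
  rw [shr_eq, land_eq, Nat.sub_eq, Nat.add_eq, Nat.mul_eq, hV, pk_add, mul_pk,
    pk_sub fun i hi => by omega, pk_land (fun i hi => by have := hf i hi; omega) (fun i hi => by omega)]
  rw [← pk_shr (V := V) (f := fun j => if d ≤ f j then 1 else 0)]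
  congr 1
  refine pk_congr fun i hi => ?_
  rw [and_guard_one (by have := hf i hi; rw [← hW]; omega)]
  congr 1
  refine if_congr ?_ rfl rfl
  have := hf i hi
  omega

theorem geRows_eq {β : Type} {H ones Wt : ℕ} {Cs ds : List ℕ} (k : List (List ℕ) → β) :
    geRows W H ones Wt Cs ds U k = k (U.map fun y =>
      ds.map (geLane W H ones (Wt + y.length * ones - 2 * sumAt Cs y))) := by
  induction U generalizing k with
  | nil => rfl
  | cons y U ih =>
    have : geRows W H ones Wt Cs ds (y :: U) k =
      force (Nat.sub (Nat.add Wt (Nat.mul (len y) ones)) (Nat.mul 2 (sumAt Cs y))) fun D =>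
      mapForce (geLane W H ones D) ds fun ge => geRows W H ones Wt Cs ds U fun l => k (ge :: l) := rfl
    rw [this, force_eq, mapForce_eq, ih, len_eq]
    rfl

/-- The sums of the final segments of a list. -/
def tailSums (Cs : List ℕ) : List ℕ := Cs.tails.map List.sum

theorem tails_eq {β : Type} {Cs : List ℕ} (k : List ℕ → β) : tails Cs k = k (tailSums Cs) := by
  induction Cs generalizing k with
  | nil => rfl
  | cons C Cs ih =>
    have : tails (C :: Cs) k = tails Cs fun ts => force (Nat.add C (nth ts 0)) fun s => k (s :: ts) :=
      rfl
    rw [this, ih, force_eq, nth_eq]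
    cases Cs <;> rfl

theorem getD_tailSums {Cs : List ℕ} {e : ℕ} (he : e ≤ Cs.length) :
    (tailSums Cs).getD e 0 = (Cs.drop e).sum := by
  unfold tailSums
  rw [List.getD_eq_getElem?_getD, List.getElem?_map, List.getElem?_eq_getElem (by simp; omega)]
  simp

theorem sum_drop_range {F : ℕ → ℕ → ℕ} {e : ℕ} :
    (((List.range m).map fun e => pk W n (F e)).drop e).sum =
      pk W n fun j => ∑ i ∈ (Finset.range m).filter (e ≤ ·), F i j := by
  rw [← List.map_drop]
  have h : ∀ l : List ℕ, l.Nodup → (l.map fun e => pk W n (F e)).sum =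
      pk W n fun j => ∑ i ∈ l.toFinset, F i j := by
    intro l hl
    induction l with
    | nil => simp [pk]
    | cons x l ih =>
      rw [List.nodup_cons] at hl
      rw [List.map_cons, List.sum_cons, ih hl.2, pk_add]
      refine pk_congr fun j _ => ?_
      rw [List.toFinset_cons, Finset.sum_insert (by simpa using hl.1)]
  rw [h _ (List.nodup_range.sublist (List.drop_sublist _ _))]
  congr 1
  funext j
  refine Finset.sum_congr ?_ fun _ _ => rfl
  ext a
  simp only [List.mem_toFinset, Finset.mem_filter, Finset.mem_range, List.mem_drop_iff_getElem,
    List.getElem_range, List.length_range]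
  constructor
  · rintro ⟨i, hi, rfl⟩; omega
  · rintro ⟨h1, h2⟩; exact ⟨a - e, by omega, by omega⟩

theorem sum_memList_range {y : List ℕ} (hy : ∀ e ∈ y, e < m) (e : ℕ) :
    ∑ i ∈ (Finset.range m).filter (e ≤ ·), memList i y = tailCard y.toFinset e := by
  simp only [memList_eq, tailCard]
  rw [← Finset.card_filter]
  congr 1
  ext a
  simp only [Finset.mem_filter, Finset.mem_range, List.mem_toFinset]
  constructor
  · rintro ⟨⟨_, h⟩, h'⟩; exact ⟨h', h⟩
  · rintro ⟨h, h'⟩; exact ⟨⟨hy a h, h'⟩, h⟩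

/-- The conditions of the partial order are evaluated for all lanes at once; `tl e j` is the number
of entries of the `j`-th element that are at least `e`. -/
theorem upMask_eq {ts : List ℕ} {tl : ℕ → ℕ → ℕ} (hW : W = V + 1)
    (hts : ∀ e < m, nth ts e = pk W n (tl e)) (htl : ∀ e, ∀ j < n, tl e j < 2 ^ V)
    {y : List ℕ} (hy : ∀ e ∈ y, e < m) {j0 : ℕ} (hj0 : 0 < j0) (hl : y.length + j0 ≤ 2 ^ V) :
    upMask (pk W n fun _ => 2 ^ V) (pk W n fun _ => 1) ts y j0 = pk W n fun j => 2 ^ V *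
      if ∀ i, (h : i < y.length) → i + j0 ≤ tl y[i] j then 1 else 0 := by
  have h2 : 2 ^ W = 2 * 2 ^ V := by rw [hW, pow_succ, mul_comm]
  induction y generalizing j0 with
  | nil =>
    simp only [List.length_nil, Nat.not_lt_zero, IsEmpty.forall_iff, implies_true, if_true, mul_one]
    rfl
  | cons p y ih =>
    have h1 : upMask (pk W n fun _ => 2 ^ V) (pk W n fun _ => 1) ts (p :: y) j0 =
      Nat.land (Nat.land (Nat.sub (Nat.add (nth ts p) (pk W n fun _ => 2 ^ V))
        (Nat.mul j0 (pk W n fun _ => 1))) (pk W n fun _ => 2 ^ V))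
      (upMask (pk W n fun _ => 2 ^ V) (pk W n fun _ => 1) ts y (j0 + 1)) := rfl
    rw [List.length_cons] at hl
    rw [h1, ih (fun e h => hy e (by simp [h])) (Nat.succ_pos _) (by omega), hts p (hy p (by simp)),
      land_eq, land_eq, Nat.sub_eq, Nat.add_eq, Nat.mul_eq, pk_add, mul_pk,
      pk_sub fun i hi => by omega,
      pk_land (fun i hi => by have := htl p i hi; omega) (fun i hi => by omega),
      pk_land (fun i hi => lt_of_le_of_lt Nat.and_le_right (by omega))
        (fun i hi => by split <;> omega)]
    refine pk_congr fun j hj => ?_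
    rw [and_guard_one (by have := htl p j hj; rw [← hW]; omega)]
    have h4 : (∀ i, (h : i < (p :: y).length) → i + j0 ≤ tl (p :: y)[i] j) ↔
        (j0 ≤ tl p j ∧ ∀ i, (h : i < y.length) → i + (j0 + 1) ≤ tl y[i] j) := by
      constructor
      · intro h
        refine ⟨by have h0 := h 0 (by simp); rw [List.getElem_cons_zero] at h0; omega,
          fun i hi => ?_⟩
        have := h (i + 1) (by simpa using hi)
        simp only [List.getElem_cons_succ] at this; omega
      · rintro ⟨h1, h2⟩ i hi
        cases i with
        | zero => rw [List.getElem_cons_zero]; omega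
        | succ i =>
          have := h2 i (by simpa using hi)
          simp only [List.getElem_cons_succ]; omega
    have h5 : 2 ^ V ≤ tl p j + 2 ^ V - j0 * 1 ↔ j0 ≤ tl p j := by
      have := htl p j hj; omega
    rw [if_congr h5 rfl rfl]
    by_cases h6 : j0 ≤ tl p j
    · by_cases h7 : ∀ i, (h : i < y.length) → i + (j0 + 1) ≤ tl y[i] j
      · rw [if_pos h6, if_pos h7, if_pos (h4.2 ⟨h6, h7⟩), Nat.and_self]
      · rw [if_pos h6, if_neg h7, if_neg fun h => h7 (h4.1 h).2]; simp
    · rw [if_neg h6, if_neg fun h => h6 (h4.1 h).1]; simp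

theorem dot_pk {a : List ℕ} {l : List (ℕ → ℕ)} :
    dot a (l.map (pk W n)) = pk W n fun j => dot a (l.map fun f => f j) := by
  induction a generalizing l with
  | nil => simp [dot, pk]
  | cons x a ih =>
    have h : ∀ b, dot (x :: a) b = x * nth b 0 + dot a b.tail := fun _ => rfl
    rw [h, nth_eq, ← List.map_tail, ih]
    cases l with
    | nil => simp [h, nth_eq, pk]
    | cons f l => simp [h, nth_eq, mul_pk, pk_add]

/-- Summation by parts: a decreasing weight from its steps. -/
theorem dot_diffs {l : List ℕ} {p s D : ℕ} (hl : ∀ i, l.getD i 0 ≤ p)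
    (hl' : ∀ i j, i ≤ j → l.getD j 0 ≤ l.getD i 0) :
    p - dot (diffs l p) ((List.range' s l.length).map fun d => if d ≤ D then 1 else 0) =
      (p :: l).getD (min (D + 1 - s) l.length) 0 ∧
    dot (diffs l p) ((List.range' s l.length).map fun d => if d ≤ D then 1 else 0) ≤ p := by
  induction l generalizing p s with
  | nil => simp [diffs, dot]
  | cons x l ih =>
    have h1 : ∀ b, dot (diffs (x :: l) p) b = (p - x) * nth b 0 + dot (diffs l x) b.tail :=
      fun _ => rfl
    have hx : x ≤ p := hl 0
    obtain ⟨h2, h3⟩ := ih (p := x) (s := s + 1) (fun i => hl' 0 (i + 1) (Nat.zero_le _))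
      (fun i j h => hl' (i + 1) (j + 1) (by omega))
    rw [h1, List.length_cons, List.range'_succ, List.map_cons, List.tail_cons, nth_eq,
      List.getD_cons_zero]
    by_cases hs : s ≤ D
    · rw [if_pos hs, mul_one]
      refine ⟨?_, by omega⟩
      rw [show min (D + 1 - s) (l.length + 1) = min (D + 1 - (s + 1)) l.length + 1 by omega,
        List.getD_cons_succ, ← h2]
      omega
    · have h4 : dot (diffs l x) ((List.range' (s + 1) l.length).map fun d =>
          if d ≤ D then 1 else 0) = 0 := by
        have h5 : ∀ (a b : List ℕ), (∀ y ∈ b, y = 0) → dot a b = 0 := by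
          intro a
          induction a with
          | nil => intros; rfl
          | cons z a ih =>
            intro b hb
            have : dot (z :: a) b = z * nth b 0 + dot a b.tail := rfl
            rw [this, ih _ fun y hy => hb y (List.mem_of_mem_tail hy), nth_eq]
            cases b with
            | nil => simp
            | cons y b => simp [hb y]
        apply h5
        intro y hy
        obtain ⟨d, hd, rfl⟩ := List.mem_map.1 hy
        rw [List.mem_range'_1] at hd
        rw [if_neg (by omega)]
      rw [if_neg hs, mul_zero, h4]
      refine ⟨?_, by omega⟩
      rw [show min (D + 1 - s) (l.length + 1) = 0 by omega]
      simp

end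

/-! ### The data of the search -/

/-- The computed schedule satisfies the conditions under which the search is correct, whatever the
parameters of the levels. -/
theorem sched_sound {β : Type} {W V n w0 w2 a b : ℕ} (h : a * w0 ≤ 2 ^ V) (r : ℕ) :
    ∃ rs : Sched, rs.Ok W V n w0 w2 r ∧ ∀ k : Sched → β,
      sched (pk W n fun _ => 2 ^ V) (pk W n fun _ => 1) w0 w2 a b r k = k rs := by
  induction r with
  | zero => exact ⟨.nil, rfl, fun k => rfl⟩
  | succ r ih =>
    obtain ⟨tl, htl, hk⟩ := ih
    have hlam : (a - b * (r + 1)) * w0 / 256 ≤ 2 ^ V :=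
      (Nat.div_le_self _ _).trans ((Nat.mul_le_mul_right _ (Nat.sub_le _ _)).trans h)
    refine ⟨.cons (pk W n fun _ => 2 ^ V - (a - b * (r + 1)) * w0 / 256)
      ((r + 1) * (w0 + 2 * ((a - b * (r + 1)) * w0 / 256)) + (r + 1) * r * w2) (r + 1) tl,
      ⟨rfl, r, _, rfl, hlam, rfl, rfl, htl⟩, fun k => ?_⟩
    have h1 : sched (pk W n fun _ => 2 ^ V) (pk W n fun _ => 1) w0 w2 a b (r + 1) k =
      sched (pk W n fun _ => 2 ^ V) (pk W n fun _ => 1) w0 w2 a b r fun tl =>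
      force (Nat.succ r) fun s =>
      force (Nat.div (Nat.mul (Nat.sub a (Nat.mul b s)) w0) 256) fun lam =>
      force (Nat.sub (pk W n fun _ => 2 ^ V) (Nat.mul lam (pk W n fun _ => 1))) fun K =>
      force (Nat.add (Nat.mul s (Nat.add w0 (Nat.mul 2 lam))) (Nat.mul (Nat.mul s r) w2)) fun c =>
      k (Sched.cons K c s tl) := rfl
    have hdiv (a b : ℕ) : Nat.div a b = a / b := rfl
    rw [h1, hk, force_eq, force_eq, force_eq, force_eq]
    simp only [hdiv, Nat.mul_eq, Nat.sub_eq, Nat.add_eq, Nat.succ_eq_add_one]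
    rw [mul_pk, pk_sub fun i _ => by simpa using hlam]
    simp only [mul_one]

theorem indexOk_sound {W V n IT : ℕ} (hW : W = V + 1) (h : indexOk W n IT = true) :
    ∀ i < n, IT / 2 ^ (8 * (2 ^ (W * i + V) % 149)) % 2 ^ 8 = i := by
  have h1 : ∀ l : List ℕ, (List.rec true (fun i _ ih => andB (Nat.beq i (Nat.land (Nat.shiftRight IT
      (Nat.mul 8 (Nat.mod (Nat.shiftLeft 1 (Nat.add (Nat.mul W i) (Nat.sub W 1))) 149))) 255)) ih) l :
      Bool) = true → ∀ i ∈ l, IT / 2 ^ (8 * (2 ^ (W * i + V) % 149)) % 2 ^ 8 = i := by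
    intro l
    induction l with
    | nil => simp
    | cons x l ih =>
      intro h
      simp only [andB_eq, Bool.and_eq_true, Nat.beq_eq] at h
      intro i hi
      rcases List.mem_cons.1 hi with rfl | hi
      · have h2 := h.1
        have hmod (a b : ℕ) : Nat.mod a b = a % b := rfl
        rw [land_eq, shr_eq, Nat.mul_eq, hmod, shl_eq, Nat.add_eq, Nat.mul_eq, Nat.sub_eq, one_mul,
          show W - 1 = V by omega, show 255 = 2 ^ 8 - 1 from rfl, Nat.and_two_pow_sub_one_eq_mod]
          at h2
        exact h2.symm
      · exact ih (by simpa only [andB_eq] using h.2) i hi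
  intro i hi
  refine h1 _ h i ?_
  rw [upto_eq]; exact List.mem_range.2 hi

theorem far_le {w : List ℕ} {N d : ℕ} (hN : 2 ≤ N)
    (hw : ∀ i j, i ≤ j → w.getD j 0 ≤ w.getD i 0) : farWeight w N d ≤ w.getD 2 0 :=
  hw _ _ (by omega)

/-- The initial score of an element with `l` exponents below `m`. -/
def score (m N : ℕ) (w : List ℕ) (l : ℕ) : ℕ :=
  l * (w.getD 1 0 - w.getD 2 0) + farWeight w N l + (l * farWeight w N (l - 1) +
    (m - l) * farWeight w N (l + 1))

theorem score0_eq {m N : ℕ} {w : List ℕ} (hN : 2 ≤ N) (l : ℕ) : score0 m N w l = score m N w l := by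
  unfold score0 score
  simp only [far_eq hN, nth_eq, Nat.add_eq, Nat.mul_eq, Nat.sub_eq, Nat.pred_eq_sub_one,
    Nat.succ_eq_add_one]

/-- Scores remain below the guard bits even after all interactions are added to them. -/
theorem score_le {m N t l : ℕ} {w : List ℕ} (hN : 2 ≤ N) (hl : l ≤ m) (ht : m + 1 ≤ 2 ^ t)
    (hw : ∀ i j, i ≤ j → w.getD j 0 ≤ w.getD i 0) :
    score m N w l + (2 ^ t - (m + 1)) * w.getD 2 0 ≤ w.getD 0 0 * (m + 2 ^ t) := by
  unfold score
  have h1 := far_le (d := l) hN hw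
  have h2 := Nat.mul_le_mul_left l (far_le (d := l - 1) hN hw)
  have h3 := Nat.mul_le_mul_left (m - l) (far_le (d := l + 1) hN hw)
  have h4 : w.getD 1 0 ≤ w.getD 0 0 := hw _ _ (by omega)
  have h5 : w.getD 2 0 ≤ w.getD 0 0 := hw _ _ (by omega)
  obtain ⟨k, rfl⟩ := Nat.exists_eq_add_of_le hl
  obtain ⟨r, hr⟩ := Nat.exists_eq_add_of_le ht
  rw [hr, Nat.add_sub_cancel_left]
  rw [Nat.add_sub_cancel_left] at h3 ⊢
  have h6 := Nat.mul_le_mul_left l (show w.getD 1 0 - w.getD 2 0 ≤ w.getD 0 0 by omega)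
  have h7 := Nat.mul_le_mul_left l h5
  have h8 := Nat.mul_le_mul_left k h5
  have h9 := Nat.mul_le_mul_left r h5
  nlinarith

theorem getD_drop (l : List ℕ) (k i : ℕ) : (l.drop k).getD i 0 = l.getD (k + i) 0 := by
  rw [List.getD_eq_getElem?_getD, List.getD_eq_getElem?_getD, List.getElem?_drop]

section

variable {W V n m N t : ℕ} {U : List (List ℕ)}

theorem elem_of {P : List ℕ → Prop} (h : ∀ y ∈ U, P y) (h0 : P []) (i : ℕ) : P (U.getD i []) := by
  rw [List.getD_eq_getElem?_getD]
  rcases lt_or_ge i U.length with hi | hi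
  · rw [List.getElem?_eq_getElem hi]; exact h _ (List.getElem_mem hi)
  · rw [List.getElem?_eq_none hi]; exact h0

theorem length_le_of_lt {y : List ℕ} (hy : Decr y) (h : ∀ e ∈ y, e < m) : y.length ≤ m := by
  rw [← List.toFinset_card_of_nodup hy.nodup, ← Finset.card_range m]
  exact Finset.card_le_card fun e he => Finset.mem_range.2 (h e (List.mem_toFinset.1 he))

/-- The lanes of `|x| + |y| - 2 |x ∩ y|` contain the distances from `y`. -/
theorem distLanes_eq (hn : n = U.length) (hU : ∀ y ∈ U, Decr y ∧ ∀ e ∈ y, e < m)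
    {y : List ℕ} (hy : Decr y) (hy' : ∀ e ∈ y, e < m) :
    nth (tailSums ((List.range m).map fun e => pack W (U.map (memList e)))) 0 +
      y.length * (pk W n fun _ => 1) -
      2 * sumAt ((List.range m).map fun e => pack W (U.map (memList e))) y =
    pk W n fun j => hd y.toFinset (U.getD j []).toFinset := by
  have hC : ((List.range m).map fun e => pack W (U.map (memList e))) =
      (List.range m).map fun e => pk W n fun j => memList e (U.getD j []) :=
    List.map_congr_left fun e _ => by rw [pack_map _ _ [], hn]
  have huU := fun j => elem_of (P := fun y => Decr y ∧ ∀ e ∈ y, e < m) hU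
    ⟨List.Pairwise.nil, by simp⟩ j
  have hT : nth (tailSums ((List.range m).map fun e => pack W (U.map (memList e)))) 0 =
      pk W n fun j => (U.getD j []).length := by
    rw [nth_eq, getD_tailSums (Nat.zero_le _), hC, sum_drop_range]
    refine pk_congr fun j _ => ?_
    rw [sum_memList_range (huU j).2, tailCard, Finset.filter_true_of_mem fun _ _ => Nat.zero_le _,
      List.toFinset_card_of_nodup (huU j).1.nodup]
  rw [hT, hC, sumAt_eq hy', mul_pk, pk_add, mul_pk]
  have h1 : ∀ j, (y.map fun e => memList e (U.getD j [])).sum =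
      (y.toFinset ∩ (U.getD j []).toFinset).card := fun j => sum_memList hy
  have h2 := fun j => hd_add y.toFinset (U.getD j []).toFinset
  have h3 : ∀ j, ((U.getD j []).toFinset).card = (U.getD j []).length := fun j =>
    List.toFinset_card_of_nodup (huU j).1.nodup
  have h4 : (y.toFinset).card = y.length := List.toFinset_card_of_nodup hy.nodup
  rw [pk_sub fun j _ => by have := h2 j; rw [h1, ← h3, ← h4]; omega]
  refine pk_congr fun j _ => ?_
  have := h2 j
  rw [h1, ← h3, ← h4]; omega

/-- The rows of interactions contain the weights of the distances, by summation by parts. -/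
theorem rowLanes_eq (hW : W = V + 1) (hN : 2 ≤ N) (hNV : N ≤ 2 ^ V) {w : List ℕ}
    (hwl : w.length = N + 1) (hw : ∀ i j, i ≤ j → w.getD j 0 ≤ w.getD i 0) {f : ℕ → ℕ}
    (hf : ∀ j < n, f j < 2 ^ V) :
    w.getD 2 0 * (pk W n fun _ => 1) - dot (diffs (w.drop 3) (w.getD 2 0))
      (((List.range (N + 1)).drop 3).map
        (geLane W (pk W n fun _ => 2 ^ V) (pk W n fun _ => 1) (pk W n f))) =
      pk W n fun j => farWeight w N (f j) := by
  have h1 : (List.range (N + 1)).drop 3 = List.range' 3 (w.drop 3).length := by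
    rw [List.range_eq_range', List.drop_range', List.length_drop, hwl]
  have h2 : ((List.range (N + 1)).drop 3).map
        (geLane W (pk W n fun _ => 2 ^ V) (pk W n fun _ => 1) (pk W n f)) =
      ((List.range' 3 (w.drop 3).length).map fun d j => if d ≤ f j then 1 else 0).map (pk W n) := by
    rw [h1, List.map_map]
    refine List.map_congr_left fun d hd => ?_
    rw [List.mem_range'_1, List.length_drop, hwl] at hd
    exact geLane_eq hW hf (by omega) (by omega)
  have h3 : ∀ j, _ := fun j => dot_diffs (l := w.drop 3) (p := w.getD 2 0) (s := 3) (D := f j)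
    (fun i => by rw [getD_drop]; exact hw _ _ (by omega))
    (fun i j h => by rw [getD_drop, getD_drop]; exact hw _ _ (by omega))
  have h4 : (w.getD 2 0 :: w.drop 3) = w.drop 2 := by
    rw [List.drop_eq_getElem_cons (by omega : 2 < w.length)]
    simp [List.getD_eq_getElem?_getD, (by omega : 2 < w.length)]
  rw [h2, dot_pk, mul_pk]
  simp only [List.map_map, Function.comp_def, mul_one]
  rw [pk_sub fun j _ => (h3 j).2]
  refine pk_congr fun j _ => ?_
  rw [(h3 j).1, h4, getD_drop, farWeight, List.length_drop, hwl]
  congr 1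
  omega

/-- The table of the elements above each element represents the partial order. -/
theorem upRows_eq (hW : W = V + 1) (hn : n = U.length) (hU : ∀ y ∈ U, Decr y ∧ ∀ e ∈ y, e < m)
    (hmV : m + 1 ≤ 2 ^ V) {y : List ℕ} (hy : Decr y) (hy' : ∀ e ∈ y, e < m) :
    upMask (pk W n fun _ => 2 ^ V) (pk W n fun _ => 1)
      (tailSums ((List.range m).map fun e => pack W (U.map (memList e)))) y 1 =
    pk W n fun j => 2 ^ V * (open Classical in
      if Dom y.toFinset (U.getD j []).toFinset then 1 else 0) := by
  classical
  have hC : ((List.range m).map fun e => pack W (U.map (memList e))) =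
      (List.range m).map fun e => pk W n fun j => memList e (U.getD j []) :=
    List.map_congr_left fun e _ => by rw [pack_map _ _ [], hn]
  have huU := fun j => elem_of (P := fun y => Decr y ∧ ∀ e ∈ y, e < m) hU
    ⟨List.Pairwise.nil, by simp⟩ j
  have hT : ∀ e < m, nth (tailSums ((List.range m).map fun e => pack W (U.map (memList e)))) e =
      pk W n fun j => tailCard (U.getD j []).toFinset e := by
    intro e he
    rw [nth_eq, getD_tailSums (by simpa using he.le), hC, sum_drop_range]
    exact pk_congr fun j _ => sum_memList_range (huU j).2 e
  have hlt : ∀ e, ∀ j < n, tailCard (U.getD j []).toFinset e < 2 ^ V := fun e j _ => by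
    have h1 := length_le_of_lt (huU j).1 (huU j).2
    have h2 : tailCard (U.getD j []).toFinset e ≤ (U.getD j []).length := by
      rw [← List.toFinset_card_of_nodup (huU j).1.nodup]
      exact Finset.card_filter_le _ _
    omega
  rw [upMask_eq hW hT hlt hy' one_pos (by have := length_le_of_lt hy hy'; omega)]
  refine pk_congr fun j _ => ?_
  congr 1
  exact if_congr (dom_toFinset hy _).symm rfl rfl

/-- A set is determined by its mask. -/
theorem pk_one_inj {S : Finset ℕ} {b : ℕ → ℕ} (hb : ∀ i < n, b i ≤ 1) (hS : ∀ i ∈ S, i < n)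
    (h : ∑ k ∈ S, 2 ^ k = pk 1 n b) : ∀ i < n, (i ∈ S ↔ b i = 1) := by
  have h1 : ∑ k ∈ S, 2 ^ k = pk 1 n fun i => if i ∈ S then 1 else 0 := by
    unfold pk
    simp only [ite_mul, zero_mul, one_mul]
    rw [← Finset.sum_filter]
    refine Finset.sum_congr ?_ fun _ _ => rfl
    ext i
    simp only [Finset.mem_filter, Finset.mem_range]
    exact ⟨fun h => ⟨hS i h, h⟩, fun h => h.2⟩
  intro i hi
  have h2 := lane_pk (W := 1) (f := fun i => if i ∈ S then 1 else 0)
    (fun j _ => by split <;> norm_num) hi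
  have h3 := lane_pk (W := 1) (f := b) (fun j hj => by have := hb j hj; omega) hi
  rw [← h1, h, h3] at h2
  rw [h2]
  split <;> simp_all

end

/-! ### Correctness of the check of an interval -/

theorem lanesOk_iff {t m W n w0 a : ℕ} : lanesOk t m W n w0 a = true ↔
    (n + 1) * (w0 * (m + 2 ^ t) + 1) + a * w0 + 300 ≤ 2 ^ (W - 2) := by
  unfold lanesOk
  rw [Nat.ble_eq, shl_eq, one_mul]
  rfl

/-- The check of an interval, without the order of evaluation. -/
theorem checkInterval_eq {t m W N pa pb q : ℕ} {U : List (List ℕ)} {Gs : List (List (List ℕ))}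
    {g : List ℕ} {fs : List (ℕ × ℕ × ℕ)} :
    checkInterval t m W N pa pb q U Gs g fs = fs.all fun f =>
      checkFun t m N W U.length (pk W U.length fun _ => 1) ((pk W U.length fun _ => 1) * 2 ^ (W - 1))
        (pack (W * U.length) (U.map fun y => upMask ((pk W U.length fun _ => 1) * 2 ^ (W - 1))
          (pk W U.length fun _ => 1)
          (tailSums ((List.range m).map fun e => pack W (U.map (memList e)))) y 1)) U
        (U.map fun y => ((List.range (N + 1)).drop 3).map
          (geLane W ((pk W U.length fun _ => 1) * 2 ^ (W - 1)) (pk W U.length fun _ => 1)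
            (nth (tailSums ((List.range m).map fun e => pack W (U.map (memList e)))) 0 +
              y.length * (pk W U.length fun _ => 1) -
              2 * sumAt ((List.range m).map fun e => pack W (U.map (memList e))) y)))
        (Gs.map fun G => maskOf G U) pa pb q g f.1 f.2.1 f.2.2 := by
  unfold checkInterval
  simp only [force_eq, mapForce_eq, tails_eq, geRows_eq, upto_eq, len_eq, Nat.succ_eq_add_one,
    Nat.mul_eq, Nat.sub_eq, shl_eq, pack_map (W := W) U (fun _ => 1) []]
  induction fs with
  | nil => rfl
  | cons f fs ih =>
    rw [List.all_cons, ← ih]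
    exact andB_eq

theorem maskOf_eq {G U : List (List ℕ)} :
    maskOf G U = pk 1 U.length fun i => if anyDom G (U.getD i []) then 1 else 0 := by
  unfold maskOf
  rw [pack_map _ _ []]
  refine pk_congr fun i _ => ?_
  cases anyDom G (U.getD i []) <;> rfl

/-- The prepared data satisfy the conditions of `search_sound`, with the choice empty at the start.
-/
theorem runSearch_sound {V W n m N t a b T r0 IT w0 w2 : ℕ} {U : List (List ℕ)}
    {Gs : List (List (List ℕ))} {w : List ℕ} (hW : W = V + 1) (hn : n = U.length)
    (hU : ∀ y ∈ U, Decr y ∧ ∀ e ∈ y, e < m) (hm : m ≤ 100) (hN : 2 ≤ N) (hN' : N ≤ 100)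
    (ht : m + 1 ≤ 2 ^ t) (hr0 : r0 = 2 ^ t - (m + 1)) (hwl : w.length = N + 1)
    (hw : ∀ i j, i ≤ j → w.getD j 0 ≤ w.getD i 0) (hw0 : w0 = w.getD 0 0) (hw2 : w2 = w.getD 2 0)
    (hlanes : lanesOk t m W n w0 a = true) (hn' : n ≤ 255)
    (hIT : ∀ i < n, IT / 2 ^ (8 * (2 ^ (W * i + V) % 149)) % 2 ^ 8 = i)
    (hGs : ∀ G ∈ Gs, ∀ y ∈ G, Decr y)
    {S : Finset ℕ} (hSn : ∀ i ∈ S, i < n) (hSc : S.card = r0)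
    (hS : ∀ i < n, i ∉ S → ∀ j ∈ S, ¬ Dom (U.getD i []).toFinset (U.getD j []).toFinset)
    (h : runSearch m N W n (pk W U.length fun _ => 1) ((pk W U.length fun _ => 1) * 2 ^ (W - 1))
        (pack (W * U.length) (U.map fun y => upMask ((pk W U.length fun _ => 1) * 2 ^ (W - 1))
          (pk W U.length fun _ => 1)
          (tailSums ((List.range m).map fun e => pack W (U.map (memList e)))) y 1)) r0 IT T a b w0 w2 U
        (U.map fun y => ((List.range (N + 1)).drop 3).map
          (geLane W ((pk W U.length fun _ => 1) * 2 ^ (W - 1)) (pk W U.length fun _ => 1)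
            (nth (tailSums ((List.range m).map fun e => pack W (U.map (memList e)))) 0 +
              y.length * (pk W U.length fun _ => 1) -
              2 * sumAt ((List.range m).map fun e => pack W (U.map (memList e))) y)))
        (Gs.map fun G => maskOf G U) w = true) :
    total w0 (fun i j => farWeight w N (hd (U.getD i []).toFinset (U.getD j []).toFinset))
      (initialValue m w) (fun i => score m N w (U.getD i []).length) S ≤ T ∨
    ∃ G ∈ Gs, ∀ i < n, (i ∈ S ↔ ∃ y ∈ G, Dom (U.getD i []).toFinset y.toFinset) := by
  classical
  rw [lanesOk_iff] at hlanes
  have hV2 : 2 ^ V = 2 * 2 ^ (W - 2) := by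
    rcases Nat.lt_or_ge W 2 with h | h
    · rw [show W - 2 = 0 by omega] at hlanes; omega
    · rw [← pow_succ', show W - 2 + 1 = V by omega]
  have hW2 : 2 ^ W = 2 * 2 ^ V := by rw [hW, pow_succ, mul_comm]
  have hH : (pk W U.length fun _ => 1) * 2 ^ (W - 1) = pk W n fun _ => 2 ^ V := by
    rw [mul_comm, mul_pk, hn]
    simp only [mul_one, show W - 1 = V by omega]
  have huU := fun j => elem_of (P := fun y => Decr y ∧ ∀ e ∈ y, e < m) hU
    ⟨List.Pairwise.nil, by simp⟩ j
  have hmem : ∀ i < n, U.getD i [] ∈ U := fun i hi => by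
    rw [List.getD_eq_getElem?_getD, List.getElem?_eq_getElem (hn ▸ hi)]
    exact List.getElem_mem _
  have hhd : ∀ i j, hd (U.getD i []).toFinset (U.getD j []).toFinset < 2 ^ V := fun i j => by
    have : hd (U.getD i []).toFinset (U.getD j []).toFinset ≤ m := by
      rw [← Finset.card_range m]
      refine Finset.card_le_card fun e he => Finset.mem_range.2 ?_
      rcases Finset.mem_symmDiff.1 he with he | he
      · exact (huU i).2 e (List.mem_toFinset.1 he.1)
      · exact (huU j).2 e (List.mem_toFinset.1 he.1)
    omega
  have hrows : (U.map fun y => ((List.range (N + 1)).drop 3).map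
          (geLane W ((pk W U.length fun _ => 1) * 2 ^ (W - 1)) (pk W U.length fun _ => 1)
            (nth (tailSums ((List.range m).map fun e => pack W (U.map (memList e)))) 0 +
              y.length * (pk W U.length fun _ => 1) -
              2 * sumAt ((List.range m).map fun e => pack W (U.map (memList e))) y))) =
      U.map fun y => ((List.range (N + 1)).drop 3).map
          (geLane W (pk W n fun _ => 2 ^ V) (pk W n fun _ => 1)
            (pk W n fun j => hd y.toFinset (U.getD j []).toFinset)) := by
    refine List.map_congr_left fun y hy => ?_
    rw [hH, ← hn, distLanes_eq hn hU (hU y hy).1 (hU y hy).2]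
  have hups : pack (W * U.length) (U.map fun y => upMask ((pk W U.length fun _ => 1) * 2 ^ (W - 1))
          (pk W U.length fun _ => 1)
          (tailSums ((List.range m).map fun e => pack W (U.map (memList e)))) y 1) =
      pk (W * n) n fun i => pk W n fun j => 2 ^ V *
        (if Dom (U.getD i []).toFinset (U.getD j []).toFinset then 1 else 0) := by
    rw [pack_map _ _ [], hH, ← hn]
    refine pk_congr fun i hi => ?_
    rw [upRows_eq hW hn hU (by omega) (hU _ (hmem i hi)).1 (hU _ (hmem i hi)).2]
  rw [hrows, hups, hH, ← hn] at h
  unfold runSearch rowsOf at h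
  obtain ⟨rs, hrs, hk⟩ := sched_sound (β := Bool) (W := W) (V := V) (n := n) (w0 := w0) (w2 := w2)
    (a := a) (b := b) (by omega) r0
  simp only [mapForce_eq, force_eq, hk, List.map_id', List.map_map] at h
  have hpm {α : Type} (k : ℕ) (l : List α) (f : α → ℕ) (d : α) (hl : l.length = n) :
      pack k (l.map f) = pk k n fun i => f (l.getD i d) := by rw [pack_map _ _ d, hl]
  rw [hpm _ U _ [] hn.symm, hpm _ U _ [] hn.symm] at h
  simp only [Function.comp_def, Nat.add_eq, Nat.sub_eq, Nat.mul_eq, shl_eq, one_mul, len_eq,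
    score0_eq hN, Nat.succ_eq_add_one, show W - 1 = V by omega] at h
  have hrow : ∀ i < n, w2 * (pk W n fun _ => 1) - dot (diffs (w.drop 3) w2)
      (((List.range (N + 1)).drop 3).map (geLane W (pk W n fun _ => 2 ^ V) (pk W n fun _ => 1)
        (pk W n fun j => hd (U.getD i []).toFinset (U.getD j []).toFinset))) =
      pk W n fun j => farWeight w N (hd (U.getD i []).toFinset (U.getD j []).toFinset) := by
    intro i hi
    rw [hw2]
    exact rowLanes_eq hW hN (by omega) hwl hw fun j _ => hhd i j
  have hRT := pk_congr (W := W * n + 80) (n := n) fun i hi =>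
    congrArg (fun x => x * 2 ^ 80 + saltOf (((List.range (N + 1)).drop 3).map
      (geLane W (pk W n fun _ => 2 ^ V) (pk W n fun _ => 1)
        (pk W n fun j => hd (U.getD i []).toFinset (U.getD j []).toFinset)))) (hrow i hi)
  rw [hRT] at h
  have hscore : ∀ i, score m N w (U.getD i []).length + r0 * w2 ≤ w0 * (m + 2 ^ t) := fun i => by
    rw [hr0, hw2, hw0]
    exact score_le hN (length_le_of_lt (huU i).1 (huU i).2) ht hw
  have hnv : n * (w0 * (m + 2 ^ t)) + w0 * (m + 2 ^ t) + n + 301 ≤ 2 ^ (W - 2) := by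
    have : (n + 1) * (w0 * (m + 2 ^ t) + 1) =
      n * (w0 * (m + 2 ^ t)) + w0 * (m + 2 ^ t) + n + 1 := by ring
    omega
  have hres := search_sound (W := W) (V := V) (n := n) (w0 := w0) (w2 := w2) (T := T) (IT := IT)
    (vmax := w0 * (m + 2 ^ t))
    (R := fun i j => farWeight w N (hd (U.getD i []).toFinset (U.getD j []).toFinset))
    (up := fun i j => if Dom (U.getD i []).toFinset (U.getD j []).toFinset then 1 else 0)
    (salt := fun i => saltOf (((List.range (N + 1)).drop 3).map (geLane W (pk W n fun _ => 2 ^ V)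
      (pk W n fun _ => 1) (pk W n fun j => hd (U.getD i []).toFinset (U.getD j []).toFinset))))
    (exc := Gs.map fun G => maskOf G U) hW
    (fun i _ j _ => hw2 ▸ far_le hN hw)
    (fun i _ j _ => by rw [hd, hd, symmDiff_comm])
    (fun i _ => lt_of_lt_of_le (Nat.mod_lt _ (by norm_num)) (by norm_num))
    (fun i _ j _ => by split <;> norm_num) hIT (by omega)
    (by omega) (by omega)
    (by
      rw [hw2, hw0]
      calc w.getD 2 0 ≤ w.getD 0 0 := hw _ _ (by omega)
        _ = w.getD 0 0 * 1 := (mul_one _).symm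
        _ ≤ _ := Nat.mul_le_mul_left _ (by omega))
    hSn (fun i hi hiS j hj => if_neg (hS i hi hiS j hj)) (n + 1) (K := S)
    (v := fun i => score m N w (U.getD i []).length) (na := fun _ => 0)
    (s := initialValue m w * 2 ^ (80 + W * n + W * n) +
      (pk W n fun i => score m N w (U.getD i []).length) * 2 ^ 80)
    (A := initialValue m w) (J := 0) (rs := rs)
    subset_rfl (fun _ _ => rfl) (fun j hj hj' => absurd hj hj') (fun _ _ => by norm_num)
    (hSc ▸ hrs) (fun i _ => hSc ▸ hscore i)
    (by
      have : (initialValue m w * 2 ^ (80 + W * n + W * n) +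
          (pk W n fun i => score m N w (U.getD i []).length) * 2 ^ 80) % 2 ^ 80 = 0 := by
        rw [Nat.add_mul_mod_self_right, add_assoc, pow_add, mul_left_comm, Nat.mul_mod_right]
      rw [this, zero_add]
      exact (Nat.mul_le_mul_right (2 ^ 64) (show n + 1 ≤ 2 ^ 16 by omega)).trans (by norm_num))
    (by
      rw [show initialValue m w * 2 ^ (80 + W * n + W * n) +
          (pk W n fun i => score m N w (U.getD i []).length) * 2 ^ 80 =
          2 ^ 80 * (initialValue m w * 2 ^ (W * n + W * n) +
          pk W n fun i => score m N w (U.getD i []).length) by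
          rw [add_assoc, pow_add 2 80]; ring, Nat.mul_div_cancel_left _ (by positivity),
        show (pk W n fun i => 2 ^ V * 0) = 0 by simp [pk]]
      rw [pow_add]; ring)
    h
  refine hres.imp_right fun h => ?_
  obtain ⟨G, hG, hGS⟩ := List.mem_map.1 h
  refine ⟨G, hG, fun i hi => ?_⟩
  rw [maskOf_eq, zero_add, ← hn] at hGS
  rw [pk_one_inj (fun i _ => by split <;> norm_num) hSn hGS.symm i hi,
    ← anyDom_iff (hGs G hG) (hU _ (hmem i hi)).1]
  split <;> simp_all

/-- What the search establishes about every set of elements of weight at least two that completes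
the sets of weight at most one to a family of `2 ^ t` elements. -/
theorem checkInterval_sound {W N t m pa pb q : ℕ} {U : List (List ℕ)} {Gs : List (List (List ℕ))}
    {g : List ℕ} {fs : List (ℕ × ℕ × ℕ)}
    (hU : ∀ y ∈ U, Decr y ∧ ∀ e ∈ y, e < m) (hm : m ≤ 100) (hN : 2 ≤ N) (hN' : N ≤ 100)
    (ht : m + 1 ≤ 2 ^ t) (hGs : ∀ G ∈ Gs, ∀ y ∈ G, Decr y)
    (h : checkInterval t m W N pa pb q U Gs g fs = true) {k a b : ℕ} (hk : (k, a, b) ∈ fs)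
    {w : List ℕ} (hww : w = (List.range (N + 1)).map (omega pa pb q N k)) :
    (∀ i j, i ≤ j → w.getD j 0 ≤ w.getD i 0) ∧ strictness pa k ≤ dot g w ∧
    ∀ {S : Finset ℕ}, (∀ i ∈ S, i < U.length) → S.card = 2 ^ t - (m + 1) →
    (∀ i < U.length, i ∉ S → ∀ j ∈ S, ¬ Dom (U.getD i []).toFinset (U.getD j []).toFinset) →
    total (w.getD 0 0)
      (fun i j => farWeight w N (hd (U.getD i []).toFinset (U.getD j []).toFinset))
      (initialValue m w) (fun i => score m N w (U.getD i []).length) S + strictness pa k ≤ dot g w ∨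
    ∃ G ∈ Gs, ∀ i < U.length, (i ∈ S ↔ ∃ y ∈ G, Dom (U.getD i []).toFinset y.toFinset) := by
  rw [checkInterval_eq, List.all_eq_true] at h
  have h1 := h _ hk
  unfold checkFun checkWeights at h1
  simp only [mapForce_eq, force_eq, andB_eq, Bool.and_eq_true, upto_eq, Nat.succ_eq_add_one,
    ← hww] at h1
  obtain ⟨hd1, hlanes, hn, hanti, hidx, hrun⟩ := h1
  have hw : ∀ i j, i ≤ j → w.getD j 0 ≤ w.getD i 0 := fun i j hij => antitoneB_sound hanti hij
  have hst : strictness pa k ≤ 1 := by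
    unfold strictness
    cases Nat.beq pa 0 <;> cases Nat.beq k 0 <;> cases Nat.beq k 1 <;> norm_num
  have hd1 := Nat.le_of_ble_eq_true hd1
  refine ⟨hw, hst.trans hd1, fun {S} hSn hSc hS => ?_⟩
  have hW : W = (W - 1) + 1 := by
    rw [lanesOk_iff] at hlanes
    rcases Nat.eq_zero_or_pos W with h | h
    · rw [h] at hlanes; simp at hlanes
    · omega
  have := runSearch_sound (T := dot g w - strictness pa k) (w0 := nth w 0) (w2 := nth w 2) hW rfl hU
    hm hN hN' ht rfl (by simp [hww]) hw (nth_eq _ _) (nth_eq _ _) hlanes (Nat.le_of_ble_eq_true hn)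
    (indexOk_sound hW hidx) hGs hSn hSc hS hrun
  refine this.imp_left fun h => ?_
  rw [nth_eq] at h
  omega

/-! ### The sets with at most 64 sets below them -/

/-- The decreasing lists of numbers below `b` whose entries are at most the corresponding entries
of `y`. -/
def enumBelow : List ℕ → ℕ → List (List ℕ)
  | [], _ => [[]]
  | p :: y, b => [] :: (List.range (min b (p + 1))).flatMap fun q => (enumBelow y q).map (q :: ·)

theorem mem_enumBelow {y : List ℕ} {b : ℕ} {x : List ℕ} : x ∈ enumBelow y b ↔
    Decr x ∧ (∀ e ∈ x, e < b) ∧ ∀ i, (h : i < x.length) → ∃ h' : i < y.length, x[i] ≤ y[i] := by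
  induction y generalizing b x with
  | nil =>
    simp only [enumBelow, List.mem_singleton]
    constructor
    · rintro rfl; simp
    · rintro ⟨-, -, h⟩
      cases x with
      | nil => rfl
      | cons q x => obtain ⟨h', -⟩ := h 0 (by simp); simp at h'
  | cons p y ih =>
    cases x with
    | nil => simp [enumBelow]
    | cons q x =>
      simp only [enumBelow, List.mem_cons, reduceCtorEq, false_or, List.mem_flatMap, List.mem_range,
        List.mem_map, List.cons.injEq, lt_min_iff]
      constructor
      · rintro ⟨q', ⟨h1, h2⟩, x', hx', rfl, rfl⟩
        obtain ⟨h3, h4, h5⟩ := ih.1 hx'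
        refine ⟨List.pairwise_cons.2 ⟨h4, h3⟩, ?_, fun i hi => ?_⟩
        · rintro e (rfl | he)
          · exact h1
          · exact (h4 e he).trans h1
        · cases i with
          | zero => exact ⟨by simp, by simpa using Nat.lt_succ_iff.1 h2⟩
          | succ i =>
            obtain ⟨h', h6⟩ := h5 i (by simpa using hi)
            exact ⟨by simpa using h', by simpa using h6⟩
      · rintro ⟨h1, h2, h3⟩
        obtain ⟨h4, h5⟩ := List.pairwise_cons.1 h1
        obtain ⟨_, h6⟩ := h3 0 (by simp)
        simp only [List.getElem_cons_zero] at h6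
        refine ⟨q, ⟨h2 q (by simp), by omega⟩, x, ih.2 ⟨h5, h4, fun i hi => ?_⟩, rfl, rfl⟩
        obtain ⟨h', h7⟩ := h3 (i + 1) (by simpa using hi)
        exact ⟨by simpa using h', by simpa using h7⟩

theorem nodup_enumBelow (y : List ℕ) (b : ℕ) : (enumBelow y b).Nodup := by
  induction y generalizing b with
  | nil => simp [enumBelow]
  | cons p y ih =>
    rw [enumBelow, List.nodup_cons]
    refine ⟨by simp, List.nodup_flatMap.2 ⟨fun q _ => (ih q).map fun _ _ h => (List.cons.inj h).2, ?_⟩⟩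
    refine List.Pairwise.imp ?_ List.nodup_range
    intro q q' hqq x hx hx'
    obtain ⟨x1, -, rfl⟩ := List.mem_map.1 hx
    obtain ⟨x2, -, h⟩ := List.mem_map.1 hx'
    exact hqq (List.cons.inj h).1.symm

theorem succ_le_tailCard {y : List ℕ} (hy : Decr y) {e i : ℕ} :
    i + 1 ≤ tailCard y.toFinset e ↔ ∃ h : i < y.length, e ≤ y[i] := by
  rw [tailCard_toFinset hy]
  induction y generalizing i with
  | nil => simp
  | cons p y ih =>
    obtain ⟨h1, h2⟩ := List.pairwise_cons.1 hy
    by_cases hp : e ≤ p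
    · rw [List.filter_cons_of_pos (by simpa using hp), List.length_cons]
      cases i with
      | zero => simpa using hp
      | succ i => rw [Nat.add_le_add_iff_right, ih h2]; simp
    · have h3 : (p :: y).filter (e ≤ ·) = [] := by
        rw [List.filter_eq_nil_iff]
        intro a ha
        rcases List.mem_cons.1 ha with rfl | ha
        · simpa using hp
        · have := h1 a ha; simp; omega
      rw [h3]
      simp only [List.length_nil, Nat.le_zero, Nat.add_eq_zero_iff, one_ne_zero, and_false, false_iff,
        not_exists, not_le]
      intro h
      cases i with
      | zero => simpa using hp
      | succ i =>
        have hi : i < y.length := by simpa using h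
        have := h1 y[i] (List.getElem_mem hi)
        simp only [List.getElem_cons_succ]; omega

/-- `enumBelow` lists the sets below a given one. -/
theorem mem_enumBelow_iff_dom {y x : List ℕ} {b : ℕ} (hy : Decr y) (hx : Decr x)
    (hb : ∀ e ∈ x, e < b) : x ∈ enumBelow y b ↔ Dom x.toFinset y.toFinset := by
  rw [dom_toFinset hx, mem_enumBelow]
  simp only [succ_le_tailCard hy]
  exact ⟨fun h => h.2.2, fun h => ⟨hx, hb, h⟩⟩

/-- The length of `enumBelow y b`. -/
def countBelow (y : List ℕ) : ℕ → ℕ :=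
  List.rec (fun _ => 1) (fun p _ ih b => Nat.succ
    (Nat.rec 0 (fun q acc => Nat.add acc (ih q)) (Bool.rec b (Nat.succ p) (Nat.ble (Nat.succ p) b)))) y

theorem length_enumBelow (y : List ℕ) (b : ℕ) : (enumBelow y b).length = countBelow y b := by
  induction y generalizing b with
  | nil => rfl
  | cons p y ih =>
    have h1 : countBelow (p :: y) b = (Nat.rec 0 (fun q acc => Nat.add acc (countBelow y q))
        (Bool.rec b (Nat.succ p) (Nat.ble (Nat.succ p) b) : ℕ) : ℕ) + 1 := rfl
    have h2 : (Bool.rec b (Nat.succ p) (Nat.ble (Nat.succ p) b) : ℕ) = min b (p + 1) := by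
      by_cases h : Nat.succ p ≤ b
      · rw [Nat.ble_eq_true_of_le h]; exact (min_eq_right h).symm
      · rw [Bool.eq_false_iff.2 fun h' => h (Nat.le_of_ble_eq_true h')]
        have hb : b ≤ p + 1 := by omega
        exact (min_eq_left hb).symm
    have h3 : ∀ k, (Nat.rec 0 (fun q acc => Nat.add acc (countBelow y q)) k : ℕ) =
        ((List.range k).flatMap fun q => (enumBelow y q).map (q :: ·)).length := by
      intro k
      induction k with
      | zero => rfl
      | succ k ihk =>
        rw [List.range_succ, List.flatMap_append, List.length_append, ← ihk]
        simp [ih]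
    rw [h1, h2, h3, enumBelow, List.length_cons]

/-- The number of elements below a decreasing list. -/
def downCount (y : List ℕ) : ℕ := countBelow y (Nat.succ (nth y 0))

/-- The last entry of a list, or the given number if the list is empty. -/
def lastOf (y : List ℕ) : ℕ → ℕ := List.rec (fun d => d) (fun x _ ih _ => ih x) y

/-- Equality of lists, in a form that the kernel evaluates quickly. -/
def eqList (x : List ℕ) : List ℕ → Bool :=
  List.rec (fun y => List.rec true (fun _ _ _ => false) y)
    (fun a _ ih y => List.rec false (fun b y _ => andB (Nat.beq a b) (ih y)) y) x

/-- Whether `(c, x)` is an entry of `universeData`. -/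
def memUniverse (c : ℕ) (x : List ℕ) : Bool :=
  List.rec false (fun p _ ih => orB (andB (Nat.beq p.1 c) (eqList p.2 x)) ih) universeData

/-- Appending a further entry to `x` leads to a list in `universeData` or to more than 64 elements. -/
def extensionsOk (x : List ℕ) : Bool :=
  Nat.rec true (fun b ih => andB (force (downCount (x ++ [b])) fun c =>
    orB (Nat.ble 65 c) (memUniverse c (x ++ [b]))) ih) (lastOf x 0)

/-- The lists to which a further entry may be appended: those of length one and the ones in
`universeData`. -/
def seeds : List (List ℕ) := (upto 63).map (fun a => [a]) ++ universeData.map Prod.snd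

/-- `universeData` is closed under all extensions that have at most 64 elements below them. -/
def seedsOk : Bool := List.rec true (fun x _ ih => andB (extensionsOk x) ih) seeds

set_option maxRecDepth 100000 in
theorem seedsOk_eq : seedsOk = true := by decide +kernel

set_option maxRecDepth 100000 in
theorem universeData_decr : (universeData.all fun p => decide (Decr p.2 ∧ 2 ≤ p.2.length)) = true := by
  decide +kernel

set_option maxRecDepth 100000 in
theorem universeData_nodup : (universeData.map Prod.snd).Nodup := by
  decide +kernel

theorem eqList_iff {x y : List ℕ} : eqList x y = true ↔ x = y := by
  induction x generalizing y with
  | nil => cases y <;> simp [eqList]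
  | cons a x ih =>
    cases y with
    | nil => simp [eqList]
    | cons b y =>
      have : eqList (a :: x) (b :: y) = andB (Nat.beq a b) (eqList x y) := rfl
      rw [this, andB_eq, Bool.and_eq_true, ih, Nat.beq_eq, List.cons.injEq]

theorem memUniverse_sound {c : ℕ} {x : List ℕ} (h : memUniverse c x = true) :
    (c, x) ∈ universeData := by
  unfold memUniverse at h
  generalize universeData = l at h ⊢
  induction l with
  | nil => exact absurd h Bool.false_ne_true
  | cons p l ih =>
    simp only [orB_eq, andB_eq, Bool.or_eq_true, Bool.and_eq_true, eqList_iff, Nat.beq_eq] at h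
    rcases h with ⟨h1, h2⟩ | h
    · exact List.mem_cons.2 (Or.inl (Prod.ext h1.symm h2.symm))
    · exact List.mem_cons_of_mem _ (ih (by simpa only [orB_eq, andB_eq] using h))

theorem lastOf_append (x : List ℕ) (a d : ℕ) : lastOf (x ++ [a]) d = a := by
  induction x generalizing d with
  | nil => rfl
  | cons p x ih => exact ih p

theorem extensionsOk_sound {x : List ℕ} (h : extensionsOk x = true) {b : ℕ} (hb : b < lastOf x 0)
    (hc : downCount (x ++ [b]) ≤ 64) : (downCount (x ++ [b]), x ++ [b]) ∈ universeData := by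
  unfold extensionsOk at h
  generalize lastOf x 0 = k at h hb
  induction k with
  | zero => omega
  | succ k ih =>
    simp only [andB_eq, Bool.and_eq_true, force_eq, orB_eq, Bool.or_eq_true] at h
    rcases Nat.lt_succ_iff_lt_or_eq.1 hb with hb | rfl
    · exact ih (by simpa only [andB_eq, force_eq, orB_eq] using h.2) hb
    · rcases h.1 with h | h
      · have := Nat.le_of_ble_eq_true h; omega
      · exact memUniverse_sound h

theorem seeds_sound {x : List ℕ} (hx : x ∈ seeds) : extensionsOk x = true := by
  have h := seedsOk_eq
  unfold seedsOk at h
  generalize seeds = l at h hx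
  induction l with
  | nil => simp at hx
  | cons y l ih =>
    simp only [andB_eq, Bool.and_eq_true] at h
    rcases List.mem_cons.1 hx with rfl | hx
    · exact h.1
    · exact ih (by simpa only [andB_eq] using h.2) hx

/-- An initial segment of a list is below the list. -/
theorem downCount_append {x : List ℕ} (hx : x ≠ []) (b : ℕ) :
    downCount x ≤ downCount (x ++ [b]) := by
  obtain ⟨p, x, rfl⟩ := List.exists_cons_of_ne_nil hx
  have h : ∀ z : List ℕ, downCount (p :: z) = (enumBelow (p :: z) (p + 1)).length := fun z =>
    (length_enumBelow _ _).symm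
  rw [List.cons_append, h, h]
  refine ((List.subperm_of_subset (nodup_enumBelow _ _) fun z hz => ?_).length_le)
  obtain ⟨h1, h2, h3⟩ := mem_enumBelow.1 hz
  refine mem_enumBelow.2 ⟨h1, h2, fun i hi => ?_⟩
  obtain ⟨h', h4⟩ := h3 i hi
  refine ⟨by simp at h' ⊢; omega, ?_⟩
  have : (p :: (x ++ [b]))[i]'(by simp at h' ⊢; omega) = (p :: x)[i] := by
    simp only [← List.cons_append]
    exact List.getElem_append_left h'
  rw [this]; exact h4

/-- `universeData` holds every decreasing list with at least two entries and at most 64 elements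
below it, together with the number of these. -/
theorem mem_universeData {y : List ℕ} (hy : Decr y) (hl : 2 ≤ y.length) (hc : downCount y ≤ 64) :
    (downCount y, y) ∈ universeData := by
  induction y using List.reverseRecOn with
  | nil => simp at hl
  | append_singleton x b ih =>
    have hx0 : x ≠ [] := by rintro rfl; simp at hl
    have hcx := (downCount_append hx0 b).trans hc
    have hd := List.pairwise_append.1 hy
    have hseed : x ∈ seeds := by
      rcases Nat.lt_or_ge x.length 2 with h | h
      · obtain ⟨a, x', rfl⟩ := List.exists_cons_of_ne_nil hx0
        have : x' = [] := by simpa using h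
        subst this
        have h1 : downCount [a] = (enumBelow [a] (a + 1)).length := (length_enumBelow _ _).symm
        have h2 : (enumBelow [a] (a + 1)).length = a + 2 := by simp [enumBelow]
        refine List.mem_append_left _ (List.mem_map.2 ⟨a, ?_, rfl⟩)
        rw [upto_eq, List.mem_range]; omega
      · exact List.mem_append_right _ (List.mem_map.2 ⟨_, ih hd.1 h hcx, rfl⟩)
    refine extensionsOk_sound (seeds_sound hseed) ?_ hc
    obtain ⟨x', a, rfl⟩ : ∃ x' a, x = x' ++ [a] := ⟨_, _, (List.dropLast_append_getLast hx0).symm⟩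
    rw [lastOf_append]
    exact hd.2.2 a (by simp) b (by simp)

theorem universeOf_eq (t m : ℕ) : universeOf t m =
    (universeData.filter fun p => nth p.2 0 < m ∧ p.1 + (m - (nth p.2 0 + 1)) ≤ 2 ^ t).map Prod.snd := by
  unfold universeOf
  generalize universeData = l
  induction l with
  | nil => rfl
  | cons p l ih =>
    have hk : keep t m p = decide (nth p.2 0 < m ∧ p.1 + (m - (nth p.2 0 + 1)) ≤ 2 ^ t) := by
      unfold keep
      by_cases h1 : nth p.2 0 + 1 ≤ m
      · rw [show Nat.ble (Nat.succ (nth p.2 0)) m = true from Nat.ble_eq_true_of_le h1]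
        rw [Bool.eq_iff_iff, decide_eq_true_iff]
        exact ⟨fun h => ⟨h1, Nat.le_of_ble_eq_true h⟩, fun h => Nat.ble_eq_true_of_le h.2⟩
      · rw [Bool.eq_false_iff.2 fun h : Nat.ble (Nat.succ (nth p.2 0)) m = true =>
          h1 (Nat.le_of_ble_eq_true h)]
        exact (decide_eq_false fun h => h1 h.1).symm
    rw [List.filter_cons]
    simp only [ih, hk]
    by_cases h : nth p.2 0 < m ∧ p.1 + (m - (nth p.2 0 + 1)) ≤ 2 ^ t <;> simp [h]

theorem decr_of_mem_universeOf {t m : ℕ} {y : List ℕ} (h : y ∈ universeOf t m) :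
    Decr y ∧ 2 ≤ y.length ∧ ∀ e ∈ y, e < m := by
  rw [universeOf_eq, List.mem_map] at h
  obtain ⟨p, hp, rfl⟩ := h
  rw [List.mem_filter, decide_eq_true_iff] at hp
  have h1 := of_decide_eq_true (List.all_eq_true.1 universeData_decr p hp.1)
  refine ⟨h1.1, h1.2, fun e he => ?_⟩
  obtain ⟨a, x, hx⟩ := List.exists_cons_of_ne_nil (show p.2 ≠ [] by intro h; rw [h] at he; simp at he)
  have h2 : a < m := by have := hp.2.1; rw [hx] at this; exact this
  rw [hx] at he
  rcases List.mem_cons.1 he with rfl | he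
  · exact h2
  · have := (List.pairwise_cons.1 (hx ▸ h1.1)).1 e he; omega

theorem nodup_universeOf (t m : ℕ) : (universeOf t m).Nodup := by
  rw [universeOf_eq]
  exact universeData_nodup.sublist (List.filter_sublist.map _)

/-- `universeOf t m` is complete. -/
theorem mem_universeOf {t m : ℕ} (ht : t ≤ 6) {y : List ℕ} (hy : Decr y) (hl : 2 ≤ y.length)
    (hm : ∀ e ∈ y, e < m) (hc : downCount y + (m - (nth y 0 + 1)) ≤ 2 ^ t) : y ∈ universeOf t m := by
  have h64 : 2 ^ t ≤ 2 ^ 6 := Nat.pow_le_pow_right (by norm_num) ht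
  rw [universeOf_eq, List.mem_map]
  refine ⟨_, List.mem_filter.2 ⟨mem_universeData hy hl (by omega), ?_⟩, rfl⟩
  rw [decide_eq_true_iff]
  refine ⟨?_, hc⟩
  obtain ⟨a, x, rfl⟩ := List.exists_cons_of_ne_nil (show y ≠ [] by rintro rfl; simp at hl)
  exact hm _ (by simp [nth])

/-! ### Families of sets of exponents -/

/-- A family of `2 ^ t` finite sets of exponents below `m` that contains every one-element set and is
closed under passing to smaller sets. -/
structure IsFamily (t m : ℕ) (T : Finset (Finset ℕ)) : Prop where
  lt : ∀ x ∈ T, ∀ e ∈ x, e < m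
  single : ∀ e < m, {e} ∈ T
  down : ∀ y ∈ T, ∀ x, Dom x y → x ∈ T
  card : T.card = 2 ^ t

/-- The elements of a list of decreasing lists, as sets. -/
def elem (U : List (List ℕ)) (i : ℕ) : Finset ℕ := (U.getD i []).toFinset

theorem exists_decr (x : Finset ℕ) : ∃ y : List ℕ, Decr y ∧ y.toFinset = x :=
  ⟨x.sort (· ≥ ·), by
    have h1 := x.pairwise_sort (· ≥ ·)
    have h2 := x.sort_nodup (· ≥ ·)
    exact (h1.and h2).imp fun h => lt_of_le_of_ne h.1 h.2.symm, by simp⟩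

namespace IsFamily

variable {t m : ℕ} {T : Finset (Finset ℕ)}

theorem empty_mem (hT : IsFamily t m T) : ∅ ∈ T := by
  obtain ⟨y, hy⟩ : T.Nonempty := by
    rw [← Finset.card_pos, hT.card]; positivity
  exact hT.down y hy ∅ fun e he => absurd he (Finset.notMem_empty e)

/-- The members with at least two elements are listed in `universeOf t m`, for the family has room
for no others: the sets below a member and the one-element sets all belong to the family. -/
theorem exists_elem (hT : IsFamily t m T) (ht : t ≤ 6) {x : Finset ℕ} (hx : x ∈ T)
    (hx2 : 2 ≤ x.card) : ∃ i < (universeOf t m).length, elem (universeOf t m) i = x := by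
  obtain ⟨y, hy, rfl⟩ := exists_decr x
  rw [List.toFinset_card_of_nodup hy.nodup] at hx2
  have hlt : ∀ e ∈ y, e < m := fun e he => hT.lt _ hx e (List.mem_toFinset.2 he)
  have hU : y ∈ universeOf t m := by
    refine mem_universeOf ht hy hx2 hlt ?_
    obtain ⟨a, z, rfl⟩ := List.exists_cons_of_ne_nil (show y ≠ [] by rintro rfl; simp at hx2)
    have ha : nth (a :: z) 0 = a := rfl
    have hdc : downCount (a :: z) = (enumBelow (a :: z) (a + 1)).length := (length_enumBelow _ _).symm
    rw [ha, hdc]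
    have h1 : ((enumBelow (a :: z) (a + 1)).map List.toFinset).Nodup := by
      refine List.Nodup.map_on ?_ (nodup_enumBelow _ _)
      intro u hu v hv huv
      have hu := (mem_enumBelow.1 hu).1
      have hv := (mem_enumBelow.1 hv).1
      exact (List.perm_of_nodup_nodup_toFinset_eq hu.nodup hv.nodup huv).eq_of_pairwise'
        hu hv
    have h2 : ((enumBelow (a :: z) (a + 1)).map List.toFinset).toFinset ∪
        (Finset.Ico (a + 1) m).image (fun e => {e}) ⊆ T := by
      intro u hu
      rcases Finset.mem_union.1 hu with hu | hu
      · rw [List.mem_toFinset, List.mem_map] at hu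
        obtain ⟨v, hv, rfl⟩ := hu
        obtain ⟨hv1, hv2, -⟩ := mem_enumBelow.1 hv
        exact hT.down _ hx _ ((mem_enumBelow_iff_dom hy hv1 hv2).1 hv)
      · obtain ⟨e, he, rfl⟩ := Finset.mem_image.1 hu
        exact hT.single e (Finset.mem_Ico.1 he).2
    have h3 : Disjoint ((enumBelow (a :: z) (a + 1)).map List.toFinset).toFinset
        ((Finset.Ico (a + 1) m).image (fun e => ({e} : Finset ℕ))) := by
      rw [Finset.disjoint_left]
      intro u hu hu'
      rw [List.mem_toFinset, List.mem_map] at hu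
      obtain ⟨v, hv, rfl⟩ := hu
      obtain ⟨e, he, he'⟩ := Finset.mem_image.1 hu'
      have h4 : e ∈ v := List.mem_toFinset.1 (he' ▸ Finset.mem_singleton_self e)
      have := (mem_enumBelow.1 hv).2.1 e h4
      have := (Finset.mem_Ico.1 he).1
      omega
    have h5 := Finset.card_le_card h2
    rw [Finset.card_union_of_disjoint h3, List.toFinset_card_of_nodup h1, List.length_map, hT.card,
      Finset.card_image_of_injective _ Finset.singleton_injective, Nat.card_Ico] at h5
    exact h5
  obtain ⟨i, hi, h⟩ := List.getElem_of_mem hU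
  exact ⟨i, hi, by rw [elem, List.getD_eq_getElem _ _ hi, h]⟩

end IsFamily

theorem elem_injOn (t m : ℕ) :
    Set.InjOn (elem (universeOf t m)) (Finset.range (universeOf t m).length) := by
  intro i hi j hj hij
  have hi := Finset.mem_range.1 (Finset.mem_coe.1 hi)
  have hj := Finset.mem_range.1 (Finset.mem_coe.1 hj)
  rw [elem, elem, List.getD_eq_getElem _ _ hi, List.getD_eq_getElem _ _ hj] at hij
  have h1 := (decr_of_mem_universeOf (List.getElem_mem hi)).1
  have h2 := (decr_of_mem_universeOf (List.getElem_mem hj)).1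
  exact (List.Nodup.getElem_inj_iff (nodup_universeOf t m)).1
    ((List.perm_of_nodup_nodup_toFinset_eq h1.nodup h2.nodup hij).eq_of_pairwise' h1 h2)

theorem elem_spec {t m i : ℕ} (hi : i < (universeOf t m).length) :
    2 ≤ (elem (universeOf t m) i).card ∧ (∀ e ∈ elem (universeOf t m) i, e < m) ∧
    (elem (universeOf t m) i).card = ((universeOf t m).getD i []).length := by
  have h : (universeOf t m).getD i [] ∈ universeOf t m := by
    rw [List.getD_eq_getElem _ _ hi]; exact List.getElem_mem hi
  obtain ⟨h1, h2, h3⟩ := decr_of_mem_universeOf h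
  rw [elem, List.toFinset_card_of_nodup h1.nodup]
  exact ⟨h2, fun e he => h3 e (List.mem_toFinset.1 he), rfl⟩

namespace IsFamily

variable {t m : ℕ} {T : Finset (Finset ℕ)}

/-- The indices of the members with at least two elements. -/
def large (t m : ℕ) (T : Finset (Finset ℕ)) : Finset ℕ :=
  (Finset.range (universeOf t m).length).filter fun i => elem (universeOf t m) i ∈ T

theorem mem_large {i : ℕ} : i ∈ large t m T ↔
    i < (universeOf t m).length ∧ elem (universeOf t m) i ∈ T := by
  simp [large]

/-- A sum over a family splits into the terms of the empty set, of the one-element sets, and of the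
others. -/
theorem sum_eq (hT : IsFamily t m T) (ht : t ≤ 6) {M : Type*} [AddCommMonoid M]
    (h : Finset ℕ → M) : ∑ x ∈ T, h x = h ∅ + (∑ e ∈ Finset.range m, h {e} +
      ∑ i ∈ large t m T, h (elem (universeOf t m) i)) := by
  classical
  have hT' : T = insert ∅ ((Finset.range m).image (fun e => {e}) ∪
      (large t m T).image (elem (universeOf t m))) := by
    ext x
    constructor
    · intro hx
      rcases Nat.lt_or_ge x.card 2 with h2 | h2
      · rcases Finset.card_le_one_iff_subset_singleton.1 (Nat.le_of_lt_succ h2) with ⟨e, he⟩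
        rcases Finset.subset_singleton_iff.1 he with rfl | rfl
        · simp
        · have := hT.lt _ hx e (by simp)
          simp [this]
      · obtain ⟨i, hi, rfl⟩ := hT.exists_elem ht hx h2
        exact Finset.mem_insert_of_mem (Finset.mem_union_right _
          (Finset.mem_image_of_mem _ (mem_large.2 ⟨hi, hx⟩)))
    · intro hx
      rcases Finset.mem_insert.1 hx with rfl | hx
      · exact hT.empty_mem
      rcases Finset.mem_union.1 hx with hx | hx
      · obtain ⟨e, he, rfl⟩ := Finset.mem_image.1 hx
        exact hT.single e (Finset.mem_range.1 he)
      · obtain ⟨i, hi, rfl⟩ := Finset.mem_image.1 hx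
        exact (mem_large.1 hi).2
  have h2 : ∀ i ∈ large t m T, 2 ≤ (elem (universeOf t m) i).card := fun i hi =>
    (elem_spec (mem_large.1 hi).1).1
  conv_lhs => rw [hT']
  rw [Finset.sum_insert, Finset.sum_union, Finset.sum_image, Finset.sum_image]
  · intro i hi j hj
    exact elem_injOn t m (Finset.mem_coe.2 (Finset.mem_range.2 (mem_large.1 hi).1))
      (Finset.mem_coe.2 (Finset.mem_range.2 (mem_large.1 hj).1))
  · exact fun i _ j _ h => Finset.singleton_injective h
  · rw [Finset.disjoint_left]
    intro x hx hx'
    obtain ⟨e, he, rfl⟩ := Finset.mem_image.1 hx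
    obtain ⟨i, hi, hi'⟩ := Finset.mem_image.1 hx'
    have := h2 i hi
    rw [hi', Finset.card_singleton] at this
    omega
  · intro hx
    rcases Finset.mem_union.1 hx with hx | hx
    · obtain ⟨e, he, he'⟩ := Finset.mem_image.1 hx
      exact Finset.singleton_ne_empty e he'
    · obtain ⟨i, hi, hi'⟩ := Finset.mem_image.1 hx
      have := h2 i hi
      rw [hi', Finset.card_empty] at this
      omega

theorem card_large (hT : IsFamily t m T) (ht : t ≤ 6) : (large t m T).card + (m + 1) = 2 ^ t := by
  have := hT.sum_eq ht fun _ => 1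
  rw [← Finset.card_eq_sum_ones, hT.card] at this
  simp only [Finset.sum_const, Finset.card_range, smul_eq_mul, mul_one] at this
  omega

end IsFamily

theorem hd_self (x : Finset ℕ) : hd x x = 0 := by simp [hd]

theorem hd_comm (x y : Finset ℕ) : hd x y = hd y x := by rw [hd, hd, symmDiff_comm]

theorem hd_empty_left (x : Finset ℕ) : hd ∅ x = x.card := by simp [hd, symmDiff]

theorem hd_singleton_left (e : ℕ) (x : Finset ℕ) :
    hd {e} x = if e ∈ x then x.card - 1 else x.card + 1 := by
  have h := hd_add {e} x
  by_cases he : e ∈ x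
  · rw [Finset.singleton_inter_of_mem he, Finset.card_singleton] at h
    rw [if_pos he]; omega
  · rw [Finset.singleton_inter_of_notMem he, Finset.card_singleton, Finset.card_empty] at h
    rw [if_neg he]; omega

theorem hd_eq_zero {x y : Finset ℕ} : hd x y = 0 ↔ x = y := by
  rw [hd, Finset.card_eq_zero]
  exact symmDiff_eq_bot

theorem exists_erase_of_hd {x y : Finset ℕ} (h : hd x y = 1) :
    (∃ e ∈ x, x.erase e = y) ∨ ∃ e ∈ y, y.erase e = x := by
  obtain ⟨e, he⟩ := Finset.card_eq_one.1 h
  have h1 : ∀ a, (a ∈ x ∧ a ∉ y ∨ a ∈ y ∧ a ∉ x) ↔ a = e := fun a => by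
    rw [← Finset.mem_symmDiff, he, Finset.mem_singleton]
  rcases (h1 e).2 rfl with h2 | h2
  · refine Or.inl ⟨e, h2.1, ?_⟩
    ext a
    have := h1 a
    rw [Finset.mem_erase]
    by_cases ha : a = e
    · subst ha; tauto
    · tauto
  · refine Or.inr ⟨e, h2.1, ?_⟩
    ext a
    have := h1 a
    rw [Finset.mem_erase]
    by_cases ha : a = e
    · subst ha; tauto
    · tauto

/-- There are at most `2 ∑ |x|` ordered pairs at distance one. -/
theorem sum_hd_one_le (T : Finset (Finset ℕ)) :
    ∑ x ∈ T, ∑ y ∈ T, (if hd x y = 1 then 1 else 0) ≤ 2 * ∑ x ∈ T, x.card := by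
  have h1 : ∀ x ∈ T, ∑ y ∈ T, (if ∃ e ∈ x, x.erase e = y then 1 else 0) ≤ x.card := fun x _ => by
    rw [Finset.sum_boole, Nat.cast_id]
    refine (Finset.card_le_card fun y hy => ?_).trans (Finset.card_image_le (f := x.erase))
    exact Finset.mem_image.2 (Finset.mem_filter.1 hy).2
  calc ∑ x ∈ T, ∑ y ∈ T, (if hd x y = 1 then 1 else 0)
      ≤ ∑ x ∈ T, ∑ y ∈ T, ((if ∃ e ∈ x, x.erase e = y then 1 else 0) +
          (if ∃ e ∈ y, y.erase e = x then 1 else 0)) := by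
        refine Finset.sum_le_sum fun x _ => Finset.sum_le_sum fun y _ => ?_
        by_cases h : hd x y = 1
        · rcases exists_erase_of_hd h with h' | h' <;> simp [h, h']
        · simp [h]
    _ = ∑ x ∈ T, ∑ y ∈ T, (if ∃ e ∈ x, x.erase e = y then 1 else 0) +
          ∑ x ∈ T, ∑ y ∈ T, (if ∃ e ∈ y, y.erase e = x then 1 else 0) := by
        simp only [Finset.sum_add_distrib]
    _ = 2 * ∑ x ∈ T, ∑ y ∈ T, (if ∃ e ∈ x, x.erase e = y then 1 else 0) := by
        rw [two_mul]
        exact congrArg _ Finset.sum_comm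
    _ ≤ _ := Nat.mul_le_mul_left 2 (Finset.sum_le_sum h1)

/-! ### The value of a family -/

namespace IsFamily

variable {t m N : ℕ} {T : Finset (Finset ℕ)} {w : List ℕ}

theorem initialValue_eq (m : ℕ) (w : List ℕ) : initialValue m w =
    (m + 1) * w.getD 0 0 + 2 * m * w.getD 1 0 + m * (m - 1) * w.getD 2 0 := by
  unfold initialValue
  simp only [nth_eq]
  rfl

theorem farWeight_small (hN : 2 ≤ N) {d : ℕ} (hd : d ≤ 2) : farWeight w N d = w.getD 2 0 := by
  rw [farWeight, max_eq_right hd, min_eq_left hN]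

/-- The weights of the pairs that involve a set with at most one element. -/
theorem sum_far_small (hT : IsFamily t m T) (ht : t ≤ 6) {x : Finset ℕ} (hx : x ∈ T) (h : ℕ → ℕ) :
    ∑ y ∈ T, h (hd y x) = h x.card + (x.card * h (x.card - 1) + (m - x.card) * h (x.card + 1)) +
      ∑ i ∈ large t m T, h (hd (elem (universeOf t m) i) x) := by
  rw [hT.sum_eq ht, hd_empty_left, ← add_assoc]
  congr 2
  have h1 : ∀ e ∈ Finset.range m, h (hd {e} x) =
      if e ∈ x then h (x.card - 1) else h (x.card + 1) := fun e _ => by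
    rw [hd_singleton_left]; split <;> rfl
  rw [Finset.sum_congr rfl h1, Finset.sum_ite, Finset.sum_const, Finset.sum_const, smul_eq_mul,
    smul_eq_mul]
  have h2 : (Finset.range m).filter (· ∈ x) = x := by
    ext e
    simp only [Finset.mem_filter, Finset.mem_range]
    exact ⟨fun h => h.2, fun h => ⟨hT.lt x hx e h, h⟩⟩
  have h3 : (Finset.range m).filter (· ∉ x) = Finset.range m \ x := Finset.sdiff_eq_filter _ _ |>.symm
  rw [h2, h3, Finset.card_sdiff_of_subset fun e he => Finset.mem_range.2 (hT.lt x hx e he),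
    Finset.card_range]

/-- The search bounds the functionals. The inequality is due to the pairs at distance one: as the
weights decrease, their number may be replaced by the upper bound `2 ∑ |x|`, which is additive over
the members. -/
theorem sum_weights_le (hT : IsFamily t m T) (ht : t ≤ 6) (hm : 0 < m) (hN : 2 ≤ N)
    (hw : ∀ i j, i ≤ j → w.getD j 0 ≤ w.getD i 0) :
    ∑ x ∈ T, ∑ y ∈ T, w.getD (min (hd x y) N) 0 ≤ total (w.getD 0 0)
      (fun i j => farWeight w N (hd (elem (universeOf t m) i) (elem (universeOf t m) j)))
      (initialValue m w) (fun i => score m N w ((universeOf t m).getD i []).length) (large t m T) := by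
  set U := universeOf t m with hU
  set L := large t m T with hL
  obtain ⟨a, ha⟩ := Nat.exists_eq_add_of_le (hw 1 2 (by norm_num))
  obtain ⟨b, hb⟩ := Nat.exists_eq_add_of_le (hw 0 2 (by norm_num))
  set w2 := w.getD 2 0 with hw2
  set F := farWeight w N with hF
  have hcard := hT.card_large ht
  rw [← hL] at hcard
  -- the pairs at distances zero and one, separated from the others
  have h1 : ∀ x ∈ T, ∀ y ∈ T, w.getD (min (hd x y) N) 0 =
      F (hd x y) + (if x = y then b else 0) + a * (if hd x y = 1 then 1 else 0) := by
    intro x _ y _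
    rcases Nat.lt_or_ge (hd x y) 2 with h | h
    · rw [hF, farWeight_small hN h.le, ← hw2]
      rcases Nat.lt_succ_iff_lt_or_eq.1 h with h | h
      · have h0 : hd x y = 0 := by omega
        rw [if_pos (hd_eq_zero.1 h0), h0, if_neg (by norm_num), Nat.zero_min]
        omega
      · have hne : x ≠ y := fun h' => by rw [hd_eq_zero.2 h'] at h; omega
        rw [if_neg hne, h, if_pos rfl, min_eq_left (by omega)]
        omega
    · have hne : x ≠ y := fun h' => by rw [hd_eq_zero.2 h'] at h; omega
      rw [if_neg hne, if_neg (by omega), hF, farWeight, max_eq_left h]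
      simp
  have h2 : ∑ x ∈ T, ∑ y ∈ T, w.getD (min (hd x y) N) 0 = ∑ x ∈ T, ∑ y ∈ T, F (hd x y) +
      (m + 1 + L.card) * b + a * ∑ x ∈ T, ∑ y ∈ T, (if hd x y = 1 then 1 else 0) := by
    rw [Finset.sum_congr rfl fun x hx => Finset.sum_congr rfl (h1 x hx)]
    simp only [Finset.sum_add_distrib, ← Finset.mul_sum, Finset.sum_ite_eq]
    rw [Finset.sum_congr rfl fun x hx => if_pos hx, Finset.sum_const, hT.card, ← hcard, smul_eq_mul]
    ring
  have h3 : ∑ x ∈ T, x.card = m + ∑ i ∈ L, (elem U i).card := by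
    rw [hT.sum_eq ht]
    simp only [Finset.card_empty, Finset.card_singleton, Finset.sum_const, Finset.card_range,
      smul_eq_mul, mul_one, zero_add]
    rfl
  have h4 := sum_hd_one_le T
  -- the contribution of a single set
  have hsmall : ∀ x ∈ T, _ := fun x hx => hT.sum_far_small ht hx F
  have h5 : ∑ x ∈ T, ∑ y ∈ T, F (hd x y) = (m + 1) * (m + 1) * w2 +
      2 * ∑ i ∈ L, (F (elem U i).card + ((elem U i).card * F ((elem U i).card - 1) +
        (m - (elem U i).card) * F ((elem U i).card + 1))) +
      ∑ i ∈ L, ∑ j ∈ L, F (hd (elem U j) (elem U i)) := by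
    set G := fun i => F (elem U i).card + ((elem U i).card * F ((elem U i).card - 1) +
        (m - (elem U i).card) * F ((elem U i).card + 1)) with hG
    have hLT : ∀ i ∈ L, elem U i ∈ T := fun i hi => (mem_large.1 hi).2
    have e1 : ∑ x ∈ T, ∑ y ∈ T, F (hd x y) = ∑ x ∈ T, ∑ y ∈ T, F (hd y x) := Finset.sum_comm
    have e2 : F 0 = w2 := farWeight_small hN (by norm_num)
    have e3 : F 1 = w2 := farWeight_small hN (by norm_num)
    have e4 : F 2 = w2 := farWeight_small hN le_rfl
    have e5 : ∑ y ∈ T, F (hd y ∅) = (m + 1) * w2 + ∑ i ∈ L, F (elem U i).card := by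
      rw [hsmall ∅ hT.empty_mem]
      simp only [Finset.card_empty, zero_mul, zero_add, Nat.sub_zero, e2, e3, hd_comm _ ∅,
        hd_empty_left]
      ring
    have e6 : ∀ e ∈ Finset.range m, ∑ y ∈ T, F (hd y {e}) =
        (m + 1) * w2 + ∑ i ∈ L, F (hd {e} (elem U i)) := fun e he => by
      rw [hsmall {e} (hT.single e (Finset.mem_range.1 he))]
      simp only [Finset.card_singleton, one_mul, Nat.sub_self, e2, e3, e4, hd_comm _ {e},
        Nat.reduceAdd]
      obtain ⟨k, rfl⟩ := Nat.exists_eq_add_of_le' hm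
      rw [Nat.add_sub_cancel]
      ring
    have e7 : ∑ i ∈ L, ∑ y ∈ T, F (hd y (elem U i)) = ∑ i ∈ L, G i +
        ∑ i ∈ L, ∑ j ∈ L, F (hd (elem U j) (elem U i)) := by
      rw [← Finset.sum_add_distrib]
      exact Finset.sum_congr rfl fun i hi => hsmall _ (hLT i hi)
    have e8 : ∑ i ∈ L, G i = ∑ i ∈ L, F (elem U i).card +
        ∑ e ∈ Finset.range m, ∑ i ∈ L, F (hd {e} (elem U i)) := by
      rw [Finset.sum_comm (s := Finset.range m), ← Finset.sum_add_distrib]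
      refine Finset.sum_congr rfl fun i hi => ?_
      have a1 := hsmall _ (hLT i hi)
      have a2 := hT.sum_eq ht fun y => F (hd y (elem U i))
      rw [a2, hd_empty_left] at a1
      rw [hG]
      dsimp only
      omega
    rw [e1, hT.sum_eq ht, e5, Finset.sum_congr rfl e6, e7, Finset.sum_add_distrib, Finset.sum_const,
      Finset.card_range, smul_eq_mul, two_mul, e8]
    ring
  have h6 : ∑ i ∈ L, ∑ j ∈ L, F (hd (elem U j) (elem U i)) = L.card * w2 +
      ∑ i ∈ L, ∑ j ∈ L.erase i, F (hd (elem U i) (elem U j)) := by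
    rw [Finset.card_eq_sum_ones, Finset.sum_mul, ← Finset.sum_add_distrib]
    refine Finset.sum_congr rfl fun i hi => ?_
    rw [← Finset.add_sum_erase _ _ hi, hd_self, one_mul, hF, farWeight_small hN (by norm_num), ← hw2]
    simp only [hd_comm _ (elem U i)]
  have h7 : ∀ i ∈ L, score m N w (U.getD i []).length = (elem U i).card * a +
      (F (elem U i).card + ((elem U i).card * F ((elem U i).card - 1) +
        (m - (elem U i).card) * F ((elem U i).card + 1))) := fun i hi => by
    have hc := (elem_spec (mem_large.1 hi).1).2.2
    rw [← hU] at hc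
    rw [← hc, score, ← hF, ha, ← hw2, Nat.add_sub_cancel_left, add_assoc]
  rw [h2, h5, h6]
  have h9 := Finset.sum_congr rfl h7
  unfold total
  rw [h3] at h4
  have h8 := Nat.mul_le_mul_left a h4
  rw [initialValue_eq, ha, hb, ← hw2]
  have hmm : m * (m - 1) * w2 + m * w2 = m * m * w2 := by
    obtain ⟨k, rfl⟩ := Nat.exists_eq_add_of_le' hm
    rw [Nat.add_sub_cancel]; ring
  rw [Finset.sum_add_distrib, ← Finset.sum_mul] at h9
  simp only [Finset.sum_add_distrib, ← Finset.mul_sum, Finset.sum_const, smul_eq_mul] at h8 h9 ⊢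
  linarith

end IsFamily

/-! ### Distance distribution functions and functionals -/

/-- The value at `y` of the polynomial with the given coefficients. -/
def evalList (l : List ℕ) (y : ℝ) : ℝ := ∑ k ∈ Finset.range l.length, (l.getD k 0 : ℝ) * y ^ k

theorem evalList_cons (x : ℕ) (l : List ℕ) (y : ℝ) : evalList (x :: l) y = x + y * evalList l y := by
  unfold evalList
  rw [List.length_cons, Finset.sum_range_succ', Finset.mul_sum, add_comm]
  congr 1
  · simp
  · refine Finset.sum_congr rfl fun k _ => ?_
    rw [List.getD_cons_succ, pow_succ]; ring

theorem evalList_eq {l : List ℕ} {n : ℕ} (h : l.length ≤ n) (y : ℝ) :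
    evalList l y = ∑ k ∈ Finset.range n, (l.getD k 0 : ℝ) * y ^ k := by
  refine Finset.sum_subset (Finset.range_mono h) fun k _ hk => ?_
  rw [List.getD_eq_default _ _ (by simpa using hk)]; simp

theorem mulLin_spec (a b : ℕ) (l : List ℕ) : (mulLin a b l).length = l.length + 1 ∧
    (∀ y : ℝ, evalList (mulLin a b l) y = (a + b * y) * evalList l y) ∧
    (mulLin a b l).getD 0 0 = a * l.getD 0 0 ∧
    (mulLin a b l).getD l.length 0 = b * l.getD (l.length - 1) 0 := by
  have h : ∀ (l : List ℕ) (c : ℕ), ∃ r : List ℕ, r = List.rec (fun c => [Nat.mul b c])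
      (fun x _ ih c => Nat.add (Nat.mul a x) (Nat.mul b c) :: ih x) l c ∧ r.length = l.length + 1 ∧
      (∀ y : ℝ, evalList r y = b * c + (a + b * y) * evalList l y) ∧
      r.getD 0 0 = a * l.getD 0 0 + b * c ∧ r.getD l.length 0 = b * (c :: l).getD l.length 0 := by
    intro l
    induction l with
    | nil =>
      intro c
      refine ⟨_, rfl, rfl, fun y => ?_, ?_, ?_⟩
      · simp [evalList]
      · simp
      · simp
    | cons x l ih =>
      intro c
      obtain ⟨r, hr, h1, h2, h3, h4⟩ := ih x
      refine ⟨(a * x + b * c) :: r, by rw [hr]; rfl, by simp [h1], fun y => ?_, by simp, ?_⟩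
      · rw [evalList_cons, evalList_cons, h2]; push_cast; ring
      · rw [List.length_cons, List.getD_cons_succ, h4, List.getD_cons_succ]
  obtain ⟨r, hr, h1, h2, h3, h4⟩ := h l 0
  have : mulLin a b l = r := hr.symm
  rw [this]
  refine ⟨h1, fun y => by rw [h2]; simp, by rw [h3]; simp, ?_⟩
  rw [h4]
  cases l <;> simp

theorem powLin_spec (a b : ℕ) (l : List ℕ) (hl : l ≠ []) (k : ℕ) :
    (powLin a b l k).length = l.length + k ∧
    (∀ y : ℝ, evalList (powLin a b l k) y = (a + b * y) ^ k * evalList l y) ∧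
    (powLin a b l k).getD 0 0 = a ^ k * l.getD 0 0 ∧
    (powLin a b l k).getD (l.length - 1 + k) 0 = b ^ k * l.getD (l.length - 1) 0 := by
  have hl' := List.length_pos_iff.2 hl
  induction k with
  | zero =>
    refine ⟨rfl, fun y => ?_, ?_, ?_⟩
    · rw [pow_zero, one_mul]; rfl
    · rw [pow_zero, one_mul]; rfl
    · rw [pow_zero, one_mul]; rfl
  | succ k ih =>
    obtain ⟨h1, h2, h3, h4⟩ := ih
    have : powLin a b l (k + 1) = mulLin a b (powLin a b l k) := rfl
    obtain ⟨g1, g2, g3, g4⟩ := mulLin_spec a b (powLin a b l k)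
    rw [this]
    refine ⟨by rw [g1, h1]; ring, fun y => by rw [g2, h2, pow_succ]; ring, by rw [g3, h3]; ring, ?_⟩
    rw [h1] at g4
    rw [show l.length - 1 + (k + 1) = l.length + k by omega, g4,
      show l.length + k - 1 = l.length - 1 + k by omega, h4]
    ring

/-- The numbers `omega` are the coefficients of `(a + b y) ^ d (q + q y) ^ (N - d)`. The outermost
ones are powers, so that the functionals with index `0` and `N` are the values at the ends of the
interval. -/
theorem omega_spec (a b q : ℕ) {N d : ℕ} (hd : d ≤ N) :
    (∀ y : ℝ, ∑ k ∈ Finset.range (N + 1), (omega a b q N k d : ℝ) * y ^ k =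
      (a + b * y) ^ d * (q + q * y) ^ (N - d)) ∧
    omega a b q N 0 d = a ^ d * q ^ (N - d) ∧ omega a b q N N d = b ^ d * q ^ (N - d) := by
  obtain ⟨h1, h2, h3, h4⟩ := powLin_spec q q [1] (by simp) (N - d)
  obtain ⟨g1, g2, g3, g4⟩ := powLin_spec a b (powLin q q [1] (N - d))
    (by rw [← List.length_pos_iff, h1]; simp) d
  rw [h1, List.length_singleton] at g1 g4
  have hom : ∀ k, omega a b q N k d = (powLin a b (powLin q q [1] (N - d)) d).getD k 0 := fun k =>
    nth_eq _ _
  refine ⟨fun y => ?_, ?_, ?_⟩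
  · rw [← mul_one ((q + q * y : ℝ) ^ (N - d)), ← show evalList [1] y = 1 by simp [evalList], ← h2, ← g2,
      evalList_eq (n := N + 1) (by rw [g1]; omega)]
    simp only [hom]
  · rw [hom, g3, h3]; simp
  · rw [List.length_singleton, Nat.sub_self, zero_add] at h4
    rw [Nat.add_sub_cancel_left, Nat.sub_add_cancel hd, h4] at g4
    rw [hom, g4]; simp

/-- The weights that the `k`-th functional attaches to the distances up to `N`. -/
def weights (a b q N k : ℕ) : List ℕ := (List.range (N + 1)).map (omega a b q N k)

theorem weights_getD {a b q N k d : ℕ} (hd : d ≤ N) :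
    (weights a b q N k).getD d 0 = omega a b q N k d := by
  rw [weights, List.getD_eq_getElem _ _ (by simpa using Nat.lt_succ_of_le hd)]
  simp

theorem dot_eq (g w : List ℕ) : dot g w = ∑ d ∈ Finset.range g.length, g.getD d 0 * w.getD d 0 := by
  induction g generalizing w with
  | nil => rfl
  | cons x g ih =>
    have : dot (x :: g) w = x * nth w 0 + dot g w.tail := rfl
    rw [this, ih, List.length_cons, Finset.sum_range_succ', nth_eq, add_comm]
    congr 1
    refine Finset.sum_congr rfl fun k _ => ?_
    cases w <;> simp

theorem dot_weights {g : List ℕ} {a b q N k : ℕ} (hg : g.length ≤ N + 1) :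
    dot g (weights a b q N k) =
      ∑ d ∈ Finset.range g.length, g.getD d 0 * omega a b q N k d := by
  rw [dot_eq]
  refine Finset.sum_congr rfl fun d hd => ?_
  rw [weights_getD (by have := Finset.mem_range.1 hd; omega)]

/-- `∑ θ ^ |x ∆ y|` over the pairs of members of a family. -/
def distSum (T : Finset (Finset ℕ)) (θ : ℝ) : ℝ := ∑ x ∈ T, ∑ y ∈ T, θ ^ hd x y

/-- The sum of the weights of the pairs of members of a family, for weights up to `N`. -/
def weightSum (T : Finset (Finset ℕ)) (w : List ℕ) (N : ℕ) : ℕ :=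
  ∑ x ∈ T, ∑ y ∈ T, w.getD (min (hd x y) N) 0

theorem weightSum_weights (T : Finset (Finset ℕ)) (a b q N k : ℕ) :
    weightSum T (weights a b q N k) N = ∑ x ∈ T, ∑ y ∈ T, omega a b q N k (min (hd x y) N) :=
  Finset.sum_congr rfl fun _ _ => Finset.sum_congr rfl fun _ _ => weights_getD (min_le_right _ _)

/-- Comparing the functionals suffices on an interval. With `θ = (a + b y) / (q + q y)`, both sides become polynomials in `y` whose coefficients are the
values of the functionals. -/
theorem distSum_lt_of_weightSum {T : Finset (Finset ℕ)} {g : List ℕ} {a b q N : ℕ}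
    (hg : g.length ≤ N + 1) (hq : 0 < q) (hab : a < b) (hbq : b ≤ q)
    (hle : ∀ k ≤ N, weightSum T (weights a b q N k) N ≤ dot g (weights a b q N k))
    (hlt : ∃ k ≤ N, (k = 0 ∨ a = 0) ∧
      weightSum T (weights a b q N k) N < dot g (weights a b q N k))
    {θ : ℝ} (hθ : 0 < θ) (ha : (a : ℝ) / q ≤ θ) (hb : θ < b / q) : distSum T θ < evalList g θ := by
  have hq' : (0 : ℝ) < q := by exact_mod_cast hq
  rw [div_le_iff₀ hq'] at ha
  rw [lt_div_iff₀ hq'] at hb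
  have hbq' : (b : ℝ) ≤ q := by exact_mod_cast hbq
  have hθ1 : θ ≤ 1 := by nlinarith
  have hden : 0 < (b : ℝ) - θ * q := by linarith
  set y : ℝ := (θ * q - a) / (b - θ * q) with hy
  have hy0 : 0 ≤ y := div_nonneg (by linarith) hden.le
  have hD : 0 < (q : ℝ) + q * y := by positivity
  have hθy : θ * (q + q * y) = a + b * y := by
    have : y * (b - θ * q) = θ * q - a := div_mul_cancel₀ _ hden.ne'
    linarith
  have hpow : ∀ d ≤ N, θ ^ d * (q + q * y) ^ N =
      ∑ k ∈ Finset.range (N + 1), (omega a b q N k d : ℝ) * y ^ k := fun d hd => by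
    rw [(omega_spec a b q hd).1, ← hθy, mul_pow, mul_assoc, ← pow_add, Nat.add_sub_cancel' hd]
  have h1 : distSum T θ * (q + q * y) ^ N ≤
      ∑ k ∈ Finset.range (N + 1), (weightSum T (weights a b q N k) N : ℝ) * y ^ k := by
    have e1 : ∑ k ∈ Finset.range (N + 1), (weightSum T (weights a b q N k) N : ℝ) * y ^ k =
        ∑ x ∈ T, ∑ z ∈ T, θ ^ min (hd x z) N * (q + q * y) ^ N := by
      simp only [weightSum_weights, Nat.cast_sum, Finset.sum_mul]
      rw [Finset.sum_comm]
      refine Finset.sum_congr rfl fun x _ => ?_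
      rw [Finset.sum_comm]
      refine Finset.sum_congr rfl fun z _ => ?_
      rw [hpow _ (min_le_right _ _)]
    rw [e1, distSum, Finset.sum_mul]
    simp only [Finset.sum_mul]
    refine Finset.sum_le_sum fun x _ => Finset.sum_le_sum fun z _ => ?_
    exact mul_le_mul_of_nonneg_right (pow_le_pow_of_le_one hθ.le hθ1 (min_le_left _ _)) (by positivity)
  have h2 : evalList g θ * (q + q * y) ^ N =
      ∑ k ∈ Finset.range (N + 1), (dot g (weights a b q N k) : ℝ) * y ^ k := by
    simp only [dot_weights hg, Nat.cast_sum, Nat.cast_mul, Finset.sum_mul]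
    rw [Finset.sum_comm, evalList, Finset.sum_mul]
    refine Finset.sum_congr rfl fun d hd => ?_
    rw [mul_assoc, hpow d (by have := Finset.mem_range.1 hd; omega), Finset.mul_sum]
    simp only [mul_assoc]
  have h3 : ∑ k ∈ Finset.range (N + 1), (weightSum T (weights a b q N k) N : ℝ) * y ^ k <
      ∑ k ∈ Finset.range (N + 1), (dot g (weights a b q N k) : ℝ) * y ^ k := by
    obtain ⟨k, hk, hk0, hk1⟩ := hlt
    refine Finset.sum_lt_sum (fun k hk => ?_) ⟨k, Finset.mem_range.2 (Nat.lt_succ_of_le hk), ?_⟩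
    · have : (weightSum T (weights a b q N k) N : ℝ) ≤ dot g (weights a b q N k) := by
        exact_mod_cast hle k (Nat.lt_succ_iff.1 (Finset.mem_range.1 hk))
      exact mul_le_mul_of_nonneg_right this (by positivity)
    · have h4 : (weightSum T (weights a b q N k) N : ℝ) < dot g (weights a b q N k) := by
        exact_mod_cast hk1
      refine mul_lt_mul_of_pos_right h4 ?_
      rcases hk0 with rfl | rfl
      · simp
      · have : 0 < y := div_pos (by push_cast; nlinarith) hden
        positivity
  have h4 : distSum T θ * (q + q * y) ^ N < evalList g θ * (q + q * y) ^ N := by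
    rw [h2]; exact h1.trans_lt h3
  exact lt_of_mul_lt_mul_right h4 (by positivity)

/-! ### Certificates -/

/-- One interval of a subdivision of `[0, 1)`: for `pa / q ≤ θ < pb / q` the row with index `row` is
compared with all other families. Distances above `N` count as `N`, so that there are functionals with
index `0` to `N`; the entries `(a, b)` of `levels` describe the levels used for those with index less
than `N` that do not hold automatically. -/
structure Interval where
  pa : ℕ
  pb : ℕ
  q : ℕ
  N : ℕ
  row : ℕ
  levels : List (ℕ × ℕ)

/-- The entries of a list with their numbers, starting from `k`. -/
def numbered : List (ℕ × ℕ) → ℕ → List (ℕ × ℕ × ℕ)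
  | [], _ => []
  | p :: l, k => (k, p) :: numbered l (k + 1)

/-- The first functional that does not hold automatically. -/
def Interval.first (v : Interval) : ℕ := if v.pa = 0 then 1 else 0

/-- The distance distribution of a row of the table. -/
def rowDist (i : ℕ) : List ℕ := (optTable[i]?.map OptRow.dist).getD []

/-- The binary exponents of a number below `2 ^ 64`, in decreasing order. -/
def bitsOf (g : ℕ) : List ℕ := (List.range 64).reverse.filter fun e => g.testBit e

/-- The generators, as lists of exponents, of the sets of all rows with given `t` and `n`. -/
def rowSets (t m : ℕ) : List (List (List ℕ)) :=
  ((optTable.filter fun r => decide (r.t = t ∧ r.n = m)).flatMap OptRow.sets).map (List.map bitsOf)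

/-- `q ^ N` times the value of the row at `p / q`. -/
def scaled (g : List ℕ) (p q N : ℕ) : ℕ :=
  ∑ d ∈ Finset.range g.length, g.getD d 0 * (p ^ d * q ^ (N - d))

/-- The conditions on the data of an interval under which its functionals show that a row is better.
The row has to be available for `2 ^ t` points in dimension `m`. -/
def Interval.Ok (t m : ℕ) (v : Interval) : Prop :=
  2 ≤ v.N ∧ v.N ≤ 100 ∧ v.pa < v.pb ∧ v.pb ≤ v.q ∧ (rowDist v.row).length ≤ v.N + 1 ∧
  (rowDist v.row).getD 0 0 = 2 ^ t ∧ (rowDist v.row).sum = 2 ^ t * 2 ^ t ∧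
  v.levels.length + v.first = v.N ∧ (∃ r ∈ optTable[v.row]?, r.t = t ∧ r.n ≤ m)

instance (t m : ℕ) (v : Interval) : Decidable (v.Ok t m) := by
  unfold Interval.Ok; infer_instance

/-- The interval `v` ends at `1`, or the next one starts where `v` ends, with a row that is not
better at this point. -/
def Interval.Linked (v : Interval) : List Interval → Prop
  | [] => v.pb = v.q
  | u :: _ => v.pb * u.q = u.pa * v.q ∧ 0 < u.pa ∧ u.N ≤ v.N ∧
      scaled (rowDist u.row) v.pb v.q v.N ≤ scaled (rowDist v.row) v.pb v.q v.N

instance (v : Interval) (l : List Interval) : Decidable (v.Linked l) := by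
  cases l <;> (unfold Interval.Linked; infer_instance)

/-- The intervals are correct and linked up to `1`. -/
def Chain (t m : ℕ) : List Interval → Prop
  | [] => True
  | v :: l => v.Ok t m ∧ v.Linked l ∧ Chain t m l

instance Chain.decidable (t m : ℕ) : ∀ l : List Interval, Decidable (Chain t m l)
  | [] => inferInstanceAs (Decidable True)
  | v :: l => by
    have := Chain.decidable t m l
    unfold Chain; infer_instance

/-- A proof, up to a finite search, that the rows of the table beat every other family of `2 ^ t` sets of
exponents below `m`: an interval decomposition of `[0, 1)`. The sets listed in the table for `t` and
`m` are excepted, and lanes have `W` bits. -/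
structure Certificate where
  t : ℕ
  m : ℕ
  W : ℕ
  sets : List (List (List ℕ))
  intervals : List Interval

/-- The conditions on a certificate apart from the search. -/
def Certificate.Ok (c : Certificate) : Prop :=
  c.t ≤ 6 ∧ 0 < c.m ∧ c.m ≤ 100 ∧ c.m + 1 ≤ 2 ^ c.t ∧ c.sets = rowSets c.t c.m ∧
  (∀ G ∈ c.sets, ∀ y ∈ G, Decr y) ∧ (∃ v ∈ c.intervals.head?, v.pa = 0) ∧ Chain c.t c.m c.intervals

instance (c : Certificate) : Decidable c.Ok := by
  unfold Certificate.Ok; infer_instance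

/-- The search for the functionals `fs` of an interval. -/
def Certificate.search (c : Certificate) (v : Interval) (fs : List (ℕ × ℕ × ℕ)) : Bool :=
  checkInterval c.t c.m c.W v.N v.pa v.pb v.q (universeOf c.t c.m) c.sets (rowDist v.row) fs

/-- The search for all intervals of a certificate. -/
def searchAll (c : Certificate) : Bool :=
  List.rec true (fun v _ ih => andB (c.search v (numbered v.levels v.first)) ih) c.intervals

/-- The search for all certificates in a list. -/
def searchList (l : List Certificate) : Bool :=
  List.rec true (fun c _ ih => andB (searchAll c) ih) l

theorem scaled_eq {g : List ℕ} {p q N : ℕ} (hq : 0 < q) (hg : g.length ≤ N + 1) :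
    (scaled g p q N : ℝ) = q ^ N * evalList g (p / q) := by
  have hq' : (q : ℝ) ≠ 0 := by positivity
  rw [scaled, evalList, Finset.mul_sum]
  push_cast
  refine Finset.sum_congr rfl fun d hd => ?_
  have hd : d ≤ N := by have := Finset.mem_range.1 hd; omega
  obtain ⟨k, rfl⟩ := Nat.exists_eq_add_of_le hd
  rw [Nat.add_sub_cancel_left, div_pow, pow_add]
  field_simp

theorem mem_numbered {l : List (ℕ × ℕ)} {s k : ℕ} (h1 : s ≤ k) (h2 : k < s + l.length) :
    ∃ p, (k, p) ∈ numbered l s := by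
  induction l generalizing s with
  | nil => simp at h2; omega
  | cons p l ih =>
    rcases h1.eq_or_lt with rfl | h1
    · exact ⟨p, by simp [numbered]⟩
    · obtain ⟨p', hp'⟩ := ih (s := s + 1) h1 (by rw [List.length_cons] at h2; omega)
      exact ⟨p', by simp [numbered, hp']⟩

theorem strictness_eq (pa k : ℕ) : strictness pa k = if k = (if pa = 0 then 1 else 0) then 1 else 0 := by
  unfold strictness
  by_cases h : pa = 0
  · subst h
    by_cases hk : k = 1
    · subst hk; rfl
    · have : Nat.beq k 1 = false := Bool.eq_false_iff.2 fun h => hk (Nat.eq_of_beq_eq_true h)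
      simp [this, hk]
  · have h' : Nat.beq pa 0 = false := Bool.eq_false_iff.2 fun h' => h (Nat.eq_of_beq_eq_true h')
    by_cases hk : k = 0
    · subst hk; simp [h', h]
    · have : Nat.beq k 0 = false := Bool.eq_false_iff.2 fun h => hk (Nat.eq_of_beq_eq_true h)
      simp [this, hk, h', h]

/-- The value of the functional with index `0`, or `N`, in terms of powers of the left, or right, end
of the interval. -/
theorem weightSum_pow {T : Finset (Finset ℕ)} {a b q N k p : ℕ} (hq : 0 < q)
    (h : ∀ d ≤ N, omega a b q N k d = p ^ d * q ^ (N - d)) :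
    (weightSum T (weights a b q N k) N : ℝ) =
      q ^ N * ∑ x ∈ T, ∑ y ∈ T, ((p : ℝ) / q) ^ min (hd x y) N := by
  have hq' : (q : ℝ) ≠ 0 := by positivity
  rw [weightSum_weights, Finset.mul_sum]
  simp only [Finset.mul_sum, Nat.cast_sum]
  refine Finset.sum_congr rfl fun x _ => Finset.sum_congr rfl fun y _ => ?_
  rw [h _ (min_le_right _ _)]
  obtain ⟨k, hk⟩ := Nat.exists_eq_add_of_le (min_le_right (hd x y) N)
  have : (q : ℝ) ^ N = q ^ (min (hd x y) N) * q ^ k := by rw [← pow_add, ← hk]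
  rw [show N - min (hd x y) N = k by omega, this, div_pow]
  push_cast
  field_simp

theorem dot_weights_pow {g : List ℕ} {a b q N k p : ℕ} (hq : 0 < q) (hg : g.length ≤ N + 1)
    (h : ∀ d ≤ N, omega a b q N k d = p ^ d * q ^ (N - d)) :
    (dot g (weights a b q N k) : ℝ) = q ^ N * evalList g (p / q) := by
  rw [← scaled_eq hq hg, dot_weights hg, scaled]
  congr 1
  refine Finset.sum_congr rfl fun d hd => ?_
  rw [h d (by have := Finset.mem_range.1 hd; omega)]

theorem evalList_zero (g : List ℕ) : evalList g 0 = g.getD 0 0 := by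
  cases g with
  | nil => simp [evalList]
  | cons x g => rw [evalList_cons]; simp

theorem evalList_one (g : List ℕ) : evalList g 1 = g.sum := by
  induction g with
  | nil => simp [evalList]
  | cons x g ih => rw [evalList_cons, ih]; simp

/-- The functionals of the interval `v` do not exceed their values for the row. -/
def Interval.Holds (v : Interval) (T : Finset (Finset ℕ)) : Prop :=
  ∀ f ∈ numbered v.levels v.first,
    weightSum T (weights v.pa v.pb v.q v.N f.1) v.N + strictness v.pa f.1 ≤
      dot (rowDist v.row) (weights v.pa v.pb v.q v.N f.1)

namespace Interval

variable {t m : ℕ} {T : Finset (Finset ℕ)} {v : Interval}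

theorem Holds.le (h : v.Holds T) (hv : v.Ok t m) {k : ℕ} (h1 : v.first ≤ k) (h2 : k < v.N) :
    weightSum T (weights v.pa v.pb v.q v.N k) v.N + strictness v.pa k ≤
      dot (rowDist v.row) (weights v.pa v.pb v.q v.N k) := by
  obtain ⟨p, hp⟩ := mem_numbered (l := v.levels) (s := v.first) (k := k) h1
    (by obtain ⟨-, -, -, -, -, -, -, h3, -⟩ := hv; omega)
  have h4 := h _ hp
  dsimp only at h4
  exact h4

/-- The row is better at the left end of the interval, by the functional with index `0`. -/
theorem Holds.start_lt (h : v.Holds T) (hv : v.Ok t m) (hpa : 0 < v.pa) :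
    ∑ x ∈ T, ∑ y ∈ T, ((v.pa : ℝ) / v.q) ^ min (hd x y) v.N <
      evalList (rowDist v.row) (v.pa / v.q) := by
  have hq : 0 < v.q := by have := hv.2.2.1; have := hv.2.2.2.1; omega
  have h1 := h.le hv (k := 0) (by rw [first, if_neg hpa.ne']) (by have := hv.1; omega)
  rw [strictness_eq, if_neg hpa.ne', if_pos rfl] at h1
  have h2 : (weightSum T (weights v.pa v.pb v.q v.N 0) v.N : ℝ) <
      dot (rowDist v.row) (weights v.pa v.pb v.q v.N 0) := by exact_mod_cast h1
  rw [weightSum_pow hq fun d hd => (omega_spec _ _ _ hd).2.1,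
    dot_weights_pow hq hv.2.2.2.2.1 fun d hd => (omega_spec _ _ _ hd).2.1] at h2
  exact lt_of_mul_lt_mul_left h2 (by positivity)

/-- The row is better on the interval, provided that it is not worse at the right end; this is the
condition on the functional with index `N`, which is not searched. -/
theorem Holds.lt (h : v.Holds T) (hT : T.card = 2 ^ t) (hv : v.Ok t m)
    (hN : ∑ x ∈ T, ∑ y ∈ T, ((v.pb : ℝ) / v.q) ^ min (hd x y) v.N ≤
      evalList (rowDist v.row) (v.pb / v.q)) {θ : ℝ} (hθ : 0 < θ) (ha : (v.pa : ℝ) / v.q ≤ θ)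
    (hb : θ < v.pb / v.q) : distSum T θ < evalList (rowDist v.row) θ := by
  have hOk := hv
  obtain ⟨hN2, -, hab, hbq, hg, hg0, -, -, -⟩ := hv
  have hq : 0 < v.q := by omega
  refine distSum_lt_of_weightSum hg hq hab hbq (fun k hk => ?_) ?_ hθ ha hb
  · rcases hk.eq_or_lt with rfl | hk
    · have h2 : (weightSum T (weights v.pa v.pb v.q v.N v.N) v.N : ℝ) ≤
          dot (rowDist v.row) (weights v.pa v.pb v.q v.N v.N) := by
        rw [weightSum_pow hq fun d hd => (omega_spec _ _ _ hd).2.2,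
          dot_weights_pow hq hg fun d hd => (omega_spec _ _ _ hd).2.2]
        exact mul_le_mul_of_nonneg_left hN (by positivity)
      exact_mod_cast h2
    · rcases Nat.lt_or_ge k v.first with hk1 | hk1
      · -- the functional with index zero on an interval that starts at zero counts the members
        have hpa : v.pa = 0 := by
          by_contra hpa
          rw [first, if_neg hpa] at hk1; omega
        have hk0 : k = 0 := by rw [first, if_pos hpa] at hk1; omega
        subst hk0
        have h2 : (weightSum T (weights v.pa v.pb v.q v.N 0) v.N : ℝ) =
            dot (rowDist v.row) (weights v.pa v.pb v.q v.N 0) := by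
          rw [weightSum_pow hq fun d hd => (omega_spec _ _ _ hd).2.1,
            dot_weights_pow hq hg fun d hd => (omega_spec _ _ _ hd).2.1, hpa, Nat.cast_zero, zero_div,
            evalList_zero, hg0, ← hT]
          congr 1
          have h3 : ∀ x ∈ T, ∑ y ∈ T, (0 : ℝ) ^ min (hd x y) v.N = 1 := fun x hx => by
            rw [Finset.sum_eq_single x]
            · rw [hd_self]; simp
            · intro y _ hy
              refine zero_pow ?_
              have : hd x y ≠ 0 := fun h' => hy (hd_eq_zero.1 h').symm
              omega
            · exact fun h' => absurd hx h'
          rw [Finset.sum_congr rfl h3]; simp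
        exact_mod_cast h2.le
      · exact (Nat.le_add_right _ _).trans (h.le hOk hk1 hk)
  · refine ⟨v.first, ?_, ?_, ?_⟩
    · unfold first; split <;> omega
    · unfold first; split <;> simp [*]
    · have h1 := h.le hOk (k := v.first) le_rfl (by unfold first; split <;> omega)
      rw [strictness_eq, show (if v.pa = 0 then 1 else 0) = v.first from rfl, if_pos rfl] at h1
      omega

end Interval

/-- A chain of intervals covers `[v.pa / v.q, 1)`. The condition of each interval at its right end
follows from the next interval, at whose left end the row is better; at `1` both sides count all
pairs. -/
theorem Chain.exists_lt {t m : ℕ} {T : Finset (Finset ℕ)} (hT : T.card = 2 ^ t) {l : List Interval}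
    {v : Interval} (hc : Chain t m (v :: l)) (h : ∀ u ∈ v :: l, u.Holds T)
    {θ : ℝ} (hθ : 0 < θ) (hθ1 : θ < 1) (hv : (v.pa : ℝ) / v.q ≤ θ) :
    ∃ u ∈ v :: l, distSum T θ < evalList (rowDist u.row) θ := by
  induction l generalizing v with
  | nil =>
    obtain ⟨hOk, hl, -⟩ := hc
    have hq : 0 < v.q := by have := hOk.2.2.1; have := hOk.2.2.2.1; omega
    have h1 : (v.pb : ℝ) / v.q = 1 := by
      rw [show v.pb = v.q from hl]
      exact div_self (by positivity)
    refine ⟨v, by simp, (h v (by simp)).lt hT hOk ?_ hθ hv (by rwa [h1])⟩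
    rw [h1, evalList_one, hOk.2.2.2.2.2.2.1]
    simp [hT]
  | cons u l ih =>
    obtain ⟨hOk, ⟨hl1, hl2, hl3, hl4⟩, hc'⟩ := hc
    have hOk' := hc'.1
    have hq : 0 < v.q := by have := hOk.2.2.1; have := hOk.2.2.2.1; omega
    have hqu : 0 < u.q := by have := hOk'.2.2.1; have := hOk'.2.2.2.1; omega
    have hpt : (v.pb : ℝ) / v.q = u.pa / u.q := by
      rw [div_eq_div_iff (by positivity) (by positivity)]
      exact_mod_cast hl1
    rcases le_or_gt ((u.pa : ℝ) / u.q) θ with hu | hu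
    · obtain ⟨w, hw, hw'⟩ := ih hc' (fun w hw => h w (List.mem_cons_of_mem _ hw)) hu
      exact ⟨w, List.mem_cons_of_mem _ hw, hw'⟩
    · refine ⟨v, by simp, (h v (by simp)).lt hT hOk ?_ hθ hv (by rwa [hpt])⟩
      have h1 := (h u (by simp)).start_lt hOk' hl2
      have h2 : ∑ x ∈ T, ∑ y ∈ T, ((v.pb : ℝ) / v.q) ^ min (hd x y) v.N ≤
          ∑ x ∈ T, ∑ y ∈ T, ((u.pa : ℝ) / u.q) ^ min (hd x y) u.N := by
        refine Finset.sum_le_sum fun x _ => Finset.sum_le_sum fun y _ => ?_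
        rw [hpt]
        refine pow_le_pow_of_le_one (by positivity) ?_ (min_le_min_left _ hl3)
        rw [div_le_one (by positivity)]
        have : u.pa ≤ u.q := (hOk'.2.2.1.trans_le hOk'.2.2.2.1).le
        exact_mod_cast this
      have h3 : (scaled (rowDist u.row) v.pb v.q v.N : ℝ) ≤ scaled (rowDist v.row) v.pb v.q v.N := by
        exact_mod_cast hl4
      rw [scaled_eq hq (by have := hOk'.2.2.2.2.1; omega), scaled_eq hq hOk.2.2.2.2.1] at h3
      have h4 := le_of_mul_le_mul_left h3 (by positivity)
      rw [hpt] at h4 h2 ⊢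
      linarith

/-- A family that the certificate does not except is beaten, for every `θ`, by a row of the table. -/
theorem Certificate.sound {c : Certificate} (hc : c.Ok)
    (hs : ∀ v ∈ c.intervals, ∀ f ∈ numbered v.levels v.first, c.search v [f] = true)
    {T : Finset (Finset ℕ)} (hT : IsFamily c.t c.m T) :
    (∃ G ∈ rowSets c.t c.m, ∀ x ∈ T, 2 ≤ x.card → ∃ y ∈ G, Dom x y.toFinset) ∨
    ∀ θ : ℝ, 0 < θ → θ < 1 → ∃ (i : ℕ) (r : OptRow), optTable[i]? = some r ∧ r.t = c.t ∧ r.n ≤ c.m ∧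
      distSum T θ < evalList r.dist θ := by
  obtain ⟨ht, hm0, hm, hmt, hsets, hdecr, ⟨v0, hv0, hv0'⟩, hchain⟩ := hc
  by_cases hex : ∃ G ∈ rowSets c.t c.m, ∀ x ∈ T, 2 ≤ x.card → ∃ y ∈ G, Dom x y.toFinset
  · exact Or.inl hex
  refine Or.inr fun θ hθ hθ1 => ?_
  have hOk : ∀ {l : List Interval}, Chain c.t c.m l → ∀ v ∈ l, v.Ok c.t c.m := by
    intro l hl
    induction l with
    | nil => simp
    | cons u l ih =>
      intro v hv
      rcases List.mem_cons.1 hv with rfl | hv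
      · exact hl.1
      · exact ih hl.2.2 v hv
  have hholds : ∀ v ∈ c.intervals, v.Holds T := by
    intro v hv f hf
    have hvOk := hOk hchain v hv
    obtain ⟨k, a, b⟩ := f
    obtain ⟨hw, -, h3⟩ := checkInterval_sound (fun y hy => ⟨(decr_of_mem_universeOf hy).1,
      (decr_of_mem_universeOf hy).2.2⟩) hm hvOk.1 hvOk.2.1 hmt hdecr (hs v hv _ hf)
      (List.mem_singleton_self _) rfl
    have hSc := hT.card_large ht
    rcases h3 (S := IsFamily.large c.t c.m T) (fun i hi => (IsFamily.mem_large.1 hi).1) (by omega)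
      (fun i hi hi' j hj hdom => hi' (IsFamily.mem_large.2 ⟨hi,
        hT.down _ (IsFamily.mem_large.1 hj).2 _ hdom⟩)) with h4 | ⟨G, hG, h4⟩
    · exact (Nat.add_le_add_right (hT.sum_weights_le ht hm0 hvOk.1 hw) _).trans h4
    · refine absurd ⟨G, hsets ▸ hG, fun x hx hx2 => ?_⟩ hex
      obtain ⟨i, hi, rfl⟩ := hT.exists_elem ht hx hx2
      exact (h4 i hi).1 (IsFamily.mem_large.2 ⟨hi, hx⟩)
  obtain ⟨l, hl⟩ : ∃ l, c.intervals = v0 :: l := by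
    rcases hci : c.intervals with _ | ⟨w, l⟩
    · rw [hci] at hv0; simp at hv0
    · rw [hci] at hv0; simp at hv0; exact ⟨l, by rw [hv0]⟩
  rw [hl] at hchain hholds
  obtain ⟨u, hu, hlt⟩ := hchain.exists_lt hT.card hholds hθ hθ1 (by rw [hv0']; simpa using hθ.le)
  obtain ⟨r, hr, hr1, hr2⟩ := (hOk hchain u hu).2.2.2.2.2.2.2.2
  have hr : optTable[u.row]? = some r := hr
  refine ⟨u.row, r, hr, hr1, hr2, ?_⟩
  rw [rowDist, hr] at hlt
  exact hlt

/-! ### The certificates and their searches -/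

/-- The certificates for `t ≤ 5`. -/
def certificatesA : List Certificate := [
  ⟨1, 1, 11, [[[0]]], [⟨0, 1, 1, 2, 0, [(0, 0)]⟩]⟩,
  ⟨2, 2, 13, [[[1, 0]]], [⟨0, 1, 1, 2, 1, [(256, 0)]⟩]⟩,
  ⟨2, 3, 11, [], [⟨0, 1, 1, 2, 1, [(0, 0)]⟩]⟩,
  ⟨3, 3, 13, [[[2, 1, 0]]], [⟨0, 1, 1, 3, 2, [(256, 26), (427, 0)]⟩]⟩,
  ⟨3, 4, 13, [], [⟨0, 1, 1, 3, 2, [(171, 0), (427, 0)]⟩]⟩,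
  ⟨3, 5, 13, [], [⟨0, 1, 1, 3, 2, [(171, 0), (427, 0)]⟩]⟩,
  ⟨3, 6, 13, [], [⟨0, 1, 1, 3, 2, [(171, 0), (427, 0)]⟩]⟩,
  ⟨3, 7, 11, [], [⟨0, 1, 1, 3, 2, [(0, 0), (0, 0)]⟩]⟩,
  ⟨4, 4, 17, [[[3, 2, 1, 0]]], [⟨0, 1, 1, 4, 3, [(233, 12), (695, 38), (1783, 114)]⟩]⟩,
  ⟨4, 5, 15, [], [⟨0, 1, 1, 4, 3, [(128, 0), (606, 30), (1523, 83)]⟩]⟩,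
  ⟨4, 6, 15, [], [⟨0, 1, 1, 4, 3, [(128, 0), (299, 0), (1365, 64)]⟩]⟩,
  ⟨4, 7, 15, [], [⟨0, 1, 1, 4, 3, [(128, 0), (299, 0), (832, 0)]⟩]⟩,
  ⟨4, 8, 15, [], [⟨0, 1, 1, 4, 3, [(128, 0), (299, 0), (896, 0)]⟩]⟩,
  ⟨4, 9, 15, [], [⟨0, 1, 1, 4, 3, [(128, 0), (299, 0), (960, 0)]⟩]⟩,
  ⟨4, 10, 15, [], [⟨0, 1, 1, 4, 3, [(128, 0), (299, 0), (1024, 0)]⟩]⟩,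
  ⟨4, 11, 15, [], [⟨0, 1, 1, 4, 3, [(128, 0), (299, 0), (1088, 0)]⟩]⟩,
  ⟨4, 12, 25, [[[11], [3, 0]], [[11], [2, 1]]], [⟨0, 5, 6, 4, 3, [(107, 0), (243, 0), (779, 0)]⟩,
    ⟨5, 6, 6, 3, 4, [(2619, 178), (2434, 0), (2844, 0)]⟩]⟩,
  ⟨4, 13, 29, [[[12], [2, 0]]], [⟨0, 9, 14, 4, 3, [(82, 0), (182, 0), (487, 0)]⟩,
    ⟨9, 14, 14, 3, 5, [(1395, 106), (1699, 0), (2456, 0)]⟩]⟩,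
  ⟨4, 14, 19, [[[13], [1, 0]]], [⟨0, 1, 2, 4, 3, [(64, 0), (139, 0), (320, 0)]⟩,
    ⟨1, 2, 2, 3, 6, [(704, 0), (1216, 0), (2133, 0)]⟩]⟩,
  ⟨4, 15, 25, [[[14]]], [⟨0, 5, 13, 4, 3, [(0, 0), (0, 0), (0, 0)]⟩,
    ⟨5, 13, 13, 2, 7, [(0, 0), (0, 0)]⟩]⟩,
  ⟨5, 5, 17, [[[4, 3, 2, 1, 0]]], [⟨0, 1, 1, 5, 8, [(220, 5), (641, 17), (1533, 48), (3682, 126)]⟩]⟩,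
  ⟨5, 6, 17, [], [⟨0, 1, 1, 5, 8, [(260, 6), (547, 12), (1353, 36), (3152, 92)]⟩]⟩,
  ⟨5, 7, 17, [], [⟨0, 1, 1, 5, 8, [(105, 0), (539, 12), (1255, 31), (3070, 87)]⟩]⟩,
  ⟨5, 8, 17, [], [⟨0, 1, 1, 5, 8, [(105, 0), (552, 13), (1253, 32), (2967, 80)]⟩]⟩,
  ⟨5, 9, 17, [], [⟨0, 1, 1, 5, 8, [(105, 0), (547, 14), (1138, 26), (3107, 87)]⟩]⟩,
  ⟨5, 10, 17, [], [⟨0, 1, 1, 5, 8, [(102, 0), (633, 19), (1158, 26), (3199, 89)]⟩]⟩,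
  ⟨5, 11, 17, [], [⟨0, 1, 1, 5, 8, [(102, 0), (594, 18), (1195, 28), (3261, 92)]⟩]⟩,
  ⟨5, 12, 39, [[[11, 0], [9, 1]], [[11], [10, 1]]], [⟨0, 17, 18, 5, 8, [(97, 0), (525, 16), (1162, 30), (2945, 87)]⟩,
    ⟨17, 18, 18, 4, 9, [(6949, 216), (7233, 225), (7539, 235), (7860, 245)]⟩]⟩,
  ⟨5, 13, 39, [[[12, 0], [7, 1]]], [⟨0, 13, 16, 5, 8, [(83, 0), (183, 0), (954, 28), (2055, 57)]⟩,
    ⟨13, 16, 16, 4, 10, [(4589, 142), (5261, 160), (6094, 187), (7068, 219)]⟩]⟩,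
  ⟨5, 14, 39, [[[13, 0], [3, 1, 0]]], [⟨0, 9, 14, 5, 8, [(66, 0), (142, 0), (311, 0), (1287, 37)]⟩,
    ⟨9, 14, 14, 4, 11, [(2614, 86), (3304, 97), (4454, 132), (6026, 183)]⟩]⟩,
  ⟨5, 15, 23, [[[14, 0], [2, 1, 0]]], [⟨0, 1, 2, 5, 8, [(51, 0), (109, 0), (214, 0), (802, 24)]⟩,
    ⟨1, 2, 2, 4, 12, [(1631, 61), (2055, 57), (3226, 91), (5075, 148)]⟩]⟩,
  ⟨5, 16, 35, [[[15, 0]]], [⟨0, 5, 13, 5, 8, [(39, 0), (83, 0), (150, 0), (262, 0)]⟩,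
    ⟨5, 13, 13, 3, 13, [(1008, 38), (1931, 67), (4001, 137)]⟩]⟩,
  ⟨5, 17, 35, [], [⟨0, 5, 13, 5, 8, [(39, 0), (83, 0), (151, 0), (268, 0)]⟩,
    ⟨5, 13, 13, 3, 13, [(892, 31), (1901, 67), (4149, 151)]⟩]⟩,
  ⟨5, 18, 35, [], [⟨0, 5, 13, 5, 8, [(39, 0), (83, 0), (153, 0), (273, 0)]⟩,
    ⟨5, 13, 13, 3, 13, [(875, 31), (1872, 67), (3924, 137)]⟩]⟩,
  ⟨5, 19, 35, [[[18], [12, 0]]], [⟨0, 5, 13, 5, 8, [(39, 0), (83, 0), (154, 0), (279, 0)]⟩,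
    ⟨10, 13, 26, 3, 13, [(859, 31), (1041, 37), (1260, 45)]⟩,
    ⟨1, 2, 2, 3, 14, [(1632, 65), (2688, 95), (4693, 159)]⟩]⟩,
  ⟨5, 20, 35, [[[19], [11, 0]]], [⟨0, 5, 13, 5, 8, [(39, 0), (83, 0), (156, 0), (285, 0)]⟩,
    ⟨5, 13, 13, 3, 15, [(910, 38), (1812, 67), (3848, 137)]⟩]⟩,
  ⟨5, 21, 39, [[[20], [10, 0]]], [⟨0, 7, 19, 5, 8, [(38, 0), (79, 0), (148, 0), (269, 0)]⟩,
    ⟨7, 19, 19, 3, 16, [(809, 35), (1678, 64), (3694, 134)]⟩]⟩,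
  ⟨5, 22, 39, [[[21], [9, 0]]], [⟨0, 6, 17, 5, 8, [(36, 0), (75, 0), (141, 0), (254, 0)]⟩,
    ⟨6, 17, 17, 3, 17, [(718, 32), (1552, 60), (3543, 131)]⟩]⟩,
  ⟨5, 23, 25, [[[22], [8, 0]]], [⟨0, 1, 3, 5, 8, [(34, 0), (71, 0), (131, 0), (233, 0)]⟩,
    ⟨1, 3, 3, 3, 18, [(617, 28), (1406, 56), (3361, 127)]⟩]⟩,
  ⟨5, 24, 35, [[[23], [7, 0]]], [⟨0, 4, 13, 5, 8, [(32, 0), (65, 0), (118, 0), (206, 0)]⟩,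
    ⟨4, 13, 13, 4, 19, [(513, 24), (739, 0), (1567, 0), (3298, 0)]⟩]⟩,
  ⟨5, 25, 29, [[[24], [6, 0]]], [⟨0, 2, 7, 5, 8, [(29, 0), (61, 0), (108, 0), (184, 0)]⟩,
    ⟨2, 7, 7, 3, 20, [(436, 23), (1086, 45), (2927, 118)]⟩]⟩,
  ⟨5, 26, 35, [[[25], [5, 0]]], [⟨0, 4, 15, 5, 8, [(27, 0), (56, 0), (99, 0), (167, 0)]⟩,
    ⟨4, 15, 15, 4, 21, [(356, 17), (630, 0), (1453, 0), (3345, 0)]⟩]⟩,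
  ⟨5, 27, 39, [[[26], [4, 0]]], [⟨0, 6, 25, 5, 8, [(25, 0), (51, 0), (87, 0), (143, 0)]⟩,
    ⟨6, 25, 25, 4, 22, [(278, 12), (557, 0), (1356, 0), (3325, 0)]⟩]⟩,
  ⟨5, 28, 31, [[[27], [3, 0]], [[27], [2, 1]]], [⟨0, 2, 9, 5, 8, [(23, 0), (47, 0), (79, 0), (128, 0)]⟩,
    ⟨2, 9, 9, 3, 23, [(237, 13), (617, 0), (1982, 0)]⟩]⟩,
  ⟨5, 29, 35, [[[28], [2, 0]]], [⟨0, 4, 19, 5, 8, [(22, 0), (44, 0), (75, 0), (119, 0)]⟩,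
    ⟨4, 19, 19, 3, 24, [(206, 11), (589, 0), (1954, 0)]⟩]⟩,
  ⟨5, 30, 33, [[[29], [1, 0]]], [⟨0, 3, 16, 5, 8, [(19, 0), (39, 0), (65, 0), (101, 0)]⟩,
    ⟨3, 16, 16, 3, 25, [(152, 0), (522, 0), (1835, 0)]⟩]⟩,
  ⟨5, 31, 33, [[[30]]], [⟨0, 3, 17, 5, 8, [(0, 0), (0, 0), (0, 0), (0, 0)]⟩,
    ⟨3, 17, 17, 2, 26, [(0, 0), (0, 0)]⟩]⟩]

/-- The certificates for `t = 6` and `6 ≤ m ≤ 11`. -/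
def certificatesB : List Certificate := [
  ⟨6, 6, 19, [[[5, 4, 3, 2, 1, 0]]], [⟨0, 1, 1, 6, 27, [(202, 2), (599, 8), (1361, 20), (3196, 56), (7427, 129)]⟩]⟩,
  ⟨6, 7, 21, [], [⟨0, 1, 1, 6, 27, [(119, 0), (522, 6), (1252, 17), (2878, 45), (6726, 107)]⟩]⟩,
  ⟨6, 8, 21, [], [⟨0, 1, 1, 6, 27, [(116, 0), (507, 5), (1193, 16), (2946, 48), (6597, 104)]⟩]⟩,
  ⟨6, 9, 21, [], [⟨0, 1, 1, 6, 27, [(128, 0), (525, 6), (1158, 15), (2885, 47), (6628, 105)]⟩]⟩,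
  ⟨6, 10, 21, [], [⟨0, 1, 1, 6, 27, [(128, 0), (497, 5), (1082, 12), (2860, 47), (7207, 128)]⟩]⟩,
  ⟨6, 11, 21, [], [⟨0, 1, 1, 6, 27, [(128, 0), (504, 6), (1115, 14), (2698, 40), (7661, 154)]⟩]⟩]

/-- The certificate for `t = 6` and `m = 12`. -/
def certificatesC : List Certificate := [
  ⟨6, 12, 45, [[[11], [10, 5], [9, 8]]], [⟨0, 16, 17, 6, 27, [(120, 0), (482, 6), (1036, 14), (2707, 52), (6494, 133)]⟩,
    ⟨16, 17, 17, 5, 28, [(13380, 212), (13935, 220), (14512, 229), (15112, 238), (15736, 247)]⟩]⟩]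

/-- The certificate for `t = 6` and `m = 13`. -/
def certificatesD : List Certificate := [
  ⟨6, 13, 45, [[[12], [10, 4], [9, 8]]], [⟨0, 15, 17, 6, 27, [(113, 0), (401, 4), (825, 8), (2252, 40), (5478, 115)]⟩,
    ⟨15, 17, 17, 5, 29, [(10896, 177), (11825, 191), (12835, 205), (13927, 221), (15109, 238)]⟩]⟩]

/-- The certificate for `t = 6` and `m = 14`. -/
def certificatesE : List Certificate := [
  ⟨6, 14, 39, [[[13, 2], [13, 1, 0], [3, 2, 0]]], [⟨0, 7, 9, 6, 27, [(100, 0), (322, 3), (663, 6), (1639, 25), (3948, 83)]⟩,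
    ⟨7, 9, 9, 5, 30, [(7416, 125), (8704, 145), (10209, 168), (11963, 194), (14006, 223)]⟩]⟩]

/-- The certificates for `t = 6` and `15 ≤ m ≤ 16`. -/
def certificatesF : List Certificate := [
  ⟨6, 15, 41, [[[14, 1, 0], [10, 2]]], [⟨0, 7, 11, 6, 27, [(81, 0), (216, 1), (517, 6), (967, 11), (2469, 52)]⟩,
    ⟨7, 11, 11, 5, 31, [(4487, 95), (5926, 125), (7320, 125), (9597, 159), (12553, 202)]⟩]⟩,
  ⟨6, 16, 27, [[[15, 1, 0], [3, 2, 1, 0]]], [⟨0, 1, 2, 6, 27, [(64, 0), (137, 0), (349, 3), (645, 8), (1219, 18)]⟩,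
    ⟨1, 2, 2, 5, 32, [(2528, 56), (3709, 77), (5263, 100), (7651, 130), (11244, 184)]⟩]⟩]

/-- The certificates for `t = 6` and `17 ≤ m ≤ 20`. -/
def certificatesG : List Certificate := [
  ⟨6, 17, 43, [[[16, 1, 0]]], [⟨0, 5, 13, 6, 27, [(49, 0), (96, 0), (225, 2), (449, 6), (720, 10)]⟩,
    ⟨5, 13, 13, 4, 33, [(1245, 21), (2497, 47), (4874, 95), (8579, 139)]⟩]⟩,
  ⟨6, 18, 43, [], [⟨0, 5, 13, 6, 27, [(49, 0), (95, 0), (214, 2), (416, 5), (685, 9)]⟩,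
    ⟨5, 13, 13, 4, 33, [(1244, 21), (2641, 56), (4915, 98), (8631, 141)]⟩]⟩,
  ⟨6, 19, 47, [[[18, 1], [10, 1, 0]]], [⟨0, 5, 13, 6, 27, [(49, 0), (84, 0), (210, 1), (414, 5), (806, 14)]⟩,
    ⟨45, 65, 117, 4, 33, [(1247, 21), (1659, 32), (2092, 41), (2635, 53)]⟩,
    ⟨5, 9, 9, 4, 34, [(3309, 66), (5029, 100), (7607, 148), (10783, 173)]⟩]⟩,
  ⟨6, 20, 39, [[[19, 1], [7, 1, 0]]], [⟨0, 3, 8, 6, 27, [(48, 0), (118, 1), (194, 1), (403, 5), (695, 10)]⟩,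
    ⟨3, 8, 8, 4, 35, [(1234, 24), (2394, 45), (4865, 100), (8681, 144)]⟩]⟩]

/-- The certificates for `t = 6` and `21 ≤ m ≤ 25`. -/
def certificatesH : List Certificate := [
  ⟨6, 21, 45, [[[20, 1], [4, 1, 0]]], [⟨0, 6, 17, 6, 27, [(45, 0), (117, 1), (176, 1), (357, 4), (658, 10)]⟩,
    ⟨6, 17, 17, 4, 36, [(1086, 20), (2370, 53), (4416, 84), (8602, 156)]⟩]⟩,
  ⟨6, 22, 47, [[[21, 1]]], [⟨0, 6, 19, 6, 27, [(40, 0), (81, 0), (143, 1), (300, 3), (516, 7)]⟩,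
    ⟨6, 19, 19, 4, 37, [(888, 17), (1929, 37), (4086, 78), (7928, 124)]⟩]⟩,
  ⟨6, 23, 45, [[[22, 0], [19, 1]]], [⟨0, 5, 16, 6, 27, [(40, 0), (80, 0), (132, 0), (295, 3), (529, 8)]⟩,
    ⟨5, 16, 16, 4, 38, [(868, 17), (1904, 37), (4064, 81), (7947, 127)]⟩]⟩,
  ⟨6, 24, 43, [[[23, 0], [17, 1]]], [⟨0, 4, 13, 6, 27, [(39, 0), (79, 0), (167, 1), (292, 3), (485, 6)]⟩,
    ⟨4, 13, 13, 4, 39, [(844, 17), (1875, 38), (3792, 64), (7945, 129)]⟩]⟩,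
  ⟨6, 25, 41, [[[24, 0], [15, 1]]], [⟨0, 3, 10, 6, 27, [(38, 0), (77, 0), (156, 1), (293, 4), (454, 6)]⟩,
    ⟨3, 10, 10, 4, 40, [(832, 17), (1813, 37), (3903, 74), (8271, 151)]⟩]⟩]

/-- The certificates for `t = 6` and `26 ≤ m ≤ 31`. -/
def certificatesI : List Certificate := [
  ⟨6, 26, 39, [[[25, 0], [13, 1]]], [⟨0, 2, 7, 6, 27, [(37, 0), (73, 0), (163, 1), (252, 3), (415, 5)]⟩,
    ⟨2, 7, 7, 4, 41, [(784, 18), (1725, 35), (3845, 78), (7945, 132)]⟩]⟩,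
  ⟨6, 27, 45, [[[26, 0], [11, 1]]], [⟨0, 4, 15, 6, 27, [(34, 0), (68, 0), (103, 0), (216, 2), (365, 5)]⟩,
    ⟨4, 15, 15, 4, 42, [(661, 14), (1620, 36), (3562, 71), (8038, 155)]⟩]⟩,
  ⟨6, 28, 49, [[[27, 0], [5, 1, 0]], [[27, 0], [9, 1]]], [⟨0, 6, 25, 6, 27, [(31, 0), (61, 0), (92, 0), (142, 0), (319, 4)]⟩,
    ⟨18, 25, 75, 4, 43, [(561, 12), (715, 16), (775, 15), (952, 20)]⟩,
    ⟨1, 3, 3, 4, 44, [(1202, 28), (2248, 43), (4810, 100), (9104, 170)]⟩]⟩,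
  ⟨6, 29, 39, [[[28, 0], [4, 1, 0]], [[28, 0], [3, 2, 0]], [[28, 0], [7, 1]]], [⟨0, 2, 9, 6, 27, [(28, 0), (57, 0), (85, 0), (135, 1), (285, 4)]⟩,
    ⟨4, 9, 18, 4, 45, [(535, 12), (666, 11), (997, 15), (1491, 22)]⟩,
    ⟨1, 2, 2, 4, 46, [(3084, 67), (4567, 86), (7003, 121), (10597, 170)]⟩]⟩,
  ⟨6, 30, 47, [[[29, 0], [3, 1, 0]]], [⟨0, 4, 19, 6, 27, [(27, 0), (54, 0), (81, 0), (109, 0), (211, 2)]⟩,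
    ⟨4, 19, 19, 4, 47, [(511, 11), (943, 13), (2073, 22), (6078, 72)]⟩]⟩,
  ⟨6, 31, 45, [[[30, 0], [2, 1, 0]]], [⟨0, 3, 16, 6, 27, [(24, 0), (48, 0), (72, 0), (97, 0), (124, 0)]⟩,
    ⟨3, 16, 16, 4, 48, [(424, 9), (798, 11), (1836, 16), (4388, 21)]⟩]⟩]

/-- The certificates for `t = 6` and `32 ≤ m ≤ 63`. -/
def certificatesJ : List Certificate := [
  ⟨6, 32, 45, [[[31, 0]]], [⟨0, 3, 17, 6, 27, [(23, 0), (45, 0), (68, 0), (91, 0), (116, 0)]⟩,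
    ⟨3, 17, 17, 3, 49, [(383, 8), (998, 14), (4851, 97)]⟩]⟩,
  ⟨6, 33, 45, [], [⟨0, 3, 17, 6, 27, [(23, 0), (45, 0), (68, 0), (91, 0), (116, 0)]⟩,
    ⟨3, 17, 17, 3, 49, [(249, 3), (993, 14), (5351, 115)]⟩]⟩,
  ⟨6, 34, 45, [], [⟨0, 3, 17, 6, 27, [(23, 0), (45, 0), (68, 0), (91, 0), (116, 0)]⟩,
    ⟨3, 17, 17, 3, 49, [(255, 3), (969, 13), (4748, 97)]⟩]⟩,
  ⟨6, 35, 45, [[[34], [28, 0]]], [⟨0, 3, 17, 6, 27, [(23, 0), (45, 0), (68, 0), (91, 0), (116, 0)]⟩,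
    ⟨6, 17, 34, 3, 49, [(254, 3), (531, 7), (1179, 19)]⟩,
    ⟨1, 2, 2, 3, 50, [(3167, 64), (5235, 95), (9288, 159)]⟩]⟩,
  ⟨6, 36, 45, [[[35], [27, 0]]], [⟨0, 3, 17, 6, 27, [(23, 0), (45, 0), (68, 0), (91, 0), (116, 0)]⟩,
    ⟨9, 17, 51, 3, 49, [(252, 3), (386, 5), (604, 8)]⟩,
    ⟨1, 3, 3, 3, 51, [(1284, 28), (2554, 44), (6881, 127)]⟩]⟩,
  ⟨6, 37, 45, [[[36], [26, 0]]], [⟨0, 3, 17, 6, 27, [(23, 0), (45, 0), (68, 0), (91, 0), (116, 0)]⟩,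
    ⟨12, 17, 68, 3, 49, [(244, 3), (311, 4), (393, 5)]⟩,
    ⟨1, 4, 4, 3, 52, [(694, 16), (1590, 26), (5647, 111)]⟩]⟩,
  ⟨6, 38, 45, [[[37], [25, 0]]], [⟨0, 3, 17, 6, 27, [(23, 0), (45, 0), (68, 0), (91, 0), (117, 0)]⟩,
    ⟨15, 17, 85, 3, 49, [(242, 3), (264, 3), (287, 3)]⟩,
    ⟨1, 5, 5, 3, 53, [(435, 10), (1121, 16), (4881, 101)]⟩]⟩,
  ⟨6, 39, 45, [[[38], [24, 0]]], [⟨0, 3, 17, 6, 27, [(15, 0), (31, 0), (49, 0), (74, 0), (107, 0)]⟩,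
    ⟨3, 17, 17, 3, 54, [(338, 8), (1197, 26), (4491, 97)]⟩]⟩,
  ⟨6, 40, 35, [[[39], [23, 0]]], [⟨0, 1, 6, 6, 27, [(14, 0), (29, 0), (46, 0), (69, 0), (98, 0)]⟩,
    ⟨1, 6, 6, 3, 55, [(299, 7), (1119, 25), (4298, 95)]⟩]⟩,
  ⟨6, 41, 35, [[[40], [22, 0]]], [⟨0, 1, 6, 6, 27, [(14, 0), (29, 0), (46, 0), (69, 0), (99, 0)]⟩,
    ⟨1, 6, 6, 3, 56, [(293, 7), (1101, 25), (4246, 95)]⟩]⟩,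
  ⟨6, 42, 35, [[[41], [21, 0]]], [⟨0, 1, 6, 6, 27, [(14, 0), (29, 0), (46, 0), (69, 0), (100, 0)]⟩,
    ⟨1, 6, 6, 3, 57, [(288, 7), (1055, 24), (4194, 95)]⟩]⟩,
  ⟨6, 43, 35, [[[42], [20, 0]]], [⟨0, 1, 6, 6, 27, [(14, 0), (29, 0), (47, 0), (69, 0), (100, 0)]⟩,
    ⟨1, 6, 6, 3, 58, [(282, 7), (1060, 25), (4142, 95)]⟩]⟩,
  ⟨6, 44, 45, [[[43], [19, 0]]], [⟨0, 3, 19, 6, 27, [(13, 0), (27, 0), (44, 0), (65, 0), (93, 0)]⟩,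
    ⟨3, 19, 19, 3, 59, [(249, 6), (991, 25), (3961, 93)]⟩]⟩,
  ⟨6, 45, 41, [[[44], [18, 0]]], [⟨0, 2, 13, 6, 27, [(13, 0), (27, 0), (43, 0), (63, 0), (90, 0)]⟩,
    ⟨2, 13, 13, 3, 60, [(233, 6), (922, 23), (3848, 92)]⟩]⟩,
  ⟨6, 46, 41, [[[45], [17, 0]]], [⟨0, 2, 13, 6, 27, [(13, 0), (27, 0), (43, 0), (63, 0), (90, 0)]⟩,
    ⟨2, 13, 13, 3, 61, [(229, 6), (905, 23), (3795, 92)]⟩]⟩,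
  ⟨6, 47, 45, [[[46], [16, 0]]], [⟨0, 3, 20, 6, 27, [(13, 0), (26, 0), (41, 0), (61, 0), (87, 0)]⟩,
    ⟨3, 20, 20, 3, 62, [(214, 6), (883, 23), (3685, 91)]⟩]⟩,
  ⟨6, 48, 39, [[[47], [15, 0]]], [⟨0, 1, 7, 6, 27, [(12, 0), (25, 0), (39, 0), (58, 0), (82, 0)]⟩,
    ⟨1, 7, 7, 3, 63, [(193, 6), (761, 18), (3525, 90)]⟩]⟩,
  ⟨6, 49, 39, [[[48], [14, 0]]], [⟨0, 1, 7, 6, 27, [(12, 0), (25, 0), (39, 0), (58, 0), (82, 0)]⟩,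
    ⟨1, 7, 7, 4, 64, [(187, 5), (397, 0), (1343, 0), (4846, 0)]⟩]⟩,
  ⟨6, 50, 43, [[[49], [13, 0]]], [⟨0, 2, 15, 6, 27, [(11, 0), (23, 0), (36, 0), (53, 0), (74, 0)]⟩,
    ⟨2, 15, 15, 4, 65, [(161, 5), (370, 0), (1285, 0), (4847, 0)]⟩]⟩,
  ⟨6, 51, 43, [[[50], [12, 0]]], [⟨0, 2, 15, 6, 27, [(11, 0), (23, 0), (37, 0), (53, 0), (75, 0)]⟩,
    ⟨2, 15, 15, 4, 66, [(157, 5), (373, 0), (1304, 0), (4937, 0)]⟩]⟩,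
  ⟨6, 52, 39, [[[51], [11, 0]]], [⟨0, 1, 8, 6, 27, [(11, 0), (22, 0), (34, 0), (49, 0), (69, 0)]⟩,
    ⟨1, 8, 8, 4, 67, [(135, 4), (350, 0), (1253, 0), (4944, 0)]⟩]⟩,
  ⟨6, 53, 39, [[[52], [10, 0]]], [⟨0, 1, 8, 6, 27, [(11, 0), (22, 0), (34, 0), (49, 0), (69, 0)]⟩,
    ⟨1, 8, 8, 4, 68, [(133, 4), (353, 0), (1271, 0), (5032, 0)]⟩]⟩,
  ⟨6, 54, 43, [[[53], [9, 0]]], [⟨0, 2, 17, 6, 27, [(10, 0), (20, 0), (32, 0), (46, 0), (63, 0)]⟩,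
    ⟨2, 17, 17, 4, 69, [(117, 4), (334, 0), (1225, 0), (5045, 0)]⟩]⟩,
  ⟨6, 55, 39, [[[54], [8, 0]]], [⟨0, 1, 9, 6, 27, [(9, 0), (19, 0), (30, 0), (43, 0), (59, 0)]⟩,
    ⟨1, 9, 9, 4, 70, [(102, 3), (317, 0), (1184, 0), (5063, 0)]⟩]⟩,
  ⟨6, 56, 47, [[[55], [7, 0]]], [⟨0, 3, 26, 6, 27, [(10, 0), (20, 0), (31, 0), (45, 0), (62, 0)]⟩,
    ⟨3, 26, 26, 4, 71, [(106, 3), (332, 0), (1238, 0), (5194, 0)]⟩]⟩,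
  ⟨6, 57, 39, [[[56], [6, 0]]], [⟨0, 1, 9, 6, 27, [(9, 0), (19, 0), (30, 0), (43, 0), (59, 0)]⟩,
    ⟨1, 9, 9, 4, 72, [(97, 3), (322, 0), (1216, 0), (5234, 0)]⟩]⟩,
  ⟨6, 58, 41, [[[57], [3, 0], [2, 1, 0]], [[57], [5, 0]]], [⟨0, 1, 10, 6, 27, [(9, 0), (17, 0), (27, 0), (38, 0), (52, 0)]⟩,
    ⟨9, 10, 90, 4, 73, [(89, 5), (89, 4), (92, 4), (95, 4)]⟩,
    ⟨1, 9, 9, 3, 74, [(113, 8), (575, 38), (2494, 84)]⟩]⟩,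
  ⟨6, 59, 39, [[[58], [2, 1, 0]], [[58], [4, 0]]], [⟨0, 1, 10, 6, 27, [(9, 0), (17, 0), (27, 0), (38, 0), (52, 0)]⟩,
    ⟨4, 5, 40, 4, 75, [(89, 6), (75, 0), (81, 0), (89, 0)]⟩,
    ⟨1, 8, 8, 3, 76, [(135, 11), (645, 51), (2800, 132)]⟩]⟩,
  ⟨6, 60, 39, [[[59], [3, 0]], [[59], [2, 1]]], [⟨0, 1, 10, 6, 27, [(9, 0), (17, 0), (27, 0), (38, 0), (52, 0)]⟩,
    ⟨1, 10, 10, 3, 77, [(76, 3), (371, 0), (1946, 0)]⟩]⟩,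
  ⟨6, 61, 39, [[[60], [2, 0]]], [⟨0, 1, 11, 6, 27, [(8, 0), (16, 0), (24, 0), (34, 0), (46, 0)]⟩,
    ⟨1, 11, 11, 3, 78, [(64, 2), (343, 0), (1831, 0)]⟩]⟩,
  ⟨6, 62, 39, [[[61], [1, 0]]], [⟨0, 1, 11, 6, 27, [(8, 0), (16, 0), (24, 0), (34, 0), (46, 0)]⟩,
    ⟨1, 11, 11, 3, 79, [(60, 0), (345, 0), (1854, 0)]⟩]⟩,
  ⟨6, 63, 35, [[[62]]], [⟨0, 1, 11, 6, 27, [(0, 0), (0, 0), (0, 0), (0, 0), (0, 0)]⟩,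
    ⟨1, 11, 11, 2, 80, [(0, 0), (0, 0)]⟩]⟩]

/-- The certificates for all `t ≤ 6` and `t ≤ m < 2 ^ t`. -/
def certificates : List Certificate :=
  certificatesA ++ certificatesB ++ certificatesC ++ certificatesD ++ certificatesE ++
  certificatesF ++ certificatesG ++ certificatesH ++ certificatesI ++ certificatesJ

set_option maxRecDepth 100000 in
theorem search_certificatesA : searchList certificatesA = true := by
  decide +kernel

set_option maxRecDepth 100000 in
theorem search_certificatesB : searchList certificatesB = true := by
  decide +kernel

set_option maxRecDepth 100000 in
theorem search_certificatesC : searchList certificatesC = true := by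
  decide +kernel

set_option maxRecDepth 100000 in
theorem search_certificatesD : searchList certificatesD = true := by
  decide +kernel

set_option maxRecDepth 100000 in
theorem search_certificatesE : searchList certificatesE = true := by
  decide +kernel

set_option maxRecDepth 100000 in
theorem search_certificatesF : searchList certificatesF = true := by
  decide +kernel

set_option maxRecDepth 100000 in
theorem search_certificatesG : searchList certificatesG = true := by
  decide +kernel

set_option maxRecDepth 100000 in
theorem search_certificatesH : searchList certificatesH = true := by
  decide +kernel

set_option maxRecDepth 100000 in
theorem search_certificatesI : searchList certificatesI = true := by
  decide +kernel

set_option maxRecDepth 100000 in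
theorem search_certificatesJ : searchList certificatesJ = true := by
  decide +kernel

set_option maxRecDepth 100000 in
theorem certificates_ok : ∀ c ∈ certificates, c.Ok := by decide +kernel

set_option maxRecDepth 100000 in
theorem exists_certificate : ∀ t < 7, 1 ≤ t → ∀ m < 2 ^ t, t ≤ m →
    ∃ c ∈ certificates, c.t = t ∧ c.m = m := by decide +kernel

theorem searchList_sound {l : List Certificate} (h : searchList l = true) :
    ∀ c ∈ l, searchAll c = true := by
  induction l with
  | nil => simp
  | cons c l ih =>
    have : searchList (c :: l) = andB (searchAll c) (searchList l) := rfl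
    rw [this, andB_eq, Bool.and_eq_true] at h
    intro c' hc'
    rcases List.mem_cons.1 hc' with rfl | hc'
    · exact h.1
    · exact ih h.2 c' hc'

theorem searchAll_sound {c : Certificate} (h : searchAll c = true) :
    ∀ v ∈ c.intervals, ∀ f ∈ numbered v.levels v.first, c.search v [f] = true := by
  have h1 : ∀ l : List Interval, (List.rec true (fun v _ ih =>
      andB (c.search v (numbered v.levels v.first)) ih) l : Bool) = true →
      ∀ v ∈ l, c.search v (numbered v.levels v.first) = true := by
    intro l
    induction l with
    | nil => simp
    | cons u l ih =>
      intro h v hv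
      simp only [andB_eq, Bool.and_eq_true] at h
      rcases List.mem_cons.1 hv with rfl | hv
      · exact h.1
      · exact ih (by simpa only [andB_eq] using h.2) v hv
  intro v hv f hf
  have h2 := h1 _ h v hv
  unfold Certificate.search at h2 ⊢
  rw [checkInterval_eq, List.all_eq_true] at h2 ⊢
  intro f' hf'
  rw [List.mem_singleton.1 hf']
  exact h2 f hf

theorem searchAll_certificates : ∀ c ∈ certificates, searchAll c = true := by
  intro c hc
  simp only [certificates, List.mem_append, or_assoc] at hc
  rcases hc with h | h | h | h | h | h | h | h | h | h
  · exact searchList_sound search_certificatesA c h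
  · exact searchList_sound search_certificatesB c h
  · exact searchList_sound search_certificatesC c h
  · exact searchList_sound search_certificatesD c h
  · exact searchList_sound search_certificatesE c h
  · exact searchList_sound search_certificatesF c h
  · exact searchList_sound search_certificatesG c h
  · exact searchList_sound search_certificatesH c h
  · exact searchList_sound search_certificatesI c h
  · exact searchList_sound search_certificatesJ c h

/-- A family is excepted, or it is beaten, for every `θ`, by a row of the table. -/
theorem family_beaten {t m : ℕ} (ht : 1 ≤ t) (ht6 : t ≤ 6) (hm : m < 2 ^ t) (htm : t ≤ m)
    {T : Finset (Finset ℕ)} (hT : IsFamily t m T) :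
    (∃ G ∈ rowSets t m, ∀ x ∈ T, 2 ≤ x.card → ∃ y ∈ G, Dom x y.toFinset) ∨
    ∀ θ : ℝ, 0 < θ → θ < 1 → ∃ (i : ℕ) (r : OptRow), optTable[i]? = some r ∧ r.t = t ∧ r.n ≤ m ∧
      distSum T θ < evalList r.dist θ := by
  obtain ⟨c, hc, rfl, rfl⟩ := exists_certificate t (by omega) ht m hm htm
  exact Certificate.sound (certificates_ok c hc) (searchAll_sound (searchAll_certificates c hc)) hT

/-! ### Supports of the points of the cube -/

section

variable {x y z : Finset ℕ}

/-- It suffices to compare the final segments that begin at an element of `x`. -/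
theorem Dom.tailCard_le (h : Dom x y) (e : ℕ) : tailCard x e ≤ tailCard y e := by
  rcases (x.filter (e ≤ ·)).eq_empty_or_nonempty with h0 | h0
  · rw [tailCard, h0, Finset.card_empty]; exact Nat.zero_le _
  · obtain ⟨h1, h2⟩ := Finset.mem_filter.1 (Finset.min'_mem _ h0)
    set f := (x.filter (e ≤ ·)).min' h0 with hf
    have h3 : tailCard x e ≤ tailCard x f := Finset.card_le_card fun a ha =>
      Finset.mem_filter.2 ⟨(Finset.mem_filter.1 ha).1, Finset.min'_le _ _ ha⟩
    have h4 : tailCard y f ≤ tailCard y e := Finset.card_le_card fun a ha =>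
      Finset.mem_filter.2 ⟨(Finset.mem_filter.1 ha).1, h2.trans (Finset.mem_filter.1 ha).2⟩
    exact (h3.trans (h f h1)).trans h4

theorem Dom.refl (x : Finset ℕ) : Dom x x := fun _ _ => le_rfl

theorem Dom.trans (h : Dom x y) (h' : Dom y z) : Dom x z := fun e he => (h e he).trans (h'.tailCard_le e)

theorem Dom.of_subset (h : x ⊆ y) : Dom x y := fun _ _ => Finset.card_le_card (Finset.filter_subset_filter _ h)

theorem Dom.lt {m : ℕ} (h : Dom x y) (hy : ∀ e ∈ y, e < m) : ∀ e ∈ x, e < m := by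
  intro e he
  have h1 : 0 < tailCard x e := Finset.card_pos.2 ⟨e, Finset.mem_filter.2 ⟨he, le_rfl⟩⟩
  obtain ⟨f, hf⟩ := Finset.card_pos.1 (h1.trans_le (h e he))
  obtain ⟨h2, h3⟩ := Finset.mem_filter.1 hf
  exact lt_of_le_of_lt h3 (hy f h2)

/-- The tails of `y` with the element `a` replaced by a smaller number. -/
theorem tailCard_insert_erase {a b : ℕ} (ha : a ∈ y) (hb : b ∉ y) (j : ℕ) :
    tailCard (insert b (y.erase a)) j + (if j ≤ a then 1 else 0) =
      tailCard y j + if j ≤ b then 1 else 0 := by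
  have h1 : tailCard (y.erase a) j + (if j ≤ a then 1 else 0) = tailCard y j := by
    unfold tailCard
    rw [Finset.filter_erase]
    split_ifs with h
    · exact Finset.card_erase_add_one (Finset.mem_filter.2 ⟨ha, h⟩)
    · rw [Finset.erase_eq_of_notMem fun h' => h (Finset.mem_filter.1 h').2]; rfl
  have h2 : tailCard (insert b (y.erase a)) j = tailCard (y.erase a) j + if j ≤ b then 1 else 0 := by
    unfold tailCard
    rw [Finset.filter_insert]
    split_ifs with h
    · exact Finset.card_insert_of_notMem fun h' =>
        hb (Finset.mem_of_mem_erase (Finset.mem_filter.1 h').1)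
    · rfl
  omega

theorem Dom.insert_erase {a b : ℕ} (hab : b ≤ a) (ha : a ∈ y) (hb : b ∉ y) :
    Dom (insert b (y.erase a)) y := fun j _ => by
  have := tailCard_insert_erase ha hb j
  split_ifs at this <;> omega

/-- If `x ≠ y` lies below `y`, one step leads from `y` to a set above `x` that is closer to `x`. -/
theorem Dom.exists_step (h : Dom x y) (hne : x ≠ y) :
    (∃ e ∈ y, Dom x (y.erase e) ∧ hd x (y.erase e) < hd x y) ∨
    ∃ e ∈ y, ∃ f < e, f ∉ y ∧ f ∈ x ∧ Dom x (insert f (y.erase e)) ∧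
      hd x (insert f (y.erase e)) < hd x y := by
  have hlt : ∀ y' : Finset ℕ, ∀ e ∈ y, e ∉ x → symmDiff x y' ⊆ (symmDiff x y).erase e →
      hd x y' < hd x y := fun y' e he he' hs =>
    lt_of_le_of_lt (Finset.card_le_card hs)
      (Finset.card_erase_lt_of_mem (Finset.mem_symmDiff.2 (Or.inr ⟨he, he'⟩)))
  rcases (x \ y).eq_empty_or_nonempty with h0 | h0
  · have hsub := Finset.sdiff_eq_empty_iff_subset.1 h0
    obtain ⟨e, he, he'⟩ := Finset.exists_of_ssubset (hsub.ssubset_of_ne hne)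
    refine Or.inl ⟨e, he, Dom.of_subset (Finset.subset_erase.2 ⟨hsub, he'⟩), hlt _ e he he' ?_⟩
    intro a ha
    simp only [Finset.mem_symmDiff, Finset.mem_erase] at ha ⊢
    by_cases hae : a = e
    · subst hae; tauto
    · tauto
  · obtain ⟨hfx, hfy⟩ := Finset.mem_sdiff.1 (Finset.max'_mem _ h0)
    set f := (x \ y).max' h0 with hf
    have hfmax : ∀ a ∈ x, f < a → a ∈ y := fun a ha hfa => by
      by_contra hay
      exact absurd (Finset.le_max' _ a (Finset.mem_sdiff.2 ⟨ha, hay⟩)) (not_le.2 hfa)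
    have h1 : (symmDiff x y).Nonempty := ⟨f, Finset.mem_symmDiff.2 (Or.inl ⟨hfx, hfy⟩)⟩
    have h2 := Finset.max'_mem _ h1
    set e := (symmDiff x y).max' h1 with he
    have hemax : ∀ a, e < a → (a ∈ x ↔ a ∈ y) := fun a hea => by
      by_contra h'
      have : a ∈ symmDiff x y := Finset.mem_symmDiff.2 (by tauto)
      exact absurd (Finset.le_max' _ a this) (not_le.2 hea)
    have hfe : f ≤ e := Finset.le_max' _ _ (Finset.mem_symmDiff.2 (Or.inl ⟨hfx, hfy⟩))
    have hey : e ∈ y ∧ e ∉ x := by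
      rcases Finset.mem_symmDiff.1 h2 with h' | h'
      · exfalso
        -- otherwise the tail of `x` from `e` on would have one more element than that of `y`
        have hs : y.filter (e ≤ ·) ⊂ x.filter (e ≤ ·) := by
          refine (Finset.ssubset_iff_of_subset fun a ha => ?_).2
            ⟨e, Finset.mem_filter.2 ⟨h'.1, le_rfl⟩, fun ha => h'.2 (Finset.mem_filter.1 ha).1⟩
          obtain ⟨ha1, ha2⟩ := Finset.mem_filter.1 ha
          rcases ha2.eq_or_lt with rfl | ha2'
          · exact absurd ha1 h'.2
          · exact Finset.mem_filter.2 ⟨(hemax a ha2').2 ha1, ha2⟩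
        exact absurd (h e h'.1) (not_le.2 (Finset.card_lt_card hs))
      · exact h'
    have hfe' : f < e := lt_of_le_of_ne hfe fun h' => hfy (h' ▸ hey.1)
    refine Or.inr ⟨e, hey.1, f, hfe', hfy, hfx, fun j _ => ?_, hlt _ e hey.1 hey.2 ?_⟩
    · have h3 := tailCard_insert_erase hey.1 hfy j
      have h4 := h.tailCard_le j
      by_cases hjf : j ≤ f
      · rw [if_pos hjf, if_pos (hjf.trans hfe)] at h3; omega
      · by_cases hje : j ≤ e
        · rw [if_neg hjf, if_pos hje] at h3
          have hs : x.filter (j ≤ ·) ⊂ y.filter (j ≤ ·) := by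
            refine (Finset.ssubset_iff_of_subset fun a ha => ?_).2
              ⟨e, Finset.mem_filter.2 ⟨hey.1, hje⟩, fun ha => hey.2 (Finset.mem_filter.1 ha).1⟩
            obtain ⟨ha1, ha2⟩ := Finset.mem_filter.1 ha
            exact Finset.mem_filter.2 ⟨hfmax a ha1 (by omega), ha2⟩
          have : tailCard x j < tailCard y j := Finset.card_lt_card hs
          omega
        · rw [if_neg hjf, if_neg hje] at h3; omega
    · intro a ha
      simp only [Finset.mem_symmDiff, Finset.mem_erase, Finset.mem_insert] at ha ⊢
      by_cases hae : a = e
      · subst hae; have := hey.2; have := hfe'.ne'; tauto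
      · by_cases haf : a = f
        · subst haf; tauto
        · tauto

end

section

variable {n : ℕ}

/-- The exponents `e` for which the bit of weight `2 ^ e` of a point of the cube is set. -/
def supp (x : BitCube n) : Finset ℕ :=
  (Finset.univ.filter fun k : Fin n => x k ≠ 0).image fun k : Fin n => n - 1 - (k : ℕ)

theorem mem_supp {x : BitCube n} {e : ℕ} : e ∈ supp x ↔ ∃ k : Fin n, x k ≠ 0 ∧ n - 1 - k = e := by
  simp [supp]

theorem sub_mem_supp {x : BitCube n} {k : Fin n} : n - 1 - (k : ℕ) ∈ supp x ↔ x k ≠ 0 := by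
  rw [mem_supp]
  constructor
  · rintro ⟨l, hl, h⟩
    have : l = k := Fin.ext (by have := l.isLt; have := k.isLt; omega)
    exact this ▸ hl
  · exact fun h => ⟨k, h, rfl⟩

theorem supp_lt {x : BitCube n} {e : ℕ} (h : e ∈ supp x) : e < n := by
  obtain ⟨k, -, rfl⟩ := mem_supp.1 h
  have := k.isLt; omega

theorem supp_injective : Function.Injective (supp (n := n)) := by
  intro x y h
  funext k
  have h1 := sub_mem_supp (x := x) (k := k)
  have h2 := sub_mem_supp (x := y) (k := k)
  rw [h] at h1
  rcases bit_cases (x k) with h3 | h3 <;> rcases bit_cases (y k) with h4 | h4 <;> simp_all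

theorem exists_supp {s : Finset ℕ} (hs : ∀ e ∈ s, e < n) : ∃ x : BitCube n, supp x = s := by
  refine ⟨fun k => if n - 1 - (k : ℕ) ∈ s then 1 else 0, ?_⟩
  ext e
  rw [mem_supp]
  constructor
  · rintro ⟨k, hk, rfl⟩
    by_contra h; exact hk (if_neg h)
  · intro he
    have := hs e he
    refine ⟨⟨n - 1 - e, by omega⟩, ?_, by simp only; omega⟩
    have h1 : n - 1 - (n - 1 - e) = e := by omega
    simp only [h1, if_pos he]; decide

theorem hd_supp (x y : BitCube n) : hd (supp x) (supp y) = hammingDist x y := by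
  have : symmDiff (supp x) (supp y) =
      (Finset.univ.filter fun k : Fin n => x k ≠ y k).image fun k : Fin n => n - 1 - (k : ℕ) := by
    ext e
    rw [Finset.mem_image]
    constructor
    · intro h
      have hen : e < n := by
        rcases Finset.mem_symmDiff.1 h with h | h <;> exact supp_lt h.1
      refine ⟨⟨n - 1 - e, by omega⟩, Finset.mem_filter.2 ⟨Finset.mem_univ _, fun hxy => ?_⟩,
        by simp only; omega⟩
      have h1 := sub_mem_supp (x := x) (k := ⟨n - 1 - e, by omega⟩)
      have h2 := sub_mem_supp (x := y) (k := ⟨n - 1 - e, by omega⟩)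
      have h3 : n - 1 - (n - 1 - e) = e := by omega
      simp only [h3] at h1 h2
      rw [Finset.mem_symmDiff, h1, h2, hxy] at h
      tauto
    · rintro ⟨k, hk, rfl⟩
      have hk := (Finset.mem_filter.1 hk).2
      rw [Finset.mem_symmDiff, sub_mem_supp, sub_mem_supp]
      rcases bit_cases (x k) with h3 | h3 <;> rcases bit_cases (y k) with h4 | h4 <;> simp_all
  rw [hd, this, Finset.card_image_of_injective]
  · rfl
  · intro k l h
    exact Fin.ext (by have := l.isLt; have := k.isLt; simp only at h; omega)

theorem supp_clearCoord (i : Fin n) (x : BitCube n) :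
    supp (clearCoord i x) = (supp x).erase (n - 1 - i) := by
  ext e
  rw [Finset.mem_erase, mem_supp, mem_supp]
  constructor
  · rintro ⟨k, hk, rfl⟩
    have hki : k ≠ i := by rintro rfl; simp [clearCoord] at hk
    refine ⟨fun h => hki (Fin.ext (by have := k.isLt; have := i.isLt; omega)), k, ?_, rfl⟩
    simpa [clearCoord, hki] using hk
  · rintro ⟨h, k, hk, rfl⟩
    have hki : k ≠ i := by rintro rfl; exact h rfl
    exact ⟨k, by simpa [clearCoord, hki] using hk, rfl⟩

theorem supp_shiftCoord {i j : Fin n} (hij : i < j) (x : BitCube n) : supp (shiftCoord i j x) =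
    if n - 1 - (i : ℕ) ∈ supp x ∧ n - 1 - (j : ℕ) ∉ supp x then
      insert (n - 1 - (j : ℕ)) ((supp x).erase (n - 1 - i)) else supp x := by
  unfold shiftCoord
  simp only [min_eq_left hij.le, sub_mem_supp]
  by_cases hi : x i = 0
  · rw [if_pos hi, if_neg fun h => h.1 hi]
  · rw [if_neg hi]
    have hinj : ∀ k l : Fin n, n - 1 - (k : ℕ) = n - 1 - l → k = l := fun k l h =>
      Fin.ext (by have := l.isLt; have := k.isLt; omega)
    ext e
    by_cases hen : e < n
    · obtain ⟨k, rfl⟩ : ∃ k : Fin n, n - 1 - (k : ℕ) = e := ⟨⟨n - 1 - e, by omega⟩, by simp only; omega⟩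
      rw [sub_mem_supp]
      have e1 : n - 1 - (k : ℕ) = n - 1 - j ↔ k = j := ⟨hinj k j, fun h => h ▸ rfl⟩
      have e2 : n - 1 - (k : ℕ) ≠ n - 1 - i ↔ k ≠ i := not_congr ⟨hinj k i, fun h => h ▸ rfl⟩
      by_cases hj : x j = 0
      · rw [if_pos ⟨hi, fun h => h hj⟩, Finset.mem_insert, Finset.mem_erase, e1, e2, sub_mem_supp]
        by_cases hki : k = i
        · subst hki; simp [swapCoord, hj, hij.ne]
        · by_cases hkj : k = j
          · subst hkj; simp [swapCoord, hi]
          · simp [swapCoord, Equiv.swap_apply_of_ne_of_ne hki hkj, hki, hkj]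
      · rw [if_neg fun h => h.2 hj, sub_mem_supp]
        by_cases hki : k = i
        · subst hki; simp [swapCoord, hj, hi]
        · by_cases hkj : k = j
          · subst hkj; simp [swapCoord, hi, hj]
          · simp [swapCoord, Equiv.swap_apply_of_ne_of_ne hki hkj]
    · refine iff_of_false (fun h => hen (supp_lt h)) fun h => ?_
      split_ifs at h
      · rcases Finset.mem_insert.1 h with h | h
        · have := i.isLt; omega
        · exact hen (supp_lt (Finset.mem_of_mem_erase h))
      · exact hen (supp_lt h)

theorem shiftCoord_self (i : Fin n) (x : BitCube n) : shiftCoord i i x = x := by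
  have : swapCoord i i x = x := by funext k; simp [swapCoord]
  unfold shiftCoord
  rw [this, ite_self]

theorem _root_.Below.trans {x y z : BitCube n} (h : Below x y) (h' : Below y z) : Below x z := by
  induction h' with
  | refl => exact h
  | clear w i _ ih => exact ih.clear w i
  | shift w i j _ ih => exact ih.shift w i j

theorem dom_supp_shiftCoord (i j : Fin n) (x : BitCube n) : Dom (supp (shiftCoord i j x)) (supp x) := by
  have key : ∀ i j : Fin n, i < j → Dom (supp (shiftCoord i j x)) (supp x) := fun i j hij => by
    rw [supp_shiftCoord hij]
    split_ifs with h
    · exact Dom.insert_erase (by have : (i : ℕ) < j := hij; omega) h.1 h.2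
    · exact Dom.refl _
  rcases lt_trichotomy i j with h | h | h
  · exact key i j h
  · subst h; rw [shiftCoord_self]; exact Dom.refl _
  · rw [shiftCoord_comm]; exact key j i h

/-- `x` can be reached from `y` by the operations `ρ_i` and `σ_ij` if and only if every final segment
of exponents contains at most as many exponents of `x` as of `y`. -/
theorem below_iff {x y : BitCube n} : Below y x ↔ Dom (supp x) (supp y) := by
  constructor
  · intro h
    induction h with
    | refl => exact Dom.refl _
    | clear z i _ ih =>
      rw [supp_clearCoord]; exact (Dom.of_subset (Finset.erase_subset _ _)).trans ih
    | shift z i j _ ih => exact (dom_supp_shiftCoord i j z).trans ih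
  · intro h
    induction hk : hd (supp x) (supp y) using Nat.strong_induction_on generalizing y with
    | _ k ih =>
      subst hk
      by_cases hne : supp x = supp y
      · rw [supp_injective hne]; exact .refl
      have hidx : ∀ e < n, ∃ k : Fin n, n - 1 - (k : ℕ) = e := fun e he =>
        ⟨⟨n - 1 - e, by omega⟩, by simp only; omega⟩
      rcases h.exists_step hne with ⟨e, he, h1, h2⟩ | ⟨e, he, f, hfe, hf, hfx, h1, h2⟩
      · obtain ⟨i, rfl⟩ := hidx e (supp_lt he)
        rw [← supp_clearCoord] at h1 h2
        exact (Below.clear _ i .refl).trans (ih _ h2 h1 rfl)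
      · obtain ⟨i, rfl⟩ := hidx e (supp_lt he)
        obtain ⟨j, rfl⟩ := hidx f (supp_lt hfx)
        have hij : i < j := by
          by_contra h'
          have : (j : ℕ) ≤ i := not_lt.1 h'
          omega
        have h3 := supp_shiftCoord hij y
        rw [if_pos ⟨he, hf⟩] at h3
        rw [← h3] at h1 h2
        exact (Below.shift _ i j .refl).trans (ih _ h2 h1 rfl)

end

/-! ### Generated families -/

/-- The sets below one of the given decreasing lists, without repetitions. -/
def unionBelow : List (List ℕ) → List (List ℕ)
  | [] => []
  | g :: G => ((enumBelow g (g.headD 0 + 1)).filter fun x => !anyDom G x) ++ unionBelow G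

theorem decr_lt_head {g : List ℕ} (hg : Decr g) : ∀ e ∈ g.toFinset, e < g.headD 0 + 1 := by
  intro e he
  rw [List.mem_toFinset] at he
  cases g with
  | nil => simp at he
  | cons a g =>
    rcases List.mem_cons.1 he with rfl | he
    · simp
    · have := (List.pairwise_cons.1 hg).1 e he
      simp only [List.headD_cons]; omega

theorem mem_unionBelow {G : List (List ℕ)} (hG : ∀ g ∈ G, Decr g) {x : List ℕ} :
    x ∈ unionBelow G ↔ Decr x ∧ ∃ g ∈ G, Dom x.toFinset g.toFinset := by
  induction G with
  | nil => simp [unionBelow]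
  | cons g G ih =>
    have hg := hG g (by simp)
    have hG' : ∀ g ∈ G, Decr g := fun g' h => hG g' (by simp [h])
    rw [unionBelow, List.mem_append, List.mem_filter, ih hG']
    constructor
    · rintro (⟨h1, -⟩ | ⟨h1, g', h2, h3⟩)
      · obtain ⟨h3, h4, -⟩ := mem_enumBelow.1 h1
        exact ⟨h3, g, by simp, (mem_enumBelow_iff_dom hg h3 h4).1 h1⟩
      · exact ⟨h1, g', by simp [h2], h3⟩
    · rintro ⟨h1, g', h2, h3⟩
      by_cases h4 : ∃ g ∈ G, Dom x.toFinset g.toFinset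
      · exact Or.inr ⟨h1, h4⟩
      · rcases List.mem_cons.1 h2 with rfl | h2
        · have hlt : ∀ e ∈ x, e < g'.headD 0 + 1 := fun e he =>
            h3.lt (decr_lt_head hg) e (List.mem_toFinset.2 he)
          refine Or.inl ⟨(mem_enumBelow_iff_dom hg h1 hlt).2 h3, ?_⟩
          rw [← anyDom_iff hG' h1] at h4
          simpa using h4
        · exact absurd ⟨g', h2, h3⟩ h4

theorem nodup_unionBelow {G : List (List ℕ)} (hG : ∀ g ∈ G, Decr g) : (unionBelow G).Nodup := by
  induction G with
  | nil => simp [unionBelow]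
  | cons g G ih =>
    have hG' : ∀ g ∈ G, Decr g := fun g' h => hG g' (by simp [h])
    refine List.nodup_append.2 ⟨(nodup_enumBelow _ _).filter _, ih hG', ?_⟩
    rintro x hx _ hy rfl
    obtain ⟨h1, h2⟩ := (mem_unionBelow hG').1 hy
    have := (List.mem_filter.1 hx).2
    rw [(anyDom_iff hG' h1).2 h2] at this
    simp at this

/-- The family represented by a list of decreasing lists. -/
def familyOf (U : List (List ℕ)) : Finset (Finset ℕ) := (U.map List.toFinset).toFinset

theorem sum_familyOf {U : List (List ℕ)} (hU : ∀ y ∈ U, Decr y) (hn : U.Nodup) {M : Type*}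
    [AddCommMonoid M] (f : Finset ℕ → M) :
    ∑ x ∈ familyOf U, f x = (U.map fun y => f y.toFinset).sum := by
  have h : (U.map List.toFinset).Nodup := by
    refine List.Nodup.map_on (fun u hu v hv huv => ?_) hn
    exact (List.perm_of_nodup_nodup_toFinset_eq (hU u hu).nodup (hU v hv).nodup huv).eq_of_pairwise'
      (hU u hu) (hU v hv)
  rw [familyOf, List.sum_toFinset _ h, List.map_map]
  rfl

theorem sum_range_getD {α : Type*} (l : List α) (d : α) (f : α → ℕ) :
    ∑ i ∈ Finset.range l.length, f (l.getD i d) = (l.map f).sum := by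
  induction l with
  | nil => rfl
  | cons a l ih =>
    rw [List.length_cons, Finset.sum_range_succ', List.map_cons, List.sum_cons, ← ih, add_comm]
    simp

/-- For every member of the list and `d = 1, …, 8`, the number of members at distance at least
`d`. -/
def farCounts (m : ℕ) (U : List (List ℕ)) : List (List ℕ) :=
  force (pack 9 (U.map fun _ => 1)) fun ones =>
  force (Nat.shiftLeft ones 8) fun H =>
  mapForce (fun e => pack 9 (U.map (memList e))) (upto m) fun Cs =>
  tails Cs fun ts =>
  geRows 9 H ones (nth ts 0) Cs [1, 2, 3, 4, 5, 6, 7, 8] U fun ges =>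
  ges.map fun l => l.map fun a => Nat.mod a 511

theorem farCounts_eq {m : ℕ} {U : List (List ℕ)} (hm : m < 256) (hl : U.length < 511)
    (hU : ∀ y ∈ U, Decr y ∧ ∀ e ∈ y, e < m) : farCounts m U = U.map fun y =>
      [1, 2, 3, 4, 5, 6, 7, 8].map fun d =>
        (U.map fun z => if d ≤ hd y.toFinset z.toFinset then 1 else 0).sum := by
  unfold farCounts
  have hones : pack 9 (U.map fun _ => 1) = pk 9 U.length fun _ => 1 := pack_map _ _ []
  simp only [force_eq, mapForce_eq, tails_eq, geRows_eq, upto_eq, hones, List.map_map]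
  refine List.map_congr_left fun y hy => ?_
  simp only [Function.comp_def, List.map_map]
  refine List.map_congr_left fun d hd' => ?_
  have hH : Nat.shiftLeft (pk 9 U.length fun _ => 1) 8 = pk 9 U.length fun _ => 2 ^ 8 := by
    rw [shl_eq, mul_comm, mul_pk]
    rfl
  have hhd : ∀ j < U.length, hd y.toFinset (U.getD j []).toFinset < 2 ^ 8 := fun j hj => by
    have hj' : U.getD j [] ∈ U := by rw [List.getD_eq_getElem _ _ hj]; exact List.getElem_mem hj
    have : hd y.toFinset (U.getD j []).toFinset ≤ m := by
      rw [← Finset.card_range m]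
      refine Finset.card_le_card fun e he => Finset.mem_range.2 ?_
      rcases Finset.mem_symmDiff.1 he with he | he
      · exact (hU y hy).2 e (List.mem_toFinset.1 he.1)
      · exact (hU _ hj').2 e (List.mem_toFinset.1 he.1)
    omega
  have hd8 : 0 < d ∧ d ≤ 8 := by
    simp only [List.mem_cons, List.not_mem_nil, or_false] at hd'
    omega
  rw [distLanes_eq rfl hU (hU y hy).1 (hU y hy).2, hH,
    geLane_eq rfl hhd (by norm_num; omega) hd8.1]
  have hmod : ∀ a b : ℕ, Nat.mod a b = a % b := fun _ _ => rfl
  rw [hmod, show 511 = 2 ^ 9 - 1 from rfl, pk_mod]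
  · rw [← sum_range_getD U []]
  · refine lt_of_le_of_lt (Finset.sum_le_card_nsmul _ _ 1 fun i _ => ?_) ?_
    · split <;> norm_num
    · simpa using hl

section

variable {n : ℕ}

/-- The supports of the points of a set. -/
def supports (S : Finset (BitCube n)) : Finset (Finset ℕ) := S.image supp

theorem card_supports (S : Finset (BitCube n)) : (supports S).card = S.card :=
  Finset.card_image_of_injective _ supp_injective

theorem cubeSum_eq (S : Finset (BitCube n)) (θ : ℝ) : cubeSum S θ = distSum (supports S) θ := by
  unfold cubeSum distSum supports
  rw [Finset.sum_image fun _ _ _ _ h => supp_injective h]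
  simp only [Finset.sum_image fun _ _ _ _ h => supp_injective h, hd_supp]

theorem mem_bitsOf {g e : ℕ} : e ∈ bitsOf g ↔ e < 64 ∧ g.testBit e = true := by
  simp [bitsOf]

theorem decr_bitsOf (g : ℕ) : Decr (bitsOf g) := by
  refine List.Pairwise.filter _ (List.pairwise_reverse.2 ?_)
  exact List.pairwise_lt_range

theorem supp_bitVector {g : ℕ} (hn : n ≤ 64) (hg : g < 2 ^ n) :
    supp (bitVector n g) = (bitsOf g).toFinset := by
  ext e
  rw [List.mem_toFinset, mem_bitsOf, mem_supp]
  constructor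
  · rintro ⟨k, hk, rfl⟩
    have := k.isLt
    refine ⟨by omega, ?_⟩
    by_contra h
    exact hk (if_neg h)
  · rintro ⟨-, h⟩
    have hen : e < n := by
      by_contra hen
      rw [Nat.testBit_lt_two_pow (hg.trans_le (Nat.pow_le_pow_right (by norm_num) (not_lt.1 hen)))] at h
      exact Bool.false_ne_true h
    refine ⟨⟨n - 1 - e, by omega⟩, ?_, by simp only; omega⟩
    have h1 : n - 1 - (n - 1 - e) = e := by omega
    simp only [bitVector, h1, h, if_true]
    decide

/-- The family of the sets below one of the generators. -/
def generatedFamily (G : List ℕ) : Finset (Finset ℕ) := familyOf (unionBelow (G.map bitsOf))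

theorem mem_generatedFamily {G : List ℕ} {x : Finset ℕ} :
    x ∈ generatedFamily G ↔ ∃ g ∈ G, Dom x (bitsOf g).toFinset := by
  have hG : ∀ g ∈ G.map bitsOf, Decr g := fun g hg => by
    obtain ⟨a, -, rfl⟩ := List.mem_map.1 hg
    exact decr_bitsOf a
  rw [generatedFamily, familyOf, List.mem_toFinset, List.mem_map]
  constructor
  · rintro ⟨y, hy, rfl⟩
    obtain ⟨-, g, hg, h⟩ := (mem_unionBelow hG).1 hy
    obtain ⟨a, ha, rfl⟩ := List.mem_map.1 hg
    exact ⟨a, ha, h⟩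
  · rintro ⟨g, hg, h⟩
    obtain ⟨y, hy, rfl⟩ := exists_decr x
    exact ⟨y, (mem_unionBelow hG).2 ⟨hy, _, List.mem_map_of_mem hg, h⟩, rfl⟩

theorem mem_generated {G : List ℕ} (hn : n ≤ 64) (hG : ∀ g ∈ G, g < 2 ^ n) {x : BitCube n} :
    x ∈ generated n G ↔ ∃ g ∈ G, Dom (supp x) (bitsOf g).toFinset := by
  classical
  rw [generated, Finset.mem_filter]
  simp only [Finset.mem_univ, true_and, below_iff]
  constructor
  · rintro ⟨g, hg, h⟩
    exact ⟨g, hg, by rwa [supp_bitVector hn (hG g hg)] at h⟩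
  · rintro ⟨g, hg, h⟩
    exact ⟨g, hg, by rwa [supp_bitVector hn (hG g hg)]⟩

/-- The supports of a generated set do not depend on the dimension. -/
theorem supports_generated {G : List ℕ} (hn : n ≤ 64) (hG : ∀ g ∈ G, g < 2 ^ n) :
    supports (generated n G) = generatedFamily G := by
  ext x
  rw [supports, Finset.mem_image, mem_generatedFamily]
  constructor
  · rintro ⟨y, hy, rfl⟩
    exact (mem_generated hn hG).1 hy
  · rintro ⟨g, hg, h⟩
    have hlt : ∀ e ∈ (bitsOf g).toFinset, e < n := fun e he => by
      rw [← supp_bitVector hn (hG g hg)] at he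
      exact supp_lt he
    obtain ⟨y, rfl⟩ := exists_supp (h.lt hlt)
    exact ⟨y, (mem_generated hn hG).2 ⟨g, hg, h⟩, rfl⟩

theorem generated_closed (G : List ℕ) :
    IsDownSet (generated n G) ∧ IsRightShifted (generated n G) := by
  classical
  constructor
  · intro i x hx
    obtain ⟨-, g, hg, h⟩ := Finset.mem_filter.1 hx
    exact Finset.mem_filter.2 ⟨Finset.mem_univ _, g, hg, h.clear x i⟩
  · intro i j x hx
    obtain ⟨-, g, hg, h⟩ := Finset.mem_filter.1 hx
    exact Finset.mem_filter.2 ⟨Finset.mem_univ _, g, hg, h.shift x i j⟩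

end

/-! ### Evaluations of the sets in the table -/

/-- The list `U` with all its entries evaluated. -/
def forceLists {β : Type} (U : List (List ℕ)) : (List (List ℕ) → β) → β :=
  List.rec (fun k => k []) (fun y _ ih k => mapForce (fun e => e) y fun y' => ih fun l => k (y' :: l)) U

theorem forceLists_eq {β : Type} (U : List (List ℕ)) (k : List (List ℕ) → β) :
    forceLists U k = k U := by
  induction U generalizing k with
  | nil => rfl
  | cons y U ih =>
    change mapForce (fun e => e) y (fun y' => forceLists U fun l => k (y' :: l)) = _
    rw [mapForce_eq, ih, List.map_id']

/-- `farCounts`, passed on without rebuilding it. -/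
def withFarCounts {β : Type} (m : ℕ) (U : List (List ℕ)) (k : List (List ℕ) → β) : β :=
  force (pack 9 (U.map fun _ => 1)) fun ones =>
  force (Nat.shiftLeft ones 8) fun H =>
  mapForce (fun e => pack 9 (U.map (memList e))) (upto m) fun Cs =>
  tails Cs fun ts =>
  geRows 9 H ones (nth ts 0) Cs [1, 2, 3, 4, 5, 6, 7, 8] U fun ges =>
  k (ges.map fun l => l.map fun a => Nat.mod a 511)

theorem withFarCounts_eq {β : Type} (m : ℕ) (U : List (List ℕ)) (k : List (List ℕ) → β) :
    withFarCounts m U k = k (farCounts m U) := by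
  unfold withFarCounts farCounts
  simp only [force_eq, mapForce_eq, tails_eq, geRows_eq]

/-- The sum of the values of `f`, in a form that the kernel evaluates directly. -/
def sumOf {α : Type} (f : α → ℕ) (l : List α) : ℕ := List.rec 0 (fun x _ ih => Nat.add (f x) ih) l

theorem sumOf_eq {α : Type} (f : α → ℕ) (l : List α) : sumOf f l = (l.map f).sum := by
  induction l with
  | nil => rfl
  | cons a l ih => rw [List.map_cons, List.sum_cons, ← ih]; rfl

/-- Whether all values of `f` are `true`; the evaluation stops at the first `false`. -/
def allB {α : Type} (f : α → Bool) (l : List α) : Bool :=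
  List.rec true (fun x _ ih => andB (f x) ih) l

theorem allB_iff {α : Type} {f : α → Bool} {l : List α} : allB f l = true ↔ ∀ x ∈ l, f x = true := by
  induction l with
  | nil => simp [allB]
  | cons a l ih =>
    have : allB f (a :: l) = andB (f a) (allB f l) := rfl
    rw [this, andB_eq]
    simp [ih]

/-- The entry in the table for the distance distribution of the set generated by `G`, in dimension
`m`, is correct. -/
def distCheck (t m : ℕ) (dist G : List ℕ) : Bool :=
  forceLists (unionBelow (G.map bitsOf)) fun U =>
  andB (Nat.beq (len U) (2 ^ t)) <| withFarCounts m U fun L =>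
  allB (fun k => Nat.beq (sumOf (nth · k) L) (sumOf (fun a => a) (dist.drop (k + 1))))
    [0, 1, 2, 3, 4, 5, 6, 7]

/-- The sum of the cubes of the numbers of neighbours of the members, where neighbours are members
at distance one. Sets in the same row have equal distance distributions, hence equal sums of first
powers. -/
def degreeCubes (m : ℕ) (G : List ℕ) : ℕ :=
  forceLists (unionBelow (G.map bitsOf)) fun U => withFarCounts m U fun L =>
  sumOf (fun l => (nth l 0 - nth l 1) ^ 3) L

/-- The entries of the table are consistent; the distance distributions are not looked at. -/
def Consistent (r : OptRow) : Prop :=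
  (1 ≤ r.t ∧ r.t ≤ 6) ∧ (1 ≤ r.n ∧ r.n ≤ 63) ∧ r.dist.getD 0 0 = 2 ^ r.t ∧
  r.dist.sum = 2 ^ r.t * 2 ^ r.t ∧ r.dist.length ≤ 8 ∧ r.dist.length ≤ r.n + 1 ∧ r.sets ≠ [] ∧
  ∀ G ∈ r.sets, (∀ g ∈ G, g < 2 ^ r.n) ∧
    (∀ g ∈ G, ∀ h ∈ G.erase g, domB (bitsOf h) (bitsOf g) 1 = false) ∧
    ∃ g ∈ G, (bitsOf g).head? = some (r.n - 1)

instance (r : OptRow) : Decidable (Consistent r) := by unfold Consistent; infer_instance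

set_option maxRecDepth 100000 in
theorem consistent_A : ∀ r ∈ optTableA, Consistent r := by decide +kernel

set_option maxRecDepth 100000 in
theorem consistent_B : ∀ r ∈ optTableB, Consistent r := by decide +kernel

set_option maxRecDepth 100000 in
theorem consistent_C : ∀ r ∈ optTableC, Consistent r := by decide +kernel

set_option maxRecDepth 100000 in
theorem consistent_D : ∀ r ∈ optTableD, Consistent r := by decide +kernel

/-- The check of four consecutive rows. The checks are separate declarations, for the kernel keeps the
results of all evaluations within one declaration. -/
def DistChecked (k : ℕ) : Prop :=
  allB (fun r => allB (distCheck r.t r.n r.dist) r.sets) ((optTable.drop (4 * k)).take 4) = true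

instance (k : ℕ) : Decidable (DistChecked k) := by unfold DistChecked; infer_instance

set_option maxRecDepth 100000 in
theorem distChecked_0 : DistChecked 0 := by decide +kernel

set_option maxRecDepth 100000 in
theorem distChecked_1 : DistChecked 1 := by decide +kernel

set_option maxRecDepth 100000 in
theorem distChecked_2 : DistChecked 2 := by decide +kernel

set_option maxRecDepth 100000 in
theorem distChecked_3 : DistChecked 3 := by decide +kernel

set_option maxRecDepth 100000 in
theorem distChecked_4 : DistChecked 4 := by decide +kernel

set_option maxRecDepth 100000 in
theorem distChecked_5 : DistChecked 5 := by decide +kernel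

set_option maxRecDepth 100000 in
theorem distChecked_6 : DistChecked 6 := by decide +kernel

set_option maxRecDepth 100000 in
theorem distChecked_7 : DistChecked 7 := by decide +kernel

set_option maxRecDepth 100000 in
theorem distChecked_8 : DistChecked 8 := by decide +kernel

set_option maxRecDepth 100000 in
theorem distChecked_9 : DistChecked 9 := by decide +kernel

set_option maxRecDepth 100000 in
theorem distChecked_10 : DistChecked 10 := by decide +kernel

set_option maxRecDepth 100000 in
theorem distChecked_11 : DistChecked 11 := by decide +kernel

set_option maxRecDepth 100000 in
theorem distChecked_12 : DistChecked 12 := by decide +kernel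

set_option maxRecDepth 100000 in
theorem distChecked_13 : DistChecked 13 := by decide +kernel

set_option maxRecDepth 100000 in
theorem distChecked_14 : DistChecked 14 := by decide +kernel

set_option maxRecDepth 100000 in
theorem distChecked_15 : DistChecked 15 := by decide +kernel

set_option maxRecDepth 100000 in
theorem distChecked_16 : DistChecked 16 := by decide +kernel

set_option maxRecDepth 100000 in
theorem distChecked_17 : DistChecked 17 := by decide +kernel

set_option maxRecDepth 100000 in
theorem distChecked_18 : DistChecked 18 := by decide +kernel

set_option maxRecDepth 100000 in
theorem distChecked_19 : DistChecked 19 := by decide +kernel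

set_option maxRecDepth 100000 in
theorem distChecked_20 : DistChecked 20 := by decide +kernel

theorem distChecked {k : ℕ} (hk : k < 21) : DistChecked k := by
  interval_cases k
  · exact distChecked_0
  · exact distChecked_1
  · exact distChecked_2
  · exact distChecked_3
  · exact distChecked_4
  · exact distChecked_5
  · exact distChecked_6
  · exact distChecked_7
  · exact distChecked_8
  · exact distChecked_9
  · exact distChecked_10
  · exact distChecked_11
  · exact distChecked_12
  · exact distChecked_13
  · exact distChecked_14
  · exact distChecked_15
  · exact distChecked_16
  · exact distChecked_17
  · exact distChecked_18
  · exact distChecked_19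
  · exact distChecked_20

theorem length_optTable : optTable.length = 81 := by decide +kernel

set_option maxRecDepth 100000 in
theorem degreeCubes_A : ∀ r ∈ optTableA, r.sets.Pairwise fun G H => degreeCubes r.n G ≠ degreeCubes r.n H := by decide +kernel

set_option maxRecDepth 100000 in
theorem degreeCubes_B : ∀ r ∈ optTableB, r.sets.Pairwise fun G H => degreeCubes r.n G ≠ degreeCubes r.n H := by decide +kernel

set_option maxRecDepth 100000 in
theorem degreeCubes_C : ∀ r ∈ optTableC, r.sets.Pairwise fun G H => degreeCubes r.n G ≠ degreeCubes r.n H := by decide +kernel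

set_option maxRecDepth 100000 in
theorem degreeCubes_D : ∀ r ∈ optTableD, r.sets.Pairwise fun G H => degreeCubes r.n G ≠ degreeCubes r.n H := by decide +kernel

theorem consistent {r : OptRow} (h : r ∈ optTable) : Consistent r := by
  simp only [optTable, List.mem_append] at h
  rcases h with ((h | h) | h) | h
  · exact consistent_A r h
  · exact consistent_B r h
  · exact consistent_C r h
  · exact consistent_D r h

theorem distCheck_of_mem {r : OptRow} (h : r ∈ optTable) {G : List ℕ} (hG : G ∈ r.sets) :
    distCheck r.t r.n r.dist G = true := by
  obtain ⟨i, hi, rfl⟩ := List.getElem_of_mem h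
  rw [length_optTable] at hi
  have h1 := distChecked (k := i / 4) (by omega)
  refine allB_iff.1 (allB_iff.1 h1 _ ?_) G hG
  rw [List.mem_iff_getElem]
  refine ⟨i % 4, ?_, ?_⟩
  · rw [List.length_take, List.length_drop, length_optTable]; omega
  · simp only [List.getElem_take, List.getElem_drop, Nat.div_add_mod]

theorem degreeCubes_pairwise {r : OptRow} (h : r ∈ optTable) :
    r.sets.Pairwise fun G H => degreeCubes r.n G ≠ degreeCubes r.n H := by
  simp only [optTable, List.mem_append] at h
  rcases h with ((h | h) | h) | h
  · exact degreeCubes_A r h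
  · exact degreeCubes_B r h
  · exact degreeCubes_C r h
  · exact degreeCubes_D r h

/-! ### Distance distributions and isomorphism of the sets in the table -/

section

variable {r : OptRow} {G : List ℕ}

theorem decr_map_bitsOf (G : List ℕ) : ∀ g ∈ G.map bitsOf, Decr g := fun g hg => by
  obtain ⟨a, -, rfl⟩ := List.mem_map.1 hg
  exact decr_bitsOf a

theorem lt_of_mem_bitsOf {g n e : ℕ} (hg : g < 2 ^ n) (he : e ∈ bitsOf g) : e < n := by
  by_contra h
  rw [mem_bitsOf, Nat.testBit_lt_two_pow
    (hg.trans_le (Nat.pow_le_pow_right (by norm_num) (not_lt.1 h)))] at he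
  exact Bool.false_ne_true he.2

theorem unionBelow_spec {n : ℕ} (hG : ∀ g ∈ G, g < 2 ^ n) :
    ∀ y ∈ unionBelow (G.map bitsOf), Decr y ∧ ∀ e ∈ y, e < n := fun y hy => by
  obtain ⟨h1, g, hg, h2⟩ := (mem_unionBelow (decr_map_bitsOf G)).1 hy
  obtain ⟨a, ha, rfl⟩ := List.mem_map.1 hg
  exact ⟨h1, fun e he => h2.lt (fun f hf => lt_of_mem_bitsOf (hG a ha) (List.mem_toFinset.1 hf)) e
    (List.mem_toFinset.2 he)⟩

theorem sum_generatedFamily (G : List ℕ) {M : Type*} [AddCommMonoid M] (f : Finset ℕ → M) :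
    ∑ x ∈ generatedFamily G, f x = ((unionBelow (G.map bitsOf)).map fun y => f y.toFinset).sum :=
  sum_familyOf (fun _ hy => ((mem_unionBelow (decr_map_bitsOf G)).1 hy).1)
    (nodup_unionBelow (decr_map_bitsOf G)) f

/-- The number of members of a family at distance at least `d` from `x`. -/
def farFrom (T : Finset (Finset ℕ)) (d : ℕ) (x : Finset ℕ) : ℕ :=
  ∑ y ∈ T, if d ≤ hd x y then 1 else 0

theorem farCounts_generatedFamily {n : ℕ} (hn : n < 256) (hG : ∀ g ∈ G, g < 2 ^ n)
    (hl : (unionBelow (G.map bitsOf)).length < 511) :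
    farCounts n (unionBelow (G.map bitsOf)) = (unionBelow (G.map bitsOf)).map fun y =>
      [1, 2, 3, 4, 5, 6, 7, 8].map fun d => farFrom (generatedFamily G) d y.toFinset := by
  rw [farCounts_eq hn hl (unionBelow_spec hG)]
  simp only [farFrom, sum_generatedFamily]

/-- The number of pairs at distance at least `d`. -/
def farPairs (T : Finset (Finset ℕ)) (d : ℕ) : ℕ := ∑ x ∈ T, farFrom T d x

/-- The number of pairs at distance `d`. -/
def pairsAt (T : Finset (Finset ℕ)) (d : ℕ) : ℕ := ∑ x ∈ T, ∑ y ∈ T, if hd x y = d then 1 else 0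

theorem farPairs_eq_add (T : Finset (Finset ℕ)) (d : ℕ) :
    farPairs T d = pairsAt T d + farPairs T (d + 1) := by
  unfold farPairs pairsAt farFrom
  rw [← Finset.sum_add_distrib]
  refine Finset.sum_congr rfl fun x _ => ?_
  rw [← Finset.sum_add_distrib]
  refine Finset.sum_congr rfl fun y _ => ?_
  split_ifs <;> omega

theorem farPairs_zero (T : Finset (Finset ℕ)) : farPairs T 0 = T.card * T.card := by
  simp [farPairs, farFrom]

theorem row_lt (hr : r ∈ optTable) (hG : G ∈ r.sets) : ∀ g ∈ G, g < 2 ^ r.n :=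
  ((consistent hr).2.2.2.2.2.2.2 G hG).1

theorem row_card_and_farPairs (hr : r ∈ optTable) (hG : G ∈ r.sets) :
    (generatedFamily G).card = 2 ^ r.t ∧
    ∀ d ≤ 8, farPairs (generatedFamily G) d = (r.dist.drop d).sum := by
  have h1 := distCheck_of_mem hr hG
  have ⟨⟨_, h6⟩, ⟨_, h63⟩, _, hsum, _⟩ := consistent hr
  rw [distCheck, forceLists_eq, andB_eq, Bool.and_eq_true, withFarCounts_eq] at h1
  obtain ⟨h1, h2⟩ := h1
  have h1 := Nat.eq_of_beq_eq_true h1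
  rw [len_eq] at h1
  have hcard : (generatedFamily G).card = 2 ^ r.t := by
    rw [Finset.card_eq_sum_ones, sum_generatedFamily]
    simpa using h1
  refine ⟨hcard, fun d hd8 => ?_⟩
  rcases Nat.eq_zero_or_pos d with rfl | hd0
  · rw [farPairs_zero, hcard, List.drop_zero, hsum]
  have h64 : (2 : ℕ) ^ r.t ≤ 2 ^ 6 := Nat.pow_le_pow_right (by norm_num) h6
  have h3 := Nat.eq_of_beq_eq_true (allB_iff.1 h2 (d - 1) (by
    simp only [List.mem_cons, List.not_mem_nil, or_false]; omega))
  rw [farCounts_generatedFamily (by omega) (row_lt hr hG) (by omega), sumOf_eq, sumOf_eq, List.map_map,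
    List.map_id', Nat.sub_add_cancel hd0] at h3
  rw [← h3, farPairs, sum_generatedFamily]
  congr 1
  refine List.map_congr_left fun y _ => ?_
  simp only [Function.comp_apply, nth_eq]
  interval_cases d <;> rfl

theorem sum_drop (l : List ℕ) (d : ℕ) : (l.drop d).sum = l.getD d 0 + (l.drop (d + 1)).sum := by
  induction l generalizing d with
  | nil => simp
  | cons a l ih =>
    cases d with
    | zero => simp
    | succ d => simpa using ih d

theorem farPairs_mono (T : Finset (Finset ℕ)) {d e : ℕ} (h : d ≤ e) : farPairs T e ≤ farPairs T d := by
  refine Finset.sum_le_sum fun x _ => Finset.sum_le_sum fun y _ => ?_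
  split_ifs <;> omega

theorem pairsAt_generatedFamily (hr : r ∈ optTable) (hG : G ∈ r.sets) (d : ℕ) :
    pairsAt (generatedFamily G) d = r.dist.getD d 0 := by
  have h := (row_card_and_farPairs hr hG).2
  have hlen := (consistent hr).2.2.2.2.1
  have h1 := farPairs_eq_add (generatedFamily G) d
  rcases lt_or_ge d 8 with hd8 | hd8
  · rw [h d (by omega), h (d + 1) (by omega), sum_drop] at h1
    omega
  · have h2 := farPairs_mono (generatedFamily G) hd8
    rw [h 8 le_rfl, List.drop_eq_nil_of_le hlen, List.sum_nil] at h2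
    rw [List.getD_eq_default _ _ (by omega)]
    omega

/-- Every distance that occurs in a set of a row is listed. -/
theorem hd_lt_of_row (hr : r ∈ optTable) (hG : G ∈ r.sets) {x y : Finset ℕ}
    (hx : x ∈ generatedFamily G) (hy : y ∈ generatedFamily G) : hd x y < r.dist.length := by
  by_contra h
  have h1 := pairsAt_generatedFamily hr hG (hd x y)
  rw [List.getD_eq_default _ _ (not_lt.1 h), pairsAt] at h1
  have h2 := Finset.sum_eq_zero_iff.1 (Finset.sum_eq_zero_iff.1 h1 x hx) y hy
  simp at h2

/-- The listed distance distribution gives the values of the sets of a row. -/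
theorem distSum_generatedFamily (hr : r ∈ optTable) (hG : G ∈ r.sets) (θ : ℝ) :
    distSum (generatedFamily G) θ = evalList r.dist θ := by
  unfold distSum evalList
  calc _ = ∑ x ∈ generatedFamily G, ∑ y ∈ generatedFamily G, ∑ k ∈ Finset.range r.dist.length,
        ((if hd x y = k then 1 else 0 : ℕ) : ℝ) * θ ^ k := by
        refine Finset.sum_congr rfl fun x hx => Finset.sum_congr rfl fun y hy => ?_
        rw [Finset.sum_eq_single (hd x y)]
        · simp
        · intro k _ hk; simp [hk.symm]
        · intro h; exact absurd (Finset.mem_range.2 (hd_lt_of_row hr hG hx hy)) h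
    _ = ∑ k ∈ Finset.range r.dist.length, (pairsAt (generatedFamily G) k : ℝ) * θ ^ k := by
        rw [Finset.sum_congr rfl fun x _ => Finset.sum_comm, Finset.sum_comm]
        refine Finset.sum_congr rfl fun k _ => ?_
        simp only [pairsAt, Nat.cast_sum, Finset.sum_mul]
    _ = _ := by simp only [pairsAt_generatedFamily hr hG]

variable {n : ℕ}

theorem pairCount_eq (S : Finset (BitCube n)) (i : ℕ) : pairCount S i = pairsAt (supports S) i := by
  unfold pairCount pairsAt supports
  rw [Finset.card_filter, Finset.sum_product, Finset.sum_image fun _ _ _ _ h => supp_injective h]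
  simp only [Finset.sum_image fun _ _ _ _ h => supp_injective h, hd_supp]

theorem distDistribution_generated (hr : r ∈ optTable) (hG : G ∈ r.sets) :
    distDistribution (generated r.n G) = coeffPolynomial r.dist := by
  have ⟨_, ⟨_, h63⟩, _, _, _, hlen, _⟩ := consistent hr
  unfold distDistribution coeffPolynomial
  simp only [pairCount_eq, supports_generated (show r.n ≤ 64 by omega) (row_lt hr hG),
    pairsAt_generatedFamily hr hG]
  refine (Finset.sum_subset (Finset.range_mono hlen) fun i _ hi => ?_).symm
  rw [List.getD_eq_default _ _ (not_lt.1 fun h => hi (Finset.mem_range.2 h)), map_zero]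

theorem card_generated (hr : r ∈ optTable) (hG : G ∈ r.sets) (hn : r.n ≤ n) (hn64 : n ≤ 64) :
    (generated n G).card = 2 ^ r.t := by
  rw [← card_supports, supports_generated hn64 fun g hg =>
    (row_lt hr hG g hg).trans_le (Nat.pow_le_pow_right (by norm_num) hn)]
  exact (row_card_and_farPairs hr hG).1

theorem supports_generated_row (hr : r ∈ optTable) (hG : G ∈ r.sets) (hn : r.n ≤ n) (hn64 : n ≤ 64) :
    supports (generated n G) = generatedFamily G :=
  supports_generated hn64 fun g hg =>
    (row_lt hr hG g hg).trans_le (Nat.pow_le_pow_right (by norm_num) hn)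

theorem cubeSum_generated (hr : r ∈ optTable) (hG : G ∈ r.sets) (hn : r.n ≤ n) (hn64 : n ≤ 64) (θ : ℝ) :
    cubeSum (generated n G) θ = evalList r.dist θ := by
  rw [cubeSum_eq, supports_generated_row hr hG hn hn64, distSum_generatedFamily hr hG]

/-- The vector of an omitted generator is not below any of the others. -/
theorem generated_erase_ne (hr : r ∈ optTable) (hG : G ∈ r.sets) {m : ℕ} (hm : m ∈ G) :
    generated r.n (G.erase m) ≠ generated r.n G := by
  intro h
  have ⟨_, ⟨_, h63⟩, _, _, _, _, _, hs⟩ := consistent hr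
  obtain ⟨hlt, hmin, -⟩ := hs G hG
  have hn : r.n ≤ 64 := by omega
  have h1 : bitVector r.n m ∈ generated r.n G :=
    (mem_generated hn hlt).2 ⟨m, hm, by rw [supp_bitVector hn (hlt m hm)]; exact Dom.refl _⟩
  rw [← h, mem_generated hn fun g hg => hlt g (List.mem_of_mem_erase hg)] at h1
  obtain ⟨g, hg, h2⟩ := h1
  rw [supp_bitVector hn (hlt m hm), ← domB_iff (decr_bitsOf g) (decr_bitsOf m), hmin m hm g hg] at h2
  exact Bool.false_ne_true h2

/-- The sum of the cubes of the numbers of neighbours in a set of its points. This invariant tells the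
sets in the same row apart. -/
def neighbourCubes (S : Finset (BitCube n)) : ℕ :=
  ∑ x ∈ S, (∑ y ∈ S, if hammingDist x y = 1 then 1 else 0) ^ 3

theorem neighbourCubes_image {τ : BitCube n → BitCube n} (h1 : ∀ x, τ (τ x) = x)
    (h2 : ∀ x y, hammingDist (τ x) (τ y) = hammingDist x y) (S : Finset (BitCube n)) :
    neighbourCubes (S.image τ) = neighbourCubes S := by
  have hinj : Function.Injective τ := fun x y h => by rw [← h1 x, h, h1]
  unfold neighbourCubes
  rw [Finset.sum_image fun _ _ _ _ h => hinj h]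
  simp only [Finset.sum_image fun _ _ _ _ h => hinj h, h2]

theorem neighbourCubes_eq_of_isomorphic {S T : Finset (BitCube n)} (h : Isomorphic S T) :
    neighbourCubes T = neighbourCubes S := by
  induction h with
  | refl => rfl
  | flip V i _ ih =>
    exact (neighbourCubes_image (flipCoord_flipCoord i) (hammingDist_flipCoord i) V).trans ih
  | swap V i j _ ih =>
    exact (neighbourCubes_image (swapCoord_swapCoord i j) (hammingDist_swapCoord i j) V).trans ih

theorem neighbourCubes_generated (hr : r ∈ optTable) (hG : G ∈ r.sets) :
    neighbourCubes (generated r.n G) = degreeCubes r.n G := by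
  have ⟨⟨_, h6⟩, ⟨_, h63⟩, _⟩ := consistent hr
  have h64 : (2 : ℕ) ^ r.t ≤ 2 ^ 6 := Nat.pow_le_pow_right (by norm_num) h6
  have hl : (unionBelow (G.map bitsOf)).length = 2 ^ r.t := by
    rw [← (row_card_and_farPairs hr hG).1, Finset.card_eq_sum_ones, sum_generatedFamily]
    simp
  have h1 : neighbourCubes (generated r.n G) = ∑ x ∈ generatedFamily G,
      (∑ y ∈ generatedFamily G, if hd x y = 1 then 1 else 0) ^ 3 := by
    rw [← supports_generated_row hr hG le_rfl (by omega), neighbourCubes, supports,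
      Finset.sum_image fun _ _ _ _ h => supp_injective h]
    simp only [Finset.sum_image fun _ _ _ _ h => supp_injective h, hd_supp]
  have h2 : ∀ x, (∑ y ∈ generatedFamily G, if hd x y = 1 then 1 else 0) =
      farFrom (generatedFamily G) 1 x - farFrom (generatedFamily G) 2 x := fun x => by
    have : farFrom (generatedFamily G) 1 x = (∑ y ∈ generatedFamily G, if hd x y = 1 then 1 else 0) +
        farFrom (generatedFamily G) 2 x := by
      unfold farFrom
      rw [← Finset.sum_add_distrib]
      refine Finset.sum_congr rfl fun y _ => ?_
      split_ifs <;> omega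
    omega
  rw [h1, degreeCubes, forceLists_eq, withFarCounts_eq, sumOf_eq,
    farCounts_generatedFamily (by omega) (row_lt hr hG) (by omega), List.map_map, sum_generatedFamily]
  simp only [h2]
  rfl

theorem pairwise_not_isomorphic (hr : r ∈ optTable) :
    r.sets.Pairwise fun G H => ¬ Isomorphic (generated r.n G) (generated r.n H) := by
  refine (degreeCubes_pairwise hr).imp_of_mem fun hG hH hne h => hne ?_
  rw [← neighbourCubes_generated hr hG, ← neighbourCubes_generated hr hH,
    neighbourCubes_eq_of_isomorphic h]

end

/-! ### Crossing points of distance distribution functions -/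

/-- The values of the functionals are the coefficients of a distance distribution function as a
polynomial in `y`, where `θ = (a + b y) / (q + q y)`. -/
theorem evalList_mul_pow {g : List ℕ} {a b q N : ℕ} (hg : g.length ≤ N + 1) {θ y : ℝ}
    (hθy : θ * (q + q * y) = a + b * y) : evalList g θ * (q + q * y) ^ N =
      ∑ k ∈ Finset.range (N + 1), (dot g (weights a b q N k) : ℝ) * y ^ k := by
  simp only [dot_weights hg, Nat.cast_sum, Nat.cast_mul, Finset.sum_mul]
  rw [Finset.sum_comm, evalList, Finset.sum_mul]
  refine Finset.sum_congr rfl fun d hd => ?_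
  have hd : d ≤ N := by have := Finset.mem_range.1 hd; omega
  rw [mul_assoc, ← Nat.add_sub_cancel' hd, pow_add, ← mul_assoc (θ ^ d), ← mul_pow, hθy,
    Nat.add_sub_cancel' hd, ← (omega_spec a b q hd).1, Finset.mul_sum]
  simp only [mul_assoc]

/-- The comparison of two distance distribution functions on an interval by functionals. -/
theorem evalList_lt_of_dot {g h : List ℕ} {a b q N : ℕ} (hg : g.length ≤ N + 1)
    (hh : h.length ≤ N + 1) (hq : 0 < q)
    (hle : ∀ k ≤ N, dot h (weights a b q N k) ≤ dot g (weights a b q N k))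
    (hlt : ∃ k ≤ N, dot h (weights a b q N k) < dot g (weights a b q N k))
    {θ : ℝ} (ha : (a : ℝ) / q < θ) (hb : θ < b / q) : evalList h θ < evalList g θ := by
  have hq' : (0 : ℝ) < q := by exact_mod_cast hq
  rw [div_lt_iff₀ hq'] at ha
  rw [lt_div_iff₀ hq'] at hb
  have hden : 0 < (b : ℝ) - θ * q := by linarith
  set y : ℝ := (θ * q - a) / (b - θ * q) with hy
  have hy0 : 0 < y := div_pos (by linarith) hden
  have hθy : θ * (q + q * y) = a + b * y := by
    have : y * (b - θ * q) = θ * q - a := div_mul_cancel₀ _ hden.ne'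
    linarith
  refine lt_of_mul_lt_mul_right (a := ((q : ℝ) + q * y) ^ N) ?_ (by positivity)
  rw [evalList_mul_pow hg hθy, evalList_mul_pow hh hθy]
  obtain ⟨k, hk, hk1⟩ := hlt
  refine Finset.sum_lt_sum (fun k hk => ?_) ⟨k, Finset.mem_range.2 (Nat.lt_succ_of_le hk), ?_⟩
  · have : (dot h (weights a b q N k) : ℝ) ≤ dot g (weights a b q N k) := by
      exact_mod_cast hle k (Nat.lt_succ_iff.1 (Finset.mem_range.1 hk))
    exact mul_le_mul_of_nonneg_right this (by positivity)
  · have : (dot h (weights a b q N k) : ℝ) < dot g (weights a b q N k) := by exact_mod_cast hk1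
    exact mul_lt_mul_of_pos_right this (by positivity)

/-- Abel summation. -/
theorem sum_mul_pow_eq (a : ℕ → ℝ) (x : ℝ) (n : ℕ) : ∑ k ∈ Finset.range n, a k * x ^ k =
    (1 - x) * ∑ k ∈ Finset.range n, (∑ j ∈ Finset.range (k + 1), a j) * x ^ k +
      (∑ j ∈ Finset.range n, a j) * x ^ n := by
  induction n with
  | zero => simp
  | succ n ih =>
    rw [Finset.sum_range_succ, ih, Finset.sum_range_succ _ n, Finset.sum_range_succ a n, pow_succ]
    ring

/-- If the first coefficients of a polynomial are negative and the others are positive, the quotient by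
a suitable power is increasing. -/
theorem sum_mul_pow_lt {c : ℕ → ℝ} {n s : ℕ} (h1 : ∀ k < n, k < s → c k ≤ 0)
    (h2 : ∀ k < n, s ≤ k → 0 ≤ c k) (h3 : ∃ k < n, k < s ∧ c k < 0) {x y : ℝ} (hx : 0 < x)
    (hxy : x < y) : (∑ k ∈ Finset.range n, c k * x ^ k) * y ^ s <
      (∑ k ∈ Finset.range n, c k * y ^ k) * x ^ s := by
  have hy : 0 < y := hx.trans hxy
  have hlow : ∀ k < s, y ^ k * x ^ s < x ^ k * y ^ s := fun k hk => by
    obtain ⟨d, rfl⟩ := Nat.exists_eq_add_of_lt hk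
    have : x ^ (d + 1) < y ^ (d + 1) := pow_lt_pow_left₀ hxy hx.le (by omega)
    have := mul_lt_mul_of_pos_left this (show 0 < x ^ k * y ^ k by positivity)
    calc y ^ k * x ^ (k + d + 1) = x ^ k * y ^ k * x ^ (d + 1) := by ring
      _ < x ^ k * y ^ k * y ^ (d + 1) := this
      _ = x ^ k * y ^ (k + d + 1) := by ring
  have hhigh : ∀ k, s ≤ k → x ^ k * y ^ s ≤ y ^ k * x ^ s := fun k hk => by
    obtain ⟨d, rfl⟩ := Nat.exists_eq_add_of_le hk
    have : x ^ d ≤ y ^ d := pow_le_pow_left₀ hx.le hxy.le d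
    have := mul_le_mul_of_nonneg_left this (show 0 ≤ x ^ s * y ^ s by positivity)
    rw [pow_add, pow_add]
    linarith
  rw [Finset.sum_mul, Finset.sum_mul]
  obtain ⟨k, hkn, hks, hk⟩ := h3
  refine Finset.sum_lt_sum (fun k hk => ?_) ⟨k, Finset.mem_range.2 hkn, ?_⟩
  · rw [mul_assoc, mul_assoc]
    rcases lt_or_ge k s with hks | hks
    · exact mul_le_mul_of_nonpos_left (hlow k hks).le (h1 k (Finset.mem_range.1 hk) hks)
    · exact mul_le_mul_of_nonneg_left (hhigh k hks) (h2 k (Finset.mem_range.1 hk) hks)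
  · rw [mul_assoc, mul_assoc]
    exact mul_lt_mul_of_neg_left (hlow k hks) hk

/-- `A_0 + ⋯ + A_k`. -/
def prefixSum (g : List ℕ) (k : ℕ) : ℕ := ∑ j ∈ Finset.range (k + 1), g.getD j 0

theorem continuous_evalList (g : List ℕ) : Continuous (evalList g) := by
  unfold evalList; fun_prop

/-- Two distance distribution functions cross exactly once in `(0, 1)` if their differences of partial
sums of coefficients change sign only once: these differences are the coefficients of the
difference of the functions after division by `1 - θ`. -/
theorem exists_unique_crossing {g h : List ℕ} {N s lo hi q : ℕ} (hg : g.length ≤ N + 1)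
    (hh : h.length ≤ N + 1) (hsum : prefixSum g N = prefixSum h N)
    (h1 : ∀ k < N + 1, k < s → prefixSum g k ≤ prefixSum h k)
    (h2 : ∀ k < N + 1, s ≤ k → prefixSum h k ≤ prefixSum g k)
    (h3 : ∃ k < N + 1, k < s ∧ prefixSum g k < prefixSum h k)
    (hlo : 0 < lo) (hlohi : lo ≤ hi) (hhi : hi < q)
    (h4 : scaled g lo q N ≤ scaled h lo q N) (h5 : scaled h hi q N ≤ scaled g hi q N) :
    ∃ θ : ℝ, (lo : ℝ) / q ≤ θ ∧ θ ≤ hi / q ∧ evalList g θ = evalList h θ ∧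
      (∀ x, 0 < x → x < θ → evalList g x < evalList h x) ∧
      ∀ x, θ < x → x < 1 → evalList h x < evalList g x := by
  have hq : 0 < q := by omega
  have hq' : (0 : ℝ) < q := by exact_mod_cast hq
  have hlo' : (0 : ℝ) < lo := by exact_mod_cast hlo
  have hlohi' : (lo : ℝ) ≤ hi := by exact_mod_cast hlohi
  have hhi' : (hi : ℝ) < q := by exact_mod_cast hhi
  set c : ℕ → ℝ := fun k => (prefixSum g k : ℝ) - prefixSum h k with hc
  have hdiff : ∀ x, evalList g x - evalList h x =
      (1 - x) * ∑ k ∈ Finset.range (N + 1), c k * x ^ k := fun x => by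
    rw [evalList_eq hg, evalList_eq hh, sum_mul_pow_eq (fun k => ((g.getD k 0 : ℕ) : ℝ)),
      sum_mul_pow_eq (fun k => ((h.getD k 0 : ℕ) : ℝ))]
    have e : ∀ (l : List ℕ) k, ∑ j ∈ Finset.range (k + 1), ((l.getD j 0 : ℕ) : ℝ) = prefixSum l k :=
      fun l k => by rw [prefixSum]; push_cast; rfl
    simp only [e, hsum, hc, sub_mul, Finset.sum_sub_distrib]
    ring
  have e1 : evalList g (lo / q) - evalList h (lo / q) ≤ 0 := by
    have : (scaled g lo q N : ℝ) ≤ scaled h lo q N := by exact_mod_cast h4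
    rw [scaled_eq hq hg, scaled_eq hq hh] at this
    have := le_of_mul_le_mul_left this (by positivity)
    linarith
  have e2 : 0 ≤ evalList g (hi / q) - evalList h (hi / q) := by
    have : (scaled h hi q N : ℝ) ≤ scaled g hi q N := by exact_mod_cast h5
    rw [scaled_eq hq hg, scaled_eq hq hh] at this
    have := le_of_mul_le_mul_left this (by positivity)
    linarith
  obtain ⟨θ, ⟨hθ1, hθ2⟩, hθ⟩ := intermediate_value_Icc
    (div_le_div_of_nonneg_right hlohi' hq'.le)
    ((continuous_evalList g).sub (continuous_evalList h)).continuousOn ⟨e1, e2⟩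
  have hθ : evalList g θ - evalList h θ = 0 := hθ
  have hθ0 : 0 < θ := (by positivity : (0 : ℝ) < lo / q).trans_le hθ1
  have hθ3 : θ < 1 := hθ2.trans_lt ((div_lt_one hq').2 hhi')
  have hroot : ∑ k ∈ Finset.range (N + 1), c k * θ ^ k = 0 := by
    rw [hdiff] at hθ
    exact (mul_eq_zero.1 hθ).resolve_left (by linarith)
  have hc1 : ∀ k < N + 1, k < s → c k ≤ 0 := fun k hk hks =>
    sub_nonpos.2 (by exact_mod_cast h1 k hk hks)
  have hc2 : ∀ k < N + 1, s ≤ k → 0 ≤ c k := fun k hk hks =>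
    sub_nonneg.2 (by exact_mod_cast h2 k hk hks)
  have hc3 : ∃ k < N + 1, k < s ∧ c k < 0 := by
    obtain ⟨k, hk, hks, hlt⟩ := h3
    exact ⟨k, hk, hks, sub_neg.2 (by exact_mod_cast hlt)⟩
  refine ⟨θ, hθ1, hθ2, by linarith, fun x hx hxθ => ?_, fun x hx hx1 => ?_⟩
  · have h6 := sum_mul_pow_lt hc1 hc2 hc3 hx hxθ
    rw [hroot, zero_mul] at h6
    have h7 : ∑ k ∈ Finset.range (N + 1), c k * x ^ k < 0 := by
      by_contra h
      exact absurd h6 (not_lt.2 (mul_nonneg (not_lt.1 h) (by positivity)))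
    have := hdiff x
    nlinarith
  · have h6 := sum_mul_pow_lt hc1 hc2 hc3 hθ0 hx
    rw [hroot, zero_mul] at h6
    have h7 : 0 < ∑ k ∈ Finset.range (N + 1), c k * x ^ k := (pos_iff_pos_of_mul_pos h6).2 (by positivity)
    have := hdiff x
    nlinarith

/-! ### Data on the crossover values -/

/-- Data on the crossover value `θ` of a row: `lo / q ≤ θ ≤ hi / q`, the row `base` has the same value at
`θ`, with the partial sums of coefficients changing sign at the index `sign`, and the row has greater
values than all preceding rows between `θ` and `bound / q`. -/
structure Crossing where
  base : ℕ
  sign : ℕ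
  lo : ℕ
  hi : ℕ
  bound : ℕ
  q : ℕ

/-- The crossover data; there are none for the first row of each size. -/
def crossings : List (Option Crossing) := [
  none, none, none, none, some ⟨3, 2, 83808, 83809, 100000, 100000⟩,
  some ⟨3, 2, 6471, 6472, 10000, 10000⟩, some ⟨3, 2, 1, 1, 2, 2⟩,
  some ⟨3, 2, 3939, 3940, 10000, 10000⟩, none, some ⟨8, 3, 9538, 9539, 10000, 10000⟩,
  some ⟨8, 3, 8156, 8157, 10000, 10000⟩, some ⟨8, 2, 6471, 6472, 10000, 10000⟩,
  some ⟨8, 2, 1, 1, 2, 2⟩, some ⟨8, 2, 3939, 3940, 10000, 10000⟩, some ⟨13, 2, 1, 1, 2, 2⟩,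
  some ⟨8, 2, 38878, 38879, 100000, 100000⟩, some ⟨8, 2, 3743, 3744, 10000, 10000⟩,
  some ⟨8, 2, 35636, 35637, 100000, 100000⟩, some ⟨8, 2, 335918, 335919, 1000000, 1000000⟩,
  some ⟨8, 2, 3140, 3141, 10000, 10000⟩, some ⟨8, 2, 29177, 29178, 100000, 100000⟩,
  some ⟨8, 2, 2698, 2699, 10000, 10000⟩, some ⟨8, 2, 2487, 2488, 10000, 10000⟩,
  some ⟨8, 2, 22905, 22906, 100000, 100000⟩, some ⟨8, 2, 21081, 21082, 100000, 100000⟩,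
  some ⟨8, 2, 19414, 19415, 100000, 100000⟩, some ⟨8, 2, 17902, 17903, 100000, 100000⟩, none,
  some ⟨27, 4, 948, 949, 1000, 1000⟩, some ⟨27, 4, 2664, 2665, 3000, 3000⟩,
  some ⟨27, 3, 78099, 78100, 100000, 100000⟩, some ⟨27, 3, 642, 643, 1000, 1000⟩,
  some ⟨27, 3, 1, 1, 2, 2⟩, some ⟨27, 2, 3939, 3940, 10000, 10000⟩, some ⟨33, 2, 56, 57, 100, 100⟩,
  some ⟨27, 2, 383, 384, 1000, 1000⟩, some ⟨27, 2, 356, 357, 1000, 1000⟩,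
  some ⟨27, 2, 322, 323, 1000, 1000⟩, some ⟨27, 2, 3200, 3201, 10000, 10000⟩,
  some ⟨27, 2, 312, 313, 1000, 1000⟩, some ⟨27, 2, 300, 301, 1000, 1000⟩,
  some ⟨27, 2, 28611, 28612, 100000, 100000⟩, some ⟨27, 2, 807, 808, 3000, 3000⟩,
  some ⟨27, 2, 248, 249, 1000, 1000⟩, some ⟨43, 2, 1, 1, 3, 3⟩,
  some ⟨27, 2, 2290, 2291, 10000, 10000⟩, some ⟨45, 2, 1, 1, 2, 2⟩,
  some ⟨27, 2, 210, 211, 1000, 1000⟩, some ⟨27, 2, 1941, 1942, 10000, 10000⟩,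
  some ⟨27, 2, 537, 538, 3000, 3000⟩, some ⟨49, 2, 1, 1, 2, 2⟩, some ⟨49, 2, 1, 1, 3, 3⟩,
  some ⟨49, 2, 1, 1, 4, 4⟩, some ⟨49, 2, 1, 1, 5, 5⟩, some ⟨27, 2, 534, 535, 3000, 3000⟩,
  some ⟨27, 2, 176, 177, 1000, 1000⟩, some ⟨27, 2, 521, 522, 3000, 3000⟩,
  some ⟨27, 2, 513, 514, 3000, 3000⟩, some ⟨27, 2, 504, 505, 3000, 3000⟩,
  some ⟨27, 2, 493, 494, 3000, 3000⟩, some ⟨27, 2, 161, 162, 1000, 1000⟩,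
  some ⟨27, 2, 157, 158, 1000, 1000⟩, some ⟨27, 2, 153, 154, 1000, 1000⟩,
  some ⟨27, 2, 149, 150, 1000, 1000⟩, some ⟨27, 2, 145, 146, 1000, 1000⟩,
  some ⟨27, 2, 1408, 1409, 10000, 10000⟩, some ⟨27, 2, 136, 137, 1000, 1000⟩,
  some ⟨27, 2, 132, 133, 1000, 1000⟩, some ⟨27, 2, 1282, 1283, 10000, 10000⟩,
  some ⟨27, 2, 1241, 1242, 10000, 10000⟩, some ⟨27, 2, 360, 361, 3000, 3000⟩,
  some ⟨27, 2, 348, 349, 3000, 3000⟩, some ⟨27, 2, 336, 337, 3000, 3000⟩,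
  some ⟨27, 2, 10837, 10838, 13000, 100000⟩, some ⟨73, 2, 1169, 1170, 10000, 10000⟩,
  some ⟨27, 2, 10453, 10454, 15000, 100000⟩, some ⟨75, 3, 1336, 1337, 10000, 10000⟩,
  some ⟨27, 2, 10131, 10132, 100000, 100000⟩, some ⟨27, 2, 9791, 9792, 100000, 100000⟩,
  some ⟨27, 2, 9462, 9463, 100000, 100000⟩, some ⟨27, 2, 9147, 9148, 100000, 100000⟩]

/-- The preceding rows with the same size of the sets. -/
def preceding (i t : ℕ) : List OptRow := (optTable.take i).filter fun h => decide (h.t = t)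

/-- Whether all functionals show that `g` is greater than `h`. -/
def dominates (g h : List ℕ) (ws : List (List ℕ)) : Bool :=
  andB (allB (fun w => Nat.ble (dot h w) (dot g w)) ws)
    (Bool.rec true false (allB (fun w => Nat.ble (dot g w) (dot h w)) ws))

/-- The row with distance distribution `g` has greater values between `c.lo / c.q` and `c.bound / c.q`
than the rows in the list; the row with distribution `b` is left out. -/
def leads (c : Crossing) (g b : List ℕ) (l : List OptRow) : Bool :=
  forceLists ((List.range 7).map (weights c.lo c.bound c.q 6)) fun ws =>
  allB (fun h => orB (dominates g h.dist ws) (decide (h.dist = b))) l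

/-- The crossover data of row `r` with respect to row `b`: the partial sums change sign once, the
values change their order between `lo / q` and `hi / q`, and these bounds are close enough to
determine the decimals in the table. -/
def Crossing.Ok (c : Crossing) (i : ℕ) (r b : OptRow) : Prop :=
  (c.base < i ∧ b.t = r.t) ∧ (0 < c.lo ∧ c.lo ≤ c.hi ∧ c.hi < c.bound ∧ c.bound ≤ c.q) ∧
  r.dist.length ≤ 7 ∧ b.dist.length ≤ 7 ∧ prefixSum r.dist 6 = prefixSum b.dist 6 ∧
  (∀ k < 7, k < c.sign → prefixSum r.dist k ≤ prefixSum b.dist k) ∧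
  (∀ k < 7, c.sign ≤ k → prefixSum b.dist k ≤ prefixSum r.dist k) ∧
  (∃ k < 7, k < c.sign ∧ prefixSum r.dist k < prefixSum b.dist k) ∧
  scaled r.dist c.lo c.q 6 ≤ scaled b.dist c.lo c.q 6 ∧
  scaled b.dist c.hi c.q 6 ≤ scaled r.dist c.hi c.q 6 ∧
  r.cross - 1 / (2 * 10 ^ r.digits) ≤ (c.lo : ℚ) / (c.lo + c.q) ∧
  (c.hi : ℚ) / (c.hi + c.q) ≤ r.cross + 1 / (2 * 10 ^ r.digits) ∧
  ∀ h ∈ preceding i r.t, h.n ≤ r.n ∧ h.dist.length ≤ 7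

instance (c : Crossing) (i : ℕ) (r b : OptRow) : Decidable (c.Ok i r b) := by
  unfold Crossing.Ok; infer_instance

/-- Beyond its bound, the row is beaten by the next one. -/
def Crossing.Linked (c : Crossing) (i : ℕ) (r : OptRow) : Prop :=
  c.bound = c.q ∨ ∃ h ∈ optTable[i + 1]?, h.t = r.t ∧ h.n = r.n ∧
    ∃ d ∈ (crossings[i + 1]?).join, d.hi * c.q < c.bound * d.q

instance (c : Crossing) (i : ℕ) (r : OptRow) : Decidable (c.Linked i r) := by
  unfold Crossing.Linked; infer_instance

/-- The check of the crossover data of the `i`-th row. -/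
def CrossingChecked (i : ℕ) : Prop :=
  ∃ r ∈ optTable[i]?, ∃ oc ∈ crossings[i]?, match oc with
    | none => preceding i r.t = [] ∧ r.cross = 0
    | some c => ∃ b ∈ optTable[c.base]?, c.Ok i r b ∧ c.Linked i r ∧
        leads c r.dist b.dist (preceding i r.t) = true

instance (i : ℕ) : Decidable (CrossingChecked i) := by
  unfold CrossingChecked
  have : ∀ (r : OptRow) (oc : Option Crossing), Decidable (match oc with
    | none => preceding i r.t = [] ∧ r.cross = 0
    | some c => ∃ b ∈ optTable[c.base]?, c.Ok i r b ∧ c.Linked i r ∧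
        leads c r.dist b.dist (preceding i r.t) = true) := fun r oc => by
    cases oc <;> infer_instance
  infer_instance

set_option maxRecDepth 100000 in
theorem crossingChecked_0 : ∀ i < 9, CrossingChecked (9 * 0 + i) := by decide +kernel

set_option maxRecDepth 100000 in
theorem crossingChecked_1 : ∀ i < 9, CrossingChecked (9 * 1 + i) := by decide +kernel

set_option maxRecDepth 100000 in
theorem crossingChecked_2 : ∀ i < 9, CrossingChecked (9 * 2 + i) := by decide +kernel

set_option maxRecDepth 100000 in
theorem crossingChecked_3 : ∀ i < 9, CrossingChecked (9 * 3 + i) := by decide +kernel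

set_option maxRecDepth 100000 in
theorem crossingChecked_4 : ∀ i < 9, CrossingChecked (9 * 4 + i) := by decide +kernel

set_option maxRecDepth 100000 in
theorem crossingChecked_5 : ∀ i < 9, CrossingChecked (9 * 5 + i) := by decide +kernel

set_option maxRecDepth 100000 in
theorem crossingChecked_6 : ∀ i < 9, CrossingChecked (9 * 6 + i) := by decide +kernel

set_option maxRecDepth 100000 in
theorem crossingChecked_7 : ∀ i < 9, CrossingChecked (9 * 7 + i) := by decide +kernel

set_option maxRecDepth 100000 in
theorem crossingChecked_8 : ∀ i < 9, CrossingChecked (9 * 8 + i) := by decide +kernel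

theorem crossingChecked {i : ℕ} (hi : i < 81) : CrossingChecked i := by
  have h : ∀ k < 9, ∀ i < 9, CrossingChecked (9 * k + i) := fun k hk => by
    interval_cases k
    · exact crossingChecked_0
    · exact crossingChecked_1
    · exact crossingChecked_2
    · exact crossingChecked_3
    · exact crossingChecked_4
    · exact crossingChecked_5
    · exact crossingChecked_6
    · exact crossingChecked_7
    · exact crossingChecked_8
  have := h (i / 9) (by omega) (i % 9) (Nat.mod_lt _ (by norm_num))
  rwa [Nat.div_add_mod] at this

/-! ### Rows with maximal value -/

/-- The common value at `θ` of the sets of a row. -/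
def rowValue (i : Fin optTable.length) (x : ℝ) : ℝ := evalList (optRow i).dist x

theorem continuous_rowValue (i : Fin optTable.length) : Continuous (rowValue i) :=
  continuous_evalList _

theorem getElem?_optRow (i : Fin optTable.length) : optTable[(i : ℕ)]? = some (optRow i) := by
  rw [List.getElem?_eq_getElem i.isLt]; rfl

theorem optRow_mem (i : Fin optTable.length) : optRow i ∈ optTable := List.get_mem _ _

theorem exists_optRow {i : ℕ} {r : OptRow} (h : optTable[i]? = some r) :
    ∃ hi : i < optTable.length, optRow ⟨i, hi⟩ = r := by
  obtain ⟨hi, h⟩ := List.getElem?_eq_some_iff.1 h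
  exact ⟨hi, h⟩

theorem mem_preceding {i j : Fin optTable.length} (hij : j < i) (ht : (optRow j).t = (optRow i).t) :
    optRow j ∈ preceding i (optRow i).t := by
  refine List.mem_filter.2 ⟨?_, by simpa using ht⟩
  rw [List.mem_take_iff_getElem]
  exact ⟨j, lt_min hij j.isLt, rfl⟩

/-- The point up to which a row has greater values than the preceding ones. -/
def leadBound (i : ℕ) : ℝ := ((crossings[i]?).join.map fun c => (c.bound : ℝ) / c.q).getD 1

/-- `θ i` is the point from which on the `i`-th row has greater values than all preceding rows with the
same `t`; but it has greater values only up to `u i`. -/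
structure Thresholds (θ u : Fin optTable.length → ℝ) : Prop where
  nonneg : ∀ i, 0 ≤ θ i
  lt_bound : ∀ i, θ i < u i
  bound_le : ∀ i, u i ≤ 1
  cross : ∀ i, |θ i / (1 + θ i) - ((optRow i).cross : ℝ)| ≤ 1 / (2 * 10 ^ (optRow i).digits)
  tie : ∀ i, θ i = 0 ∨ ∃ j < i, (optRow j).t = (optRow i).t ∧ rowValue i (θ i) = rowValue j (θ i) ∧
    ∀ x, 0 < x → x < θ i → rowValue i x < rowValue j x
  lead : ∀ i, ∀ j < i, (optRow j).t = (optRow i).t → ∀ x, θ i < x → x < u i →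
    rowValue j x < rowValue i x
  link : ∀ i, u i = 1 ∨ ∃ j > i, (optRow j).t = (optRow i).t ∧ (optRow j).n = (optRow i).n ∧ θ j < u i
  n_le : ∀ i, ∀ j < i, (optRow j).t = (optRow i).t → (optRow j).n ≤ (optRow i).n

/-- A leading row has greater values on the whole interval. -/
theorem dominates_sound {c : Crossing} {g b : List ℕ} {l : List OptRow} (hq : 0 < c.q)
    (hl : leads c g b l = true) (hg : g.length ≤ 7) {h : OptRow} (hh : h ∈ l) (hh7 : h.dist.length ≤ 7)
    {x : ℝ} (hx : (c.lo : ℝ) / c.q < x) (hx' : x < c.bound / c.q) :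
    evalList h.dist x < evalList g x ∨ h.dist = b := by
  rw [leads, forceLists_eq, allB_iff] at hl
  have h1 := hl h hh
  rw [orB_eq, Bool.or_eq_true, decide_eq_true_iff] at h1
  refine h1.imp (fun h1 => ?_) id
  rw [dominates, andB_eq, Bool.and_eq_true] at h1
  obtain ⟨h2, h3⟩ := h1
  have h4 : ¬ ∀ w ∈ (List.range 7).map (weights c.lo c.bound c.q 6),
      Nat.ble (dot g w) (dot h.dist w) = true := by
    rw [← allB_iff]
    intro h4
    rw [h4] at h3
    exact Bool.false_ne_true h3
  push Not at h4
  obtain ⟨w, hw, h4⟩ := h4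
  obtain ⟨k, hk, rfl⟩ := List.mem_map.1 hw
  refine evalList_lt_of_dot (N := 6) hg hh7 hq (fun k hk => ?_)
    ⟨k, Nat.lt_succ_iff.1 (List.mem_range.1 hk), ?_⟩ hx hx'
  · exact Nat.le_of_ble_eq_true (allB_iff.1 h2 _
      (List.mem_map_of_mem (List.mem_range.2 (Nat.lt_succ_of_le hk))))
  · exact not_le.1 fun h => h4 (Nat.ble_eq_true_of_le h)

/-- Each row has a crossover value; this is where the checked data of the row are used. -/
theorem exists_threshold (i : Fin optTable.length) : ∃ θ : ℝ, 0 ≤ θ ∧ θ < leadBound i ∧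
    leadBound i ≤ 1 ∧ |θ / (1 + θ) - ((optRow i).cross : ℝ)| ≤ 1 / (2 * 10 ^ (optRow i).digits) ∧
    (θ = 0 ∨ ∃ j < i, (optRow j).t = (optRow i).t ∧ rowValue i θ = rowValue j θ ∧
      ∀ x, 0 < x → x < θ → rowValue i x < rowValue j x) ∧
    (∀ j < i, (optRow j).t = (optRow i).t → ∀ x, θ < x → x < leadBound i →
      rowValue j x < rowValue i x) ∧
    (∀ c ∈ (crossings[(i : ℕ)]?).join, θ ≤ c.hi / c.q) ∧
    (leadBound i = 1 ∨ ∃ j > i, (optRow j).t = (optRow i).t ∧ (optRow j).n = (optRow i).n ∧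
      ∃ d ∈ (crossings[(j : ℕ)]?).join, (d.hi / d.q : ℝ) < leadBound i) ∧
    ∀ j < i, (optRow j).t = (optRow i).t → (optRow j).n ≤ (optRow i).n := by
  obtain ⟨r, hr, oc, hoc, h⟩ := crossingChecked (i.isLt.trans_eq length_optTable)
  rw [getElem?_optRow] at hr
  obtain rfl := Option.some.inj hr
  have hoc : crossings[(i : ℕ)]? = some oc := hoc
  rcases oc with _ | c
  · obtain ⟨h1, h2⟩ := h
    have hb : leadBound i = 1 := by simp [leadBound, hoc]
    have h0 : ∀ j < i, ¬ (optRow j).t = (optRow i).t := fun j hj ht => by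
      have := mem_preceding hj ht
      rw [h1] at this
      exact absurd this (List.not_mem_nil)
    refine ⟨0, le_rfl, by rw [hb]; norm_num, hb.le, ?_, Or.inl rfl, fun j hj ht => absurd ht (h0 j hj),
      ?_, Or.inl hb, fun j hj ht => absurd ht (h0 j hj)⟩
    · rw [h2]
      simp only [zero_div, Rat.cast_zero, sub_zero, abs_zero]
      positivity
    · simp [hoc]
  · obtain ⟨b, hb, ⟨⟨hbi, hbt⟩, ⟨hlo, hlohi, hhib, hbq⟩, hr7, hb7, hsum, h1, h2, h3, h4, h5, h6, h7, h8⟩,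
      hlink, hlead⟩ := h
    have hb : optTable[c.base]? = some b := hb
    obtain ⟨hbl, rfl⟩ := exists_optRow hb
    have hq : (0 : ℝ) < c.q := by exact_mod_cast (by omega : 0 < c.q)
    have hub : leadBound i = c.bound / c.q := by simp [leadBound, hoc]
    have hub1 : leadBound i ≤ 1 := by
      rw [hub, div_le_one hq]; exact_mod_cast hbq
    obtain ⟨θ, hθ1, hθ2, hθ3, hθ4, hθ5⟩ := exists_unique_crossing (N := 6) hr7 hb7 hsum h1 h2 h3 hlo hlohi
      (by omega) h4 h5
    have hlo' : (0 : ℝ) < c.lo := by exact_mod_cast hlo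
    have hθ0 : 0 < θ := lt_of_lt_of_le (by positivity) hθ1
    refine ⟨θ, hθ0.le, ?_, hub1, ?_, Or.inr ⟨⟨c.base, hbl⟩, hbi, hbt, hθ3, hθ4⟩, ?_, ?_, ?_, ?_⟩
    · rw [hub]
      refine hθ2.trans_lt (div_lt_div_of_pos_right ?_ hq)
      exact_mod_cast hhib
    · have e6 : ((optRow i).cross : ℝ) - 1 / (2 * 10 ^ (optRow i).digits) ≤ c.lo / (c.lo + c.q) := by
        have := (Rat.cast_le (K := ℝ)).2 h6
        push_cast at this
        exact this
      have e7 : (c.hi : ℝ) / (c.hi + c.q) ≤ (optRow i).cross + 1 / (2 * 10 ^ (optRow i).digits) := by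
        have := (Rat.cast_le (K := ℝ)).2 h7
        push_cast at this
        exact this
      have e8 : (c.lo : ℝ) / (c.lo + c.q) ≤ θ / (1 + θ) := by
        rw [div_le_iff₀ hq] at hθ1
        rw [div_le_div_iff₀ (by positivity) (by positivity)]
        nlinarith
      have e9 : θ / (1 + θ) ≤ c.hi / (c.hi + c.q) := by
        rw [le_div_iff₀ hq] at hθ2
        rw [div_le_div_iff₀ (by positivity) (by positivity)]
        nlinarith
      rw [abs_le]
      constructor <;> linarith
    · intro j hj ht x hx hxu
      have hjp := mem_preceding hj ht
      rcases dominates_sound (by omega) hlead hr7 hjp (h8 _ hjp).2 (hθ1.trans_lt hx) (hub ▸ hxu) with h | h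
      · exact h
      · rw [rowValue, h]
        exact hθ5 x hx (hxu.trans_le hub1)
    · intro d hd
      simp only [hoc, Option.join_some, Option.mem_def, Option.some.injEq] at hd
      rwa [← hd]
    · refine hlink.imp (fun h => ?_) fun h => ?_
      · rw [hub, h, div_self hq.ne']
      · obtain ⟨h, hh, ht, hn, d, hd, hdc⟩ := h
        obtain ⟨hl, rfl⟩ := exists_optRow hh
        refine ⟨⟨i + 1, hl⟩, Nat.lt_succ_self _, ht, hn, d, hd, ?_⟩
        have hdq : 0 < d.q := Nat.pos_of_ne_zero fun h0 => by simp [h0] at hdc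
        rw [hub, div_lt_div_iff₀ (by exact_mod_cast hdq) hq]
        exact_mod_cast hdc
    · intro j hj ht
      exact (h8 _ (mem_preceding hj ht)).1

theorem exists_thresholds : ∃ θ u, Thresholds θ u := by
  choose θ h1 h2 h3 h4 h5 h6 h7 h8 h9 using exists_threshold
  refine ⟨θ, fun i => leadBound i, h1, h2, h3, h4, h5, h6, fun i => (h8 i).imp id ?_, h9⟩
  rintro ⟨j, hj, ht, hn, d, hd, hlt⟩
  exact ⟨j, hj, ht, hn, (h7 j d hd).trans_lt hlt⟩

namespace Thresholds

variable {θ u : Fin optTable.length → ℝ}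

/-- By continuity, the row is not worse at the crossover value itself. -/
theorem lead_le (H : Thresholds θ u) {i j : Fin optTable.length} (hj : j < i) (ht : (optRow j).t = (optRow i).t) {x : ℝ}
    (hx : θ i ≤ x) (hxu : x < u i) : rowValue j x ≤ rowValue i x := by
  rcases hx.eq_or_lt with rfl | hx
  · refine ContinuousWithinAt.closure_le (s := Set.Ioo (θ i) (u i)) ?_
      (continuous_rowValue j).continuousWithinAt (continuous_rowValue i).continuousWithinAt
      fun y hy => (H.lead i j hj ht y hy.1 hy.2).le
    rw [closure_Ioo (H.lt_bound i).ne]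
    exact ⟨le_rfl, (H.lt_bound i).le⟩
  · exact (H.lead i j hj ht x hx hxu).le

/-- Which of the rows available in dimension `n` have the greatest value at `x`. -/
theorem maximal_iff (H : Thresholds θ u) {n : ℕ} {x : ℝ} (hx : 0 < x) (hx1 : x < 1) {i : Fin optTable.length}
    (hi : (optRow i).n ≤ n) :
    (∀ j, (optRow j).t = (optRow i).t → (optRow j).n ≤ n → rowValue j x ≤ rowValue i x) ↔
      θ i ≤ x ∧ ∀ j > i, (optRow j).t = (optRow i).t → (optRow j).n ≤ n → x ≤ θ j := by
  constructor
  · intro hmax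
    refine ⟨?_, fun j => ?_⟩
    · rcases H.tie i with h0 | ⟨j, hj, ht, -, hlt⟩
      · rw [h0]; exact hx.le
      · by_contra h
        exact absurd (hlt x hx (not_le.1 h)) (not_lt.2 (hmax j ht ((H.n_le i j hj ht).trans hi)))
    · -- A row that leads only up to some point is followed by one in the same dimension that leads
      -- from there on.
      induction j using WellFoundedGT.induction with
      | ind j ih =>
        intro hj ht hn
        by_contra h
        rcases lt_or_ge x (u j) with hxu | hxu
        · exact absurd (H.lead j i hj ht.symm x (not_le.1 h) hxu) (not_lt.2 (hmax j ht hn))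
        · rcases H.link j with h1 | ⟨k, hk, hkt, hkn, hlt⟩
          · linarith
          · have := ih k hk (hj.trans hk) (hkt.trans ht) (hkn.trans_le hn)
            linarith
  · rintro ⟨h1, h2⟩
    -- Take the first one of the best rows.
    let s := Finset.univ.filter fun j => (optRow j).t = (optRow i).t ∧ (optRow j).n ≤ n
    have hs : s.Nonempty := ⟨i, Finset.mem_filter.2 ⟨Finset.mem_univ _, rfl, hi⟩⟩
    obtain ⟨m, hm, hmmax⟩ := s.exists_max_image (fun j => rowValue j x) hs
    let s' := s.filter fun j => rowValue j x = rowValue m x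
    have hs' : s'.Nonempty := ⟨m, Finset.mem_filter.2 ⟨hm, rfl⟩⟩
    obtain ⟨k, hk', hkmin⟩ : ∃ k ∈ s', ∀ j ∈ s', k ≤ j :=
      ⟨_, Finset.min'_mem s' hs', fun j hj => Finset.min'_le _ _ hj⟩
    obtain ⟨hk, hkm⟩ := Finset.mem_filter.1 hk'
    obtain ⟨-, hkt, hkn⟩ := Finset.mem_filter.1 hk
    have hle : rowValue k x ≤ rowValue i x := by
      rcases lt_trichotomy k i with hki | rfl | hki
      · refine H.lead_le hki hkt h1 ?_
        rcases H.link i with h | ⟨j, hj, hjt, hjn, hlt⟩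
        · rw [h]; exact hx1
        · exact (h2 j hj hjt (hjn.trans_le hi)).trans_lt hlt
      · exact le_rfl
      · exfalso
        have hxk := h2 k hki hkt hkn
        rcases H.tie k with h0 | ⟨j, hj, ht, heq, hlt⟩
        · linarith
        · have hjs : j ∈ s := Finset.mem_filter.2 ⟨Finset.mem_univ _, ht.trans hkt,
            (H.n_le k j hj ht).trans hkn⟩
          rcases hxk.eq_or_lt with hxk | hxk
          · rw [← hxk] at heq
            exact absurd (hkmin j (Finset.mem_filter.2 ⟨hjs, heq.symm.trans hkm⟩)) (not_le.2 hj)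
          · have := hlt x hx hxk
            have := hmmax j hjs
            linarith
    intro j ht hn
    have := hmmax j (Finset.mem_filter.2 ⟨Finset.mem_univ _, ht, hn⟩)
    linarith

end Thresholds

/-! ### Crossover probabilities and optimal sets -/

theorem n_le_of_row (i : Fin optTable.length) : (optRow i).n ≤ 63 :=
  (consistent (optRow_mem i)).2.1.2

theorem exists_set (i : Fin optTable.length) : ∃ G, G ∈ (optRow i).sets :=
  List.exists_mem_of_ne_nil _ (consistent (optRow_mem i)).2.2.2.2.2.2.1

theorem threshold_le_iff {τ p : ℝ} (hτ : 0 ≤ τ) (hp : p < 1) : τ / (1 + τ) ≤ p ↔ τ ≤ p / (1 - p) := by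
  have : 0 < 1 - p := by linarith
  rw [div_le_iff₀ (by linarith), le_div_iff₀ this]
  constructor <;> intro h <;> nlinarith

theorem le_threshold_iff {τ p : ℝ} (hτ : 0 ≤ τ) (hp : p < 1) : p ≤ τ / (1 + τ) ↔ p / (1 - p) ≤ τ := by
  have : 0 < 1 - p := by linarith
  rw [le_div_iff₀ (by linarith), div_le_iff₀ this]
  constructor <;> intro h <;> nlinarith

theorem odds_mem {p : ℝ} (hp : p ∈ Set.Ioo (0 : ℝ) (1 / 2)) : 0 < p / (1 - p) ∧ p / (1 - p) < 1 := by
  have : 0 < 1 - p := by linarith [hp.2]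
  exact ⟨div_pos hp.1 this, by rw [div_lt_one this]; linarith [hp.2]⟩

/-- Comparing sets of two rows of the same size means comparing the values of the rows. -/
theorem collisionProb_generated_le_iff {i j : Fin optTable.length} (ht : (optRow j).t = (optRow i).t)
    {G H : List ℕ} (hG : G ∈ (optRow i).sets) (hH : H ∈ (optRow j).sets) {n : ℕ}
    (hi : (optRow i).n ≤ n) (hj : (optRow j).n ≤ n) (hn : n ≤ 64) {p : ℝ} (hp : p < 1) :
    collisionProb (generated n H) p ≤ collisionProb (generated n G) p ↔
      rowValue j (p / (1 - p)) ≤ rowValue i (p / (1 - p)) := by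
  have h1 := card_generated (optRow_mem i) hG hi hn
  have h2 := card_generated (optRow_mem j) hH hj hn
  rw [collisionProb_le_iff (by rw [h1, h2, ht]) (by rw [h1]; positivity) hp,
    cubeSum_generated (optRow_mem i) hG hi hn, cubeSum_generated (optRow_mem j) hH hj hn]
  rfl

/-- In terms of the odds `θ = p / (1 - p)`, beating the preceding rows is a condition on the values
of the rows. -/
theorem mem_beatsPreceding {θ u : Fin optTable.length → ℝ} (H : Thresholds θ u)
    {i : Fin optTable.length} {p : ℝ} : p ∈ beatsPreceding i ↔ p ∈ Set.Ioo (0 : ℝ) (1 / 2) ∧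
      ∀ j < i, (optRow j).t = (optRow i).t →
        rowValue j (p / (1 - p)) < rowValue i (p / (1 - p)) := by
  refine and_congr_right fun hp => forall₃_congr fun j hj ht => ?_
  have hn : (optRow i).n ≤ 64 := (n_le_of_row i).trans (by norm_num)
  have hp1 : p < 1 := by linarith [hp.2]
  have key : ∀ G ∈ (optRow i).sets, ∀ H' ∈ (optRow j).sets,
      (collisionProb (generated (optRow i).n H') p < collisionProb (generated (optRow i).n G) p ↔
        rowValue j (p / (1 - p)) < rowValue i (p / (1 - p))) := fun G hG H' hH' => by
    rw [← not_le, ← not_le, collisionProb_generated_le_iff ht.symm hH' hG (H.n_le i j hj ht) le_rfl hn hp1]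
  constructor
  · intro h
    obtain ⟨G, hG⟩ := exists_set i
    obtain ⟨H', hH'⟩ := exists_set j
    exact (key G hG H' hH').1 (h G hG H' hH')
  · intro h G hG H' hH'
    exact (key G hG H' hH').2 h

/-- The crossover value, as a probability, is the infimum in question: in terms of the odds, the row
has lower or equal values than some preceding row up to `θ i`, and greater ones immediately after
it. -/
theorem isGLB_beatsPreceding {θ u : Fin optTable.length → ℝ} (H : Thresholds θ u)
    (i : Fin optTable.length) : IsGLB (beatsPreceding i) (θ i / (1 + θ i)) := by
  have h0 := H.nonneg i
  constructor
  · intro p hp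
    obtain ⟨hp, hlt⟩ := (mem_beatsPreceding H).1 hp
    rw [threshold_le_iff h0 (by linarith [hp.2])]
    rcases H.tie i with h | ⟨j, hj, ht, -, h⟩
    · rw [h]; exact (odds_mem hp).1.le
    · by_contra h1
      exact absurd (hlt j hj ht) (not_lt.2 (h _ (odds_mem hp).1 (not_le.1 h1)).le)
  · intro c hc
    by_contra hlt
    -- Between the threshold and the bound, the row beats all preceding ones.
    have hu := H.lt_bound i
    have hu1 := H.bound_le i
    have hγ : θ i / (1 + θ i) < u i / (1 + u i) := by
      rw [div_lt_div_iff₀ (by linarith) (by linarith)]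
      linarith
    have hu2 : u i / (1 + u i) ≤ 1 / 2 := by
      rw [div_le_div_iff₀ (by linarith) (by norm_num)]
      linarith
    obtain ⟨p, hp1, hp2⟩ := exists_between (lt_min (not_le.1 hlt) hγ)
    obtain ⟨hpc, hpu⟩ := lt_min_iff.1 hp2
    have hp : p ∈ Set.Ioo (0 : ℝ) (1 / 2) :=
      ⟨lt_of_le_of_lt (div_nonneg h0 (by linarith)) hp1, by linarith⟩
    refine absurd (hc ((mem_beatsPreceding H).2 ⟨hp, fun j hj ht => H.lead i j hj ht _ ?_ ?_⟩))
      (not_le.2 hpc)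
    · rwa [← not_le, ← le_threshold_iff h0 (by linarith [hp.2]), not_le]
    · rwa [← not_le, ← threshold_le_iff (h0.trans hu.le) (by linarith [hp.2]), not_le]

/-- The members of a right-shifted down-set form a family closed under the partial order. -/
theorem supports_dom {n : ℕ} {T : Finset (BitCube n)} (h1 : IsDownSet T) (h2 : IsRightShifted T)
    {x y : Finset ℕ} (hy : y ∈ supports T) (hxy : Dom x y) : x ∈ supports T := by
  obtain ⟨b, hb, rfl⟩ := Finset.mem_image.1 hy
  obtain ⟨a, rfl⟩ := exists_supp (hxy.lt fun e he => supp_lt he)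
  refine Finset.mem_image_of_mem _ ?_
  have h := below_iff.2 hxy
  clear hxy
  induction h with
  | refl => exact hb
  | clear x i _ ih => exact h1 i x ih
  | shift x i j _ ih => exact h2 i j x ih

/-- The supports of a right-shifted down-set form a family, where `m` is the number of its points of
weight one. -/
theorem exists_isFamily {t n : ℕ} {T : Finset (BitCube n)} (h1 : IsDownSet T) (h2 : IsRightShifted T)
    (hT : T.card = 2 ^ t) : ∃ m ≤ n, t ≤ m ∧ IsFamily t m (supports T) := by
  classical
  have hlt : ∀ x ∈ supports T, ∀ e ∈ x, e < n := fun x hx e he => by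
    obtain ⟨b, -, rfl⟩ := Finset.mem_image.1 hx
    exact supp_lt he
  have hex : ∃ m, {m} ∉ supports T :=
    ⟨n, fun h => lt_irrefl n (hlt _ h n (Finset.mem_singleton_self n))⟩
  have hm := Nat.find_spec hex
  have hmin : ∀ e < Nat.find hex, {e} ∈ supports T := fun e he => not_not.1 (Nat.find_min hex he)
  have hmn : Nat.find hex ≤ n := Nat.find_min' hex fun h =>
    lt_irrefl n (hlt _ h n (Finset.mem_singleton_self n))
  set m := Nat.find hex
  have hltm : ∀ x ∈ supports T, ∀ e ∈ x, e < m := fun x hx e he => by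
    by_contra h
    refine hm (supports_dom h1 h2 (supports_dom h1 h2 hx
      (Dom.of_subset (Finset.singleton_subset_iff.2 he))) ?_)
    have := Dom.insert_erase (y := {e}) (a := e) (b := m)
    rcases (not_lt.1 h).eq_or_lt with h | h
    · rw [h]; exact Dom.refl _
    · simpa using this h.le (Finset.mem_singleton_self e) (by simpa using h.ne)
  have hcard : (supports T).card = 2 ^ t := (card_supports T).trans hT
  refine ⟨m, hmn, ?_, hltm, hmin, fun y hy x hxy => supports_dom h1 h2 hy hxy, hcard⟩
  have : (supports T).card ≤ (Finset.range m).powerset.card :=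
    Finset.card_le_card fun x hx => Finset.mem_powerset.2 fun e he => Finset.mem_range.2 (hltm x hx e he)
  rw [hcard, Finset.card_powerset, Finset.card_range] at this
  exact (Nat.pow_le_pow_iff_right (by norm_num)).1 this

/-- A family all of whose members with at least two elements lie below generators of a set of a row in
the same dimension is the family of this set. -/
theorem eq_generatedFamily {t m : ℕ} {F : Finset (Finset ℕ)} (hF : IsFamily t m F)
    {i : Fin optTable.length} (ht : (optRow i).t = t) (hn : (optRow i).n = m) {G : List ℕ}
    (hG : G ∈ (optRow i).sets)
    (h : ∀ x ∈ F, 2 ≤ x.card → ∃ y ∈ G.map bitsOf, Dom x y.toFinset) : F = generatedFamily G := by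
  refine Finset.eq_of_subset_of_card_le (fun x hx => ?_) ?_
  · rw [mem_generatedFamily]
    rcases le_or_gt 2 x.card with h2 | h2
    · obtain ⟨y, hy, hxy⟩ := h x hx h2
      obtain ⟨g, hg, rfl⟩ := List.mem_map.1 hy
      exact ⟨g, hg, hxy⟩
    · obtain ⟨-, -, g, hg, hhead⟩ := (consistent (optRow_mem i)).2.2.2.2.2.2.2 G hG
      refine ⟨g, hg, ?_⟩
      have hmem : m - 1 ∈ (bitsOf g).toFinset := by
        rw [List.mem_toFinset, ← hn]
        exact List.mem_of_mem_head? hhead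
      refine Dom.trans ?_ (Dom.of_subset (Finset.singleton_subset_iff.2 hmem))
      rcases Nat.eq_zero_or_pos x.card with h0 | h0
      · rw [Finset.card_eq_zero.1 h0]
        exact Dom.of_subset (Finset.empty_subset _)
      · obtain ⟨e, rfl⟩ := Finset.card_eq_one.1 (by omega : x.card = 1)
        have he := hF.lt _ hx e (Finset.mem_singleton_self e)
        rcases (show e ≤ m - 1 by omega).eq_or_lt with h | h
        · rw [h]; exact Dom.refl _
        · simpa using Dom.insert_erase (y := {m - 1}) h.le (Finset.mem_singleton_self _)
            (by simpa using h.ne)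
  · rw [(row_card_and_farPairs (optRow_mem i) hG).1, hF.card, ht]

theorem supports_injective {n : ℕ} {S T : Finset (BitCube n)} (h : supports S = supports T) : S = T :=
  Finset.image_injective supp_injective h

/-- An optimal right-shifted down-set is listed in the table. -/
theorem exists_row_of_ideal {t n : ℕ} (ht : 1 ≤ t) (ht6 : t ≤ 6) (hn : n < 2 ^ t) {p : ℝ}
    (hp : p ∈ Set.Ioo (0 : ℝ) (1 / 2)) {T : Finset (BitCube n)} (hT : T.card = 2 ^ t)
    (hopt : IsOptimalFor T p) (h1 : IsDownSet T) (h2 : IsRightShifted T) :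
    ∃ i : Fin optTable.length, (optRow i).t = t ∧ (optRow i).n ≤ n ∧
      ∃ G ∈ (optRow i).sets, T = generated n G := by
  have hn64 : n ≤ 64 := by
    have : (2 : ℕ) ^ t ≤ 2 ^ 6 := Nat.pow_le_pow_right (by norm_num) ht6
    omega
  obtain ⟨m, hmn, htm, hF⟩ := exists_isFamily h1 h2 hT
  rcases family_beaten ht ht6 (hmn.trans_lt hn) htm hF with ⟨G, hG, hdom⟩ | hbeat
  · obtain ⟨G', hG', rfl⟩ := List.mem_map.1 hG
    obtain ⟨r, hr, hG'⟩ := List.mem_flatMap.1 hG'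
    obtain ⟨hr, hrtn⟩ := List.mem_filter.1 hr
    obtain ⟨hrt, hrn⟩ := of_decide_eq_true hrtn
    obtain ⟨i, rfl⟩ := List.get_of_mem hr
    refine ⟨i, hrt, hrn.trans_le hmn, G', hG', supports_injective ?_⟩
    rw [eq_generatedFamily hF (i := i) hrt hrn hG' hdom,
      supports_generated_row (optRow_mem i) hG' (hrn.trans_le hmn) hn64]
  · exfalso
    obtain ⟨hθ0, hθ1⟩ := odds_mem hp
    obtain ⟨k, r, hr, hrt, hrn, hlt⟩ := hbeat _ hθ0 hθ1
    obtain ⟨hk, rfl⟩ := exists_optRow hr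
    obtain ⟨G, hG⟩ := exists_set ⟨k, hk⟩
    have hc := card_generated (optRow_mem ⟨k, hk⟩) hG (hrn.trans hmn) hn64
    have hle := hopt (generated n G) (by rw [hc, hrt, hT])
    rw [collisionProb_le_iff (by rw [hc, hrt, hT]) (by rw [hT]; positivity) (by linarith [hp.2]),
      cubeSum_generated (optRow_mem ⟨k, hk⟩) hG (hrn.trans hmn) hn64, cubeSum_eq] at hle
    exact absurd hlt (not_lt.2 hle)

/-- Optimal sets are isomorphic to sets of rows of the table. -/
theorem exists_row_of_isOptimalFor {t n : ℕ} (ht : 1 ≤ t) (ht6 : t ≤ 6) (hn : n < 2 ^ t) {p : ℝ}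
    (hp : p ∈ Set.Ioo (0 : ℝ) (1 / 2)) {S : Finset (BitCube n)} (hS : S.card = 2 ^ t)
    (hopt : IsOptimalFor S p) : ∃ i : Fin optTable.length, (optRow i).t = t ∧ (optRow i).n ≤ n ∧
      ∃ G ∈ (optRow i).sets, Isomorphic S (generated n G) := by
  obtain ⟨T, hST, hT, h1, h2⟩ := exists_isomorphic_ideal hp.1 hp.2 hopt
  obtain ⟨i, hi, hin, G, hG, rfl⟩ :=
    exists_row_of_ideal ht ht6 hn hp (hST.invariant.1.trans hS) hT h1 h2
  exact ⟨i, hi, hin, G, hG, hST⟩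

/-- The optimal sets are the ones of the rows with maximal value, for there is an optimal set, and
it is listed. -/
theorem isOptimalFor_iff {θ u : Fin optTable.length → ℝ} (H : Thresholds θ u) {t n : ℕ} (ht : 1 ≤ t)
    (ht6 : t ≤ 6) (hn : n < 2 ^ t) {p : ℝ} (hp : p ∈ Set.Ioo (0 : ℝ) (1 / 2))
    {S : Finset (BitCube n)} (hS : S.card = 2 ^ t) :
    IsOptimalFor S p ↔ ∃ i : Fin optTable.length, (optRow i).t = t ∧ (optRow i).n ≤ n ∧
      θ i / (1 + θ i) ≤ p ∧
      (∀ j > i, (optRow j).t = t → (optRow j).n ≤ n → p ≤ θ j / (1 + θ j)) ∧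
      ∃ G ∈ (optRow i).sets, Isomorphic S (generated n G) := by
  have hp1 : p < 1 := by linarith [hp.2]
  have hn64 : n ≤ 64 := by
    have : (2 : ℕ) ^ t ≤ 2 ^ 6 := Nat.pow_le_pow_right (by norm_num) ht6
    omega
  obtain ⟨hθ0, hθ1⟩ := odds_mem hp
  simp only [threshold_le_iff (H.nonneg _) hp1, le_threshold_iff (H.nonneg _) hp1]
  constructor
  · intro hopt
    obtain ⟨i, rfl, hin, G, hG, hiso⟩ := exists_row_of_isOptimalFor ht ht6 hn hp hS hopt
    have hmax := (H.maximal_iff hθ0 hθ1 hin).1 fun j hjt hjn => by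
      obtain ⟨G', hG'⟩ := exists_set j
      rw [← collisionProb_generated_le_iff hjt hG hG' hin hjn hn64 hp1, hiso.invariant.2 p]
      exact hopt _ (by rw [card_generated (optRow_mem j) hG' hjn hn64, hS, hjt])
    exact ⟨i, rfl, hin, hmax.1, hmax.2, G, hG, hiso⟩
  · rintro ⟨i, rfl, hin, h1, h2, G, hG, hiso⟩ R hR
    have hmax := (H.maximal_iff hθ0 hθ1 hin).2 ⟨h1, h2⟩
    -- Compare with a best set of this size, which is isomorphic to a set of some row.
    obtain ⟨Q, hQ, hQmax⟩ := (Finset.univ.filter fun Q : Finset (BitCube n) =>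
      Q.card = S.card).exists_max_image (fun Q => collisionProb Q p)
        ⟨S, Finset.mem_filter.2 ⟨Finset.mem_univ _, rfl⟩⟩
    have hQ := (Finset.mem_filter.1 hQ).2
    have hQmax : ∀ Q', Q'.card = S.card → collisionProb Q' p ≤ collisionProb Q p := fun Q' h =>
      hQmax Q' (Finset.mem_filter.2 ⟨Finset.mem_univ _, h⟩)
    obtain ⟨j, hjt, hjn, G', hG', hiso'⟩ := exists_row_of_isOptimalFor ht ht6 hn hp (hQ.trans hS)
      fun Q' h => hQmax Q' (h.trans hQ)
    refine (hQmax R hR).trans ?_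
    rw [← hiso.invariant.2 p, ← hiso'.invariant.2 p,
      collisionProb_generated_le_iff hjt hG hG' hin hjn hn64 hp1]
    exact hmax j hjt hjn

end OptimalSets

theorem mainTheorem6 :
    -- what the table says about the listed sets
    (∀ i : Fin optTable.length,
      (∀ G ∈ (optRow i).sets,
        (generated (optRow i).n G).card = 2 ^ (optRow i).t ∧
        IsDownSet (generated (optRow i).n G) ∧
        IsRightShifted (generated (optRow i).n G) ∧
        distDistribution (generated (optRow i).n G) = coeffPolynomial (optRow i).dist ∧
        ∀ m ∈ G, generated (optRow i).n (G.erase m) ≠ generated (optRow i).n G) ∧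
      (optRow i).sets.Pairwise (fun G H =>
        ¬ Isomorphic (generated (optRow i).n G) (generated (optRow i).n H))) ∧
    ∃ γ : Fin optTable.length → ℝ,
      -- the crossover probabilities
      (∀ i, IsGLB (beatsPreceding i) (γ i) ∧
        |γ i - ((optRow i).cross : ℝ)| ≤ 1 / (2 * 10 ^ (optRow i).digits)) ∧
      -- the optimal sets of size `2 ^ t` in the `n`-cube, for every `p` in `(0, 1/2)`
      ∀ t ∈ Finset.Icc 1 6, ∀ n < 2 ^ t, ∀ p ∈ Set.Ioo (0 : ℝ) (1 / 2),
        ∀ S : Finset (BitCube n), S.card = 2 ^ t →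
          (IsOptimalFor S p ↔
            ∃ i : Fin optTable.length,
              (optRow i).t = t ∧ (optRow i).n ≤ n ∧ γ i ≤ p ∧
              (∀ j > i, (optRow j).t = t → (optRow j).n ≤ n → p ≤ γ j) ∧
              ∃ G ∈ (optRow i).sets, Isomorphic S (generated n G)) := by
  obtain ⟨θ, u, H⟩ := OptimalSets.exists_thresholds
  refine ⟨fun i => ⟨fun G hG => ?_, OptimalSets.pairwise_not_isomorphic (OptimalSets.optRow_mem i)⟩,
    fun i => θ i / (1 + θ i), fun i => ⟨OptimalSets.isGLB_beatsPreceding H i, H.cross i⟩, ?_⟩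
  · have hr := OptimalSets.optRow_mem i
    obtain ⟨h1, h2⟩ := OptimalSets.generated_closed (n := (optRow i).n) G
    exact ⟨OptimalSets.card_generated hr hG le_rfl ((OptimalSets.n_le_of_row i).trans (by norm_num)), h1, h2,
      OptimalSets.distDistribution_generated hr hG, fun m hm => OptimalSets.generated_erase_ne hr hG hm⟩
  · intro t ht n hn p hp S hS
    obtain ⟨ht1, ht6⟩ := Finset.mem_Icc.1 ht
    exact OptimalSets.isOptimalFor_iff H ht1 ht6 hn hp hS

end
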